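/- Let $X$ be a compact complex manifold of dimension $n$ with a smooth Hermitian (for instance Kähler) metric $\omega$, and let $E=E_1+\dots+E_N$ be a divisor with simple normal crossings on $X$. Let $s_i$ be a holomorphic section of a line bundle $\mathcal O_X(E_i)$ that cuts out the smooth hypersurface $E_i$ with multiplicity one, and let $|s_i|$ be its norm for a smooth Hermitian metric on $\mathcal O_X(E_i)$, with $|s_i|^2<e^{-1}$ on $X$. On $X^\circ=X\setminus E$ put $$\omega_E=\omega+dd^c\Big[-\sum_{i=1}^N\log\log\frac1{|s_i|^2}\Big],\qquad dd^c=\sqrt{-1}\,\partial\bar\partial,$$ and assume that $\omega_E$ is a metric with Poincaré singularities along $E$, that is, $\omega_E\ge c\,\omega$ on $X^\circ$ for some constant $c>0$. Let $L$ be a holomorphic line bundle on $X$ with a Hermitian metric $h_L=e^{-\psi_L}$ over $X^\circ$ that has logarithmic type singularities along $E$: every point of $X$ lies in a coordinate set $\Omega$ with coordinates $z_1,\dots,z_n$ such that, for some $r$ and up to the order of the coordinates, $E\cap\Omega=\{z_1\cdots z_r=0\}$, and the local weight of $h_L$ on $\Omega\setminus E$ is $$\psi_L=-\sum_{\emptyset\ne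 I\subset\{1,\dots,r\}}b_I\log\Big(\phi_I(z)-\log\prod_{i\in I}|z_i|^{2k_i}\Big)+\chi(z),$$ where $\phi_I,\chi$ are smooth real functions on $\Omega$, $k_i\ge 0$ are integers, $0\le b_I<1$, the argument of the outer logarithm (a function on $\Omega$ with values in $(-\infty,+\infty]$) is positive, and $\sum_{I\ni i}b_I<1$ for every $i\in\{1,\dots,r\}$ with $k_i>0$. Let $(\Omega_j)_{j=1,\dots,M}$ be a finite family of coordinate sets of $X$ covering $E$, let $U$ be an open subset of their union that is not dense in any connected component of $X$, and let $p\ge 0$. Then there is a constant $C>0$ such that for every smooth $L$-valued $(p,0)$-form $\tau$ with compact support in $U\setminus E$ $$\int_U|\tau|^2_{\omega_E}e^{-\psi_L}\,dV_{\omega_E}\le C\int_U|\bar\partial\tau|^2_{\omega_E}e^{-\psi_L}\,dV_{\omega_E}.$$ -/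

import Mathlib

open scoped Manifold ContDiff ENNReal
open Bundle MeasureTheory Set

noncomputable section

/-! ### Wirtinger derivatives on `ℂⁿ` -/

/-- The derivative of `f` in the direction of the `(1,0)`-vector `∑ wⱼ ∂/∂zⱼ`. -/
def delDir {n : ℕ} (f : (Fin n → ℂ) → ℂ) (z w : Fin n → ℂ) : ℂ :=
  (1 / 2 : ℂ) * (fderiv ℝ f z w - Complex.I * fderiv ℝ f z (Complex.I • w))

/-- The derivative of `f` in the direction of the `(0,1)`-vector `∑ conj(wⱼ) ∂/∂z̄ⱼ`. -/
def dbarDir {n : ℕ} (f : (Fin n → ℂ) → ℂ) (z w : Fin n → ℂ) : ℂ :=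
  (1 / 2 : ℂ) * (fderiv ℝ f z w + Complex.I * fderiv ℝ f z (Complex.I • w))

/-! ### Charts, Hermitian forms, volume -/

section Manifold

variable {n : ℕ} {X : Type*} [TopologicalSpace X] [ChartedSpace (Fin n → ℂ) X]

/-- The holomorphic coordinate systems of the complex manifold `X`. -/
def IsCoord (φ : OpenPartialHomeomorph X (Fin n → ℂ)) : Prop :=
  φ ∈ IsManifold.maximalAtlas 𝓘(ℂ, Fin n → ℂ) ω X

/-- The tangent vector at `φ⁻¹ z` with components `v` in the coordinates `φ`, that is
`∑ vⱼ ∂/∂zⱼ`. -/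
def coordVec (φ : OpenPartialHomeomorph X (Fin n → ℂ)) (z v : Fin n → ℂ) :
    TangentSpace 𝓘(ℂ, Fin n → ℂ) (φ.symm z) :=
  mfderiv 𝓘(ℂ, Fin n → ℂ) 𝓘(ℂ, Fin n → ℂ) φ.symm z v

/-- The components of a tangent vector at `x` in the preferred coordinates at `x`. -/
def components (x : X) (v : TangentSpace 𝓘(ℂ, Fin n → ℂ) x) : Fin n → ℂ :=
  mfderiv 𝓘(ℂ, Fin n → ℂ) 𝓘(ℂ, Fin n → ℂ) (chartAt (Fin n → ℂ) x) x v

variable (n X) in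
/-- A smooth Hermitian metric on `X`. The form `∑ gⱼₖ dz̄ⱼ ⊗ dzₖ` (conjugate-linear in the first
variable) corresponds to the positive `(1,1)`-form `i ∑ gⱼₖ dzₖ ∧ dz̄ⱼ`. -/
structure HermitianMetric where
  form : ∀ x : X, TangentSpace 𝓘(ℂ, Fin n → ℂ) x →ₗ⋆[ℂ]
    TangentSpace 𝓘(ℂ, Fin n → ℂ) x →ₗ[ℂ] ℂ
  conj_symm : ∀ x v w, (starRingEnd ℂ) (form x v w) = form x w v
  pos : ∀ x v, v ≠ 0 → 0 < (form x v v).re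
  smooth : ∀ φ : OpenPartialHomeomorph X (Fin n → ℂ), IsCoord φ → ∀ v w : Fin n → ℂ,
    ContDiffOn ℝ ∞ (fun z ↦ form (φ.symm z) (coordVec φ z v) (coordVec φ z w)) φ.target

/-- The Hermitian form of the `(1,1)`-form `i∂∂̄u`, that is `∑ u_{k j̄} conj(vⱼ) wₖ` in
holomorphic coordinates (the preferred ones at `x`; the result does not depend on them). -/
def leviForm (u : X → ℝ) (x : X) (v w : TangentSpace 𝓘(ℂ, Fin n → ℂ) x) : ℂ :=
  delDir
    (fun z ↦ dbarDir (fun ζ ↦ ((u ((chartAt (Fin n → ℂ) x).symm ζ) : ℝ) : ℂ)) z (components x v))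
    (chartAt (Fin n → ℂ) x x) (components x w)

/-- The volume measure `H^n / n!` of a field `H` of Hermitian forms (with
`i dz ∧ dz̄ = 2 dx ∧ dy`). In the domain of each coordinate system it has the density
`2ⁿ det (H (∂ⱼ, ∂ₖ))` with respect to Lebesgue measure; these local measures agree on overlaps,
and the volume is their supremum over all coordinate systems. -/
def hermVolume [MeasurableSpace X]
    (H : ∀ x : X, TangentSpace 𝓘(ℂ, Fin n → ℂ) x → TangentSpace 𝓘(ℂ, Fin n → ℂ) x → ℂ) :
    Measure X :=
  ⨆ (φ : OpenPartialHomeomorph X (Fin n → ℂ)) (_ : IsCoord φ),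
    Measure.map φ.symm ((volume.restrict φ.target).withDensity fun z ↦
      ENNReal.ofReal ((2 : ℝ) ^ n * (Matrix.det (Matrix.of fun j k : Fin n ↦
        H (φ.symm z) (coordVec φ z (Pi.single j 1)) (coordVec φ z (Pi.single k 1)))).re))

/-- A unitary frame at `x` for the Hermitian form `H`. -/
def IsUnitaryFrame {x : X}
    (H : TangentSpace 𝓘(ℂ, Fin n → ℂ) x → TangentSpace 𝓘(ℂ, Fin n → ℂ) x → ℂ)
    (v : Fin n → TangentSpace 𝓘(ℂ, Fin n → ℂ) x) : Prop :=
  ∀ a b, H (v a) (v b) = if a = b then 1 else 0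

end Manifold

/-! ### Line bundles, metrics and forms with values in a line bundle -/

section LineBundle

variable {n : ℕ} {X : Type*} [TopologicalSpace X] [ChartedSpace (Fin n → ℂ) X]
  {L : X → Type*} [TopologicalSpace (TotalSpace ℂ L)] [∀ x, AddCommGroup (L x)]
  [∀ x, Module ℂ (L x)] [∀ x, TopologicalSpace (L x)] [FiberBundle ℂ L]

/-- `h x v` is the square `|v|²` of a Hermitian norm on the fibres of `L` over `A`. -/
def IsFiberMetricOn (h : ∀ x, L x → ℝ) (A : Set X) : Prop :=
  ∀ x ∈ A, (∀ (c : ℂ) (v : L x), h x (c • v) = ‖c‖ ^ 2 * h x v) ∧ ∀ v : L x, v ≠ 0 → 0 < h x v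

variable (n) in
/-- A smooth Hermitian metric on `L`: smooth in every local holomorphic frame. -/
def IsSmoothMetric (h : ∀ x, L x → ℝ) : Prop :=
  IsFiberMetricOn h univ ∧
    ∀ (e : Trivialization ℂ (TotalSpace.proj : TotalSpace ℂ L → X)) [MemTrivializationAtlas e],
      ContMDiffOn 𝓘(ℝ, Fin n → ℂ) 𝓘(ℝ, ℝ) ∞ (fun x ↦ h x (e.symm x 1)) e.baseSet

/-- The local weight `ψ` of the metric `h` near `x₀`: `|e|²_h = exp (-ψ)` for the local
holomorphic frame `e` of `L` around `x₀`. -/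
def localWeight (h : ∀ x, L x → ℝ) (x₀ x : X) : ℝ :=
  -Real.log (h x ((trivializationAt ℂ L x₀).symm x 1))

/-- The metric `h` on `L` over `X ∖ E` has logarithmic type singularities along `E`: every point
lies in the domain `Ω` of holomorphic coordinates `z` such that `E ∩ Ω` is given by
`∏_{i ∈ S} zᵢ = 0` and such that
`ψ = - ∑_I b_I log (ϕ_I - log ∏_{i ∈ I} |zᵢ|^{2 kᵢ}) + χ` on `Ω ∖ E`, with `I` running through
the non-empty subsets of `S`, with `0 ≤ b_I < 1`, `kᵢ ∈ ℕ`, and `ϕ_I`, `χ` smooth on `Ω`.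
The argument of the logarithm, which takes values in `(-∞, ∞]` on `Ω`, has to be positive.
The total exponent `∑_{I ∋ i} b_I` with which `log |zᵢ|` enters at a general point of `zᵢ = 0` is
less than one if `kᵢ ≠ 0`. -/
def HasLogSing (h : ∀ x, L x → ℝ) (E : Set X) : Prop :=
  ∀ x : X, ∃ φ : OpenPartialHomeomorph X (Fin n → ℂ), IsCoord φ ∧ x ∈ φ.source ∧
    φ.source ⊆ (trivializationAt ℂ L x).baseSet ∧
    ∃ S : Finset (Fin n),
      (∀ y ∈ φ.source, y ∈ E ↔ ∏ i ∈ S, φ y i = 0) ∧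
      ∃ (b : Finset (Fin n) → ℝ) (k : Fin n → ℕ) (ϕ : Finset (Fin n) → (Fin n → ℂ) → ℝ)
        (χ : (Fin n → ℂ) → ℝ),
        ContDiffOn ℝ ∞ χ φ.target ∧
        (∀ I ∈ S.powerset.erase ∅, 0 ≤ b I ∧ b I < 1 ∧ ContDiffOn ℝ ∞ (ϕ I) φ.target ∧
          ∀ z ∈ φ.target, ∏ i ∈ I, ‖z i‖ ^ (2 * k i) ≠ 0 →
            0 < ϕ I z - Real.log (∏ i ∈ I, ‖z i‖ ^ (2 * k i))) ∧
        (∀ i ∈ S, k i ≠ 0 → ∑ I ∈ S.powerset with i ∈ I, b I < 1) ∧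
        ∀ y ∈ φ.source, y ∉ E →
          localWeight h x y = -(∑ I ∈ S.powerset.erase ∅,
            b I * Real.log (ϕ I (φ y) - Real.log (∏ i ∈ I, ‖φ y i‖ ^ (2 * k i)))) + χ (φ y)

variable (n L) in
/-- `L`-valued differential forms of type `(p,0)` on `X` (without regularity). -/
abbrev LForm (p : ℕ) : Type _ :=
  ∀ x : X, AlternatingMap ℂ (TangentSpace 𝓘(ℂ, Fin n → ℂ) x) (L x) (Fin p)

/-- The coefficient of `τ` on `v₁, …, v_p` in the coordinates `φ` and the trivialization `e`; for
standard basis vectors this is the coefficient of `dz_{i₁} ∧ … ∧ dz_{i_p} ⊗ e`. -/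
def coeff {p : ℕ} (τ : LForm n L p) (φ : OpenPartialHomeomorph X (Fin n → ℂ))
    (e : Trivialization ℂ (TotalSpace.proj : TotalSpace ℂ L → X)) (v : Fin p → Fin n → ℂ)
    (z : Fin n → ℂ) : ℂ :=
  (e ⟨φ.symm z, τ (φ.symm z) fun a ↦ coordVec φ z (v a)⟩).2

/-- Smoothness of an `L`-valued `(p,0)`-form. -/
def IsSmoothForm {p : ℕ} (τ : LForm n L p) : Prop :=
  ∀ φ : OpenPartialHomeomorph X (Fin n → ℂ), IsCoord φ →
    ∀ (e : Trivialization ℂ (TotalSpace.proj : TotalSpace ℂ L → X)) [MemTrivializationAtlas e]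
      (v : Fin p → Fin n → ℂ),
      ContDiffOn ℝ ∞ (coeff τ φ e v) (φ.target ∩ φ.symm ⁻¹' e.baseSet)

/-- The `L`-valued `(p,1)`-form `∂̄τ`, evaluated on the `(0,1)`-vector conjugate to `w` and on the
`(1,0)`-vectors `v₁, …, v_p`. It is computed in the preferred coordinates and holomorphic
trivialization at `x`; the result does not depend on them. -/
def dbarForm {p : ℕ} (τ : LForm n L p) (x : X) (w : TangentSpace 𝓘(ℂ, Fin n → ℂ) x)
    (v : Fin p → TangentSpace 𝓘(ℂ, Fin n → ℂ) x) : L x :=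
  (trivializationAt ℂ L x).symm x
    (dbarDir (coeff τ (chartAt (Fin n → ℂ) x) (trivializationAt ℂ L x)
      fun a ↦ components x (v a)) (chartAt (Fin n → ℂ) x x) (components x w))

/-- The pointwise norm `|τ|²` with respect to the Hermitian form `H` on `X` and the metric `h` on
`L`: the sum of `|τ(v_{i₁}, …, v_{i_p})|²_h` over `i₁ < … < i_p` for a unitary frame `v`. The sum is
the same for all unitary frames. -/
def formNormSq {p : ℕ}
    (H : ∀ x : X, TangentSpace 𝓘(ℂ, Fin n → ℂ) x → TangentSpace 𝓘(ℂ, Fin n → ℂ) x → ℂ)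
    (h : ∀ x, L x → ℝ) (τ : LForm n L p) (x : X) : ℝ≥0∞ :=
  ⨆ (v : Fin n → TangentSpace 𝓘(ℂ, Fin n → ℂ) x) (_ : IsUnitaryFrame (H x) v),
    ∑ i : Fin p ↪o Fin n, ENNReal.ofReal (h x (τ x fun a ↦ v (i a)))

/-- The pointwise norm `|∂̄τ|²` of the `L`-valued `(p,1)`-form `∂̄τ`: the sum of
`|∂̄τ(v̄_b, v_{i₁}, …, v_{i_p})|²_h` over `b` and `i₁ < … < i_p` for a unitary frame `v`. The sum is
the same for all unitary frames. -/
def dbarNormSq {p : ℕ}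
    (H : ∀ x : X, TangentSpace 𝓘(ℂ, Fin n → ℂ) x → TangentSpace 𝓘(ℂ, Fin n → ℂ) x → ℂ)
    (h : ∀ x, L x → ℝ) (τ : LForm n L p) (x : X) : ℝ≥0∞ :=
  ⨆ (v : Fin n → TangentSpace 𝓘(ℂ, Fin n → ℂ) x) (_ : IsUnitaryFrame (H x) v),
    ∑ b : Fin n, ∑ i : Fin p ↪o Fin n,
      ENNReal.ofReal (h x (dbarForm τ x (v b) fun a ↦ v (i a)))

end LineBundle

/-! ### Simple normal crossing divisors and the Poincaré type metric -/

section Divisor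

variable {n : ℕ} {X : Type*} [TopologicalSpace X] [ChartedSpace (Fin n → ℂ) X]
  {N : ℕ} {F : Fin N → X → Type*} [∀ i x, AddCommGroup (F i x)]

/-- The support of the divisor `E = E₁ + … + E_N`, where `Eᵢ` is cut out by `sᵢ`. -/
def divisorSupport (s : ∀ i x, F i x) : Set X :=
  {x | ∃ i, s i x = 0}

variable (n) in
/-- The sections `sᵢ` cut out smooth hypersurfaces `Eᵢ` (each with multiplicity one) that cross
normally: at every point `x` the differentials of those `sᵢ` that vanish at `x` are linearly
independent. -/
def IsSNC [∀ i, TopologicalSpace (TotalSpace ℂ (F i))] [∀ i x, Module ℂ (F i x)]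
    [∀ i x, TopologicalSpace (F i x)] [∀ i, FiberBundle ℂ (F i)] (s : ∀ i x, F i x) : Prop :=
  ∀ x : X, LinearIndependent ℂ fun i : {i : Fin N // s i x = 0} ↦
    fderiv ℂ (fun z : Fin n → ℂ ↦ (trivializationAt ℂ (F i) x
      ⟨(chartAt (Fin n → ℂ) x).symm z, s i ((chartAt (Fin n → ℂ) x).symm z)⟩).2)
      (chartAt (Fin n → ℂ) x x)

/-- The form `ω_E = ω + dd^c (- ∑ᵢ log log (1 / |sᵢ|²))`, with the normalization `dd^c = i∂∂̄`. -/
def poincareForm (g : HermitianMetric n X) (s : ∀ i x, F i x) (hF : ∀ i x, F i x → ℝ) (x : X)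
    (v w : TangentSpace 𝓘(ℂ, Fin n → ℂ) x) : ℂ :=
  g.form x v w + leviForm (fun y ↦ -∑ i, Real.log (Real.log (1 / hF i y (s i y)))) x v w

end Divisor

end

/-! The estimate is a quantitative form of unique continuation. If `∂̄τ = 0`, then `τ` is
holomorphic and vanishes on the non-empty open set outside the closure of `U` in every component of
`X`, so `τ = 0`. To make this uniform in `τ`, let `A(V)` be the weighted mass of `τ` over `V \ E`
and `D` the total energy of `∂̄τ`. A set `V` is controlled (`IsControlled`) if for every `δ > 0`
some `C` gives `A(V) ≤ δ A(X) + C D` for all `τ` at once. The set of points with a controlled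
neighbourhood (`controlledSet`) is open by definition and contains the complement of the closure of
`U`, where the mass is zero. The core is that it is also closed (`isClosed_controlledSet`). Being
clopen and meeting every component it is all of `X`; compactness then gives control of `X` itself,
and with `δ = 1/2` half of `A(X)`, which is finite because `τ` has compact support off `E`, is
absorbed (`exists_mass_le_energy`).

Closedness is a local question about scalar functions. Near each point `ω_E` is comparable with the
model metric with coefficients `1 / (|z_j| log |z_j|)²` for the hyperplanes `z_j = 0` in `E` through
the point, and `1` in the other directions (`exists_isComparable`); the assumption `ω_E ≥ c ω`
enters there. The weight of `L` is comparable with a product of powers of `1 + ∑ k_l (-log |z_l|)`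
(`HasLogSing.exists_coord`). For `(p,0)`-forms `∂̄` acts on each coefficient separately, so mass and
energy become weighted `L²`-norms of the coefficients and of their `z̄_i`-derivatives
(`nonempty_poincareModel`), and inequalities in one complex variable, integrated over slices,
suffice.

Off `E` the one-variable inequality is a Carleman estimate with the weight `exp (s / |z|)` and `s`
large (`integral_carleman_polar`). It bounds the mass on a disc by the mass on a smaller disc, the
energy, and `δ` times the mass on a larger disc (`lintegral_ball_le_propagation`).

At `E` it is a Hardy inequality (`integral_hardy_polar`), which bounds the mass on a disc around the
puncture by the energy and the mass on a surrounding ring. In a slice the weight of `L` grows more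
slowly than `(-log r)^β` with `β = ∑_{I ∋ i} b_I` (only if `k_i ≠ 0`), and `β < 1` is what keeps the
Hardy constant positive. If `dz_i` does not occur in the coefficient, the volume brings in `1 / (r
log r)²` and the inequality applies directly; if it occurs, it is applied to `z f` with the weight
multiplied by `log² r`.

Finally, a polydisc minus the hyperplanes of `E` is connected, so Carleman propagation spreads
control over it, and the Hardy inequality fills in the hyperplanes by induction on the number of
vanishing coordinates (`PoincareModel.mem_controlledSet_of_ball`). -/

/-! ### Weighted estimates for `∂̄` in polar coordinates -/

/-- The radial derivative of a function of polar coordinates. -/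
noncomputable def radialDeriv (x : ℝ × ℝ → ℝ) (p : ℝ × ℝ) : ℝ := fderiv ℝ x p (1, 0)

/-- The angular derivative of a function of polar coordinates. -/
noncomputable def angularDeriv (x : ℝ × ℝ → ℝ) (p : ℝ × ℝ) : ℝ := fderiv ℝ x p (0, 1)

section Polar

theorem contDiff_radialDeriv {x : ℝ × ℝ → ℝ} (hx : ContDiff ℝ 2 x) :
    ContDiff ℝ 1 (radialDeriv x) :=
  (hx.fderiv_right (m := 1) (by norm_num)).clm_apply contDiff_const

theorem contDiff_angularDeriv {x : ℝ × ℝ → ℝ} (hx : ContDiff ℝ 2 x) :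
    ContDiff ℝ 1 (angularDeriv x) :=
  (hx.fderiv_right (m := 1) (by norm_num)).clm_apply contDiff_const

theorem radialDeriv_angularDeriv_comm {x : ℝ × ℝ → ℝ} (hx : ContDiff ℝ 2 x) (p : ℝ × ℝ) :
    radialDeriv (angularDeriv x) p = angularDeriv (radialDeriv x) p := by
  have hd : DifferentiableAt ℝ (fderiv ℝ x) p :=
    ((hx.fderiv_right (m := 1) (by norm_num)).differentiable (by norm_num)).differentiableAt
  have hs := (hx.contDiffAt (x := p)).isSymmSndFDerivAt (by simp)
  unfold radialDeriv angularDeriv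
  rw [fderiv_clm_apply hd (differentiableAt_const _), fderiv_clm_apply hd (differentiableAt_const _)]
  simpa using hs.eq (1, 0) (0, 1)

theorem periodic_radialDeriv {x : ℝ × ℝ → ℝ} 
    (hper : ∀ r θ, x (r, θ + 2 * Real.pi) = x (r, θ)) (r θ : ℝ) :
    radialDeriv x (r, θ + 2 * Real.pi) = radialDeriv x (r, θ) := by
  have h : x = fun p ↦ x (p + (0, 2 * Real.pi)) := by
    ext ⟨r, θ⟩; simp [hper]
  unfold radialDeriv
  conv_rhs => rw [h]
  rw [fderiv_comp_add_right]
  simp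

variable {a b : ℝ} {x y : ℝ × ℝ → ℝ} {v v' : ℝ → ℝ}

theorem hasFDerivAt_comp_fst {r : ℝ} (θ : ℝ) (hv : HasDerivAt v (v' r) r) :
    HasFDerivAt (fun p : ℝ × ℝ ↦ v p.1) (v' r • ContinuousLinearMap.fst ℝ ℝ ℝ) (r, θ) := by
  exact hv.comp_hasFDerivAt (r, θ) hasFDerivAt_fst

/-- The weighted null Lagrangian identity for the Jacobian determinant of a map in polar
coordinates. -/
theorem integral_weighted_jacobian (hab : a ≤ b) (hx : ContDiff ℝ 2 x) (hy : ContDiff ℝ 2 y)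
    (hxper : ∀ r θ, x (r, θ + 2 * Real.pi) = x (r, θ))
    (hyper : ∀ r θ, y (r, θ + 2 * Real.pi) = y (r, θ))
    (hxa : ∀ θ, x (a, θ) = 0) (hxb : ∀ θ, x (b, θ) = 0)
    (hya : ∀ θ, y (a, θ) = 0) (hyb : ∀ θ, y (b, θ) = 0)
    (hv : ∀ r ∈ Icc a b, HasDerivAt v (v' r) r) (hv' : ContinuousOn v' (Icc a b)) :
    ∫ p in Icc (a, -Real.pi) (b, Real.pi),
      v' p.1 * (y p * angularDeriv x p - x p * angularDeriv y p) +
        2 * v p.1 * (radialDeriv y p * angularDeriv x p - radialDeriv x p * angularDeriv y p) = 0 := by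
  have hpi := Real.pi_pos
  have hle : ((a, -Real.pi) : ℝ × ℝ) ≤ (b, Real.pi) := ⟨hab, by simp; linarith⟩
  have hxr := contDiff_radialDeriv hx
  have hyr := contDiff_radialDeriv hy
  have hxt := contDiff_angularDeriv hx
  have hyt := contDiff_angularDeriv hy
  have hvc : ContinuousOn v (Icc a b) := fun r hr ↦ (hv r hr).continuousAt.continuousWithinAt
  have hmaps : MapsTo (Prod.fst : ℝ × ℝ → ℝ) (Icc (a, -Real.pi) (b, Real.pi)) (Icc a b) :=
    fun p hp ↦ ⟨hp.1.1, hp.2.1⟩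
  have hvc2 : ContinuousOn (fun p : ℝ × ℝ ↦ v p.1) (Icc (a, -Real.pi) (b, Real.pi)) :=
    hvc.comp continuousOn_fst hmaps
  have hvc2' : ContinuousOn (fun p : ℝ × ℝ ↦ v' p.1) (Icc (a, -Real.pi) (b, Real.pi)) :=
    hv'.comp continuousOn_fst hmaps
  -- The integrand is `∂_r (v G1) - ∂_θ (v G2)`: the mixed second derivatives cancel, while the
  -- Jacobian occurs in both terms with the same sign, whence the factor 2.
  set G1 : ℝ × ℝ → ℝ := fun p ↦ y p * angularDeriv x p - x p * angularDeriv y p with hG1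
  set G2 : ℝ × ℝ → ℝ := fun p ↦ y p * radialDeriv x p - x p * radialDeriv y p with hG2
  have hx1 : ContDiff ℝ 1 x := hx.of_le (by norm_num)
  have hy1 : ContDiff ℝ 1 y := hy.of_le (by norm_num)
  have cG1 : ContDiff ℝ 1 G1 := (hy1.mul hxt).sub (hx1.mul hyt)
  have cG2 : ContDiff ℝ 1 G2 := (hy1.mul hxr).sub (hx1.mul hyr)
  have D {z : ℝ × ℝ → ℝ} (hz : ContDiff ℝ 1 z) (p : ℝ × ℝ) : HasFDerivAt z (fderiv ℝ z p) p :=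
    ((hz.differentiable (by norm_num)) p).hasFDerivAt
  have e1 (p : ℝ × ℝ) : fderiv ℝ G1 p (1, 0) =
      radialDeriv y p * angularDeriv x p + y p * radialDeriv (angularDeriv x) p -
      (radialDeriv x p * angularDeriv y p + x p * radialDeriv (angularDeriv y) p) := by
    have h : HasFDerivAt G1 _ p := ((D hy1 p).mul (D hxt p)).sub ((D hx1 p).mul (D hyt p))
    rw [h.fderiv]
    simp [radialDeriv]; ring
  have e2 (p : ℝ × ℝ) : fderiv ℝ G2 p (0, 1) =
      angularDeriv y p * radialDeriv x p + y p * radialDeriv (angularDeriv x) p -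
      (angularDeriv x p * radialDeriv y p + x p * radialDeriv (angularDeriv y) p) := by
    have h : HasFDerivAt G2 _ p := ((D hy1 p).mul (D hxr p)).sub ((D hx1 p).mul (D hyr p))
    rw [h.fderiv, radialDeriv_angularDeriv_comm hx, radialDeriv_angularDeriv_comm hy]
    simp [angularDeriv]; ring
  set f' : ℝ × ℝ → ℝ × ℝ →L[ℝ] ℝ := fun p ↦
    v p.1 • fderiv ℝ G1 p + G1 p • (v' p.1 • ContinuousLinearMap.fst ℝ ℝ ℝ) with hf'
  set g' : ℝ × ℝ → ℝ × ℝ →L[ℝ] ℝ := fun p ↦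
    -(v p.1 • fderiv ℝ G2 p + G2 p • (v' p.1 • ContinuousLinearMap.fst ℝ ℝ ℝ)) with hg'
  have key : ∀ p, f' p (1, 0) + g' p (0, 1) =
      v' p.1 * (y p * angularDeriv x p - x p * angularDeriv y p) +
        2 * v p.1 * (radialDeriv y p * angularDeriv x p - radialDeriv x p * angularDeriv y p) := by
    intro p
    have h1 : f' p (1, 0) = v p.1 * fderiv ℝ G1 p (1, 0) + G1 p * v' p.1 := by simp [hf']
    have h2 : g' p (0, 1) = -(v p.1 * fderiv ℝ G2 p (0, 1)) := by simp [hg']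
    rw [h1, h2, e1, e2]
    simp only [hG1]
    ring
  have hmem : ∀ p ∈ Ioo (a, -Real.pi).1 (b, Real.pi).1 ×ˢ Ioo (a, -Real.pi).2 (b, Real.pi).2,
      p.1 ∈ Icc a b := fun p hp ↦ ⟨hp.1.1.le, hp.1.2.le⟩
  have main := integral_divergence_prod_Icc_of_hasFDerivAt_of_le
    (fun p ↦ v p.1 * G1 p) (fun p ↦ -(v p.1 * G2 p)) f' g' (a, -Real.pi) (b, Real.pi) hle
    (hvc2.mul cG1.continuous.continuousOn) (hvc2.mul cG2.continuous.continuousOn).neg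
    (fun p hp ↦ (hasFDerivAt_comp_fst p.2 (hv p.1 (hmem p hp))).mul (D cG1 p))
    (fun p hp ↦ ((hasFDerivAt_comp_fst p.2 (hv p.1 (hmem p hp))).mul (D cG2 p)).neg)
    (by
      simp only [key]
      refine ContinuousOn.integrableOn_compact isCompact_Icc ?_
      refine (hvc2'.mul cG1.continuous.continuousOn).add ((continuousOn_const.mul hvc2).mul ?_)
      exact ((hyr.mul hxt).sub (hxr.mul hyt)).continuous.continuousOn)
  simp only [key] at main
  rw [main]
  -- The two sides `θ = ±π` cancel by periodicity; on the sides `r = a` and `r = b` both `x` and `y`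
  -- vanish.
  have hp2 (r : ℝ) : G2 (r, Real.pi) = G2 (r, -Real.pi) := by
    have e : Real.pi = -Real.pi + 2 * Real.pi := by ring
    simp only [hG2]
    conv_lhs => rw [e, hxper, hyper, periodic_radialDeriv hxper, periodic_radialDeriv hyper]
  have hz1 (θ : ℝ) : G1 (b, θ) = 0 := by simp [hG1, hxb, hyb]
  have hz2 (θ : ℝ) : G1 (a, θ) = 0 := by simp [hG1, hxa, hya]
  simp [hp2, hz1, hz2]

/-- Integration by parts in the radial direction. -/
theorem integral_radial_parts (hab : a ≤ b) (hx : ContDiff ℝ 2 x)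
    (hxa : ∀ θ, x (a, θ) = 0) (hxb : ∀ θ, x (b, θ) = 0)
    (hv : ∀ r ∈ Icc a b, HasDerivAt v (v' r) r) (hv' : ContinuousOn v' (Icc a b)) :
    ∫ p in Icc (a, -Real.pi) (b, Real.pi),
      v' p.1 * x p ^ 2 + 2 * v p.1 * (x p * radialDeriv x p) = 0 := by
  have hpi := Real.pi_pos
  have hle : ((a, -Real.pi) : ℝ × ℝ) ≤ (b, Real.pi) := ⟨hab, by simp; linarith⟩
  have hxr := contDiff_radialDeriv hx
  have hvc : ContinuousOn v (Icc a b) := fun r hr ↦ (hv r hr).continuousAt.continuousWithinAt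
  have hmaps : MapsTo (Prod.fst : ℝ × ℝ → ℝ) (Icc (a, -Real.pi) (b, Real.pi)) (Icc a b) :=
    fun p hp ↦ ⟨hp.1.1, hp.2.1⟩
  have hvc2 : ContinuousOn (fun p : ℝ × ℝ ↦ v p.1) (Icc (a, -Real.pi) (b, Real.pi)) :=
    hvc.comp continuousOn_fst hmaps
  have hvc2' : ContinuousOn (fun p : ℝ × ℝ ↦ v' p.1) (Icc (a, -Real.pi) (b, Real.pi)) :=
    hv'.comp continuousOn_fst hmaps
  have hx1 : ContDiff ℝ 1 x := hx.of_le (by norm_num)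
  have D (p : ℝ × ℝ) : HasFDerivAt x (fderiv ℝ x p) p :=
    ((hx1.differentiable (by norm_num)) p).hasFDerivAt
  set f' : ℝ × ℝ → ℝ × ℝ →L[ℝ] ℝ := fun p ↦
    v p.1 • ((x p) • fderiv ℝ x p + (x p) • fderiv ℝ x p) +
      (x p * x p) • (v' p.1 • ContinuousLinearMap.fst ℝ ℝ ℝ) with hf'
  have key : ∀ p, f' p (1, 0) + (0 : ℝ × ℝ → ℝ × ℝ →L[ℝ] ℝ) p (0, 1) =
      v' p.1 * x p ^ 2 + 2 * v p.1 * (x p * radialDeriv x p) := by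
    intro p
    simp [hf', radialDeriv]
    ring
  have hmem : ∀ p ∈ Ioo (a, -Real.pi).1 (b, Real.pi).1 ×ˢ Ioo (a, -Real.pi).2 (b, Real.pi).2,
      p.1 ∈ Icc a b := fun p hp ↦ ⟨hp.1.1.le, hp.1.2.le⟩
  have main := integral_divergence_prod_Icc_of_hasFDerivAt_of_le
    (fun p ↦ v p.1 * (x p * x p)) (fun p ↦ 0) f' 0 (a, -Real.pi) (b, Real.pi) hle
    (hvc2.mul (hx1.continuous.mul hx1.continuous).continuousOn) continuousOn_const
    (fun p hp ↦ (hasFDerivAt_comp_fst p.2 (hv p.1 (hmem p hp))).mul ((D p).mul (D p)))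
    (fun p hp ↦ hasFDerivAt_const _ _)
    (by
      simp only [key]
      refine ContinuousOn.integrableOn_compact isCompact_Icc ?_
      exact (hvc2'.mul (hx1.continuous.pow 2).continuousOn).add ((continuousOn_const.mul hvc2).mul
        (hx1.mul hxr).continuous.continuousOn))
  simp only [key] at main
  rw [main]
  simp [hxa, hxb]

/-- `r |F_r + (i / r) F_θ|²` for `F = x + i y`, that is `4 r |∂F/∂z̄|²` in polar coordinates. -/
noncomputable def polarDbarSq (x y : ℝ × ℝ → ℝ) (p : ℝ × ℝ) : ℝ :=
  (radialDeriv x p - angularDeriv y p / p.1) ^ 2 + (radialDeriv y p + angularDeriv x p / p.1) ^ 2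

/-- Cauchy–Schwarz on an interval of length `2π`, from the non-negativity of the variance of `|f|`.
-/
theorem sq_integral_abs_le {f : ℝ → ℝ} (hf : Continuous f) :
    (∫ θ in -Real.pi..Real.pi, |f θ|) ^ 2 ≤
      2 * Real.pi * ∫ θ in -Real.pi..Real.pi, f θ ^ 2 := by
  have hpi := Real.pi_pos
  set L := ∫ θ in -Real.pi..Real.pi, |f θ| with hL
  set m := L / (2 * Real.pi) with hm
  have hLm : L = m * (2 * Real.pi) := by rw [hm]; field_simp
  have i1 : IntervalIntegrable (fun θ ↦ f θ ^ 2) volume (-Real.pi) Real.pi :=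
    (hf.pow 2).intervalIntegrable _ _
  have i2 : IntervalIntegrable (fun θ ↦ 2 * m * |f θ|) volume (-Real.pi) Real.pi :=
    (continuous_const.mul hf.abs).intervalIntegrable _ _
  have h0 : 0 ≤ ∫ θ in -Real.pi..Real.pi, (|f θ| - m) ^ 2 :=
    intervalIntegral.integral_nonneg (by linarith) fun θ _ ↦ sq_nonneg _
  have h1 : ∫ θ in -Real.pi..Real.pi, (|f θ| - m) ^ 2 =
      (∫ θ in -Real.pi..Real.pi, f θ ^ 2) - 2 * m * L + 2 * Real.pi * m ^ 2 := by
    have : ∀ θ, (|f θ| - m) ^ 2 = (f θ ^ 2 - 2 * m * |f θ|) + m ^ 2 := fun θ ↦ by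
      rw [sub_sq, sq_abs]; ring
    simp_rw [this]
    rw [intervalIntegral.integral_add (i1.sub i2) (by simp), intervalIntegral.integral_sub i1 i2,
      intervalIntegral.integral_const_mul, intervalIntegral.integral_const, ← hL, smul_eq_mul]
    ring
  rw [h1] at h0
  rw [hLm] at h0 ⊢
  nlinarith

/-- Since `x'` has mean zero, `y` may be replaced by `y - y(-π)`, which is at most `∫ |y'|`. So each
of the two products contributes at most `∫ |x'| ∫ |y'|`, and Cauchy–Schwarz finishes. The constant
is not the isoperimetric one, but the weights used later leave ample room. -/
theorem abs_integral_circle_le {x y x' y' : ℝ → ℝ} (hx : ∀ θ, HasDerivAt x (x' θ) θ)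
    (hy : ∀ θ, HasDerivAt y (y' θ) θ) (hx' : Continuous x') (hy' : Continuous y')
    (hxp : x Real.pi = x (-Real.pi)) (hyp : y Real.pi = y (-Real.pi)) :
    |∫ θ in -Real.pi..Real.pi, (y θ * x' θ - x θ * y' θ)| ≤
      2 * Real.pi * ∫ θ in -Real.pi..Real.pi, (x' θ ^ 2 + y' θ ^ 2) := by
  have hpi := Real.pi_pos
  have key : ∀ {y y' x x' : ℝ → ℝ}, (∀ θ, HasDerivAt x (x' θ) θ) →
      (∀ θ, HasDerivAt y (y' θ) θ) → Continuous x' → Continuous y' →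
      x Real.pi = x (-Real.pi) →
      |∫ θ in -Real.pi..Real.pi, y θ * x' θ| ≤
        (∫ θ in -Real.pi..Real.pi, |y' θ|) * ∫ θ in -Real.pi..Real.pi, |x' θ| := by
    intro y y' x x' hx hy hx' hy' hxp
    have hyc : Continuous y := continuous_iff_continuousAt.2 fun θ ↦ (hy θ).continuousAt
    have e : ∫ θ in -Real.pi..Real.pi, y θ * x' θ =
        ∫ θ in -Real.pi..Real.pi, (y θ - y (-Real.pi)) * x' θ := by
      have hz : ∫ θ in -Real.pi..Real.pi, x' θ = 0 := by
        rw [intervalIntegral.integral_eq_sub_of_hasDerivAt (fun θ _ ↦ hx θ)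
          (hx'.intervalIntegrable _ _), hxp, sub_self]
      simp_rw [sub_mul]
      have i1 : IntervalIntegrable (fun θ ↦ y θ * x' θ) volume (-Real.pi) Real.pi :=
        (hyc.mul hx').intervalIntegrable _ _
      have i2 : IntervalIntegrable (fun θ ↦ y (-Real.pi) * x' θ) volume (-Real.pi) Real.pi :=
        (continuous_const.mul hx').intervalIntegrable _ _
      rw [intervalIntegral.integral_sub i1 i2, intervalIntegral.integral_const_mul, hz]
      simp
    rw [e, ← intervalIntegral.integral_const_mul, ← Real.norm_eq_abs]
    refine intervalIntegral.norm_integral_le_of_norm_le (by linarith) ?_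
      ((continuous_const.mul hx'.abs).intervalIntegrable _ _)
    refine Filter.Eventually.of_forall fun θ hθ ↦ ?_
    rw [norm_mul, Real.norm_eq_abs, Real.norm_eq_abs]
    refine mul_le_mul_of_nonneg_right ?_ (abs_nonneg _)
    rw [← intervalIntegral.integral_eq_sub_of_hasDerivAt (fun θ _ ↦ hy θ)
      (hy'.intervalIntegrable _ _)]
    refine (intervalIntegral.abs_integral_le_integral_abs hθ.1.le).trans ?_
    exact intervalIntegral.integral_mono_interval le_rfl hθ.1.le hθ.2
      (Filter.Eventually.of_forall fun _ ↦ abs_nonneg _) (hy'.abs.intervalIntegrable _ _)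
  have hyc : Continuous y := continuous_iff_continuousAt.2 fun θ ↦ (hy θ).continuousAt
  have hxc : Continuous x := continuous_iff_continuousAt.2 fun θ ↦ (hx θ).continuousAt
  have i1 : IntervalIntegrable (fun θ ↦ y θ * x' θ) volume (-Real.pi) Real.pi :=
    (hyc.mul hx').intervalIntegrable _ _
  have i2 : IntervalIntegrable (fun θ ↦ x θ * y' θ) volume (-Real.pi) Real.pi :=
    (hxc.mul hy').intervalIntegrable _ _
  have i3 : IntervalIntegrable (fun θ ↦ x' θ ^ 2) volume (-Real.pi) Real.pi :=
    (hx'.pow 2).intervalIntegrable _ _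
  have i4 : IntervalIntegrable (fun θ ↦ y' θ ^ 2) volume (-Real.pi) Real.pi :=
    (hy'.pow 2).intervalIntegrable _ _
  rw [intervalIntegral.integral_sub i1 i2, intervalIntegral.integral_add i3 i4]
  have k1 := key hx hy hx' hy' hxp
  have k2 := key hy hx hy' hx' hyp
  have s1 := sq_integral_abs_le hx'
  have s2 := sq_integral_abs_le hy'
  refine (abs_sub _ _).trans ?_
  nlinarith [sq_nonneg ((∫ θ in -Real.pi..Real.pi, |y' θ|) - ∫ θ in -Real.pi..Real.pi, |x' θ|)]

theorem hasDerivAt_angular {x : ℝ × ℝ → ℝ} (hx : ContDiff ℝ 2 x) (r θ : ℝ) :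
    HasDerivAt (fun θ ↦ x (r, θ)) (angularDeriv x (r, θ)) θ := by
  have h := ((hx.differentiable (by norm_num)) (r, θ)).hasFDerivAt
  have h2 : HasDerivAt (fun θ : ℝ ↦ ((r, θ) : ℝ × ℝ)) (0, 1) θ :=
    (hasDerivAt_const θ r).prodMk (hasDerivAt_id θ)
  exact h.comp_hasDerivAt θ h2

/-- The expansion of the weighted norm of `∂̄` in polar coordinates. -/
theorem integral_polarDbarSq (ha : 0 < a) (hab : a ≤ b) (hx : ContDiff ℝ 2 x) (hy : ContDiff ℝ 2 y)
    (hxper : ∀ r θ, x (r, θ + 2 * Real.pi) = x (r, θ))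
    (hyper : ∀ r θ, y (r, θ + 2 * Real.pi) = y (r, θ))
    (hxa : ∀ θ, x (a, θ) = 0) (hxb : ∀ θ, x (b, θ) = 0)
    (hya : ∀ θ, y (a, θ) = 0) (hyb : ∀ θ, y (b, θ) = 0)
    (hv : ∀ r ∈ Icc a b, HasDerivAt v (v' r) r) (hv' : ContinuousOn v' (Icc a b)) :
    ∫ p in Icc (a, -Real.pi) (b, Real.pi), v p.1 * p.1 * polarDbarSq x y p =
      ∫ p in Icc (a, -Real.pi) (b, Real.pi),
        (v p.1 * p.1 * (radialDeriv x p ^ 2 + radialDeriv y p ^ 2) +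
          (v p.1 / p.1 * (angularDeriv x p ^ 2 + angularDeriv y p ^ 2) -
          v' p.1 * (y p * angularDeriv x p - x p * angularDeriv y p))) := by
  have hxr := (contDiff_radialDeriv hx).continuous
  have hyr := (contDiff_radialDeriv hy).continuous
  have hxt := (contDiff_angularDeriv hx).continuous
  have hyt := (contDiff_angularDeriv hy).continuous
  have hxc := hx.continuous
  have hyc := hy.continuous
  have hvc : ContinuousOn v (Icc a b) := fun r hr ↦ (hv r hr).continuousAt.continuousWithinAt
  have hmaps : MapsTo (Prod.fst : ℝ × ℝ → ℝ) (Icc (a, -Real.pi) (b, Real.pi)) (Icc a b) :=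
    fun p hp ↦ ⟨hp.1.1, hp.2.1⟩
  have hvc2 : ContinuousOn (fun p : ℝ × ℝ ↦ v p.1) (Icc (a, -Real.pi) (b, Real.pi)) :=
    hvc.comp continuousOn_fst hmaps
  have hvc2' : ContinuousOn (fun p : ℝ × ℝ ↦ v' p.1) (Icc (a, -Real.pi) (b, Real.pi)) :=
    hv'.comp continuousOn_fst hmaps
  have hne : ∀ p ∈ Icc (a, -Real.pi) (b, Real.pi), p.1 ≠ 0 := fun p hp ↦ by
    have : a ≤ p.1 := hp.1.1
    linarith
  have J := integral_weighted_jacobian hab hx hy hxper hyper hxa hxb hya hyb hv hv'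
  have i1 : IntegrableOn (fun p : ℝ × ℝ ↦
      (v p.1 * p.1 * (radialDeriv x p ^ 2 + radialDeriv y p ^ 2) +
          (v p.1 / p.1 * (angularDeriv x p ^ 2 + angularDeriv y p ^ 2) -
          v' p.1 * (y p * angularDeriv x p - x p * angularDeriv y p))))
      (Icc (a, -Real.pi) (b, Real.pi)) := by
    refine ContinuousOn.integrableOn_compact isCompact_Icc ?_
    fun_prop (disch := assumption)
  have i2 : IntegrableOn (fun p : ℝ × ℝ ↦
      v' p.1 * (y p * angularDeriv x p - x p * angularDeriv y p) +
        2 * v p.1 * (radialDeriv y p * angularDeriv x p - radialDeriv x p * angularDeriv y p))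
      (Icc (a, -Real.pi) (b, Real.pi)) := by
    refine ContinuousOn.integrableOn_compact isCompact_Icc ?_
    fun_prop
  -- The cross term `2 v (y_r x_θ - x_r y_θ)` of the expanded square has no sign; subtracting the
  -- null identity trades it for a term with `v'` that contains angular derivatives only.
  rw [← add_zero (∫ p in Icc (a, -Real.pi) (b, Real.pi), (_ + _)), ← J, ← integral_add i1 i2]
  refine setIntegral_congr_fun measurableSet_Icc fun p hp ↦ ?_
  have := hne p hp
  simp only [polarDbarSq]
  field_simp
  ring

/-- A comparison of integrals may be checked pointwise after adding terms of zero integral; with `P`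
and `Q` from the radial integration by parts the difference becomes a sum of squares. -/
theorem setIntegral_mono_of_le_add_null {S : Set (ℝ × ℝ)} (hS : MeasurableSet S)
    {A B P Q : ℝ × ℝ → ℝ} (iA : IntegrableOn A S) (iB : IntegrableOn B S) (iP : IntegrableOn P S)
    (iQ : IntegrableOn Q S) (hP : ∫ p in S, P p = 0) (hQ : ∫ p in S, Q p = 0)
    (h : ∀ p ∈ S, A p ≤ B p + P p + Q p) : ∫ p in S, A p ≤ ∫ p in S, B p := by
  have h1 := setIntegral_mono_on iA ((iB.add iP).add iQ) hS h
  have h2 : ∫ p in S, B p + P p + Q p = ∫ p in S, B p := by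
    have : ∫ p in S, B p + P p + Q p = ∫ p in S, (B + P) p + Q p := rfl
    rw [this, integral_add (iB.add iP) iQ, hQ, add_zero]
    have : ∫ p in S, (B + P) p = ∫ p in S, B p + P p := rfl
    rw [this, integral_add iB iP, hP, add_zero]
  exact h1.trans_eq h2

/-- The exponent `s / r` is strictly subharmonic, with Laplacian `s / r³` in the plane. Half of it,
times the factor `r` of the area element, is the gain `s / (2 r²)` on the left; the rest is a sum of
four completed squares. -/
theorem integral_carleman_polar (ha : 0 < a) (hab : a ≤ b) (hx : ContDiff ℝ 2 x)
    (hy : ContDiff ℝ 2 y)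
    (hxper : ∀ r θ, x (r, θ + 2 * Real.pi) = x (r, θ))
    (hyper : ∀ r θ, y (r, θ + 2 * Real.pi) = y (r, θ))
    (hxa : ∀ θ, x (a, θ) = 0) (hxb : ∀ θ, x (b, θ) = 0)
    (hya : ∀ θ, y (a, θ) = 0) (hyb : ∀ θ, y (b, θ) = 0) (s : ℝ) :
    ∫ p in Icc (a, -Real.pi) (b, Real.pi),
        s / 2 / p.1 ^ 2 * Real.exp (s / p.1) * (x p ^ 2 + y p ^ 2) ≤
      ∫ p in Icc (a, -Real.pi) (b, Real.pi), Real.exp (s / p.1) * p.1 * polarDbarSq x y p := by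
  have hxr := (contDiff_radialDeriv hx).continuous
  have hyr := (contDiff_radialDeriv hy).continuous
  have hxt := (contDiff_angularDeriv hx).continuous
  have hyt := (contDiff_angularDeriv hy).continuous
  have hxc := hx.continuous
  have hyc := hy.continuous
  have hne' : ∀ r ∈ Icc a b, r ≠ 0 := fun r hr ↦ by have := hr.1; linarith
  have hne : ∀ p ∈ Icc (a, -Real.pi) (b, Real.pi), p.1 ≠ 0 := fun p hp ↦ hne' _ ⟨hp.1.1, hp.2.1⟩
  have hpos : ∀ p ∈ Icc (a, -Real.pi) (b, Real.pi), 0 < p.1 := fun p hp ↦ by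
    have : a ≤ p.1 := hp.1.1
    linarith
  have d1 : ∀ r ∈ Icc a b, HasDerivAt (fun r ↦ Real.exp (s / r)) (-(s / r ^ 2) * Real.exp (s / r)) r := by
    intro r hr
    have h : HasDerivAt (fun r ↦ Real.exp (s * r⁻¹)) _ r :=
      ((hasDerivAt_inv (hne' r hr)).const_mul s).exp
    simp only [div_eq_mul_inv]
    convert h using 1
    ring
  -- This multiplier supplies the cross term of the square `r (x_r - s x / (2 r²))²`. Its derivative
  -- contributes `s² / (2 r³)`, shared equally by the radial and the angular squares, and `s / (2
  -- r²)`, which is the gain.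
  have d2 : ∀ r ∈ Icc a b, HasDerivAt (fun r ↦ -(s / r) * Real.exp (s / r) / 2)
      ((s / r ^ 2 + s ^ 2 / r ^ 3) * Real.exp (s / r) / 2) r := by
    intro r hr
    have := hne' r hr
    have h0 : HasDerivAt (fun r ↦ -(s / r)) (s / r ^ 2) r := by
      have h : HasDerivAt (fun r ↦ -(s * r⁻¹)) _ r := ((hasDerivAt_inv (hne' r hr)).const_mul s).neg
      simp only [div_eq_mul_inv]
      convert h using 1
      ring
    refine ((h0.mul (d1 r hr)).div_const 2).congr_deriv ?_
    field_simp
  have cinv : ContinuousOn (fun r : ℝ ↦ r⁻¹) (Icc a b) := continuousOn_inv₀.mono hne'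
  have c1 : ContinuousOn (fun r ↦ -(s / r ^ 2) * Real.exp (s / r)) (Icc a b) := by
    simp only [div_eq_mul_inv, ← inv_pow]
    fun_prop
  have c2 : ContinuousOn (fun r ↦ (s / r ^ 2 + s ^ 2 / r ^ 3) * Real.exp (s / r) / 2) (Icc a b) := by
    simp only [div_eq_mul_inv, ← inv_pow]
    fun_prop
  rw [integral_polarDbarSq ha hab hx hy hxper hyper hxa hxb hya hyb d1 c1]
  have cinv2 : ContinuousOn (fun p : ℝ × ℝ ↦ p.1⁻¹) (Icc (a, -Real.pi) (b, Real.pi)) :=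
    continuousOn_fst.inv₀ hne
  refine setIntegral_mono_of_le_add_null measurableSet_Icc ?_ ?_ ?_ ?_
    (integral_radial_parts hab hx hxa hxb d2 c2) (integral_radial_parts hab hy hya hyb d2 c2) ?_
  any_goals
    refine ContinuousOn.integrableOn_compact isCompact_Icc ?_
    simp only [div_eq_mul_inv, ← inv_pow]
    fun_prop
  intro p hp
  have hp0 := hpos p hp
  rw [← sub_nonneg]
  have : 0 ≤ Real.exp (s / p.1) * (p.1 * (radialDeriv x p - s / (2 * p.1 ^ 2) * x p) ^ 2 +
      p.1 * (radialDeriv y p - s / (2 * p.1 ^ 2) * y p) ^ 2 +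
      1 / p.1 * (angularDeriv x p + s / (2 * p.1) * y p) ^ 2 +
      1 / p.1 * (angularDeriv y p - s / (2 * p.1) * x p) ^ 2) := by positivity
  refine this.trans_eq ?_
  field_simp
  ring

/-- Circle by circle: the term with `v'` is at most `2π |v'| ∫ |F_θ|²`, and `2π |v'| ≤ v / r` says
that the angular energy pays for it. No vanishing at the ends of the annulus is used here. -/
theorem integral_weighted_angular_nonneg (ha : 0 < a) (hx : ContDiff ℝ 2 x) (hy : ContDiff ℝ 2 y)
    (hxper : ∀ r θ, x (r, θ + 2 * Real.pi) = x (r, θ))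
    (hyper : ∀ r θ, y (r, θ + 2 * Real.pi) = y (r, θ))
    (hvc : ContinuousOn v (Icc a b)) (hv' : ContinuousOn v' (Icc a b))
    (hvv : ∀ r ∈ Icc a b, 2 * Real.pi * |v' r| ≤ v r / r) :
    0 ≤ ∫ p in Icc (a, -Real.pi) (b, Real.pi),
          (v p.1 / p.1 * (angularDeriv x p ^ 2 + angularDeriv y p ^ 2) -
          v' p.1 * (y p * angularDeriv x p - x p * angularDeriv y p)) := by
  have hpi := Real.pi_pos
  have hxt := (contDiff_angularDeriv hx).continuous
  have hyt := (contDiff_angularDeriv hy).continuous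
  have hxc := hx.continuous
  have hyc := hy.continuous
  have hmaps : MapsTo (Prod.fst : ℝ × ℝ → ℝ) (Icc (a, -Real.pi) (b, Real.pi)) (Icc a b) :=
    fun p hp ↦ ⟨hp.1.1, hp.2.1⟩
  have hvc2 : ContinuousOn (fun p : ℝ × ℝ ↦ v p.1) (Icc (a, -Real.pi) (b, Real.pi)) :=
    hvc.comp continuousOn_fst hmaps
  have hvc2' : ContinuousOn (fun p : ℝ × ℝ ↦ v' p.1) (Icc (a, -Real.pi) (b, Real.pi)) :=
    hv'.comp continuousOn_fst hmaps
  have hne : ∀ p ∈ Icc (a, -Real.pi) (b, Real.pi), p.1 ≠ 0 := fun p hp ↦ by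
    have : a ≤ p.1 := hp.1.1
    linarith
  have i1 : IntegrableOn (fun p : ℝ × ℝ ↦
      v p.1 / p.1 * (angularDeriv x p ^ 2 + angularDeriv y p ^ 2) -
          v' p.1 * (y p * angularDeriv x p - x p * angularDeriv y p))
      (Icc a b ×ˢ Icc (-Real.pi) Real.pi) := by
    rw [Icc_prod_Icc]
    refine ContinuousOn.integrableOn_compact isCompact_Icc ?_
    fun_prop (disch := assumption)
  rw [← Icc_prod_Icc, Measure.volume_eq_prod, setIntegral_prod _ i1]
  refine setIntegral_nonneg measurableSet_Icc fun r hr ↦ ?_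
  rw [integral_Icc_eq_integral_Ioc, ← intervalIntegral.integral_of_le (by linarith)]
  have e : Real.pi = -Real.pi + 2 * Real.pi := by ring
  have hxr : Continuous fun θ ↦ angularDeriv x (r, θ) := hxt.comp (by fun_prop)
  have hyr : Continuous fun θ ↦ angularDeriv y (r, θ) := hyt.comp (by fun_prop)
  have hxr0 : Continuous fun θ ↦ x (r, θ) := hxc.comp (by fun_prop)
  have hyr0 : Continuous fun θ ↦ y (r, θ) := hyc.comp (by fun_prop)
  have C := abs_integral_circle_le (hasDerivAt_angular hx r) (hasDerivAt_angular hy r) hxr hyr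
    (by conv_lhs => rw [e, hxper]) (by conv_lhs => rw [e, hyper])
  have j1 : IntervalIntegrable (fun θ ↦ v r / r *
      (angularDeriv x (r, θ) ^ 2 + angularDeriv y (r, θ) ^ 2)) volume (-Real.pi) Real.pi :=
    Continuous.intervalIntegrable (by fun_prop) _ _
  have j2 : IntervalIntegrable (fun θ ↦ v' r * (y (r, θ) * angularDeriv x (r, θ) -
      x (r, θ) * angularDeriv y (r, θ))) volume (-Real.pi) Real.pi :=
    Continuous.intervalIntegrable (by fun_prop) _ _
  rw [intervalIntegral.integral_sub j1 j2, intervalIntegral.integral_const_mul,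
    intervalIntegral.integral_const_mul, sub_nonneg]
  set A := ∫ θ in -Real.pi..Real.pi, (y (r, θ) * angularDeriv x (r, θ) -
      x (r, θ) * angularDeriv y (r, θ))
  set B := ∫ θ in -Real.pi..Real.pi, (angularDeriv x (r, θ) ^ 2 + angularDeriv y (r, θ) ^ 2)
  have hB : 0 ≤ B := intervalIntegral.integral_nonneg (by linarith) fun θ _ ↦ by positivity
  calc v' r * A ≤ |v' r| * |A| := (le_abs_self _).trans (abs_mul _ _).le
    _ ≤ |v' r| * (2 * Real.pi * B) := by gcongr
    _ = 2 * Real.pi * |v' r| * B := by ring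
    _ ≤ v r / r * B := by gcongr; exact hvv r hr

/-- A Hardy type inequality for `∂̄` near a puncture, with a weight that varies slowly in
`-log r`. -/
theorem integral_hardy_polar (ha : 0 < a) (hab : a ≤ b) (hb : b < 1) (hx : ContDiff ℝ 2 x)
    (hy : ContDiff ℝ 2 y)
    (hxper : ∀ r θ, x (r, θ + 2 * Real.pi) = x (r, θ))
    (hyper : ∀ r θ, y (r, θ + 2 * Real.pi) = y (r, θ))
    (hxa : ∀ θ, x (a, θ) = 0) (hxb : ∀ θ, x (b, θ) = 0)
    (hya : ∀ θ, y (a, θ) = 0) (hyb : ∀ θ, y (b, θ) = 0)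
    (hv : ∀ r ∈ Icc a b, HasDerivAt v (v' r) r) (hv' : ContinuousOn v' (Icc a b))
    (hv0 : ∀ r ∈ Icc a b, 0 < v r) (hvv : ∀ r ∈ Icc a b, 2 * Real.pi * |v' r| ≤ v r / r)
    {κ ε : ℝ} (hκ : 0 < κ) (hε : |ε| = 1)
    (hκv : ∀ r ∈ Icc a b, κ * (v r / -Real.log r) ≤ ε * (v r / -Real.log r + r * v' r)) :
    ∫ p in Icc (a, -Real.pi) (b, Real.pi),
        κ ^ 2 / 4 * (v p.1 / (p.1 * (-Real.log p.1) ^ 2)) * (x p ^ 2 + y p ^ 2) ≤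
      ∫ p in Icc (a, -Real.pi) (b, Real.pi), v p.1 * p.1 * polarDbarSq x y p := by
  have hxr := (contDiff_radialDeriv hx).continuous
  have hyr := (contDiff_radialDeriv hy).continuous
  have hxt := (contDiff_angularDeriv hx).continuous
  have hyt := (contDiff_angularDeriv hy).continuous
  have hxc := hx.continuous
  have hyc := hy.continuous
  have hpos' : ∀ r ∈ Icc a b, 0 < r := fun r hr ↦ by have := hr.1; linarith
  have hlog' : ∀ r ∈ Icc a b, 0 < -Real.log r := fun r hr ↦ by
    have := Real.log_neg (hpos' r hr) (hr.2.trans_lt hb); linarith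
  have hmaps : MapsTo (Prod.fst : ℝ × ℝ → ℝ) (Icc (a, -Real.pi) (b, Real.pi)) (Icc a b) :=
    fun p hp ↦ ⟨hp.1.1, hp.2.1⟩
  have hvc : ContinuousOn v (Icc a b) := fun r hr ↦ (hv r hr).continuousAt.continuousWithinAt
  have hvc2 : ContinuousOn (fun p : ℝ × ℝ ↦ v p.1) (Icc (a, -Real.pi) (b, Real.pi)) :=
    hvc.comp continuousOn_fst hmaps
  have hvc2' : ContinuousOn (fun p : ℝ × ℝ ↦ v' p.1) (Icc (a, -Real.pi) (b, Real.pi)) :=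
    hv'.comp continuousOn_fst hmaps
  have cinv : ContinuousOn (fun r : ℝ ↦ r⁻¹) (Icc a b) :=
    continuousOn_inv₀.mono fun r hr ↦ (hpos' r hr).ne'
  have clog : ContinuousOn (fun r : ℝ ↦ (-Real.log r)⁻¹) (Icc a b) :=
    (Real.continuousOn_log.mono fun r hr ↦ (hpos' r hr).ne').neg.inv₀ fun r hr ↦ (hlog' r hr).ne'
  have cinv2 : ContinuousOn (fun p : ℝ × ℝ ↦ p.1⁻¹) (Icc (a, -Real.pi) (b, Real.pi)) :=
    cinv.comp continuousOn_fst hmaps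
  have clog2 : ContinuousOn (fun p : ℝ × ℝ ↦ (-Real.log p.1)⁻¹) (Icc (a, -Real.pi) (b, Real.pi)) :=
    clog.comp continuousOn_fst hmaps
  have hκ2 := hκ.ne'
  -- The Hardy multiplier is `v / (-log r)`. The hypothesis `hκv` says that it is strictly monotone
  -- in `log r` at relative rate at least `κ / (-log r)`, with `ε` the sign of monotonicity; the
  -- factor `κ / 2` is the optimal one.
  have d2 : ∀ r ∈ Icc a b, HasDerivAt (fun r ↦ κ * ε / 2 * (v r * (-Real.log r)⁻¹))
      (κ * ε / 2 * ((r * v' r + v r * (-Real.log r)⁻¹) * r⁻¹ * (-Real.log r)⁻¹)) r := by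
    intro r hr
    have h1 := (hpos' r hr).ne'
    have h2 := (hlog' r hr).ne'
    have h3 : HasDerivAt (fun r ↦ -Real.log r) (-r⁻¹) r := (Real.hasDerivAt_log h1).neg
    refine ((hv r hr).mul (h3.inv h2)).const_mul (κ * ε / 2) |>.congr_deriv ?_
    simp only [Pi.inv_apply]
    generalize -Real.log r = T at *
    field_simp
  have c2 : ContinuousOn (fun r ↦ κ * ε / 2 * ((r * v' r + v r * (-Real.log r)⁻¹) * r⁻¹ *
      (-Real.log r)⁻¹)) (Icc a b) := by
    fun_prop
  have hN := integral_weighted_angular_nonneg ha hx hy hxper hyper hvc hv' hvv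
  rw [integral_polarDbarSq ha hab hx hy hxper hyper hxa hxb hya hyb hv hv']
  have iY : IntegrableOn (fun p : ℝ × ℝ ↦
      v p.1 * p.1 * (radialDeriv x p ^ 2 + radialDeriv y p ^ 2))
      (Icc (a, -Real.pi) (b, Real.pi)) := by
    refine ContinuousOn.integrableOn_compact isCompact_Icc ?_
    fun_prop
  have iN : IntegrableOn (fun p : ℝ × ℝ ↦
      v p.1 / p.1 * (angularDeriv x p ^ 2 + angularDeriv y p ^ 2) -
          v' p.1 * (y p * angularDeriv x p - x p * angularDeriv y p))
      (Icc (a, -Real.pi) (b, Real.pi)) := by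
    refine ContinuousOn.integrableOn_compact isCompact_Icc ?_
    simp only [div_eq_mul_inv]
    fun_prop
  rw [integral_add iY iN]
  refine le_trans ?_ (le_add_of_nonneg_right hN)
  refine setIntegral_mono_of_le_add_null measurableSet_Icc ?_ iY ?_ ?_
    (integral_radial_parts hab hx hxa hxb d2 c2) (integral_radial_parts hab hy hya hyb d2 c2) ?_
  any_goals
    refine ContinuousOn.integrableOn_compact isCompact_Icc ?_
    simp only [div_eq_mul_inv, mul_inv, ← inv_pow]
    fun_prop
  intro p hp
  have hr := hpos' p.1 (hmaps hp)
  have ht := hlog' p.1 (hmaps hp)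
  have hk := hκv p.1 (hmaps hp)
  have hvp := hv0 p.1 (hmaps hp)
  have hε2 : ε ^ 2 = 1 := by rw [← sq_abs, hε]; norm_num
  generalize hT : -Real.log p.1 = T at *
  have hk' : 0 ≤ κ / 2 * p.1⁻¹ * T⁻¹ * (x p ^ 2 + y p ^ 2) *
      (ε * (v p.1 / T + p.1 * v' p.1) - κ * (v p.1 / T)) :=
    mul_nonneg (by positivity) (sub_nonneg.2 hk)
  have hsq : 0 ≤ v p.1 / (p.1 * T ^ 2) * ((κ * ε / 2 * x p + p.1 * T * radialDeriv x p) ^ 2 +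
      (κ * ε / 2 * y p + p.1 * T * radialDeriv y p) ^ 2) := by positivity
  rw [← sub_nonneg]
  -- The last summand is zero because `ε² = 1`; with it the sum equals the required difference as a
  -- rational identity in `ε`.
  have hk2 : 0 ≤ κ / 2 * p.1⁻¹ * T⁻¹ * (x p ^ 2 + y p ^ 2) *
      (ε * (v p.1 / T + p.1 * v' p.1) - κ * (v p.1 / T)) +
      v p.1 / (p.1 * T ^ 2) * ((κ * ε / 2 * x p + p.1 * T * radialDeriv x p) ^ 2 +
      (κ * ε / 2 * y p + p.1 * T * radialDeriv y p) ^ 2) +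
      κ ^ 2 / 4 * (v p.1 / (p.1 * T ^ 2)) * (x p ^ 2 + y p ^ 2) * (1 - ε ^ 2) := by
    rw [hε2]; linarith
  refine hk2.trans_eq ?_
  field_simp
  ring

end Polar

/-! ### Estimates for `∂̄` in one complex variable -/

/-- The derivative `∂f/∂z̄` of a function of one complex variable. -/
noncomputable def dbarOne (f : ℂ → ℂ) (z : ℂ) : ℂ :=
  (1 / 2 : ℂ) * (fderiv ℝ f z 1 + Complex.I * fderiv ℝ f z Complex.I)

/-- The point with polar coordinates `p`. -/
noncomputable def polarPoint (p : ℝ × ℝ) : ℂ :=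
  p.1 * (Real.cos p.2 + Real.sin p.2 * Complex.I)

theorem norm_polarPoint (p : ℝ × ℝ) : ‖polarPoint p‖ = |p.1| := by
  have h : ‖(Real.cos p.2 + Real.sin p.2 * Complex.I : ℂ)‖ = 1 := by
    rw [Complex.ofReal_cos, Complex.ofReal_sin, ← Complex.exp_mul_I, Complex.norm_exp_ofReal_mul_I]
  rw [polarPoint, norm_mul, h, mul_one, Complex.norm_real, Real.norm_eq_abs]

theorem lintegral_annulus_eq_polar {a b : ℝ} (ha : 0 < a) {G : ℂ → ℝ} {H : ℝ × ℝ → ℝ}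
    (hG0 : ∀ z, ‖z‖ < a ∨ b < ‖z‖ → G z = 0)
    (hHi : IntegrableOn H (Icc (a, -Real.pi) (b, Real.pi)))
    (hH0 : ∀ p ∈ Icc (a, -Real.pi) (b, Real.pi), 0 ≤ H p)
    (hH : ∀ p ∈ Icc (a, -Real.pi) (b, Real.pi), H p = p.1 * G (polarPoint p)) :
    ∫⁻ z, ENNReal.ofReal (G z) =
      ENNReal.ofReal (∫ p in Icc (a, -Real.pi) (b, Real.pi), H p) := by
  rw [← Complex.lintegral_comp_polarCoord_symm, ofReal_integral_eq_lintegral_ofReal hHi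
    ((ae_restrict_iff' measurableSet_Icc).2 (Filter.Eventually.of_forall hH0)), ← Icc_prod_Icc]
  have e1 : (∫⁻ p in polarCoord.target, ENNReal.ofReal p.1 • ENNReal.ofReal
      (G (Complex.polarCoord.symm p))) =
      ∫⁻ p in Icc a b ×ˢ Ioo (-Real.pi) Real.pi, ENNReal.ofReal p.1 • ENNReal.ofReal
      (G (Complex.polarCoord.symm p)) := by
    rw [← lintegral_indicator polarCoord.open_target.measurableSet,
      ← lintegral_indicator (measurableSet_Icc.prod measurableSet_Ioo)]
    congr 1
    ext p
    simp only [indicator, polarCoord_target, mem_prod, mem_Ioi, Complex.polarCoord_symm_apply]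
    have hn := norm_polarPoint p
    by_cases h1 : 0 < p.1
    · rw [abs_of_pos h1] at hn
      by_cases h2 : p.1 ∈ Icc a b
      · simp [h1, h2]
      · have : G (polarPoint p) = 0 := by
          apply hG0
          rw [hn]
          by_contra! h
          exact h2 h
        rw [polarPoint] at this
        simp only [this]
        simp [h2]
    · have : p.1 ∉ Icc a b := fun h ↦ h1 (ha.trans_le h.1)
      simp [h1, this]
  rw [e1]
  -- Polar coordinates range over the open interval `(-π, π)`, the divergence theorem over the
  -- closed rectangle; they differ by a null set.
  have e2 : (Icc a b ×ˢ Ioo (-Real.pi) Real.pi : Set (ℝ × ℝ)) =ᵐ[volume]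
      (Icc a b ×ˢ Icc (-Real.pi) Real.pi : Set (ℝ × ℝ)) :=
    Measure.set_prod_ae_eq (by rfl) Ioo_ae_eq_Icc
  rw [setLIntegral_congr e2]
  refine setLIntegral_congr_fun (measurableSet_Icc.prod measurableSet_Icc) fun p hp ↦ ?_
  rw [Icc_prod_Icc] at hp
  have hp1 : 0 ≤ p.1 := ha.le.trans hp.1.1
  simp only [hH p hp, smul_eq_mul, Complex.polarCoord_symm_apply, polarPoint]
  rw [ENNReal.ofReal_mul hp1]

theorem hasFDerivAt_polarPoint (p : ℝ × ℝ) :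
    HasFDerivAt polarPoint
      (((p.1 : ℝ) : ℂ) • ((ContinuousLinearMap.snd ℝ ℝ ℝ).smulRight
        (-Real.sin p.2 + Real.cos p.2 * Complex.I : ℂ)) +
        (Real.cos p.2 + Real.sin p.2 * Complex.I : ℂ) •
        (ContinuousLinearMap.fst ℝ ℝ ℝ).smulRight (1 : ℂ)) p := by
  have h1 : HasFDerivAt (fun p : ℝ × ℝ ↦ (p.1 : ℂ))
      ((ContinuousLinearMap.fst ℝ ℝ ℝ).smulRight (1 : ℂ)) p := by
    have h := Complex.ofRealCLM.hasFDerivAt.comp p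
      (hasFDerivAt_fst (𝕜 := ℝ) (E := ℝ) (F := ℝ) (p := p))
    refine h.congr_fderiv ?_
    ext <;> simp
  have h2 : HasDerivAt (fun θ : ℝ ↦ (Real.cos θ + Real.sin θ * Complex.I : ℂ))
      (-Real.sin p.2 + Real.cos p.2 * Complex.I : ℂ) p.2 := by
    have := (Real.hasDerivAt_cos p.2).ofReal_comp.add
      ((Real.hasDerivAt_sin p.2).ofReal_comp.mul_const Complex.I)
    refine this.congr_deriv ?_
    push_cast
    rfl
  have h3 := h2.hasFDerivAt.comp p (hasFDerivAt_snd (𝕜 := ℝ) (E := ℝ) (F := ℝ) (p := p))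
  refine (h1.mul h3).congr_fderiv ?_
  ext <;> simp

theorem contDiff_polarPoint : ContDiff ℝ 2 polarPoint := by
  unfold polarPoint
  have h : ContDiff ℝ 2 (fun x : ℝ ↦ (x : ℂ)) := Complex.ofRealCLM.contDiff
  exact (h.comp contDiff_fst).mul (((h.comp Real.contDiff_cos).comp contDiff_snd).add
    (((h.comp Real.contDiff_sin).comp contDiff_snd).mul contDiff_const))

theorem polarPoint_add_two_pi (r θ : ℝ) : polarPoint (r, θ + 2 * Real.pi) = polarPoint (r, θ) := by
  simp [polarPoint]

theorem continuous_dbarOne {f : ℂ → ℂ} (hf : ContDiff ℝ 2 f) : Continuous (dbarOne f) := by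
  have h := hf.continuous_fderiv (by norm_num)
  unfold dbarOne
  fun_prop

/-- In polar coordinates `2 ∂/∂z̄ = e^{iθ} (∂_r + (i/r) ∂_θ)`, and the phase drops out of the norm.
-/
theorem polarDbarSq_eq {f : ℂ → ℂ} (hf : ContDiff ℝ 2 f) {p : ℝ × ℝ} (hp : p.1 ≠ 0) :
    polarDbarSq (fun p ↦ (f (polarPoint p)).re) (fun p ↦ (f (polarPoint p)).im) p =
      4 * ‖dbarOne f (polarPoint p)‖ ^ 2 := by
  have hfd : HasFDerivAt f (fderiv ℝ f (polarPoint p)) (polarPoint p) :=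
    (hf.differentiable (by norm_num) _).hasFDerivAt
  obtain ⟨L, hL, hL1, hL2⟩ : ∃ L : ℝ × ℝ →L[ℝ] ℂ, HasFDerivAt polarPoint L p ∧
      L (1, 0) = Real.cos p.2 + Real.sin p.2 * Complex.I ∧
      L (0, 1) = p.1 * (-Real.sin p.2 + Real.cos p.2 * Complex.I) :=
    ⟨_, hasFDerivAt_polarPoint p, by simp, by simp⟩
  have hF := hfd.comp p hL
  have hre : HasFDerivAt (fun p ↦ (f (polarPoint p)).re) _ p :=
    Complex.reCLM.hasFDerivAt.comp p hF
  have him : HasFDerivAt (fun p ↦ (f (polarPoint p)).im) _ p :=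
    Complex.imCLM.hasFDerivAt.comp p hF
  set D := fderiv ℝ f (polarPoint p) with hD
  have hlin (c s : ℝ) : D (c + s * Complex.I) = c * D 1 + s * D Complex.I := by
    have : (c + s * Complex.I : ℂ) = c • (1 : ℂ) + s • Complex.I := by simp
    rw [this, map_add, map_smul, map_smul]
    simp
  have hr : D (Real.cos p.2 + Real.sin p.2 * Complex.I) =
      Real.cos p.2 * D 1 + Real.sin p.2 * D Complex.I := hlin _ _
  have ht : D (p.1 * (-Real.sin p.2 + Real.cos p.2 * Complex.I)) =
      p.1 * (-Real.sin p.2 * D 1 + Real.cos p.2 * D Complex.I) := by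
    have : (p.1 * (-Real.sin p.2 + Real.cos p.2 * Complex.I) : ℂ) =
      (((-p.1 * Real.sin p.2 : ℝ) : ℂ) + ((p.1 * Real.cos p.2 : ℝ) : ℂ) * Complex.I) := by
      push_cast; ring
    rw [this, hlin]
    push_cast
    ring
  have e1 : radialDeriv (fun p ↦ (f (polarPoint p)).re) p =
      (Real.cos p.2 * D 1 + Real.sin p.2 * D Complex.I).re := by
    rw [radialDeriv, hre.fderiv, ← hr, ← hL1]; rfl
  have e2 : radialDeriv (fun p ↦ (f (polarPoint p)).im) p =
      (Real.cos p.2 * D 1 + Real.sin p.2 * D Complex.I).im := by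
    rw [radialDeriv, him.fderiv, ← hr, ← hL1]; rfl
  have e3 : angularDeriv (fun p ↦ (f (polarPoint p)).re) p =
      (p.1 * (-Real.sin p.2 * D 1 + Real.cos p.2 * D Complex.I)).re := by
    rw [angularDeriv, hre.fderiv, ← ht, ← hL2]; rfl
  have e4 : angularDeriv (fun p ↦ (f (polarPoint p)).im) p =
      (p.1 * (-Real.sin p.2 * D 1 + Real.cos p.2 * D Complex.I)).im := by
    rw [angularDeriv, him.fderiv, ← ht, ← hL2]; rfl
  simp only [polarDbarSq, e1, e2, e3, e4, dbarOne, ← hD]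
  rw [← Complex.normSq_eq_norm_sq, Complex.normSq_apply]
  have hcs := Real.sin_sq_add_cos_sq p.2
  clear e1 e2 e3 e4 hr ht hlin hL1 hL2
  generalize D 1 = A
  generalize D Complex.I = B
  generalize Real.cos p.2 = c at *
  generalize Real.sin p.2 = s at *
  simp
  field_simp
  linear_combination 4 * ((A.re - B.im) ^ 2 + (A.im + B.re) ^ 2) * hcs

/-! ### Carleman and Hardy inequalities on annuli -/

section Annulus

variable {a b : ℝ} {f : ℂ → ℂ}

theorem lintegral_weight_dbarOne_eq (ha : 0 < a) (hf : ContDiff ℝ 2 f)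
    (hfa : ∀ z, ‖z‖ ≤ a → f z = 0) (hfb : ∀ z, b ≤ ‖z‖ → f z = 0) {v : ℝ → ℝ}
    (hvc : ContinuousOn v (Icc a b)) (hv0 : ∀ r ∈ Icc a b, 0 ≤ v r) :
    ∫⁻ z, ENNReal.ofReal (4 * v ‖z‖ * ‖dbarOne f z‖ ^ 2) =
      ENNReal.ofReal (∫ p in Icc (a, -Real.pi) (b, Real.pi), v p.1 * p.1 * polarDbarSq
        (fun p ↦ (f (polarPoint p)).re) (fun p ↦ (f (polarPoint p)).im) p) := by
  have hmaps : MapsTo (Prod.fst : ℝ × ℝ → ℝ) (Icc (a, -Real.pi) (b, Real.pi)) (Icc a b) :=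
    fun p hp ↦ ⟨hp.1.1, hp.2.1⟩
  have hvc2 : ContinuousOn (fun p : ℝ × ℝ ↦ v p.1) (Icc (a, -Real.pi) (b, Real.pi)) :=
    hvc.comp continuousOn_fst hmaps
  have hpos : ∀ p ∈ Icc (a, -Real.pi) (b, Real.pi), 0 < p.1 := fun p hp ↦ ha.trans_le hp.1.1
  have hd := continuous_dbarOne hf
  have hpp := contDiff_polarPoint.continuous
  have hcomp : Continuous fun p ↦ ‖dbarOne f (polarPoint p)‖ := (hd.comp hpp).norm
  have hzero : ∀ S : Set ℂ, IsOpen S → (∀ z ∈ S, f z = 0) → ∀ z ∈ S, dbarOne f z = 0 := by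
    intro S hS h z hz
    have : f =ᶠ[nhds z] fun _ ↦ 0 := Filter.eventuallyEq_of_mem (hS.mem_nhds hz) h
    rw [dbarOne, this.fderiv_eq]
    simp
  refine lintegral_annulus_eq_polar ha ?_ ?_ ?_ ?_
  · rintro z (hz | hz)
    · rw [hzero {z | ‖z‖ < a} (isOpen_lt continuous_norm continuous_const)
        (fun z hz ↦ hfa z (le_of_lt hz)) z hz]
      simp
    · rw [hzero {z | b < ‖z‖} (isOpen_lt continuous_const continuous_norm)
        (fun z hz ↦ hfb z (le_of_lt hz)) z hz]
      simp
  · have : IntegrableOn (fun p ↦ v p.1 * p.1 * (4 * ‖dbarOne f (polarPoint p)‖ ^ 2))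
        (Icc (a, -Real.pi) (b, Real.pi)) := by
      refine ContinuousOn.integrableOn_compact isCompact_Icc ?_
      fun_prop
    refine this.congr_fun (fun p hp ↦ ?_) measurableSet_Icc
    simp only [polarDbarSq_eq hf (hpos p hp).ne']
  · intro p hp
    have := hpos p hp
    have := hv0 p.1 (hmaps hp)
    rw [polarDbarSq_eq hf (hpos p hp).ne']
    positivity
  · intro p hp
    rw [polarDbarSq_eq hf (hpos p hp).ne', norm_polarPoint, abs_of_pos (hpos p hp)]
    ring

theorem lintegral_weight_sq_eq (ha : 0 < a) (hf : ContDiff ℝ 2 f)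
    (hfa : ∀ z, ‖z‖ ≤ a → f z = 0) (hfb : ∀ z, b ≤ ‖z‖ → f z = 0) {v : ℝ → ℝ}
    (hvc : ContinuousOn v (Icc a b)) (hv0 : ∀ r ∈ Icc a b, 0 ≤ v r) {w : ℝ → ℝ}
    (hw : ∀ r ∈ Icc a b, v r = r * w r) :
    ∫⁻ z, ENNReal.ofReal (w ‖z‖ * ‖f z‖ ^ 2) =
      ENNReal.ofReal (∫ p in Icc (a, -Real.pi) (b, Real.pi), v p.1 *
        ((f (polarPoint p)).re ^ 2 + (f (polarPoint p)).im ^ 2)) := by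
  have hmaps : MapsTo (Prod.fst : ℝ × ℝ → ℝ) (Icc (a, -Real.pi) (b, Real.pi)) (Icc a b) :=
    fun p hp ↦ ⟨hp.1.1, hp.2.1⟩
  have hvc2 : ContinuousOn (fun p : ℝ × ℝ ↦ v p.1) (Icc (a, -Real.pi) (b, Real.pi)) :=
    hvc.comp continuousOn_fst hmaps
  have hpos : ∀ p ∈ Icc (a, -Real.pi) (b, Real.pi), 0 < p.1 := fun p hp ↦ ha.trans_le hp.1.1
  have hc : Continuous fun p ↦ f (polarPoint p) :=
    hf.continuous.comp contDiff_polarPoint.continuous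
  refine lintegral_annulus_eq_polar ha ?_ ?_ ?_ ?_
  · rintro z (hz | hz)
    · simp [hfa z hz.le]
    · simp [hfb z hz.le]
  · refine ContinuousOn.integrableOn_compact isCompact_Icc ?_
    have h1 : Continuous fun p ↦ (f (polarPoint p)).re := Complex.continuous_re.comp hc
    have h2 : Continuous fun p ↦ (f (polarPoint p)).im := Complex.continuous_im.comp hc
    fun_prop
  · intro p hp
    have := hv0 p.1 (hmaps hp)
    positivity
  · intro p hp
    rw [norm_polarPoint, abs_of_pos (hpos p hp), ← mul_assoc, hw p.1 (hmaps hp),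
      ← Complex.normSq_eq_norm_sq, Complex.normSq_apply]
    ring

theorem contDiff_re_polar (hf : ContDiff ℝ 2 f) : ContDiff ℝ 2 fun p ↦ (f (polarPoint p)).re :=
  Complex.reCLM.contDiff.comp (hf.comp contDiff_polarPoint)

theorem contDiff_im_polar (hf : ContDiff ℝ 2 f) : ContDiff ℝ 2 fun p ↦ (f (polarPoint p)).im :=
  Complex.imCLM.contDiff.comp (hf.comp contDiff_polarPoint)

/-- The polar inequality divided by the area factor `r`, whence `‖z‖ ^ 3`. The constants do not
depend on the inner radius. -/
theorem lintegral_carleman_annulus (ha : 0 < a) (hab : a ≤ b) (hf : ContDiff ℝ 2 f)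
    (hfa : ∀ z, ‖z‖ ≤ a → f z = 0) (hfb : ∀ z, b ≤ ‖z‖ → f z = 0) {s : ℝ} (hs : 0 ≤ s) :
    ∫⁻ z, ENNReal.ofReal (s / 2 / ‖z‖ ^ 3 * Real.exp (s / ‖z‖) * ‖f z‖ ^ 2) ≤
      ∫⁻ z, ENNReal.ofReal (4 * Real.exp (s / ‖z‖) * ‖dbarOne f z‖ ^ 2) := by
  have hpos : ∀ r ∈ Icc a b, 0 < r := fun r hr ↦ ha.trans_le hr.1
  have cinv : ContinuousOn (fun r : ℝ ↦ r⁻¹) (Icc a b) :=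
    continuousOn_inv₀.mono fun r hr ↦ (hpos r hr).ne'
  have z1 (θ : ℝ) : f (polarPoint (a, θ)) = 0 := hfa _ (by simp [norm_polarPoint, abs_of_pos ha])
  have z2 (θ : ℝ) : f (polarPoint (b, θ)) = 0 :=
    hfb _ (by simp [norm_polarPoint, abs_of_pos (ha.trans_le hab)])
  rw [lintegral_weight_dbarOne_eq (v := fun r ↦ Real.exp (s / r)) ha hf hfa hfb
    (by simp only [div_eq_mul_inv]; fun_prop) (fun r _ ↦ (Real.exp_pos _).le),
    lintegral_weight_sq_eq (v := fun r ↦ s / 2 / r ^ 2 * Real.exp (s / r))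
    (w := fun r ↦ s / 2 / r ^ 3 * Real.exp (s / r)) ha hf hfa hfb
    (by simp only [div_eq_mul_inv, ← inv_pow]; fun_prop) (fun r _ ↦ by positivity)
    (fun r hr ↦ by have := hpos r hr; field_simp)]
  refine ENNReal.ofReal_le_ofReal (integral_carleman_polar ha hab (contDiff_re_polar hf)
    (contDiff_im_polar hf) ?_ ?_ ?_ ?_ ?_ ?_ s)
  all_goals intros
  all_goals simp [polarPoint_add_two_pi, z1, z2]

theorem lintegral_hardy_annulus (ha : 0 < a) (hab : a ≤ b) (hb : b < 1) (hf : ContDiff ℝ 2 f)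
    (hfa : ∀ z, ‖z‖ ≤ a → f z = 0) (hfb : ∀ z, b ≤ ‖z‖ → f z = 0) {v v' : ℝ → ℝ}
    (hv : ∀ r ∈ Icc a b, HasDerivAt v (v' r) r) (hv' : ContinuousOn v' (Icc a b))
    (hv0 : ∀ r ∈ Icc a b, 0 < v r) (hvv : ∀ r ∈ Icc a b, 2 * Real.pi * |v' r| ≤ v r / r)
    {κ ε : ℝ} (hκ : 0 < κ) (hε : |ε| = 1)
    (hκv : ∀ r ∈ Icc a b, κ * (v r / -Real.log r) ≤ ε * (v r / -Real.log r + r * v' r)) :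
    ∫⁻ z, ENNReal.ofReal (κ ^ 2 / 4 * (v ‖z‖ / (‖z‖ * Real.log ‖z‖) ^ 2) * ‖f z‖ ^ 2) ≤
      ∫⁻ z, ENNReal.ofReal (4 * v ‖z‖ * ‖dbarOne f z‖ ^ 2) := by
  have hpos : ∀ r ∈ Icc a b, 0 < r := fun r hr ↦ ha.trans_le hr.1
  have hlog : ∀ r ∈ Icc a b, 0 < -Real.log r := fun r hr ↦ by
    have := Real.log_neg (hpos r hr) (hr.2.trans_lt hb); linarith
  have cinv : ContinuousOn (fun r : ℝ ↦ r⁻¹) (Icc a b) :=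
    continuousOn_inv₀.mono fun r hr ↦ (hpos r hr).ne'
  have clog : ContinuousOn (fun r : ℝ ↦ (-Real.log r)⁻¹) (Icc a b) :=
    (Real.continuousOn_log.mono fun r hr ↦ (hpos r hr).ne').neg.inv₀ fun r hr ↦ (hlog r hr).ne'
  have hvc : ContinuousOn v (Icc a b) := fun r hr ↦ (hv r hr).continuousAt.continuousWithinAt
  have z1 (θ : ℝ) : f (polarPoint (a, θ)) = 0 := hfa _ (by simp [norm_polarPoint, abs_of_pos ha])
  have z2 (θ : ℝ) : f (polarPoint (b, θ)) = 0 :=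
    hfb _ (by simp [norm_polarPoint, abs_of_pos (ha.trans_le hab)])
  rw [lintegral_weight_dbarOne_eq (v := v) ha hf hfa hfb hvc fun r hr ↦ (hv0 r hr).le,
    lintegral_weight_sq_eq (v := fun r ↦ κ ^ 2 / 4 * (v r / (r * (-Real.log r) ^ 2)))
    (w := fun r ↦ κ ^ 2 / 4 * (v r / (r * Real.log r) ^ 2)) ha hf hfa hfb
    (by simp only [div_eq_mul_inv, mul_inv, ← inv_pow]; fun_prop)
    (fun r hr ↦ by have := hpos r hr; have := hv0 r hr; positivity)
    (fun r hr ↦ by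
      have := hpos r hr
      have := hlog r hr
      have h3 : Real.log r ≠ 0 := by linarith
      rw [neg_sq]
      field_simp)]
  refine ENNReal.ofReal_le_ofReal (integral_hardy_polar ha hab hb (contDiff_re_polar hf)
    (contDiff_im_polar hf) ?_ ?_ ?_ ?_ ?_ ?_ hv hv' hv0 hvv hκ hε hκv)
  all_goals intros
  all_goals simp [polarPoint_add_two_pi, z1, z2]

end Annulus

/-! ### Cutoff functions and local estimates on discs -/

theorem dbarOne_mul {f g : ℂ → ℂ} (hf : ContDiff ℝ 2 f) (hg : ContDiff ℝ 2 g) (z : ℂ) :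
    dbarOne (fun z ↦ f z * g z) z = f z * dbarOne g z + g z * dbarOne f z := by
  have h1 := (hf.differentiable (by norm_num)) z
  have h2 := (hg.differentiable (by norm_num)) z
  have h : HasFDerivAt (fun z ↦ f z * g z) _ z := h1.hasFDerivAt.mul h2.hasFDerivAt
  rw [dbarOne, h.fderiv, dbarOne, dbarOne]
  simp
  ring

theorem dbarOne_id (z : ℂ) : dbarOne (fun z ↦ z) z = 0 := by
  have h : HasFDerivAt (fun z : ℂ ↦ z) (ContinuousLinearMap.id ℝ ℂ) z := hasFDerivAt_id z
  rw [dbarOne, h.fderiv]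
  simp

theorem dbarOne_comp_add (f : ℂ → ℂ) (a z : ℂ) :
    dbarOne (fun z ↦ f (a + z)) z = dbarOne f (a + z) := by
  rw [dbarOne, fderiv_comp_add_left]; rfl

/-- A smooth cutoff function with bounded `∂̄`. -/
theorem exists_cutoff {r₁ r₂ : ℝ} (h₁ : 0 < r₁) (h₂ : r₁ < r₂) :
    ∃ η : ℂ → ℂ, ContDiff ℝ 2 η ∧ (∀ z, ‖z‖ ≤ r₁ → η z = 1) ∧ (∀ z, r₂ ≤ ‖z‖ → η z = 0) ∧
      (∀ z, ‖η z‖ ≤ 1 ∧ ‖1 - η z‖ ≤ 1) ∧ ∃ M : ℝ, 0 < M ∧ ∀ z, ‖dbarOne η z‖ ^ 2 ≤ M ∧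
        (‖z‖ < r₁ ∨ r₂ ≤ ‖z‖ → dbarOne η z = 0) := by
  let b : ContDiffBump (0 : ℂ) := ⟨r₁, r₂, h₁, h₂⟩
  have hb : ContDiff ℝ 2 (fun z ↦ ((b z : ℝ) : ℂ)) := Complex.ofRealCLM.contDiff.comp b.contDiff
  have hz (z : ℂ) (hz : r₂ ≤ ‖z‖) : b z = 0 := b.zero_of_le_dist (by simpa using hz)
  have hone (z : ℂ) (hz : ‖z‖ ≤ r₁) : b z = 1 :=
    b.one_of_mem_closedBall (by simpa using hz)
  have hdc := continuous_dbarOne hb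
  have hd0 : ∀ z, ‖z‖ < r₁ ∨ r₂ ≤ ‖z‖ → dbarOne (fun z ↦ ((b z : ℝ) : ℂ)) z = 0 := by
    have hd1 : ∀ z, ‖z‖ < r₁ → dbarOne (fun z ↦ ((b z : ℝ) : ℂ)) z = 0 := by
      intro z hz'
      have : (fun z ↦ ((b z : ℝ) : ℂ)) =ᶠ[nhds z] fun _ ↦ 1 :=
        Filter.eventuallyEq_of_mem ((isOpen_lt continuous_norm continuous_const).mem_nhds hz')
          fun w hw ↦ by simp [hone w (le_of_lt hw)]
      rw [dbarOne, this.fderiv_eq]; simp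
    have hd2 : ∀ z, r₂ < ‖z‖ → dbarOne (fun z ↦ ((b z : ℝ) : ℂ)) z = 0 := by
      intro z hz'
      have : (fun z ↦ ((b z : ℝ) : ℂ)) =ᶠ[nhds z] fun _ ↦ 0 :=
        Filter.eventuallyEq_of_mem ((isOpen_lt continuous_const continuous_norm).mem_nhds hz')
          fun w hw ↦ by simp [hz w (le_of_lt hw)]
      rw [dbarOne, this.fderiv_eq]; simp
    rintro z (h | h)
    · exact hd1 z h
    -- On the circle `‖z‖ = r₂` itself the derivative vanishes by continuity from outside.
    · have hcl : IsClosed {z | dbarOne (fun z ↦ ((b z : ℝ) : ℂ)) z = 0} :=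
        isClosed_eq hdc continuous_const
      have hsub : (Metric.closedBall (0 : ℂ) r₂)ᶜ ⊆ {z | dbarOne (fun z ↦ ((b z : ℝ) : ℂ)) z = 0} :=
        fun w hw ↦ hd2 w (by simpa using hw)
      refine hcl.closure_subset_iff.2 hsub ?_
      rw [closure_compl, interior_closedBall _ (h₁.trans h₂).ne']
      simpa using h
  have hM : ∃ M : ℝ, ∀ z, ‖dbarOne (fun z ↦ ((b z : ℝ) : ℂ)) z‖ ^ 2 ≤ M := by
    obtain ⟨M, hM⟩ := (isCompact_closedBall (0 : ℂ) r₂).exists_bound_of_continuousOn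
      (hdc.norm.pow 2).continuousOn
    refine ⟨max M 0, fun z ↦ ?_⟩
    by_cases h : ‖z‖ ≤ r₂
    · have := hM z (by simpa using h)
      exact (le_abs_self _).trans (this.trans (le_max_left _ _))
    · rw [hd0 z (Or.inr (not_le.1 h).le)]; simp
  obtain ⟨M, hM⟩ := hM
  refine ⟨_, hb, fun z h ↦ by simp [hone z h], fun z h ↦ by simp [hz z h], fun z ↦ ?_,
    max M 1, by positivity, fun z ↦ ⟨(hM z).trans (le_max_left _ _), hd0 z⟩⟩
  have h : (1 - (b z : ℝ) : ℂ) = ((1 - b z : ℝ) : ℂ) := by push_cast; rfl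
  rw [h, Complex.norm_real, Complex.norm_real, Real.norm_eq_abs, Real.norm_eq_abs,
    abs_of_nonneg b.nonneg, abs_of_nonneg (sub_nonneg.2 b.le_one)]
  exact ⟨b.le_one, by linarith [b.nonneg (x := z)]⟩

theorem norm_add_sq_le_two_mul (x y : ℂ) : ‖x + y‖ ^ 2 ≤ 2 * ‖x‖ ^ 2 + 2 * ‖y‖ ^ 2 := by
  have := norm_add_le x y
  nlinarith [norm_nonneg (x + y), sq_nonneg (‖x‖ - ‖y‖), norm_nonneg x, norm_nonneg y]

theorem norm_dbarOne_mul_sq_le {η f : ℂ → ℂ} (hη : ContDiff ℝ 2 η) (hf : ContDiff ℝ 2 f) (z : ℂ)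
    (h1 : ‖η z‖ ≤ 1) :
    ‖dbarOne (fun z ↦ η z * f z) z‖ ^ 2 ≤
      2 * ‖dbarOne f z‖ ^ 2 + 2 * (‖f z‖ ^ 2 * ‖dbarOne η z‖ ^ 2) := by
  rw [dbarOne_mul hη hf]
  refine (norm_add_sq_le_two_mul _ _).trans ?_
  rw [norm_mul, norm_mul, mul_pow, mul_pow]
  have : ‖η z‖ ^ 2 ≤ 1 := pow_le_one₀ (norm_nonneg _) h1
  nlinarith [sq_nonneg ‖dbarOne f z‖]

theorem lintegral_ite_const_mul {S : Set ℂ} (hS : MeasurableSet S) [DecidablePred (· ∈ S)] {c : ℝ}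
    (hc : 0 ≤ c) (h : ℂ → ℝ) :
    ∫⁻ z, ENNReal.ofReal (if z ∈ S then c * h z else 0) =
      ENNReal.ofReal c * ∫⁻ z in S, ENNReal.ofReal (h z) := by
  rw [← lintegral_const_mul' _ _ ENNReal.ofReal_ne_top, ← lintegral_indicator hS]
  congr 1
  ext z
  by_cases hz : z ∈ S <;> simp [hz, ENNReal.ofReal_mul hc]

theorem lintegral_ofReal_add₃ {f g h : ℂ → ℝ} (hf : Measurable f) (hg : Measurable g) :
    ∫⁻ z, ENNReal.ofReal (f z + g z + h z) ≤
      (∫⁻ z, ENNReal.ofReal (f z)) + (∫⁻ z, ENNReal.ofReal (g z)) +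
        ∫⁻ z, ENNReal.ofReal (h z) := by
  rw [← lintegral_add_left hf.ennreal_ofReal]
  have h1 : Measurable fun z ↦ ENNReal.ofReal (f z) + ENNReal.ofReal (g z) :=
    hf.ennreal_ofReal.add hg.ennreal_ofReal
  rw [← lintegral_add_left h1]
  exact lintegral_mono fun z ↦ ENNReal.ofReal_add_le.trans (by gcongr; exact ENNReal.ofReal_add_le)

/-- The weighted error of the cutoff by zones. It is zero for `‖z‖ < ρ/2` and for `‖z‖ ≥ R'`, and in
the middle zone the cutoff equals one. In the inner transition zone the weight is at most `exp (s /
(ρ/2))`, which may be large but multiplies only the mass of the small disc. In the outer one it is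
at most `exp (s / R)`, and this must be beaten by the gain on the disc of radius `R`. -/
theorem cutoff_pointwise_le {ρ R R' M₀ M₁ s A B : ℝ} {η₀ η₁ f : ℂ → ℂ} (hρ : 0 < ρ) (hR : ρ < R)
    (hR' : R < R') (hM0 : 0 < M₀) (hM1 : 0 < M₁)
    (h1i : ∀ z, ‖z‖ ≤ R → η₁ z = 1) (h0i : ∀ z, ‖z‖ ≤ ρ / 2 → η₀ z = 1)
    (h0o : ∀ z, ρ ≤ ‖z‖ → η₀ z = 0) (h1o : ∀ z, R' ≤ ‖z‖ → η₁ z = 0)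
    (h0d : ∀ z, ‖dbarOne η₀ z‖ ^ 2 ≤ M₀ ∧ (‖z‖ < ρ / 2 ∨ ρ ≤ ‖z‖ → dbarOne η₀ z = 0))
    (h1d : ∀ z, ‖dbarOne η₁ z‖ ^ 2 ≤ M₁ ∧ (‖z‖ < R ∨ R' ≤ ‖z‖ → dbarOne η₁ z = 0))
    (hηc : ContDiff ℝ 2 fun z ↦ (1 - η₀ z) * η₁ z) (hη1 : ∀ z, ‖(1 - η₀ z) * η₁ z‖ ≤ 1)
    (hdη : ∀ z, dbarOne (fun z ↦ (1 - η₀ z) * η₁ z) z =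
      (1 - η₀ z) * dbarOne η₁ z - η₁ z * dbarOne η₀ z) (hf : ContDiff ℝ 2 f) (hs0 : 0 < s)
    (hA0 : 0 < A) (hA : 8 * (1 + (M₀ + M₁)) * Real.exp (s / (ρ / 2)) ≤ A)
    (hB : 8 * (M₀ + M₁) * Real.exp (s / R) ≤ B) (hB0 : 0 ≤ B) (z : ℂ)
    [DecidablePred (· ∈ Metric.ball (0 : ℂ) ρ)] [DecidablePred (· ∈ Metric.ball (0 : ℂ) R')] :
    4 * Real.exp (s / ‖z‖) * ‖dbarOne (fun z ↦ (1 - η₀ z) * η₁ z * f z) z‖ ^ 2 ≤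
        (if z ∈ Metric.ball (0 : ℂ) ρ then A * ‖f z‖ ^ 2 else 0) +
        (if z ∈ Metric.ball (0 : ℂ) R' then A * ‖dbarOne f z‖ ^ 2 else 0) +
        (if z ∈ Metric.ball (0 : ℂ) R' then B * ‖f z‖ ^ 2 else 0) := by
  set M := M₀ + M₁ with hM
  have hM' : 0 < M := by positivity
  have hgen := norm_dbarOne_mul_sq_le hηc hf z (hη1 z)
  have hdg := dbarOne_mul hηc hf z
  have hdηz := hdη z
  clear hdη hη1
  simp only [mem_ball_zero_iff]
  have hE := Real.exp_pos (s / ‖z‖)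
  have hE0 := Real.exp_pos (s / (ρ / 2))
  have hd0 := h0d z
  have hd1 := h1d z
  have hf2 := sq_nonneg ‖f z‖
  have hdf2 := sq_nonneg ‖dbarOne f z‖
  have e2 : 0 ≤ B * ‖f z‖ ^ 2 := by positivity
  have e5 : 0 ≤ A * ‖dbarOne f z‖ ^ 2 := by positivity
  have e6 : 0 ≤ A * ‖f z‖ ^ 2 := by positivity
  have e3 : 4 * Real.exp (s / ‖z‖) * ‖dbarOne (fun z ↦ (1 - η₀ z) * η₁ z * f z) z‖ ^ 2 ≤
      4 * Real.exp (s / ‖z‖) * (2 * ‖dbarOne f z‖ ^ 2) + 4 * Real.exp (s / ‖z‖) *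
        (2 * (‖f z‖ ^ 2 * ‖dbarOne (fun z ↦ (1 - η₀ z) * η₁ z) z‖ ^ 2)) := by
    rw [← mul_add]
    exact mul_le_mul_of_nonneg_left hgen (by positivity)
  clear hgen
  by_cases h1 : ‖z‖ < ρ / 2
  · rw [hdg, hdηz, hd0.2 (Or.inl h1), hd1.2 (Or.inl (by linarith)), h0i z h1.le]
    simp only [show ‖z‖ < ρ by linarith, show ‖z‖ < R' by linarith, if_true]
    simp only [mul_zero, zero_mul, add_zero, norm_zero, sub_self, ne_eq,
      OfNat.ofNat_ne_zero, not_false_eq_true, zero_pow]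
    linarith
  have h1' := not_lt.1 h1
  have hz0 : 0 < ‖z‖ := (half_pos hρ).trans_le h1'
  have hEle : Real.exp (s / ‖z‖) ≤ Real.exp (s / (ρ / 2)) := by gcongr
  have hbase : 4 * Real.exp (s / ‖z‖) * (2 * ‖dbarOne f z‖ ^ 2) ≤ A * ‖dbarOne f z‖ ^ 2 := by
    have h8 : 4 * Real.exp (s / ‖z‖) * (2 * ‖dbarOne f z‖ ^ 2) ≤
      4 * Real.exp (s / (ρ / 2)) * (2 * ‖dbarOne f z‖ ^ 2) := by gcongr
    have h9 := mul_le_mul_of_nonneg_right hA hdf2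
    have h10 : 0 ≤ M * Real.exp (s / (ρ / 2)) * ‖dbarOne f z‖ ^ 2 := by positivity
    linarith
  by_cases h2 : ‖z‖ < ρ
  · have h7 : ‖dbarOne (fun z ↦ (1 - η₀ z) * η₁ z) z‖ ^ 2 ≤ M := by
      rw [hdηz, hd1.2 (Or.inl (by linarith)), h1i z (by linarith)]
      simp only [mul_zero, one_mul, zero_sub, norm_neg]
      linarith
    simp only [h2, show ‖z‖ < R' by linarith, if_true]
    have e1 : 4 * Real.exp (s / ‖z‖) *
        (2 * (‖f z‖ ^ 2 * ‖dbarOne (fun z ↦ (1 - η₀ z) * η₁ z) z‖ ^ 2)) ≤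
        4 * Real.exp (s / (ρ / 2)) * (2 * (‖f z‖ ^ 2 * M)) := by gcongr
    have h9 := mul_le_mul_of_nonneg_right hA hf2
    have h10 : 0 ≤ Real.exp (s / (ρ / 2)) * ‖f z‖ ^ 2 := by positivity
    linarith
  have h2' := not_lt.1 h2
  by_cases h3 : ‖z‖ < R
  · have h7 : dbarOne (fun z ↦ (1 - η₀ z) * η₁ z) z = 0 := by
      rw [hdηz, hd1.2 (Or.inl (by linarith)), hd0.2 (Or.inr h2')]
      simp
    rw [h7] at e3
    simp only [h2, show ‖z‖ < R' by linarith, if_true, if_false]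
    simp only [norm_zero, ne_eq, OfNat.ofNat_ne_zero, not_false_eq_true, zero_pow, mul_zero,
      add_zero] at e3
    linarith
  have h3' := not_lt.1 h3
  by_cases h4 : ‖z‖ < R'
  · have h7 : ‖dbarOne (fun z ↦ (1 - η₀ z) * η₁ z) z‖ ^ 2 ≤ M := by
      rw [hdηz, hd0.2 (Or.inr (by linarith)), h0o z (by linarith)]
      simp only [mul_zero, one_mul, sub_zero]
      linarith
    simp only [h2, h4, if_true, if_false]
    have hR0 : 0 < R := hρ.trans hR
    have hEle2 : Real.exp (s / ‖z‖) ≤ Real.exp (s / R) := by gcongr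
    have e1 : 4 * Real.exp (s / ‖z‖) *
        (2 * (‖f z‖ ^ 2 * ‖dbarOne (fun z ↦ (1 - η₀ z) * η₁ z) z‖ ^ 2)) ≤
        4 * Real.exp (s / R) * (2 * (‖f z‖ ^ 2 * M)) := by gcongr
    have h9 := mul_le_mul_of_nonneg_right hB hf2
    linarith
  · have h4' := not_lt.1 h4
    rw [hdg, hdηz, hd0.2 (Or.inr (by linarith)), hd1.2 (Or.inr h4'), h1o z h4']
    simp [h2, h4]

/-- Propagation of smallness for `∂̄` from a disc to a concentric disc. -/
theorem lintegral_ball_le_propagation {ρ R R' δ : ℝ} (hρ : 0 < ρ) (hR : ρ < R) (hR' : R < R')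
    (hδ : 0 < δ) :
    ∃ C : ℝ, 0 < C ∧ ∀ (a : ℂ) (f : ℂ → ℂ), ContDiff ℝ 2 f →
      ∫⁻ z in Metric.ball a R, ENNReal.ofReal (‖f z‖ ^ 2) ≤
        ENNReal.ofReal C * (∫⁻ z in Metric.ball a ρ, ENNReal.ofReal (‖f z‖ ^ 2)) +
        ENNReal.ofReal C * (∫⁻ z in Metric.ball a R', ENNReal.ofReal (‖dbarOne f z‖ ^ 2)) +
          ENNReal.ofReal δ * ∫⁻ z in Metric.ball a R', ENNReal.ofReal (‖f z‖ ^ 2) := by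
  classical
  obtain ⟨η₀, h0c, h0i, h0o, h0b, M₀, hM0, h0d⟩ := exists_cutoff (half_pos hρ) (half_lt_self hρ)
  obtain ⟨η₁, h1c, h1i, h1o, h1b, M₁, hM1, h1d⟩ := exists_cutoff (hρ.trans hR) hR'
  set M := M₀ + M₁ with hM
  -- With this `s` the gain `K`, the value of the Carleman weight at `‖z‖ = R`, satisfies `K δ = 8 M
  -- exp (s / R)`, so that after division by `K` the error of the outer cutoff has coefficient
  -- exactly `δ`.
  set s := 16 * M * R ^ 3 / δ with hs
  have hR0 : 0 < R := hρ.trans hR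
  have hR'0 : 0 < R' := hR0.trans hR'
  have hM' : 0 < M := by positivity
  have hs0 : 0 < s := by positivity
  set K := s / 2 / R ^ 3 * Real.exp (s / R) with hK
  have hKδ : K * δ = 8 * M * Real.exp (s / R) := by rw [hK, hs]; field_simp; norm_num
  have hK0 : 0 < K := by positivity
  set A := 8 * (1 + M) * Real.exp (s / (ρ / 2)) with hA
  have hA0 : 0 < A := by positivity
  -- The `1` accounts for the mass on the small disc, where the cutoff hides `f` and the left side
  -- is simply moved to the right.
  refine ⟨A / K + 1, by positivity, ?_⟩
  have main : ∀ f : ℂ → ℂ, ContDiff ℝ 2 f →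
      ∫⁻ z in Metric.ball 0 R, ENNReal.ofReal (‖f z‖ ^ 2) ≤
        ENNReal.ofReal (A / K + 1) * (∫⁻ z in Metric.ball 0 ρ, ENNReal.ofReal (‖f z‖ ^ 2)) +
        ENNReal.ofReal (A / K + 1) *
          (∫⁻ z in Metric.ball 0 R', ENNReal.ofReal (‖dbarOne f z‖ ^ 2)) +
          ENNReal.ofReal δ * ∫⁻ z in Metric.ball 0 R', ENNReal.ofReal (‖f z‖ ^ 2) := by
    intro f hf
    set η : ℂ → ℂ := fun z ↦ (1 - η₀ z) * η₁ z with hη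
    have h0c' : ContDiff ℝ 2 (fun z ↦ 1 - η₀ z) := contDiff_const.sub h0c
    have hηc : ContDiff ℝ 2 η := h0c'.mul h1c
    have hη1 : ∀ z, ‖η z‖ ≤ 1 := fun z ↦ by
      rw [hη, norm_mul]
      exact mul_le_one₀ (h0b z).2 (norm_nonneg _) (h1b z).1
    have hdη : ∀ z, dbarOne η z = (1 - η₀ z) * dbarOne η₁ z - η₁ z * dbarOne η₀ z := by
      intro z
      rw [dbarOne_mul h0c' h1c]
      have : dbarOne (fun z ↦ 1 - η₀ z) z = - dbarOne η₀ z := by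
        simp only [dbarOne, fderiv_const_sub]
        simp
        ring
      rw [this]; ring
    have carl := lintegral_carleman_annulus (half_pos hρ) (by linarith : ρ / 2 ≤ R')
      (hηc.mul hf) (fun z hz ↦ by simp [hη, h0i z hz]) (fun z hz ↦ by simp [hη, h1o z hz]) hs0.le
    -- Between `ρ` and `R` the cutoff equals one and the Carleman weight, being decreasing in `‖z‖`,
    -- is at least `K`.
    have low : ∀ z, (if z ∈ Metric.ball (0 : ℂ) R then K * ‖f z‖ ^ 2 else 0) ≤
        (if z ∈ Metric.ball (0 : ℂ) ρ then K * ‖f z‖ ^ 2 else 0) + 0 +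
        s / 2 / ‖z‖ ^ 3 * Real.exp (s / ‖z‖) * ‖η z * f z‖ ^ 2 := by
      intro z
      simp only [mem_ball_zero_iff]
      have hnn : 0 ≤ s / 2 / ‖z‖ ^ 3 * Real.exp (s / ‖z‖) * ‖η z * f z‖ ^ 2 := by positivity
      by_cases h1 : ‖z‖ < ρ
      · simp only [h1, h1.trans hR, if_true]; linarith
      · by_cases h2 : ‖z‖ < R
        · have hz0 : 0 < ‖z‖ := hρ.trans_le (not_lt.1 h1)
          simp only [h1, h2, if_true, if_false, hη, h0o z (not_lt.1 h1), h1i z h2.le]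
          simp only [sub_zero, one_mul, zero_add, hK]
          gcongr
        · simp only [h1, h2, if_false]; linarith
    have up := fun z ↦ cutoff_pointwise_le (hρ := hρ) (hR := hR) (hR' := hR') hM0 hM1 h1i h0i h0o h1o
      h0d h1d hηc hη1 hdη hf hs0 hA0 hA.symm.le hKδ.symm.le (mul_nonneg hK0.le hδ.le) z
    have hfm : Measurable fun z ↦ ‖f z‖ ^ 2 := (hf.continuous.norm.pow 2).measurable
    have hdm : Measurable fun z ↦ ‖dbarOne f z‖ ^ 2 :=
      ((continuous_dbarOne hf).norm.pow 2).measurable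
    have mb (r : ℝ) : MeasurableSet (Metric.ball (0 : ℂ) r) := Metric.isOpen_ball.measurableSet
    have I1 := (lintegral_mono fun z ↦ ENNReal.ofReal_le_ofReal (low z)).trans
      (lintegral_ofReal_add₃ (Measurable.ite (mb ρ) (hfm.const_mul K) measurable_const)
        measurable_const)
    have I2 := (lintegral_mono fun z ↦ ENNReal.ofReal_le_ofReal (up z)).trans
      (lintegral_ofReal_add₃ (Measurable.ite (mb ρ) (hfm.const_mul A) measurable_const)
        (Measurable.ite (mb R') (hdm.const_mul A) measurable_const))
    rw [lintegral_ite_const_mul (mb R) hK0.le, lintegral_ite_const_mul (mb ρ) hK0.le] at I1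
    rw [lintegral_ite_const_mul (mb ρ) hA0.le, lintegral_ite_const_mul (mb R') hA0.le,
      lintegral_ite_const_mul (mb R') (by positivity)] at I2
    simp only [ENNReal.ofReal_zero, lintegral_const, zero_mul, add_zero] at I1
    have I3 := I1.trans (add_le_add_right (carl.trans I2) _)
    have hK1 : ENNReal.ofReal K ≠ 0 := by simpa using hK0
    rw [← ENNReal.mul_le_mul_iff_right hK1 ENNReal.ofReal_ne_top]
    refine I3.trans ((le_add_of_nonneg_right (zero_le :
      0 ≤ ENNReal.ofReal K * ∫⁻ z in Metric.ball 0 R',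
        ENNReal.ofReal (‖dbarOne f z‖ ^ 2))).trans_eq ?_)
    have hA' : ENNReal.ofReal A = ENNReal.ofReal K * ENNReal.ofReal (A / K) := by
      rw [← ENNReal.ofReal_mul hK0.le]
      congr 1
      field_simp
    rw [ENNReal.ofReal_mul hK0.le, hA', ENNReal.ofReal_add (by positivity) zero_le_one,
      ENNReal.ofReal_one]
    ring
  intro a f hf
  have h := main (fun z ↦ f (a + z)) (hf.comp (contDiff_const.add contDiff_id))
  have tr (g : ℂ → ℝ≥0∞) (r : ℝ) : ∫⁻ z in Metric.ball 0 r, g (a + z) =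
      ∫⁻ z in Metric.ball a r, g z := by
    rw [← lintegral_indicator Metric.isOpen_ball.measurableSet,
      ← lintegral_indicator Metric.isOpen_ball.measurableSet,
      ← lintegral_add_left_eq_self ((Metric.ball a r).indicator g) a]
    congr 1
    ext z
    simp [indicator]
  simp only [dbarOne_comp_add f a] at h
  rw [tr (fun z ↦ ENNReal.ofReal (‖f z‖ ^ 2)), tr (fun z ↦ ENNReal.ofReal (‖f z‖ ^ 2)),
    tr (fun z ↦ ENNReal.ofReal (‖f z‖ ^ 2)), tr (fun z ↦ ENNReal.ofReal (‖dbarOne f z‖ ^ 2))] at h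
  exact h

/-- The Hardy type inequality for `∂̄` near a puncture, with a control on an annulus. -/
theorem lintegral_ball_le_hardy {r₁ r₂ κ : ℝ} (h₁ : 0 < r₁) (h₂ : r₁ < r₂) (h₂' : r₂ < 1)
    (hκ : 0 < κ) :
    ∃ C : ℝ, 0 < C ∧ ∀ (ε : ℝ) (v v' : ℝ → ℝ), |ε| = 1 → Measurable v →
      (∀ r ∈ Ioc 0 r₂, HasDerivAt v (v' r) r) → ContinuousOn v' (Ioc 0 r₂) →
      (∀ r ∈ Ioc 0 r₂, 0 < v r) → (∀ r ∈ Ioc 0 r₂, 2 * Real.pi * |v' r| ≤ v r / r) →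
      (∀ r ∈ Ioc 0 r₂, κ * (v r / -Real.log r) ≤ ε * (v r / -Real.log r + r * v' r)) →
      ∀ f : ℂ → ℂ, ContDiff ℝ 2 f → (∃ a, 0 < a ∧ ∀ z, ‖z‖ ≤ a → f z = 0) →
      ∫⁻ z in Metric.ball 0 r₁, ENNReal.ofReal (v ‖z‖ / (‖z‖ * Real.log ‖z‖) ^ 2 * ‖f z‖ ^ 2) ≤
        ENNReal.ofReal C *
          (∫⁻ z in Metric.ball 0 r₂, ENNReal.ofReal (v ‖z‖ * ‖dbarOne f z‖ ^ 2)) +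
        ENNReal.ofReal C * (∫⁻ z in Metric.ball 0 r₂ \ Metric.ball 0 r₁,
          ENNReal.ofReal (v ‖z‖ / (‖z‖ * Real.log ‖z‖) ^ 2 * ‖f z‖ ^ 2)) := by
  classical
  obtain ⟨η, hηc, hi, ho, hb, M, hM0, hd⟩ := exists_cutoff h₁ h₂
  refine ⟨32 * (1 + M) / κ ^ 2, by positivity, ?_⟩
  intro ε v v' hε hvm hv hv' hv0 hvv hκv f hf ⟨a, ha, hfa⟩
  set K := κ ^ 2 / 4 with hK
  have hK0 : 0 < K := by positivity
  set A := 8 * (1 + M) with hA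
  have hA0 : 0 < A := by positivity
  have hAK : 32 * (1 + M) / κ ^ 2 = A / K := by rw [hA, hK]; field_simp; ring
  rw [hAK]
  -- Only an outer cutoff is needed, because `f` vanishes near the puncture. The radius `a'` on
  -- which it vanishes enters no constant.
  set a' := min a r₂ with ha'
  have ha'0 : 0 < a' := lt_min ha (h₁.trans h₂)
  have hsub : Icc a' r₂ ⊆ Ioc 0 r₂ := fun r hr ↦ ⟨ha'0.trans_le hr.1, hr.2⟩
  have hardy := lintegral_hardy_annulus ha'0 (min_le_right _ _) h₂' (hηc.mul hf)
    (fun z hz ↦ by simp [hfa z (hz.trans (min_le_left _ _))]) (fun z hz ↦ by simp [ho z hz])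
    (fun r hr ↦ hv r (hsub hr)) (hv'.mono hsub) (fun r hr ↦ hv0 r (hsub hr))
    (fun r hr ↦ hvv r (hsub hr)) hκ hε (fun r hr ↦ hκv r (hsub hr))
  set W : ℂ → ℝ := fun z ↦ v ‖z‖ / (‖z‖ * Real.log ‖z‖) ^ 2 with hW
  have hv00 : ∀ z : ℂ, ‖z‖ < r₂ → z ≠ 0 → 0 < v ‖z‖ := fun z hz hz0 ↦
    hv0 _ ⟨norm_pos_iff.2 hz0, hz.le⟩
  have hf0 : f 0 = 0 := hfa 0 (by simpa using ha.le)
  have low : ∀ z, (if z ∈ Metric.ball (0 : ℂ) r₁ then K * (W z * ‖f z‖ ^ 2) else 0) ≤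
      (if z ∈ Metric.ball (0 : ℂ) r₁ then K * W z * ‖η z * f z‖ ^ 2 else 0) := by
    intro z
    by_cases h : ‖z‖ < r₁
    · simp only [mem_ball_zero_iff, h, if_true, hi z h.le]
      rw [one_mul, mul_assoc]
    · simp [h]
  have low2 : ∀ z, ENNReal.ofReal
      (if z ∈ Metric.ball (0 : ℂ) r₁ then K * W z * ‖η z * f z‖ ^ 2 else 0) ≤
      ENNReal.ofReal (κ ^ 2 / 4 * (v ‖z‖ / (‖z‖ * Real.log ‖z‖) ^ 2) * ‖η z * f z‖ ^ 2) := by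
    intro z
    by_cases h : z ∈ Metric.ball (0 : ℂ) r₁ <;> simp [h, hW, hK]
  have hd0 : ∀ z, ‖z‖ < a' → dbarOne f z = 0 := by
    intro z hz
    have : f =ᶠ[nhds z] fun _ ↦ 0 :=
      Filter.eventuallyEq_of_mem ((isOpen_lt continuous_norm continuous_const).mem_nhds hz)
        fun w hw ↦ hfa w ((le_of_lt hw).trans (min_le_left _ _))
    rw [dbarOne, this.fderiv_eq]; simp
  have up : ∀ z, 4 * v ‖z‖ * ‖dbarOne (fun z ↦ η z * f z) z‖ ^ 2 ≤
      (if z ∈ Metric.ball (0 : ℂ) r₂ then A * (v ‖z‖ * ‖dbarOne f z‖ ^ 2) else 0) + 0 +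
      (if z ∈ Metric.ball (0 : ℂ) r₂ \ Metric.ball (0 : ℂ) r₁ then
        A * (W z * ‖f z‖ ^ 2) else 0) := by
    intro z
    have hgen := norm_dbarOne_mul_sq_le hηc hf z (hb z).1
    have hdz := hd z
    by_cases h2 : ‖z‖ < r₂
    swap
    · rw [dbarOne_mul hηc hf, hdz.2 (Or.inr (not_lt.1 h2)), ho z (not_lt.1 h2)]
      simp [h2]
    by_cases hz0 : z = 0
    · subst hz0
      rw [dbarOne_mul hηc hf, hd0 0 (by simpa using ha'0), hf0]
      simp
    have hvz := hv00 z h2 hz0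
    have hv4 : 0 ≤ 4 * v ‖z‖ := by positivity
    have hn := norm_pos_iff.2 hz0
    have e3 := mul_le_mul_of_nonneg_left hgen hv4
    have e4 : 0 ≤ M * (v ‖z‖ * ‖dbarOne f z‖ ^ 2) := by positivity
    by_cases h1 : ‖z‖ < r₁
    · rw [hdz.2 (Or.inl h1)] at e3
      simp only [mem_sdiff, mem_ball_zero_iff, h1, h2, if_true, not_true_eq_false, and_false,
        if_false]
      simp only [norm_zero, ne_eq, OfNat.ofNat_ne_zero, not_false_eq_true, zero_pow, mul_zero,
        add_zero] at e3
      rw [hA]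
      linarith
    · simp only [mem_sdiff, mem_ball_zero_iff, h1, h2, if_true, not_false_eq_true, and_true]
      -- Since `r |log r| ≤ 1`, the cutoff error, which carries the weight `v`, is bounded by the
      -- mass on the ring with the larger weight `W`.
      have hvW : v ‖z‖ ≤ W z := by
        have hl : Real.log ‖z‖ < 0 := Real.log_neg hn (h2.trans h₂')
        have h3 : ‖z‖ * -Real.log ‖z‖ ≤ 1 := by
          have := Real.add_one_le_exp (-Real.log ‖z‖)
          rw [Real.exp_neg, Real.exp_log hn] at this
          calc ‖z‖ * -Real.log ‖z‖ ≤ ‖z‖ * ‖z‖⁻¹ := by gcongr; linarith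
            _ = 1 := mul_inv_cancel₀ hn.ne'
        have h4 : 0 < (‖z‖ * Real.log ‖z‖) ^ 2 := by
          have : ‖z‖ * Real.log ‖z‖ ≠ 0 := mul_ne_zero hn.ne' hl.ne
          positivity
        rw [hW]
        simp only
        rw [le_div_iff₀ h4]
        have : (‖z‖ * Real.log ‖z‖) ^ 2 ≤ 1 := by
          have h0 : 0 ≤ ‖z‖ * -Real.log ‖z‖ := mul_nonneg hn.le (by linarith)
          have : (‖z‖ * Real.log ‖z‖) ^ 2 = (‖z‖ * -Real.log ‖z‖) ^ 2 := by ring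
          rw [this]
          exact pow_le_one₀ h0 h3
        nlinarith
      have e5 : v ‖z‖ * (‖f z‖ ^ 2 * ‖dbarOne η z‖ ^ 2) ≤ W z * (‖f z‖ ^ 2 * M) := by
        have := hdz.1
        have hW0 : 0 ≤ W z := hvz.le.trans hvW
        gcongr
      have e6 : 0 ≤ W z * ‖f z‖ ^ 2 := mul_nonneg (hvz.le.trans hvW) (sq_nonneg _)
      rw [hA]
      linarith
  have mb (r : ℝ) : MeasurableSet (Metric.ball (0 : ℂ) r) := Metric.isOpen_ball.measurableSet
  have hdm : Measurable fun z ↦ v ‖z‖ * ‖dbarOne f z‖ ^ 2 :=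
    (hvm.comp measurable_norm).mul ((continuous_dbarOne hf).norm.pow 2).measurable
  have I1 := lintegral_mono (μ := volume) fun z ↦ ENNReal.ofReal_le_ofReal (low z)
  have I2 := lintegral_mono (μ := volume) low2
  have I3 := (lintegral_mono fun z ↦ ENNReal.ofReal_le_ofReal (up z)).trans
      (lintegral_ofReal_add₃ (Measurable.ite (mb r₂) (hdm.const_mul A) measurable_const)
        measurable_const)
  rw [lintegral_ite_const_mul (mb r₁) hK0.le] at I1
  rw [lintegral_ite_const_mul (mb r₂) hA0.le,
    lintegral_ite_const_mul ((mb r₂).diff (mb r₁)) hA0.le] at I3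
  simp only [ENNReal.ofReal_zero, lintegral_const, zero_mul, add_zero] at I3
  have hK1 : ENNReal.ofReal K ≠ 0 := by simpa using hK0
  rw [← ENNReal.mul_le_mul_iff_right hK1 ENNReal.ofReal_ne_top]
  refine ((I1.trans I2).trans (hardy.trans I3)).trans_eq ?_
  have hA' : ENNReal.ofReal A = ENNReal.ofReal K * ENNReal.ofReal (A / K) := by
    rw [← ENNReal.ofReal_mul hK0.le]
    congr 1
    field_simp
  rw [hA']
  ring

/-- The weights that occur near a divisor: a weight that grows slower than `(-log r) ^ β` for some
`β < 1`. -/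
structure IsSlowWeight (w w' : ℝ → ℝ) (r₂ β : ℝ) : Prop where
  measurable : Measurable w
  hasDerivAt : ∀ r ∈ Ioc 0 r₂, HasDerivAt w (w' r) r
  continuousOn : ContinuousOn w' (Ioc 0 r₂)
  pos : ∀ r ∈ Ioc 0 r₂, 0 < w r
  nonpos : ∀ r ∈ Ioc 0 r₂, w' r ≤ 0
  le : ∀ r ∈ Ioc 0 r₂, -(r * w' r) ≤ β * (w r / -Real.log r)

/-- The number 40 is chosen larger than `6π`, so that the logarithmic derivatives of the weights
below are small enough for the angular part of the Hardy inequality. -/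
theorem neg_log_ge_of_le {r : ℝ} (hr0 : 0 < r) (hr : r ≤ Real.exp (-40)) : 40 ≤ -Real.log r := by
  have := Real.log_le_log hr0 hr
  rw [Real.log_exp] at this
  linarith

/-- Here `v = w` and `ε = 1`: as `w` decays no faster in `r` than `(-log r)^β`, the multiplier `w /
(-log r)` is increasing with rate `κ = 1 - β`. -/
theorem lintegral_ball_le_slowWeight {r₁ r₂ β : ℝ} (h₁ : 0 < r₁) (h₂ : r₁ < r₂)
    (h₂' : r₂ ≤ Real.exp (-40)) (hβ : β < 1) :
    ∃ C : ℝ, 0 < C ∧ ∀ (w w' : ℝ → ℝ), IsSlowWeight w w' r₂ β →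
      ∀ f : ℂ → ℂ, ContDiff ℝ 2 f → (∃ a, 0 < a ∧ ∀ z, ‖z‖ ≤ a → f z = 0) →
      ∫⁻ z in Metric.ball 0 r₁, ENNReal.ofReal (w ‖z‖ / (‖z‖ * Real.log ‖z‖) ^ 2 * ‖f z‖ ^ 2) ≤
        ENNReal.ofReal C *
          (∫⁻ z in Metric.ball 0 r₂, ENNReal.ofReal (w ‖z‖ * ‖dbarOne f z‖ ^ 2)) +
        ENNReal.ofReal C * (∫⁻ z in Metric.ball 0 r₂ \ Metric.ball 0 r₁,
          ENNReal.ofReal (w ‖z‖ / (‖z‖ * Real.log ‖z‖) ^ 2 * ‖f z‖ ^ 2)) := by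
  have h₂'' : r₂ < 1 := h₂'.trans_lt (by rw [Real.exp_lt_one_iff]; norm_num)
  obtain ⟨C, hC, H⟩ := lintegral_ball_le_hardy h₁ h₂ h₂'' (sub_pos.2 hβ)
  refine ⟨C, hC, fun w w' hw f hf hf0 ↦ H 1 w w' (by simp) hw.measurable hw.hasDerivAt
    hw.continuousOn hw.pos (fun r hr ↦ ?_) (fun r hr ↦ ?_) f hf hf0⟩
  · have hpi : Real.pi < 4 := Real.pi_lt_four
    have hpi0 := Real.pi_pos
    have h40 := neg_log_ge_of_le hr.1 (hr.2.trans h₂')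
    have h1 := hw.le r hr
    have h2 := hw.nonpos r hr
    have h3 := hw.pos r hr
    rw [abs_of_nonpos h2, le_div_iff₀ hr.1]
    have h4 : β * (w r / -Real.log r) ≤ w r / 40 := by
      have h5 : 0 ≤ w r / -Real.log r := by positivity
      have h6 : w r / -Real.log r ≤ w r / 40 := by gcongr
      nlinarith
    have h7 : 0 ≤ -(r * w' r) := by nlinarith [hr.1]
    nlinarith
  · have := hw.le r hr
    linarith

/-- The Hardy inequality for `z f`, which has `∂̄(z f) = z ∂̄f`, and for the weight `w log² r`. The
factors `|z|²` and `log² r` cancel the Hardy weight on the left and produce `(r log r)²` on the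
right. -/
theorem lintegral_ball_le_slowWeight_mul {r₁ r₂ β : ℝ} (h₁ : 0 < r₁) (h₂ : r₁ < r₂)
    (h₂' : r₂ ≤ Real.exp (-40)) (hβ : β < 1) :
    ∃ C : ℝ, 0 < C ∧ ∀ (w w' : ℝ → ℝ), IsSlowWeight w w' r₂ β →
      ∀ f : ℂ → ℂ, ContDiff ℝ 2 f → (∃ a, 0 < a ∧ ∀ z, ‖z‖ ≤ a → f z = 0) →
      ∫⁻ z in Metric.ball 0 r₁, ENNReal.ofReal (w ‖z‖ * ‖f z‖ ^ 2) ≤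
        ENNReal.ofReal C * (∫⁻ z in Metric.ball 0 r₂,
          ENNReal.ofReal (w ‖z‖ * (‖z‖ * Real.log ‖z‖) ^ 2 * ‖dbarOne f z‖ ^ 2)) +
        ENNReal.ofReal C * (∫⁻ z in Metric.ball 0 r₂ \ Metric.ball 0 r₁,
          ENNReal.ofReal (w ‖z‖ * ‖f z‖ ^ 2)) := by
  have h₂'' : r₂ < 1 := h₂'.trans_lt (by rw [Real.exp_lt_one_iff]; norm_num)
  obtain ⟨C, hC, H⟩ := lintegral_ball_le_hardy h₁ h₂ h₂'' one_pos
  refine ⟨C, hC, fun w w' hw f hf hf0 ↦ ?_⟩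
  have hzf : ContDiff ℝ 2 (fun z ↦ z * f z) := contDiff_id.mul hf
  obtain ⟨a, ha, hfa⟩ := hf0
  have hlog : ∀ r ∈ Ioc 0 r₂, Real.log r < 0 := fun r hr ↦
    Real.log_neg hr.1 (hr.2.trans_lt h₂'')
  -- Now the multiplier is `w (-log r)`, which decreases in `r`; hence `ε = -1`, with rate `κ = 1`
  -- because `w' ≤ 0`. The bound on `β` serves only for the slow variation of the weight.
  have h := H (-1) (fun r ↦ w r * Real.log r ^ 2)
    (fun r ↦ w' r * Real.log r ^ 2 + w r * (2 * Real.log r / r)) (by simp)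
    (hw.measurable.mul (Real.measurable_log.pow_const 2))
    (fun r hr ↦ by
      refine ((hw.hasDerivAt r hr).mul ((Real.hasDerivAt_log hr.1.ne').pow 2)).congr_deriv ?_
      simp
      left
      field_simp)
    (by
      have h1 : ContinuousOn Real.log (Ioc 0 r₂) :=
        Real.continuousOn_log.mono fun r hr ↦ hr.1.ne'
      have h2 : ContinuousOn (fun r : ℝ ↦ r⁻¹) (Ioc 0 r₂) :=
        continuousOn_inv₀.mono fun r hr ↦ hr.1.ne'
      have h3 : ContinuousOn w (Ioc 0 r₂) := fun r hr ↦
        (hw.hasDerivAt r hr).continuousAt.continuousWithinAt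
      have h4 := hw.continuousOn
      simp only [div_eq_mul_inv]
      fun_prop)
    (fun r hr ↦ by
      have := hw.pos r hr
      have := (hlog r hr).ne
      positivity)
    (fun r hr ↦ by
      have hpi : Real.pi < 4 := Real.pi_lt_four
      have hpi0 := Real.pi_pos
      have h40 := neg_log_ge_of_le hr.1 (hr.2.trans h₂')
      have h1 := hw.le r hr
      have h2 := hw.nonpos r hr
      have h3 := hw.pos r hr
      have h0 := hr.1
      have e : w' r * Real.log r ^ 2 + w r * (2 * Real.log r / r) ≤ 0 := by
        have : w r * (2 * Real.log r / r) ≤ 0 := by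
          apply mul_nonpos_of_nonneg_of_nonpos h3.le
          apply div_nonpos_of_nonpos_of_nonneg _ h0.le
          linarith
        nlinarith [sq_nonneg (Real.log r)]
      rw [abs_of_nonpos e, le_div_iff₀ h0]
      generalize hT : -Real.log r = T at *
      have hT' : Real.log r = -T := by linarith
      rw [hT'] at e ⊢
      have h5 : -(r * w' r) * T ≤ w r := by
        have : -(r * w' r) * T ≤ β * (w r / T) * T := by gcongr
        have h6 : β * (w r / T) * T = β * w r := by field_simp
        nlinarith
      have h7 : 2 * Real.pi * -(w' r * (-T) ^ 2 + w r * (2 * -T / r)) * r =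
          2 * Real.pi * T * (-(r * w' r) * T + 2 * w r) := by field_simp; ring
      rw [h7]
      have h8 : 2 * Real.pi * T * (-(r * w' r) * T + 2 * w r) ≤ 2 * Real.pi * T * (3 * w r) := by
        gcongr; linarith
      refine h8.trans ?_
      have h9 : 2 * Real.pi * 3 ≤ T := by linarith
      nlinarith [mul_pos (by linarith : 0 < T) h3])
    (fun r hr ↦ by
      have h2 := hw.nonpos r hr
      have h3 := hw.pos r hr
      have h0 := hr.1
      have h4 := hlog r hr
      have e1 : w r * Real.log r ^ 2 / -Real.log r = -(w r * Real.log r) := by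
        field_simp
      have e2 : r * (w' r * Real.log r ^ 2 + w r * (2 * Real.log r / r)) =
          r * w' r * Real.log r ^ 2 + 2 * (w r * Real.log r) := by field_simp
      rw [e1, e2]
      nlinarith [sq_nonneg (Real.log r), mul_nonneg h0.le (neg_nonneg.2 h2)])
    _ hzf ⟨a, ha, fun z hz ↦ by simp [hfa z hz]⟩
  have e1 : ∀ z, ‖z‖ < r₂ → w ‖z‖ * Real.log ‖z‖ ^ 2 / (‖z‖ * Real.log ‖z‖) ^ 2 * ‖z * f z‖ ^ 2 =
      w ‖z‖ * ‖f z‖ ^ 2 := by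
    intro z hz
    by_cases hz0 : z = 0
    · subst hz0; simp [hfa 0 (by simpa using ha.le)]
    · have hn := norm_pos_iff.2 hz0
      have := (hlog ‖z‖ ⟨hn, hz.le⟩).ne
      rw [norm_mul]
      field_simp
  have e2 : ∀ z, w ‖z‖ * Real.log ‖z‖ ^ 2 * ‖dbarOne (fun z ↦ z * f z) z‖ ^ 2 =
      w ‖z‖ * (‖z‖ * Real.log ‖z‖) ^ 2 * ‖dbarOne f z‖ ^ 2 := by
    intro z
    rw [dbarOne_mul (f := fun z ↦ z) contDiff_id hf, dbarOne_id, mul_zero, add_zero, norm_mul]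
    ring
  have mb (r : ℝ) : MeasurableSet (Metric.ball (0 : ℂ) r) := Metric.isOpen_ball.measurableSet
  simp only [e2] at h
  rwa [setLIntegral_congr_fun (mb r₁) fun z hz ↦ by
      rw [e1 z ((mem_ball_zero_iff.1 hz).trans h₂)],
    setLIntegral_congr_fun ((mb r₂).diff (mb r₁)) fun z hz ↦ by
      rw [e1 z (mem_ball_zero_iff.1 hz.1)]] at h

/-! ### Estimates in one of several complex variables -/

section Slices

variable {n : ℕ}

theorem dbarOne_update {f : (Fin n → ℂ) → ℂ} (hf : ContDiff ℝ 2 f) (z : Fin n → ℂ) (i : Fin n)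
    (t : ℂ) : dbarOne (fun t ↦ f (Function.update z i t)) t =
      dbarDir f (Function.update z i t) (Pi.single i 1) := by
  have h1 := (hf.differentiable (by norm_num) (Function.update z i t)).hasFDerivAt
  have h2 : HasFDerivAt (fun t : ℂ ↦ Function.update z i t)
      (ContinuousLinearMap.single ℝ (fun _ : Fin n ↦ ℂ) i) t :=
    (hasFDerivAt_update (𝕜 := ℝ) z t).congr_fderiv <| by
      ext v j
      by_cases hj : j = i
      · subst hj; simp
      · simp [hj]
  have h3 : HasFDerivAt (fun t ↦ f (Function.update z i t)) _ t := h1.comp t h2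
  have h4 : (Complex.I • Pi.single i 1 : Fin n → ℂ) = Pi.single i Complex.I := by
    rw [← Pi.single_smul]; simp
  rw [dbarOne, dbarDir, h3.fderiv, h4]
  simp

theorem contDiff_update_slice {f : (Fin n → ℂ) → ℂ} (hf : ContDiff ℝ 2 f) (z : Fin n → ℂ)
    (i : Fin n) : ContDiff ℝ 2 fun t ↦ f (Function.update z i t) :=
  hf.comp (contDiff_update 2 z i)

theorem update_mem_pi_update {z : Fin n → ℂ} {i : Fin n} {t : ℂ} {Q : Fin n → Set ℂ} {B : Set ℂ} :
    Function.update z i t ∈ univ.pi (Function.update Q i B) ↔ t ∈ B ∧ ∀ j ≠ i, z j ∈ Q j := by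
  simp only [mem_pi, mem_univ, true_imp_iff]
  constructor
  · intro h
    refine ⟨by simpa using h i, fun j hj ↦ by simpa [hj] using h j⟩
  · rintro ⟨h1, h2⟩ j
    by_cases hj : j = i
    · subst hj; simpa using h1
    · simpa [hj] using h2 j hj

theorem measurableSet_pi_update {Q : Fin n → Set ℂ} (hQ : ∀ j, MeasurableSet (Q j)) (i : Fin n)
    {B : Set ℂ} (hB : MeasurableSet B) : MeasurableSet (univ.pi (Function.update Q i B)) := by
  refine MeasurableSet.univ_pi fun j ↦ ?_
  by_cases hj : j = i
  · subst hj; simpa using hB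
  · simpa [hj] using hQ j

theorem lintegral_update_indicator {Q : Fin n → Set ℂ} (i : Fin n)
    {B : Set ℂ} (hB : MeasurableSet B) (F : (Fin n → ℂ) → ℝ≥0∞) {z : Fin n → ℂ}
    (hz : ∀ j ≠ i, z j ∈ Q j) :
    ∫⁻ t, (univ.pi (Function.update Q i B)).indicator F (Function.update z i t) =
      ∫⁻ t in B, F (Function.update z i t) := by
  rw [← lintegral_indicator hB]
  congr 1
  ext t
  by_cases ht : t ∈ B
  · rw [indicator_of_mem (update_mem_pi_update.2 ⟨ht, hz⟩), indicator_of_mem ht]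
  · rw [indicator_of_notMem (fun h ↦ ht (update_mem_pi_update.1 h).1), indicator_of_notMem ht]

/-- An inequality of integrals that holds in all slices in the direction of one coordinate. -/
theorem lintegral_pi_le_of_slices {Q : Fin n → Set ℂ} (hQ : ∀ j, MeasurableSet (Q j)) (i : Fin n)
    {B₀ B₁ B₂ B₃ : Set ℂ} (h₀ : MeasurableSet B₀) (h₁ : MeasurableSet B₁) (h₂ : MeasurableSet B₂)
    (h₃ : MeasurableSet B₃) {c₁ c₂ c₃ : ℝ≥0∞} {F₀ F₁ F₂ F₃ : (Fin n → ℂ) → ℝ≥0∞}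
    (hF₀ : Measurable F₀) (hF₁ : Measurable F₁) (hF₂ : Measurable F₂) (hF₃ : Measurable F₃)
    (h : ∀ z : Fin n → ℂ, (∀ j ≠ i, z j ∈ Q j) → ∫⁻ t in B₀, F₀ (Function.update z i t) ≤
      c₁ * (∫⁻ t in B₁, F₁ (Function.update z i t)) +
      c₂ * (∫⁻ t in B₂, F₂ (Function.update z i t)) +
      c₃ * ∫⁻ t in B₃, F₃ (Function.update z i t)) :
    ∫⁻ z in univ.pi (Function.update Q i B₀), F₀ z ≤
      c₁ * (∫⁻ z in univ.pi (Function.update Q i B₁), F₁ z) +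
      c₂ * (∫⁻ z in univ.pi (Function.update Q i B₂), F₂ z) +
      c₃ * ∫⁻ z in univ.pi (Function.update Q i B₃), F₃ z := by
  have m₀ := measurableSet_pi_update hQ i h₀
  have m₁ := measurableSet_pi_update hQ i h₁
  have m₂ := measurableSet_pi_update hQ i h₂
  have m₃ := measurableSet_pi_update hQ i h₃
  have i₀ := hF₀.indicator m₀
  have i₁ := hF₁.indicator m₁
  have i₂ := hF₂.indicator m₂
  have i₃ := hF₃.indicator m₃
  rw [← lintegral_indicator m₀, ← lintegral_indicator m₁, ← lintegral_indicator m₂,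
    ← lintegral_indicator m₃, ← lintegral_const_mul _ i₁, ← lintegral_const_mul _ i₂,
    ← lintegral_const_mul _ i₃, ← lintegral_add_left (i₁.const_mul _)]
  have i₁₂ : Measurable fun z ↦ c₁ * (univ.pi (Function.update Q i B₁)).indicator F₁ z +
      c₂ * (univ.pi (Function.update Q i B₂)).indicator F₂ z :=
    (i₁.const_mul _).add (i₂.const_mul _)
  rw [← lintegral_add_left i₁₂]
  -- Only the marginals in the `i`-th coordinate are compared. If another coordinate leaves its
  -- factor `Q j`, the left marginal is zero.
  refine lintegral_le_of_lmarginal_le {i} i₀ (i₁₂.add (i₃.const_mul _)) fun z ↦ ?_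
  have u : Measurable fun t : ℂ ↦ Function.update z i t := measurable_update z
  rw [lmarginal_singleton, lmarginal_singleton]
  beta_reduce
  by_cases hz : ∀ j ≠ i, z j ∈ Q j
  · have j₁ : Measurable fun t ↦ (univ.pi (Function.update Q i B₁)).indicator F₁
      (Function.update z i t) := i₁.comp u
    have j₂ : Measurable fun t ↦ (univ.pi (Function.update Q i B₂)).indicator F₂
      (Function.update z i t) := i₂.comp u
    have j₃ : Measurable fun t ↦ (univ.pi (Function.update Q i B₃)).indicator F₃
      (Function.update z i t) := i₃.comp u
    have j₁₂ := i₁₂.comp u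
    simp only [Function.comp_def] at j₁₂
    rw [lintegral_add_left j₁₂, lintegral_add_left (j₁.const_mul _), lintegral_const_mul _ j₁,
      lintegral_const_mul _ j₂, lintegral_const_mul _ j₃]
    rw [lintegral_update_indicator i h₀ F₀ hz, lintegral_update_indicator i h₁ F₁ hz,
      lintegral_update_indicator i h₂ F₂ hz, lintegral_update_indicator i h₃ F₃ hz]
    exact h z hz
  · have : ∀ t, (univ.pi (Function.update Q i B₀)).indicator F₀ (Function.update z i t) = 0 := by
      intro t
      rw [indicator_of_notMem]
      rw [update_mem_pi_update]
      exact fun h ↦ hz h.2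
    simp [this]

theorem continuous_dbarDir {f : (Fin n → ℂ) → ℂ} (hf : ContDiff ℝ 2 f) (w : Fin n → ℂ) :
    Continuous fun z ↦ dbarDir f z w := by
  have h := hf.continuous_fderiv (by norm_num)
  unfold dbarDir
  fun_prop

/-- Only the `z̄_i`-derivative enters and the constant is independent of the other factors `Q`, so a
polydisc can be enlarged one coordinate at a time. -/
theorem lintegral_pi_le_propagation {ρ R R' δ : ℝ} (hρ : 0 < ρ) (hR : ρ < R) (hR' : R < R')
    (hδ : 0 < δ) :
    ∃ C : ℝ, 0 < C ∧ ∀ (Q : Fin n → Set ℂ), (∀ j, MeasurableSet (Q j)) → ∀ (i : Fin n) (a : ℂ)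
      (f : (Fin n → ℂ) → ℂ), ContDiff ℝ 2 f →
      ∫⁻ z in univ.pi (Function.update Q i (Metric.ball a R)), ENNReal.ofReal (‖f z‖ ^ 2) ≤
        ENNReal.ofReal C * (∫⁻ z in univ.pi (Function.update Q i (Metric.ball a ρ)),
          ENNReal.ofReal (‖f z‖ ^ 2)) +
        ENNReal.ofReal C * (∫⁻ z in univ.pi (Function.update Q i (Metric.ball a R')),
          ENNReal.ofReal (‖dbarDir f z (Pi.single i 1)‖ ^ 2)) +
          ENNReal.ofReal δ * ∫⁻ z in univ.pi (Function.update Q i (Metric.ball a R')),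
            ENNReal.ofReal (‖f z‖ ^ 2) := by
  obtain ⟨C, hC, H⟩ := lintegral_ball_le_propagation hρ hR hR' hδ
  refine ⟨C, hC, fun Q hQ i a f hf ↦ ?_⟩
  have m (r : ℝ) : MeasurableSet (Metric.ball a r) := Metric.isOpen_ball.measurableSet
  have hfm : Measurable fun z ↦ ENNReal.ofReal (‖f z‖ ^ 2) :=
    (hf.continuous.norm.pow 2).measurable.ennreal_ofReal
  refine lintegral_pi_le_of_slices hQ i (m _) (m _) (m _) (m _) hfm hfm
    ((continuous_dbarDir hf _).norm.pow 2).measurable.ennreal_ofReal hfm fun z _ ↦ ?_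
  have := H a _ (contDiff_update_slice hf z i)
  simpa only [dbarOne_update hf] using this

end Slices

/-! ### Unitary frames and alternating forms -/

section Frames

theorem exists_unitary_frame {V : Type*} [AddCommGroup V] [Module ℂ V] [FiniteDimensional ℂ V]
    (H : V →ₗ⋆[ℂ] V →ₗ[ℂ] ℂ) (hsymm : ∀ v w, (starRingEnd ℂ) (H v w) = H w v)
    (hpos : ∀ v, v ≠ 0 → 0 < (H v v).re) {n : ℕ} (hn : Module.finrank ℂ V = n) :
    ∃ v : Fin n → V, ∀ a b, H (v a) (v b) = if a = b then 1 else 0 := by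
  let core : InnerProductSpace.Core ℂ V :=
    { inner := fun v w ↦ H v w
      conj_inner_symm := fun v w ↦ hsymm w v
      re_inner_nonneg := fun v ↦ by
        by_cases hv : v = 0
        · subst hv; simp
        · exact (hpos v hv).le
      add_left := fun x y z ↦ by simp
      smul_left := fun x y r ↦ by simp
      definite := fun v hv ↦ by
        by_contra h
        have := hpos v h
        have hv' : H v v = 0 := hv
        rw [hv'] at this
        simp at this }
  let _ : NormedAddCommGroup V := core.toNormedAddCommGroup
  let _ : InnerProductSpace ℂ V := InnerProductSpace.ofCore core.toCore
  let b := (stdOrthonormalBasis ℂ V).reindex (finCongr hn)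
  refine ⟨fun a ↦ b a, fun a c ↦ ?_⟩
  exact orthonormal_iff_ite.1 b.orthonormal a c

/-- A form on an arbitrary tuple of vectors of a frame is controlled by its values on increasing
tuples. -/
theorem norm_sq_alternating_le_sum {V : Type*} [AddCommGroup V] [Module ℂ V] {n p : ℕ}
    (α : V [⋀^Fin p]→ₗ[ℂ] ℂ) (u : Fin n → V) (k : Fin p → Fin n) :
    ‖α fun a ↦ u (k a)‖ ^ 2 ≤ ∑ J : Fin p ↪o Fin n, ‖α fun a ↦ u (J a)‖ ^ 2 := by
  by_cases hk : Function.Injective k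
  · have hmono : StrictMono (k ∘ Tuple.sort k) :=
      (Tuple.monotone_sort k).strictMono_of_injective (hk.comp (Tuple.sort k).injective)
    have h1 : α ((fun a ↦ u (k a)) ∘ Tuple.sort k) = _ := α.map_perm _ (Tuple.sort k)
    have h2 : ‖α fun a ↦ u (k a)‖ = ‖α fun a ↦ u (OrderEmbedding.ofStrictMono _ hmono a)‖ := by
      have h3 : (fun a ↦ u (OrderEmbedding.ofStrictMono _ hmono a)) =
        (fun a ↦ u (k a)) ∘ Tuple.sort k := rfl
      rw [h3, h1]
      rcases Int.units_eq_one_or (Equiv.Perm.sign (Tuple.sort k)) with h | h <;> simp [h]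
    rw [h2]
    exact Finset.single_le_sum (f := fun J : Fin p ↪o Fin n ↦ ‖α fun a ↦ u (J a)‖ ^ 2)
      (fun J _ ↦ by positivity) (Finset.mem_univ _)
  · rw [α.map_eq_zero_of_not_injective]
    · simp only [norm_zero, ne_eq, OfNat.ofNat_ne_zero, not_false_eq_true, zero_pow]
      positivity
    · intro h
      exact hk fun a b hab ↦ h (by simp [hab])

theorem norm_sq_sum_le_card_mul {ι : Type*} [Fintype ι] (x : ι → ℂ) {K : ℝ} (hK : ∀ i, ‖x i‖ ^ 2 ≤ K) :
    ‖∑ i, x i‖ ^ 2 ≤ (Fintype.card ι : ℝ) ^ 2 * K := by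
  have h1 : ‖∑ i, x i‖ ^ 2 ≤ (∑ i, ‖x i‖) ^ 2 := by gcongr; exact norm_sum_le _ _
  have h2 : (∑ i, ‖x i‖) ^ 2 ≤ (Fintype.card ι : ℝ) * ∑ i, ‖x i‖ ^ 2 := by
    simpa using sq_sum_le_card_mul_sum_sq (s := Finset.univ) (f := fun i ↦ ‖x i‖)
  have h3 : ∑ i, ‖x i‖ ^ 2 ≤ (Fintype.card ι : ℝ) * K := by
    refine (Finset.sum_le_sum fun i _ ↦ hK i).trans ?_
    simp
  calc _ ≤ _ := h1
    _ ≤ _ := h2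
    _ ≤ (Fintype.card ι : ℝ) * ((Fintype.card ι : ℝ) * K) := by gcongr
    _ = _ := by ring

/-- The constant in the comparison of the norms of a form with respect to two frames. -/
noncomputable def frameConst (n p : ℕ) (K : ℝ) : ℝ :=
  (Fintype.card (Fin p ↪o Fin n) : ℝ) * ((Fintype.card (Fin p → Fin n) : ℝ) ^ 2 * K ^ p)

theorem frameConst_nonneg (n p : ℕ) {K : ℝ} (hK : 0 ≤ K) : 0 ≤ frameConst n p K := by
  unfold frameConst; positivity

/-- The comparison of the norms of an alternating form with respect to two frames. -/
theorem sum_norm_sq_alternating_le {V : Type*} [AddCommGroup V] [Module ℂ V] {n p : ℕ}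
    (α : V [⋀^Fin p]→ₗ[ℂ] ℂ) (u v : Fin n → V) (A : Fin n → Fin n → ℂ) {K : ℝ}
    (hA : ∀ a j, ‖A a j‖ ^ 2 ≤ K) (hv : ∀ a, v a = ∑ j, A a j • u j) :
    ∑ J : Fin p ↪o Fin n, ‖α fun a ↦ v (J a)‖ ^ 2 ≤
      frameConst n p K * ∑ J : Fin p ↪o Fin n, ‖α fun a ↦ u (J a)‖ ^ 2 := by
  classical
  set S := ∑ J : Fin p ↪o Fin n, ‖α fun a ↦ u (J a)‖ ^ 2 with hS
  have hS0 : 0 ≤ S := by positivity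
  have key : ∀ J : Fin p ↪o Fin n, ‖α fun a ↦ v (J a)‖ ^ 2 ≤
      (Fintype.card (Fin p → Fin n) : ℝ) ^ 2 * (K ^ p * S) := by
    intro J
    have h1 : α (fun a ↦ v (J a)) = ∑ k : Fin p → Fin n,
        (∏ a, A (J a) (k a)) • α fun a ↦ u (k a) := by
      simp_rw [hv]
      have := α.toMultilinearMap.map_sum (fun (a : Fin p) (j : Fin n) ↦ A (J a) j • u j)
      simp only [AlternatingMap.coe_multilinearMap] at this
      rw [this]
      refine Finset.sum_congr rfl fun k _ ↦ ?_
      exact α.toMultilinearMap.map_smul_univ (fun a ↦ A (J a) (k a)) fun a ↦ u (k a)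
    rw [h1]
    refine norm_sq_sum_le_card_mul _ fun k ↦ ?_
    rw [norm_smul, mul_pow, norm_prod, ← Finset.prod_pow]
    have h2 : ∏ a, ‖A (J a) (k a)‖ ^ 2 ≤ K ^ p := by
      refine (Finset.prod_le_prod (fun a _ ↦ by positivity) fun a _ ↦ hA (J a) (k a)).trans ?_
      simp
    have h3 := norm_sq_alternating_le_sum α u k
    have h4 : 0 ≤ K ^ p := le_trans (Finset.prod_nonneg fun a _ ↦ by positivity) h2
    gcongr
  refine (Finset.sum_le_sum fun J _ ↦ key J).trans ?_
  simp only [Finset.sum_const, Finset.card_univ, nsmul_eq_mul, frameConst]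
  apply le_of_eq
  ring

variable {n : ℕ}

/-- The rescaled standard frame `√mⱼ ∂/∂zⱼ`. -/
noncomputable def scaledFrame (m : Fin n → ℝ) (j : Fin n) : Fin n → ℂ :=
  (Real.sqrt (m j) : ℂ) • Pi.single j 1

/-- A Hermitian form on `ℂⁿ` that is comparable to `∑ |vⱼ|² / mⱼ`. -/
structure IsComparable (H : (Fin n → ℂ) →ₗ⋆[ℂ] (Fin n → ℂ) →ₗ[ℂ] ℂ) (m : Fin n → ℝ)
    (c C : ℝ) : Prop where
  symm : ∀ v w, (starRingEnd ℂ) (H v w) = H w v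
  pos : ∀ j, 0 < m j
  hc : 0 < c
  hC : 0 < C
  le : ∀ v, c * ∑ j, ‖v j‖ ^ 2 / m j ≤ (H v v).re
  ge : ∀ v, (H v v).re ≤ C * ∑ j, ‖v j‖ ^ 2 / m j

variable {H : (Fin n → ℂ) →ₗ⋆[ℂ] (Fin n → ℂ) →ₗ[ℂ] ℂ} {m : Fin n → ℝ} {c C : ℝ}

theorem IsComparable.exists_frame (h : IsComparable H m c C) :
    ∃ v : Fin n → Fin n → ℂ, ∀ a b, H (v a) (v b) = if a = b then 1 else 0 := by
  refine exists_unitary_frame H h.symm (fun v hv ↦ ?_) (by simp)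
  refine lt_of_lt_of_le (mul_pos h.hc ?_) (h.le v)
  obtain ⟨j, hj⟩ := Function.ne_iff.1 hv
  have hpos := h.pos
  refine Finset.sum_pos' (fun i _ ↦ div_nonneg (by positivity) (hpos i).le) ⟨j, Finset.mem_univ _, ?_⟩
  have : 0 < ‖v j‖ := norm_pos_iff.2 hj
  have := hpos j
  positivity

theorem IsComparable.frame_expansion {v : Fin n → Fin n → ℂ}
    (hv : ∀ a b, H (v a) (v b) = if a = b then 1 else 0) (x : Fin n → ℂ) :
    x = ∑ a, H (v a) x • v a := by
  have hli : LinearIndependent ℂ v := by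
    rw [Fintype.linearIndependent_iff]
    intro g hg b
    have : H (v b) (∑ a, g a • v a) = g b := by simp [map_sum, hv]
    rw [← this, hg, map_zero]
  let B := basisOfLinearIndependentOfCardEqFinrank' v hli (by simp)
  have hB : ⇑B = v := coe_basisOfLinearIndependentOfCardEqFinrank' v hli (by simp)
  have h1 := B.sum_repr x
  rw [hB] at h1
  have h2 : ∀ b, H (v b) x = B.repr x b := by
    intro b
    conv_lhs => rw [← h1]
    simp [map_sum, hv]
  simp_rw [h2]
  exact h1.symm

theorem IsComparable.norm_frame_sq_le (h : IsComparable H m c C) {v : Fin n → Fin n → ℂ}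
    (hv : ∀ a b, H (v a) (v b) = if a = b then 1 else 0) (a j : Fin n) :
    ‖v a j / (Real.sqrt (m j) : ℂ)‖ ^ 2 ≤ c⁻¹ := by
  have h1 := h.le (v a)
  rw [hv, if_pos rfl, Complex.one_re] at h1
  have hpos := h.pos
  have h2 : ‖v a j‖ ^ 2 / m j ≤ ∑ j, ‖v a j‖ ^ 2 / m j :=
    Finset.single_le_sum (f := fun j ↦ ‖v a j‖ ^ 2 / m j)
      (fun i _ ↦ div_nonneg (by positivity) (hpos i).le) (Finset.mem_univ j)
  rw [norm_div, div_pow, Complex.norm_real, Real.norm_eq_abs, sq_abs, Real.sq_sqrt (hpos j).le]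
  have hc := h.hc
  rw [← one_div, le_div_iff₀ hc]
  nlinarith

theorem IsComparable.frame_eq_sum (h : IsComparable H m c C) (v : Fin n → Fin n → ℂ) (a : Fin n) :
    v a = ∑ j, (v a j / (Real.sqrt (m j) : ℂ)) • scaledFrame m j := by
  ext i
  have hne : ((Real.sqrt (m i) : ℝ) : ℂ) ≠ 0 := by
    exact_mod_cast (Real.sqrt_pos.2 (h.pos i)).ne'
  simp only [Finset.sum_apply, scaledFrame, Pi.smul_apply, smul_eq_mul]
  rw [Finset.sum_eq_single i (fun j _ hj ↦ by simp [Ne.symm hj]) (by simp)]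
  rw [Pi.single_eq_same]
  field_simp

/-- Parseval: the squares of the coefficients of a vector in a unitary frame sum up to its squared
`H`-norm, which for a rescaled basis vector is at most `C`. -/
theorem IsComparable.norm_coeff_sq_le (h : IsComparable H m c C) {v : Fin n → Fin n → ℂ}
    (hv : ∀ a b, H (v a) (v b) = if a = b then 1 else 0) (a j : Fin n) :
    ‖H (v a) (scaledFrame m j)‖ ^ 2 ≤ C := by
  have h1 := h.ge (scaledFrame m j)
  have hpos := h.pos
  have h2 : ∑ i, ‖scaledFrame m j i‖ ^ 2 / m i = 1 := by
    rw [Finset.sum_eq_single j (fun i _ hi ↦ by simp [scaledFrame, hi]) (by simp)]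
    simp only [scaledFrame, Pi.smul_apply, Pi.single_eq_same, smul_eq_mul, mul_one]
    rw [Complex.norm_real, Real.norm_eq_abs, sq_abs, Real.sq_sqrt (hpos j).le,
      div_self (hpos j).ne']
  have h3 : (H (scaledFrame m j) (scaledFrame m j)).re = ∑ a, ‖H (v a) (scaledFrame m j)‖ ^ 2 := by
    conv_lhs => 
      arg 1
      arg 2
      rw [IsComparable.frame_expansion hv (scaledFrame m j)]
    rw [map_sum, Complex.re_sum]
    refine Finset.sum_congr rfl fun b _ ↦ ?_
    rw [map_smul, smul_eq_mul, ← h.symm (v b), Complex.mul_conj, Complex.ofReal_re,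
      Complex.normSq_eq_norm_sq]
  rw [h2, h3, mul_one] at h1
  refine le_trans ?_ h1
  exact Finset.single_le_sum (f := fun a ↦ ‖H (v a) (scaledFrame m j)‖ ^ 2)
    (fun i _ ↦ by positivity) (Finset.mem_univ a)

/-- Bounds for the determinant of a Hermitian form. -/
theorem IsComparable.det_bounds (h : IsComparable H m c C) :
    ((n.factorial : ℝ) ^ 2 * (c⁻¹) ^ n)⁻¹ * ∏ j, (m j)⁻¹ ≤
      (Matrix.det (Matrix.of fun j k : Fin n ↦ H (Pi.single j 1) (Pi.single k 1))).re ∧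
    (Matrix.det (Matrix.of fun j k : Fin n ↦ H (Pi.single j 1) (Pi.single k 1))).re ≤
      ((n.factorial : ℝ) ^ 2 * C ^ n) * ∏ j, (m j)⁻¹ := by
  obtain ⟨v, hv⟩ := h.exists_frame
  -- `A` and `B` are the mutually inverse transition matrices between a unitary frame and the
  -- rescaled frame. The rescaled Gram matrix is `B̄ Bᵀ`, so `det G ∏ m_j = |det B|²`. The entries
  -- of `B` give the upper bound, and those of `A = B⁻¹` the lower one.
  set A : Matrix (Fin n) (Fin n) ℂ := Matrix.of fun a j ↦ v a j / (Real.sqrt (m j) : ℂ) with hA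
  set B : Matrix (Fin n) (Fin n) ℂ := Matrix.of fun j a ↦ H (v a) (scaledFrame m j) with hB
  have hAB : A * B = 1 := by
    ext a b
    rw [Matrix.mul_apply, Matrix.one_apply]
    have := hv b a
    rw [h.frame_eq_sum v a, map_sum] at this
    simp only [map_smul, smul_eq_mul] at this
    simp only [hA, hB, Matrix.of_apply]
    rw [this]
    simp [eq_comm]
  have hdet : A.det * B.det = 1 := by rw [← Matrix.det_mul, hAB, Matrix.det_one]
  set G : Matrix (Fin n) (Fin n) ℂ := Matrix.of fun j k : Fin n ↦ H (Pi.single j 1) (Pi.single k 1)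
    with hG
  set D : Matrix (Fin n) (Fin n) ℂ := Matrix.diagonal fun j ↦ (Real.sqrt (m j) : ℂ) with hD
  have hDG : D * G * D = B.map (starRingEnd ℂ) * B.transpose := by
    ext j k
    rw [Matrix.mul_diagonal, Matrix.diagonal_mul, Matrix.mul_apply]
    simp only [hB, hG, Matrix.of_apply, Matrix.map_apply, Matrix.transpose_apply]
    have : H (scaledFrame m j) (scaledFrame m k) =
        (Real.sqrt (m j) : ℂ) * H (Pi.single j 1) (Pi.single k 1) * (Real.sqrt (m k) : ℂ) := by
      simp only [scaledFrame, map_smulₛₗ, LinearMap.smul_apply, smul_eq_mul,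
        Complex.conj_ofReal]
      simp
      ring
    rw [← this]
    conv_lhs =>
      arg 2
      rw [IsComparable.frame_expansion hv (scaledFrame m k)]
    rw [map_sum]
    refine Finset.sum_congr rfl fun b _ ↦ ?_
    rw [map_smul, smul_eq_mul, ← h.symm (v b), mul_comm]
  have hpos := h.pos
  have hdd : ((∏ j, m j : ℝ) : ℂ) * G.det = ((‖B.det‖ ^ 2 : ℝ) : ℂ) := by
    have h1 := congrArg Matrix.det hDG
    rw [Matrix.det_mul, Matrix.det_mul, Matrix.det_mul, Matrix.det_transpose, hD,
      Matrix.det_diagonal] at h1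
    have h2 : (B.map (starRingEnd ℂ)).det = (starRingEnd ℂ) B.det := by
      rw [RingHom.map_det]; rfl
    rw [h2, ← Complex.normSq_eq_conj_mul_self, Complex.normSq_eq_norm_sq] at h1
    rw [← h1]
    have h3 : ((∏ j, m j : ℝ) : ℂ) = (∏ j, (Real.sqrt (m j) : ℂ)) * ∏ j, (Real.sqrt (m j) : ℂ) := by
      rw [← Finset.prod_mul_distrib]
      push_cast
      refine Finset.prod_congr rfl fun j _ ↦ ?_
      rw [← Complex.ofReal_mul, Real.mul_self_sqrt (hpos j).le]
    rw [h3]; ring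
  have hP : 0 < ∏ j, m j := Finset.prod_pos fun j _ ↦ hpos j
  have hre : G.det.re = ‖B.det‖ ^ 2 * ∏ j, (m j)⁻¹ := by
    have h1 := congrArg Complex.re hdd
    rw [Complex.re_ofReal_mul, Complex.ofReal_re] at h1
    rw [Finset.prod_inv_distrib, ← h1]
    field_simp
  have hAn : ‖A.det‖ ^ 2 ≤ (n.factorial : ℝ) ^ 2 * (c⁻¹) ^ n := by
    have h1 : ‖A.det‖ ≤ n.factorial • (Real.sqrt c⁻¹) ^ n := by
      have := Matrix.det_le (A := A) (abv := IsAbsoluteValue.toAbsoluteValue (norm : ℂ → ℝ))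
        (x := Real.sqrt c⁻¹) fun i j ↦ Real.le_sqrt_of_sq_le (h.norm_frame_sq_le hv i j)
      simpa using this
    calc ‖A.det‖ ^ 2 ≤ (n.factorial • (Real.sqrt c⁻¹) ^ n) ^ 2 := by gcongr
      _ = (n.factorial : ℝ) ^ 2 * ((Real.sqrt c⁻¹) ^ 2) ^ n := by rw [nsmul_eq_mul]; ring
      _ = _ := by rw [Real.sq_sqrt (inv_pos.2 h.hc).le]
  have hBn : ‖B.det‖ ^ 2 ≤ (n.factorial : ℝ) ^ 2 * C ^ n := by
    have h1 : ‖B.det‖ ≤ n.factorial • (Real.sqrt C) ^ n := by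
      have := Matrix.det_le (A := B) (abv := IsAbsoluteValue.toAbsoluteValue (norm : ℂ → ℝ))
        (x := Real.sqrt C) fun i j ↦ Real.le_sqrt_of_sq_le (h.norm_coeff_sq_le hv j i)
      simpa using this
    calc ‖B.det‖ ^ 2 ≤ (n.factorial • (Real.sqrt C) ^ n) ^ 2 := by gcongr
      _ = (n.factorial : ℝ) ^ 2 * ((Real.sqrt C) ^ 2) ^ n := by rw [nsmul_eq_mul]; ring
      _ = _ := by rw [Real.sq_sqrt h.hC.le]
  have hPi : 0 ≤ ∏ j, (m j)⁻¹ := Finset.prod_nonneg fun j _ ↦ (inv_pos.2 (hpos j)).le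
  rw [hre]
  refine ⟨mul_le_mul_of_nonneg_right ?_ hPi, mul_le_mul_of_nonneg_right hBn hPi⟩
  have hn : ‖A.det‖ ^ 2 * ‖B.det‖ ^ 2 = 1 := by
    rw [← mul_pow, ← norm_mul, hdet]; simp
  have hA0 : 0 < ‖A.det‖ ^ 2 := by
    rcases (sq_nonneg ‖A.det‖).lt_or_eq with h | h
    · exact h
    · rw [← h] at hn; simp at hn
  rw [eq_inv_of_mul_eq_one_right hn]
  exact inv_anti₀ hA0 hAn

end Frames

/-! ### Calculus of Wirtinger derivatives -/

section Wirtinger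

open Filter Topology

variable {n : ℕ} {f g : (Fin n → ℂ) → ℂ} {z w v : Fin n → ℂ}

theorem dbarDir_congr (h : f =ᶠ[𝓝 z] g) (w : Fin n → ℂ) : dbarDir f z w = dbarDir g z w := by
  simp only [dbarDir, h.fderiv_eq]

theorem delDir_congr (h : f =ᶠ[𝓝 z] g) (w : Fin n → ℂ) : delDir f z w = delDir g z w := by
  simp only [delDir, h.fderiv_eq]

theorem eventuallyEq_dbarDir (h : f =ᶠ[𝓝 z] g) (w : Fin n → ℂ) :
    (fun ζ ↦ dbarDir f ζ w) =ᶠ[𝓝 z] fun ζ ↦ dbarDir g ζ w := by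
  filter_upwards [h.eventuallyEq_nhds] with ζ hζ using dbarDir_congr hζ w

theorem dbarDir_const (c : ℂ) : dbarDir (fun _ : Fin n → ℂ ↦ c) z w = 0 := by
  simp [dbarDir]

theorem dbarDir_add_right (f : (Fin n → ℂ) → ℂ) (z v w : Fin n → ℂ) :
    dbarDir f z (v + w) = dbarDir f z v + dbarDir f z w := by
  simp only [dbarDir, smul_add, map_add]; ring

theorem dbarDir_smul_right (f : (Fin n → ℂ) → ℂ) (z : Fin n → ℂ) (c : ℂ) (w : Fin n → ℂ) :
    dbarDir f z (c • w) = (starRingEnd ℂ) c * dbarDir f z w := by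
  have h1 : c • w = c.re • w + c.im • (Complex.I • w) := by
    ext j
    simp only [Pi.smul_apply, smul_eq_mul, Pi.add_apply, Complex.real_smul]
    conv_lhs => rw [← Complex.re_add_im c]
    ring
  have h2 : Complex.I • c • w = c.re • (Complex.I • w) - c.im • w := by
    ext j
    simp only [Pi.smul_apply, smul_eq_mul, Pi.sub_apply, Complex.real_smul]
    conv_lhs => rw [← Complex.re_add_im c]
    linear_combination (c.im * w j : ℂ) * Complex.I_mul_I
  have h3 : (starRingEnd ℂ) c = c.re - c.im * Complex.I := by
    apply Complex.ext <;> simp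
  simp only [dbarDir, h2]
  rw [h1]
  simp only [map_add, map_sub, map_smul, Complex.real_smul, h3]
  linear_combination ((1 / 2) * (c.im : ℂ) * fderiv ℝ f z (Complex.I • w)) * Complex.I_mul_I

theorem delDir_add_right (f : (Fin n → ℂ) → ℂ) (z v w : Fin n → ℂ) :
    delDir f z (v + w) = delDir f z v + delDir f z w := by
  simp only [delDir, smul_add, map_add]; ring

theorem delDir_smul_right (f : (Fin n → ℂ) → ℂ) (z : Fin n → ℂ) (c : ℂ) (w : Fin n → ℂ) :
    delDir f z (c • w) = c * delDir f z w := by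
  have h1 : c • w = c.re • w + c.im • (Complex.I • w) := by
    ext j
    simp only [Pi.smul_apply, smul_eq_mul, Pi.add_apply, Complex.real_smul]
    conv_lhs => rw [← Complex.re_add_im c]
    ring
  have h2 : Complex.I • c • w = c.re • (Complex.I • w) - c.im • w := by
    ext j
    simp only [Pi.smul_apply, smul_eq_mul, Pi.sub_apply, Complex.real_smul]
    conv_lhs => rw [← Complex.re_add_im c]
    linear_combination (c.im * w j : ℂ) * Complex.I_mul_I
  have h3 : c = c.re + c.im * Complex.I := (Complex.re_add_im c).symm
  simp only [delDir, h2]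
  rw [h1]
  simp only [map_add, map_sub, map_smul, Complex.real_smul]
  conv_rhs => rw [h3]
  linear_combination ((1 / 2) * (c.im : ℂ) * fderiv ℝ f z (Complex.I • w)) * Complex.I_mul_I

/-- `dbarDir` as a conjugate-linear map. -/
noncomputable def dbarLin (f : (Fin n → ℂ) → ℂ) (z : Fin n → ℂ) : (Fin n → ℂ) →ₗ⋆[ℂ] ℂ where
  toFun := dbarDir f z
  map_add' := dbarDir_add_right f z
  map_smul' := dbarDir_smul_right f z

theorem dbarDir_eq_sum (f : (Fin n → ℂ) → ℂ) (z w : Fin n → ℂ) :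
    dbarDir f z w = ∑ j, (starRingEnd ℂ) (w j) * dbarDir f z (Pi.single j 1) := by
  have h : w = ∑ j, w j • (Pi.single j 1 : Fin n → ℂ) := by
    simpa using (pi_eq_sum_univ' w)
  conv_lhs => rw [h]
  change dbarLin f z _ = _
  rw [map_sum]
  refine Finset.sum_congr rfl fun j _ ↦ ?_
  rw [map_smulₛₗ]
  rfl

theorem dbarDir_sum_right {ι : Type*} (t : Finset ι) (f : (Fin n → ℂ) → ℂ) (z : Fin n → ℂ)
    (c : ι → ℂ) (u : ι → Fin n → ℂ) :
    dbarDir f z (∑ i ∈ t, c i • u i) = ∑ i ∈ t, (starRingEnd ℂ) (c i) * dbarDir f z (u i) := by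
  change dbarLin f z _ = _
  rw [map_sum]
  refine Finset.sum_congr rfl fun j _ ↦ ?_
  rw [map_smulₛₗ]
  rfl

theorem dbarDir_add (hf : DifferentiableAt ℝ f z) (hg : DifferentiableAt ℝ g z) (w : Fin n → ℂ) :
    dbarDir (fun ζ ↦ f ζ + g ζ) z w = dbarDir f z w + dbarDir g z w := by
  simp only [dbarDir, fderiv_fun_add hf hg, add_apply]; ring

theorem delDir_add (hf : DifferentiableAt ℝ f z) (hg : DifferentiableAt ℝ g z) (w : Fin n → ℂ) :
    delDir (fun ζ ↦ f ζ + g ζ) z w = delDir f z w + delDir g z w := by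
  simp only [delDir, fderiv_fun_add hf hg, add_apply]; ring

theorem dbarDir_mul (hf : DifferentiableAt ℝ f z) (hg : DifferentiableAt ℝ g z) (w : Fin n → ℂ) :
    dbarDir (fun ζ ↦ f ζ * g ζ) z w = f z * dbarDir g z w + g z * dbarDir f z w := by
  simp only [dbarDir, fderiv_fun_mul hf hg, add_apply,
    smul_apply, smul_eq_mul]; ring

theorem delDir_mul (hf : DifferentiableAt ℝ f z) (hg : DifferentiableAt ℝ g z) (w : Fin n → ℂ) :
    delDir (fun ζ ↦ f ζ * g ζ) z w = f z * delDir g z w + g z * delDir f z w := by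
  simp only [delDir, fderiv_fun_mul hf hg, add_apply,
    smul_apply, smul_eq_mul]; ring

theorem dbarDir_sum {ι : Type*} (t : Finset ι) {f : ι → (Fin n → ℂ) → ℂ}
    (hf : ∀ i ∈ t, DifferentiableAt ℝ (f i) z) (w : Fin n → ℂ) :
    dbarDir (fun ζ ↦ ∑ i ∈ t, f i ζ) z w = ∑ i ∈ t, dbarDir (f i) z w := by
  simp only [dbarDir, fderiv_fun_sum hf, sum_apply, Finset.mul_sum,
    ← Finset.sum_add_distrib]

theorem delDir_sum {ι : Type*} (t : Finset ι) {f : ι → (Fin n → ℂ) → ℂ}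
    (hf : ∀ i ∈ t, DifferentiableAt ℝ (f i) z) (w : Fin n → ℂ) :
    delDir (fun ζ ↦ ∑ i ∈ t, f i ζ) z w = ∑ i ∈ t, delDir (f i) z w := by
  simp only [delDir, fderiv_fun_sum hf, sum_apply, Finset.mul_sum,
    ← Finset.sum_sub_distrib]

theorem fderiv_real_eq {E G : Type*} [NormedAddCommGroup E] [NormedSpace ℂ E]
    [NormedAddCommGroup G] [NormedSpace ℂ G] {F : E → G} {z : E} (hF : DifferentiableAt ℂ F z)
    (w : E) : fderiv ℝ F z w = fderiv ℂ F z w := by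
  rw [(hF.hasFDerivAt.restrictScalars ℝ).fderiv]; rfl

theorem dbarDir_eq_zero (hf : DifferentiableAt ℂ f z) (w : Fin n → ℂ) : dbarDir f z w = 0 := by
  simp only [dbarDir, fderiv_real_eq hf, map_smul, smul_eq_mul]
  linear_combination (1 / 2 * fderiv ℂ f z w) * Complex.I_mul_I

theorem fderiv_conj_apply (hf : DifferentiableAt ℝ f z) (w : Fin n → ℂ) :
    fderiv ℝ (fun ζ ↦ (starRingEnd ℂ) (f ζ)) z w = (starRingEnd ℂ) (fderiv ℝ f z w) := by
  have h : HasFDerivAt (fun ζ ↦ (starRingEnd ℂ) (f ζ))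
    ((Complex.conjCLE : ℂ →L[ℝ] ℂ).comp (fderiv ℝ f z)) z :=
    (Complex.conjCLE : ℂ →L[ℝ] ℂ).hasFDerivAt.comp z hf.hasFDerivAt
  rw [h.fderiv]; rfl

theorem delDir_conj (hf : DifferentiableAt ℝ f z) (w : Fin n → ℂ) :
    delDir (fun ζ ↦ (starRingEnd ℂ) (f ζ)) z w = (starRingEnd ℂ) (dbarDir f z w) := by
  simp [delDir, dbarDir, fderiv_conj_apply hf, sub_eq_add_neg, Complex.conj_ofNat]

theorem dbarDir_comp {F : (Fin n → ℂ) → Fin n → ℂ} (hF : DifferentiableAt ℂ F z)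
    (hf : DifferentiableAt ℝ f (F z)) (w : Fin n → ℂ) :
    dbarDir (fun ζ ↦ f (F ζ)) z w = dbarDir f (F z) (fderiv ℂ F z w) := by
  have h : fderiv ℝ (fun ζ ↦ f (F ζ)) z = (fderiv ℝ f (F z)).comp (fderiv ℝ F z) :=
    fderiv_comp z hf (hF.restrictScalars ℝ)
  simp only [dbarDir, h, ContinuousLinearMap.comp_apply, fderiv_real_eq hF, map_smul]

theorem delDir_comp {F : (Fin n → ℂ) → Fin n → ℂ} (hF : DifferentiableAt ℂ F z)
    (hf : DifferentiableAt ℝ f (F z)) (w : Fin n → ℂ) :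
    delDir (fun ζ ↦ f (F ζ)) z w = delDir f (F z) (fderiv ℂ F z w) := by
  have h : fderiv ℝ (fun ζ ↦ f (F ζ)) z = (fderiv ℝ f (F z)).comp (fderiv ℝ F z) :=
    fderiv_comp z hf (hF.restrictScalars ℝ)
  simp only [delDir, h, ContinuousLinearMap.comp_apply, fderiv_real_eq hF, map_smul]

theorem fderiv_ofReal_apply {u : (Fin n → ℂ) → ℝ} (hu : DifferentiableAt ℝ u z) (w : Fin n → ℂ) :
    fderiv ℝ (fun ζ ↦ (u ζ : ℂ)) z w = (fderiv ℝ u z w : ℝ) := by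
  have h : HasFDerivAt (fun ζ ↦ (u ζ : ℂ)) (Complex.ofRealCLM.comp (fderiv ℝ u z)) z :=
    Complex.ofRealCLM.hasFDerivAt.comp z hu.hasFDerivAt
  rw [h.fderiv]; rfl

theorem DifferentiableAt.complex_ofReal {u : (Fin n → ℂ) → ℝ} (hu : DifferentiableAt ℝ u z) :
    DifferentiableAt ℝ (fun ζ ↦ (u ζ : ℂ)) z :=
  Complex.ofRealCLM.differentiableAt.comp z hu

theorem delDir_ofReal {u : (Fin n → ℂ) → ℝ} (hu : DifferentiableAt ℝ u z) (w : Fin n → ℂ) :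
    delDir (fun ζ ↦ (u ζ : ℂ)) z w = (starRingEnd ℂ) (dbarDir (fun ζ ↦ (u ζ : ℂ)) z w) := by
  rw [← delDir_conj hu.complex_ofReal]
  simp

theorem dbarDir_comp_real {u : (Fin n → ℂ) → ℝ} {ρ : ℝ → ℝ} (hρ : DifferentiableAt ℝ ρ (u z))
    (hu : DifferentiableAt ℝ u z) (w : Fin n → ℂ) :
    dbarDir (fun ζ ↦ (ρ (u ζ) : ℂ)) z w = (deriv ρ (u z) : ℝ) * dbarDir (fun ζ ↦ (u ζ : ℂ)) z w := by
  have h : HasFDerivAt (fun ζ ↦ ρ (u ζ)) (deriv ρ (u z) • fderiv ℝ u z) z :=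
    hρ.hasDerivAt.comp_hasFDerivAt z hu.hasFDerivAt
  simp only [dbarDir, fderiv_ofReal_apply h.differentiableAt, fderiv_ofReal_apply hu, h.fderiv,
    smul_apply, smul_eq_mul, Complex.ofReal_mul]
  ring

/-- Locally `log |f|² = log f + conj (log f)`, and only the second summand has a `∂̄`-derivative;
the computation with real derivatives avoids the choice of a branch. -/
theorem dbarDir_log_normSq (hf : DifferentiableAt ℂ f z) (h0 : f z ≠ 0) (w : Fin n → ℂ) :
    dbarDir (fun ζ ↦ ((Real.log (‖f ζ‖ ^ 2) : ℝ) : ℂ)) z w =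
      (starRingEnd ℂ) (fderiv ℂ f z w / f z) := by
  have hfr : HasFDerivAt f ((fderiv ℂ f z).restrictScalars ℝ) z :=
    hf.hasFDerivAt.restrictScalars ℝ
  have hn : ‖f z‖ ^ 2 ≠ 0 := by positivity
  have h1 := (hfr.norm_sq).log hn
  have h2 : ∀ v, fderiv ℝ (fun ζ ↦ Real.log (‖f ζ‖ ^ 2)) z v = 2 * (fderiv ℂ f z v / f z).re := by
    intro v
    rw [h1.fderiv]
    simp only [smul_apply, ContinuousLinearMap.comp_apply, innerSL_apply_apply,
      smul_eq_mul, Complex.inner, ContinuousLinearMap.coe_restrictScalars', nsmul_eq_mul]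
    have h3 : fderiv ℂ f z v / f z =
        (((‖f z‖ ^ 2)⁻¹ : ℝ) : ℂ) * (fderiv ℂ f z v * (starRingEnd ℂ) (f z)) := by
      rw [div_eq_mul_inv, Complex.inv_def, Complex.normSq_eq_norm_sq]
      ring
    rw [h3, Complex.re_ofReal_mul]
    push_cast
    ring
  have hd : DifferentiableAt ℝ (fun ζ ↦ Real.log (‖f ζ‖ ^ 2)) z := h1.differentiableAt
  simp only [dbarDir, fderiv_ofReal_apply hd, h2, map_smul, smul_eq_mul]
  rw [mul_div_assoc]
  set a := fderiv ℂ f z w / f z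
  apply Complex.ext <;> simp

end Wirtinger

/-! ### The Levi form in coordinates -/

section Levi

open Filter Topology

variable {n : ℕ} {f g : (Fin n → ℂ) → ℂ} {z w v : Fin n → ℂ}

/-- The complex Hessian `∑ f_{k j̄} conj(vⱼ) wₖ`. -/
noncomputable def complexHessian (f : (Fin n → ℂ) → ℂ) (z v w : Fin n → ℂ) : ℂ :=
  delDir (fun ζ ↦ dbarDir f ζ v) z w

theorem complexHessian_congr (h : f =ᶠ[𝓝 z] g) (v w : Fin n → ℂ) :
    complexHessian f z v w = complexHessian g z v w :=
  delDir_congr (eventuallyEq_dbarDir h v) w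

theorem contDiffAt_dbarDir {m k : WithTop ℕ∞} (hf : ContDiffAt ℝ k f z) (hmk : m + 1 ≤ k)
    (v : Fin n → ℂ) : ContDiffAt ℝ m (fun ζ ↦ dbarDir f ζ v) z := by
  have h := hf.fderiv_right hmk
  unfold dbarDir
  exact contDiffAt_const.mul ((h.clm_apply contDiffAt_const).add
    (contDiffAt_const.mul (h.clm_apply contDiffAt_const)))

theorem differentiableAt_dbarDir (hf : ContDiffAt ℝ 2 f z) (v : Fin n → ℂ) :
    DifferentiableAt ℝ (fun ζ ↦ dbarDir f ζ v) z :=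
  (contDiffAt_dbarDir (m := 1) hf (by norm_num) v).differentiableAt (by norm_num)

theorem complexHessian_add_right (f : (Fin n → ℂ) → ℂ) (z v w w' : Fin n → ℂ) :
    complexHessian f z v (w + w') = complexHessian f z v w + complexHessian f z v w' :=
  delDir_add_right _ _ _ _

theorem complexHessian_smul_right (f : (Fin n → ℂ) → ℂ) (z v : Fin n → ℂ) (c : ℂ) (w : Fin n → ℂ) :
    complexHessian f z v (c • w) = c * complexHessian f z v w :=
  delDir_smul_right _ _ _ _

theorem delDir_const_mul (c : ℂ) (hf : DifferentiableAt ℝ f z) (w : Fin n → ℂ) :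
    delDir (fun ζ ↦ c * f ζ) z w = c * delDir f z w := by
  rw [delDir_mul (differentiableAt_const c) hf]
  simp [delDir]

theorem complexHessian_add_left (hf : ContDiffAt ℝ 2 f z) (v v' w : Fin n → ℂ) :
    complexHessian f z (v + v') w = complexHessian f z v w + complexHessian f z v' w := by
  simp only [complexHessian, dbarDir_add_right]
  exact delDir_add (differentiableAt_dbarDir hf v) (differentiableAt_dbarDir hf v') w

theorem complexHessian_smul_left (hf : ContDiffAt ℝ 2 f z) (c : ℂ) (v w : Fin n → ℂ) :
    complexHessian f z (c • v) w = (starRingEnd ℂ) c * complexHessian f z v w := by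
  simp only [complexHessian, dbarDir_smul_right]
  exact delDir_const_mul _ (differentiableAt_dbarDir hf v) w

theorem complexHessian_sum_left (hf : ContDiffAt ℝ 2 f z) {ι : Type*} (t : Finset ι) (c : ι → ℂ)
    (u : ι → Fin n → ℂ) (w : Fin n → ℂ) :
    complexHessian f z (∑ i ∈ t, c i • u i) w =
      ∑ i ∈ t, (starRingEnd ℂ) (c i) * complexHessian f z (u i) w := by
  simp only [complexHessian, dbarDir_sum_right]
  rw [delDir_sum t fun i _ ↦ (differentiableAt_dbarDir hf (u i)).const_mul _]
  exact Finset.sum_congr rfl fun i _ ↦ delDir_const_mul _ (differentiableAt_dbarDir hf (u i)) w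

/-- The complex Hessian is invariant under holomorphic changes of coordinates. -/
theorem complexHessian_comp {F : (Fin n → ℂ) → Fin n → ℂ} (hF : ContDiffAt ℂ 2 F z)
    (hf : ContDiffAt ℝ 2 f (F z)) (v w : Fin n → ℂ) :
    complexHessian (fun ζ ↦ f (F ζ)) z v w =
      complexHessian f (F z) (fderiv ℂ F z v) (fderiv ℂ F z w) := by
  have hFz : DifferentiableAt ℂ F z := hF.differentiableAt (by norm_num)
  have hFr : DifferentiableAt ℝ F z := hFz.restrictScalars ℝ
  have h1 : ∀ᶠ ζ in 𝓝 z, DifferentiableAt ℂ F ζ :=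
    (hF.eventually (by simp)).mono fun ζ hζ ↦ hζ.differentiableAt (by norm_num)
  have h2 : ∀ᶠ ζ in 𝓝 z, DifferentiableAt ℝ f (F ζ) :=
    hFr.continuousAt.eventually
      ((hf.eventually (by simp)).mono fun ζ hζ ↦ hζ.differentiableAt (by norm_num))
  have h3 : (fun ζ ↦ dbarDir (fun ζ ↦ f (F ζ)) ζ v) =ᶠ[𝓝 z] fun ζ ↦
      ∑ j, (starRingEnd ℂ) (fderiv ℂ F ζ v j) * dbarDir f (F ζ) (Pi.single j 1) := by
    filter_upwards [h1, h2] with ζ hζ1 hζ2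
    rw [dbarDir_comp hζ1 hζ2, dbarDir_eq_sum]
  have hd : DifferentiableAt ℂ (fun ζ ↦ fderiv ℂ F ζ v) z :=
    ((hF.fderiv_right (m := 1) (by norm_num)).clm_apply contDiffAt_const).differentiableAt
      (by norm_num)
  have hdj : ∀ j, DifferentiableAt ℂ (fun ζ ↦ fderiv ℂ F ζ v j) z :=
    fun j ↦ differentiableAt_pi.1 hd j
  have hcj : ∀ j, DifferentiableAt ℝ (fun ζ ↦ (starRingEnd ℂ) (fderiv ℂ F ζ v j)) z := fun j ↦
    Complex.conjCLE.differentiableAt.comp z ((hdj j).restrictScalars ℝ)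
  have hbj : ∀ j : Fin n, DifferentiableAt ℝ (fun ζ ↦ dbarDir f ζ (Pi.single j 1)) (F z) := fun j ↦
    differentiableAt_dbarDir hf _
  have hbFj : ∀ j : Fin n, DifferentiableAt ℝ (fun ζ ↦ dbarDir f (F ζ) (Pi.single j 1)) z :=
    fun j ↦ (hbj j).comp z hFr
  have hmj : ∀ j : Fin n, DifferentiableAt ℝ (fun ζ ↦ (starRingEnd ℂ) (fderiv ℂ F ζ v j) *
      dbarDir f (F ζ) (Pi.single j 1)) z := fun j ↦ (hcj j).mul (hbFj j)
  rw [complexHessian, delDir_congr h3, delDir_sum _ fun j _ ↦ hmj j]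
  have h4 : fderiv ℂ F z v = ∑ j, (fderiv ℂ F z v j) • (Pi.single j 1 : Fin n → ℂ) := by
    simpa using (pi_eq_sum_univ' (fderiv ℂ F z v))
  conv_rhs => rw [h4, complexHessian_sum_left hf]
  -- In the product rule the factor `conj (∂F_j)` is antiholomorphic and has no `(1,0)`-derivative,
  -- so no second derivatives of `F` survive.
  refine Finset.sum_congr rfl fun j _ ↦ ?_
  rw [delDir_mul (hcj j) (hbFj j), delDir_conj ((hdj j).restrictScalars ℝ),
    dbarDir_eq_zero (hdj j), delDir_comp (f := fun ζ ↦ dbarDir f ζ (Pi.single j 1)) hFz (hbj j)]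
  simp [complexHessian]

/-- This makes the symmetry and the operator norm of the real second derivative available for the
complex Hessian. -/
theorem complexHessian_eq_fderiv (hf : ContDiffAt ℝ 2 f z) (v w : Fin n → ℂ) :
    complexHessian f z v w = (1 / 4 : ℂ) *
      (fderiv ℝ (fderiv ℝ f) z w v + Complex.I * fderiv ℝ (fderiv ℝ f) z w (Complex.I • v)
      - Complex.I * (fderiv ℝ (fderiv ℝ f) z (Complex.I • w) v
      + Complex.I * fderiv ℝ (fderiv ℝ f) z (Complex.I • w) (Complex.I • v))) := by
  have h := (hf.fderiv_right (m := 1) (by norm_num)).differentiableAt (by norm_num)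
  have h1 : ∀ u, HasFDerivAt (fun ζ ↦ fderiv ℝ f ζ u)
      ((fderiv ℝ (fderiv ℝ f) z).flip u) z := fun u ↦ by
    simpa using h.hasFDerivAt.clm_apply (hasFDerivAt_const u z)
  have h2 : HasFDerivAt (fun ζ ↦ dbarDir f ζ v) ((1 / 2 : ℂ) •
      ((fderiv ℝ (fderiv ℝ f) z).flip v + Complex.I •
        (fderiv ℝ (fderiv ℝ f) z).flip (Complex.I • v))) z :=
    ((h1 v).add ((h1 _).const_mul Complex.I)).const_mul (1 / 2 : ℂ)
  simp only [complexHessian, delDir, h2.fderiv]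
  simp only [smul_apply, add_apply, ContinuousLinearMap.flip_apply, smul_eq_mul]
  ring

theorem ContDiffAt.complex_ofReal {m : WithTop ℕ∞} {u : (Fin n → ℂ) → ℝ} (hu : ContDiffAt ℝ m u z) :
    ContDiffAt ℝ m (fun ζ ↦ (u ζ : ℂ)) z :=
  Complex.ofRealCLM.contDiff.contDiffAt.comp z hu

theorem complexHessian_conj_symm {u : (Fin n → ℂ) → ℝ} (hu : ContDiffAt ℝ 2 u z)
    (v w : Fin n → ℂ) :
    (starRingEnd ℂ) (complexHessian (fun ζ ↦ (u ζ : ℂ)) z v w) =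
      complexHessian (fun ζ ↦ (u ζ : ℂ)) z w v := by
  have hf := hu.complex_ofReal
  have hsymm : IsSymmSndFDerivAt ℝ (fun ζ ↦ (u ζ : ℂ)) z := hf.isSymmSndFDerivAt (by simp)
  have hreal : ∀ a b, (starRingEnd ℂ) (fderiv ℝ (fderiv ℝ fun ζ ↦ (u ζ : ℂ)) z a b) =
      fderiv ℝ (fderiv ℝ fun ζ ↦ (u ζ : ℂ)) z a b := by
    intro a b
    have h := (hf.fderiv_right (m := 1) (by norm_num)).differentiableAt (by norm_num)
    have h' := (hu.fderiv_right (m := 1) (by norm_num)).differentiableAt (by norm_num)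
    have h1 : HasFDerivAt (fun ζ ↦ fderiv ℝ (fun ζ ↦ (u ζ : ℂ)) ζ b)
      ((fderiv ℝ (fderiv ℝ fun ζ ↦ (u ζ : ℂ)) z).flip b) z := by
      simpa using h.hasFDerivAt.clm_apply (hasFDerivAt_const b z)
    have h1' : DifferentiableAt ℝ (fun ζ ↦ fderiv ℝ u ζ b) z :=
      h'.clm_apply (differentiableAt_const b)
    have h2 : (fun ζ ↦ fderiv ℝ (fun ζ ↦ (u ζ : ℂ)) ζ b) =ᶠ[𝓝 z] fun ζ ↦ (fderiv ℝ u ζ b : ℂ) := by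
      filter_upwards [hu.eventually (by simp)] with ζ hζ
      exact fderiv_ofReal_apply (hζ.differentiableAt (by norm_num)) b
    have h3 : fderiv ℝ (fderiv ℝ fun ζ ↦ (u ζ : ℂ)) z a b =
        fderiv ℝ (fun ζ ↦ fderiv ℝ (fun ζ ↦ (u ζ : ℂ)) ζ b) z a := by
      rw [h1.fderiv]; rfl
    rw [h3, h2.fderiv_eq, fderiv_ofReal_apply h1', Complex.conj_ofReal]
  rw [complexHessian_eq_fderiv hf, complexHessian_eq_fderiv hf]
  simp only [map_mul, map_add, map_sub, Complex.conj_I, hreal]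
  rw [hsymm w v, hsymm w (Complex.I • v), hsymm (Complex.I • w) v,
    hsymm (Complex.I • w) (Complex.I • v)]
  have h4 : (starRingEnd ℂ) (1 / 4) = 1 / 4 := by simp [Complex.conj_ofNat]
  rw [h4]
  ring

theorem complexHessian_add (hf : ContDiffAt ℝ 2 f z) (hg : ContDiffAt ℝ 2 g z) (v w : Fin n → ℂ) :
    complexHessian (fun ζ ↦ f ζ + g ζ) z v w = complexHessian f z v w + complexHessian g z v w := by
  have h1 : (fun ζ ↦ dbarDir (fun ζ ↦ f ζ + g ζ) ζ v) =ᶠ[𝓝 z]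
      fun ζ ↦ dbarDir f ζ v + dbarDir g ζ v := by
    filter_upwards [hf.eventually (by simp), hg.eventually (by simp)] with ζ h2 h3
    exact dbarDir_add (h2.differentiableAt (by norm_num)) (h3.differentiableAt (by norm_num)) v
  rw [complexHessian, delDir_congr h1]
  exact delDir_add (differentiableAt_dbarDir hf v) (differentiableAt_dbarDir hg v) w

theorem complexHessian_sum {ι : Type*} (t : Finset ι) {f : ι → (Fin n → ℂ) → ℂ}
    (hf : ∀ i ∈ t, ContDiffAt ℝ 2 (f i) z) (v w : Fin n → ℂ) :
    complexHessian (fun ζ ↦ ∑ i ∈ t, f i ζ) z v w = ∑ i ∈ t, complexHessian (f i) z v w := by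
  have h1 : (fun ζ ↦ dbarDir (fun ζ ↦ ∑ i ∈ t, f i ζ) ζ v) =ᶠ[𝓝 z]
      fun ζ ↦ ∑ i ∈ t, dbarDir (f i) ζ v := by
    have h2 : ∀ᶠ ζ in 𝓝 z, ∀ i ∈ t, ContDiffAt ℝ 2 (f i) ζ :=
      (Filter.eventually_all_finset t).2 fun i hi ↦ (hf i hi).eventually (by simp)
    filter_upwards [h2] with ζ h3
    exact dbarDir_sum t (fun i hi ↦ (h3 i hi).differentiableAt (by norm_num)) v
  rw [complexHessian, delDir_congr h1]
  exact delDir_sum t (fun i hi ↦ differentiableAt_dbarDir (hf i hi) v) w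

/-- The formula `∂∂̄ρ(u) = ρ' ∂∂̄u + ρ'' ∂u ∧ ∂̄u`; as `u` is real, its `∂`-derivative is the
conjugate of its `∂̄`-derivative. -/
theorem complexHessian_comp_real {u : (Fin n → ℂ) → ℝ} {ρ : ℝ → ℝ} (hρ : ContDiffAt ℝ 2 ρ (u z))
    (hu : ContDiffAt ℝ 2 u z) (v w : Fin n → ℂ) :
    complexHessian (fun ζ ↦ (ρ (u ζ) : ℂ)) z v w =
      (deriv ρ (u z) : ℝ) * complexHessian (fun ζ ↦ (u ζ : ℂ)) z v w +
      (deriv (deriv ρ) (u z) : ℝ) * (dbarDir (fun ζ ↦ (u ζ : ℂ)) z v *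
        (starRingEnd ℂ) (dbarDir (fun ζ ↦ (u ζ : ℂ)) z w)) := by
  have hud : DifferentiableAt ℝ u z := hu.differentiableAt (by norm_num)
  have hρ' : DifferentiableAt ℝ (deriv ρ) (u z) := by
    have := (hρ.fderiv_right (m := 1) (by norm_num)).differentiableAt (by norm_num)
    have h2 : deriv ρ = fun t ↦ fderiv ℝ ρ t 1 := by ext t; simp
    rw [h2]
    exact this.clm_apply (differentiableAt_const _)
  have h1 : (fun ζ ↦ dbarDir (fun ζ ↦ (ρ (u ζ) : ℂ)) ζ v) =ᶠ[𝓝 z]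
      fun ζ ↦ ((deriv ρ (u ζ) : ℝ) : ℂ) * dbarDir (fun ζ ↦ (u ζ : ℂ)) ζ v := by
    filter_upwards [hu.eventually (by simp), hud.continuousAt.eventually
      (hρ.eventually (by simp))] with ζ h2 h3
    exact dbarDir_comp_real (h3.differentiableAt (by norm_num)) (h2.differentiableAt (by norm_num)) v
  have hcomp : DifferentiableAt ℝ (fun ζ ↦ deriv ρ (u ζ)) z := hρ'.comp z hud
  rw [complexHessian, delDir_congr h1, delDir_mul hcomp.complex_ofReal
    (differentiableAt_dbarDir hu.complex_ofReal v), delDir_ofReal hcomp,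
    dbarDir_comp_real hρ' hud, map_mul, Complex.conj_ofReal]
  simp only [complexHessian]
  ring

/-- `log |f|²` is pluriharmonic off the zeros of `f`: its `∂̄`-derivative is the conjugate of a
holomorphic function. -/
theorem complexHessian_log_normSq (hf : ContDiffAt ℂ 2 f z) (h0 : f z ≠ 0) (v w : Fin n → ℂ) :
    complexHessian (fun ζ ↦ ((Real.log (‖f ζ‖ ^ 2) : ℝ) : ℂ)) z v w = 0 := by
  have hfz : DifferentiableAt ℂ f z := hf.differentiableAt (by norm_num)
  have h1 : (fun ζ ↦ dbarDir (fun ζ ↦ ((Real.log (‖f ζ‖ ^ 2) : ℝ) : ℂ)) ζ v) =ᶠ[𝓝 z]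
      fun ζ ↦ (starRingEnd ℂ) (fderiv ℂ f ζ v / f ζ) := by
    filter_upwards [hf.eventually (by simp), hfz.continuousAt.eventually_ne h0] with ζ h2 h3
    exact dbarDir_log_normSq (h2.differentiableAt (by norm_num)) h3 v
  have hd : DifferentiableAt ℂ (fun ζ ↦ fderiv ℂ f ζ v / f ζ) z :=
    (ContDiffAt.div ((hf.fderiv_right (m := 1) (by norm_num)).clm_apply contDiffAt_const)
      (hf.of_le (by norm_num)) h0).differentiableAt (by norm_num)
  rw [complexHessian, delDir_congr h1, delDir_conj (hd.restrictScalars ℝ), dbarDir_eq_zero hd,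
    map_zero]

/-- The Levi form of `∑ -log (-uᵢ)` with `uᵢ = log hᵢ + log |fᵢ|²`. -/
theorem complexHessian_sum_neg_log_neg {N : ℕ} {h : Fin N → (Fin n → ℂ) → ℝ}
    {f : Fin N → (Fin n → ℂ) → ℂ} (hh : ∀ i, ContDiffAt ℝ 2 (h i) z)
    (hf : ∀ i, ContDiffAt ℂ 2 (f i) z) (h0 : ∀ i, f i z ≠ 0)
    (hlt : ∀ i, h i z + Real.log (‖f i z‖ ^ 2) < 0) (v : Fin n → ℂ) :
    (complexHessian (fun ζ ↦ ((-∑ i, Real.log (-(h i ζ + Real.log (‖f i ζ‖ ^ 2))) : ℝ) : ℂ))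
      z v v).re = ∑ i, ((complexHessian (fun ζ ↦ (h i ζ : ℂ)) z v v).re /
        (-(h i z + Real.log (‖f i z‖ ^ 2))) +
        ‖dbarDir (fun ζ ↦ (h i ζ : ℂ)) z v + (starRingEnd ℂ) (fderiv ℂ (f i) z v / f i z)‖ ^ 2 /
        (h i z + Real.log (‖f i z‖ ^ 2)) ^ 2) := by
  have hl : ∀ i, ContDiffAt ℝ 2 (fun ζ ↦ Real.log (‖f i ζ‖ ^ 2)) z := fun i ↦
    (((hf i).restrict_scalars ℝ).norm_sq ℝ).log (by have := h0 i; positivity)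
  have hu : ∀ i, ContDiffAt ℝ 2 (fun ζ ↦ h i ζ + Real.log (‖f i ζ‖ ^ 2)) z := fun i ↦
    (hh i).add (hl i)
  have hρ : ∀ i, ContDiffAt ℝ 2 (fun t ↦ -Real.log (-t)) (h i z + Real.log (‖f i z‖ ^ 2)) :=
    fun i ↦ (contDiffAt_id.neg.log (by have := hlt i; simp only [id]; linarith)).neg
  have hcomp : ∀ i, ContDiffAt ℝ 2
      (fun ζ ↦ -Real.log (-(h i ζ + Real.log (‖f i ζ‖ ^ 2)))) z := fun i ↦
    ((hu i).neg.log (by have := hlt i; linarith)).neg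
  have h1 : (fun ζ ↦ ((-∑ i, Real.log (-(h i ζ + Real.log (‖f i ζ‖ ^ 2))) : ℝ) : ℂ)) =
      fun ζ ↦ ∑ i, ((-Real.log (-(h i ζ + Real.log (‖f i ζ‖ ^ 2))) : ℝ) : ℂ) := by
    ext ζ; push_cast; rw [Finset.sum_neg_distrib]
  rw [h1, complexHessian_sum _ fun i _ ↦ (hcomp i).complex_ofReal, Complex.re_sum]
  refine Finset.sum_congr rfl fun i _ ↦ ?_
  -- At a negative `u` the function `ρ(t) = -log (-t)` has `ρ' = 1 / (-u)` and `ρ'' = 1 / u²`. The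
  -- first divides the bounded curvature term, the second gives the Poincaré term.
  have hd1 : deriv (fun t ↦ -Real.log (-t)) = fun t ↦ -t⁻¹ := by
    ext t
    have : (fun t ↦ -Real.log (-t)) = fun t ↦ -Real.log t := by ext; simp
    rw [this]
    simp
  have hd2 : ∀ t : ℝ, deriv (fun t : ℝ ↦ -t⁻¹) t = (t ^ 2)⁻¹ := by
    intro t; simp
  rw [complexHessian_comp_real (ρ := fun t ↦ -Real.log (-t))
    (u := fun ζ ↦ h i ζ + Real.log (‖f i ζ‖ ^ 2)) (hρ i) (hu i), hd1, hd2]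
  have h2 : (fun ζ ↦ ((h i ζ + Real.log (‖f i ζ‖ ^ 2) : ℝ) : ℂ)) =
      fun ζ ↦ (h i ζ : ℂ) + ((Real.log (‖f i ζ‖ ^ 2) : ℝ) : ℂ) := by
    ext ζ; push_cast; rfl
  rw [h2, complexHessian_add (hh i).complex_ofReal (hl i).complex_ofReal,
    complexHessian_log_normSq (hf i) (h0 i), add_zero,
    dbarDir_add ((hh i).complex_ofReal.differentiableAt (by norm_num))
      ((hl i).complex_ofReal.differentiableAt (by norm_num)),
    dbarDir_log_normSq ((hf i).differentiableAt (by norm_num)) (h0 i), Complex.mul_conj,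
    Complex.normSq_eq_norm_sq, Complex.add_re, Complex.re_ofReal_mul, ← Complex.ofReal_mul,
    Complex.ofReal_re]
  have := (hlt i).ne
  rw [div_neg, div_eq_mul_inv, div_eq_mul_inv]
  ring

end Levi

/-! ### Tangent vectors, Levi forms and `∂̄` in holomorphic coordinates -/

section Coordinates

open Filter Topology

variable {n : ℕ} {X : Type*} [TopologicalSpace X] [ChartedSpace (Fin n → ℂ) X]
  {φ φ' : OpenPartialHomeomorph X (Fin n → ℂ)} {z : Fin n → ℂ}

theorem IsCoord.mdifferentiable [IsManifold 𝓘(ℂ, Fin n → ℂ) ω X] (hφ : IsCoord φ) :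
    φ.MDifferentiable 𝓘(ℂ, Fin n → ℂ) 𝓘(ℂ, Fin n → ℂ) :=
  ⟨(contMDiffOn_of_mem_maximalAtlas hφ).mdifferentiableOn (by simp),
    (contMDiffOn_symm_of_mem_maximalAtlas hφ).mdifferentiableOn (by simp)⟩

variable [IsManifold 𝓘(ℂ, Fin n → ℂ) ω X]

theorem isCoord_chartAt (x : X) : IsCoord (chartAt (Fin n → ℂ) x) :=
  IsManifold.chart_mem_maximalAtlas x

/-- The identification of `ℂⁿ` with the tangent space given by holomorphic coordinates. -/
noncomputable def coordEquiv (hφ : IsCoord φ) (hz : z ∈ φ.target) :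
    (Fin n → ℂ) ≃ₗ[ℂ] TangentSpace 𝓘(ℂ, Fin n → ℂ) (φ.symm z) :=
  (hφ.mdifferentiable.symm.mfderiv hz).toLinearEquiv

omit [IsManifold 𝓘(ℂ, Fin n → ℂ) ω X] in
theorem contDiffAt_transition (hφ : IsCoord φ) (hφ' : IsCoord φ') (hz : z ∈ φ.target)
    (hz' : φ.symm z ∈ φ'.source) : ContDiffAt ℂ ω (fun ζ ↦ φ' (φ.symm ζ)) z :=
  ((contMDiffAt_of_mem_maximalAtlas hφ' hz').comp z
    (contMDiffAt_symm_of_mem_maximalAtlas hφ hz)).contDiffAt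

theorem components_coordVec (hφ : IsCoord φ) (hz : z ∈ φ.target) (v : Fin n → ℂ) :
    components (φ.symm z) (coordVec φ z v) =
      fderiv ℂ (fun ζ ↦ chartAt (Fin n → ℂ) (φ.symm z) (φ.symm ζ)) z v := by
  have h := mfderiv_comp z
    ((isCoord_chartAt (φ.symm z)).mdifferentiable.mdifferentiableAt (mem_chart_source _ _))
    (hφ.mdifferentiable.mdifferentiableAt_symm hz)
  rw [← mfderiv_eq_fderiv]
  exact (congrArg (fun A ↦ A v) h).symm

omit [ChartedSpace (Fin n → ℂ) X] [IsManifold 𝓘(ℂ, Fin n → ℂ) ω X] in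
theorem eventually_symm_mem (hz : z ∈ φ.target) {s : Set X} (hs : IsOpen s)
    (hz' : φ.symm z ∈ s) : ∀ᶠ ζ in 𝓝 z, ζ ∈ φ.target ∧ φ.symm ζ ∈ s :=
  (φ.open_target.eventually_mem hz).and
    ((φ.continuousAt_symm hz).eventually (hs.eventually_mem hz'))

theorem coordVec_eq (hφ : IsCoord φ) (hφ' : IsCoord φ') (hz : z ∈ φ.target)
    (hz' : φ.symm z ∈ φ'.source) (v : Fin n → ℂ) :
    (coordVec φ z v : Fin n → ℂ) =
      coordVec φ' (φ' (φ.symm z)) (fderiv ℂ (fun ζ ↦ φ' (φ.symm ζ)) z v) := by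
  have hF := contDiffAt_transition hφ hφ' hz hz'
  have h1 : MDifferentiableAt 𝓘(ℂ, Fin n → ℂ) 𝓘(ℂ, Fin n → ℂ) φ'.symm (φ' (φ.symm z)) :=
    hφ'.mdifferentiable.mdifferentiableAt_symm (φ'.map_source hz')
  have h2 : MDifferentiableAt 𝓘(ℂ, Fin n → ℂ) 𝓘(ℂ, Fin n → ℂ) (fun ζ ↦ φ' (φ.symm ζ)) z :=
    (hF.differentiableAt (by simp)).mdifferentiableAt
  have h := mfderiv_comp z h1 h2
  have h3 : φ'.symm ∘ (fun ζ ↦ φ' (φ.symm ζ)) =ᶠ[𝓝 z] φ.symm := by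
    filter_upwards [eventually_symm_mem hz φ'.open_source hz'] with ζ hζ
    exact φ'.left_inv hζ.2
  have h4 := h3.mfderiv_eq (I := 𝓘(ℂ, Fin n → ℂ)) (I' := 𝓘(ℂ, Fin n → ℂ))
  have h5 : (coordVec φ z v : Fin n → ℂ) = mfderiv 𝓘(ℂ, Fin n → ℂ) 𝓘(ℂ, Fin n → ℂ)
      (φ'.symm ∘ (fun ζ ↦ φ' (φ.symm ζ))) z v := (congrArg (fun A ↦ A v) h4).symm
  rw [h5, h, mfderiv_eq_fderiv]
  rfl

/-- The definition uses the preferred chart, which changes from point to point; the invariance of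
the complex Hessian under holomorphic transitions allows one fixed chart for a whole neighbourhood.
-/
theorem leviForm_coordVec (hφ : IsCoord φ) (hz : z ∈ φ.target) {u : X → ℝ}
    (hu : ContDiffAt ℝ 2 (fun ζ ↦ u (φ.symm ζ)) z) (v w : Fin n → ℂ) :
    leviForm u (φ.symm z) (coordVec φ z v) (coordVec φ z w) =
      complexHessian (fun ζ ↦ ((u (φ.symm ζ) : ℝ) : ℂ)) z v w := by
  have hφ₀ := isCoord_chartAt (n := n) (φ.symm z)
  have hy : φ.symm z ∈ (chartAt (Fin n → ℂ) (φ.symm z)).source := mem_chart_source _ _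
  have hys : φ.symm z ∈ φ.source := φ.map_target hz
  set φ₀ := chartAt (Fin n → ℂ) (φ.symm z) with hφ₀_def
  have hz0 : φ₀ (φ.symm z) ∈ φ₀.target := φ₀.map_source hy
  have hF := contDiffAt_transition hφ hφ₀ hz hy
  have hG := contDiffAt_transition hφ₀ hφ hz0 (by rw [φ₀.left_inv hy]; exact hys)
  have hGz : φ (φ₀.symm (φ₀ (φ.symm z))) = z := by rw [φ₀.left_inv hy, φ.right_inv hz]
  have h1 : (fun ζ ↦ u (φ₀.symm ζ)) =ᶠ[𝓝 (φ₀ (φ.symm z))]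
      fun ζ ↦ u (φ.symm (φ (φ₀.symm ζ))) := by
    filter_upwards [eventually_symm_mem hz0 φ.open_source (by rw [φ₀.left_inv hy]; exact hys)]
      with ζ hζ
    rw [φ.left_inv hζ.2]
  have h2 : ContDiffAt ℝ 2 (fun ζ ↦ u (φ₀.symm ζ)) (φ₀ (φ.symm z)) := by
    refine ContDiffAt.congr_of_eventuallyEq ?_ h1
    have : ContDiffAt ℝ 2 (fun ζ ↦ u (φ.symm ζ)) (φ (φ₀.symm (φ₀ (φ.symm z)))) := by rwa [hGz]
    exact ContDiffAt.comp (g := fun ζ ↦ u (φ.symm ζ)) (φ₀ (φ.symm z)) this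
      ((hG.of_le (by simp)).restrict_scalars ℝ)
  have h3 : (fun ζ ↦ ((u (φ₀.symm (φ₀ (φ.symm ζ))) : ℝ) : ℂ)) =ᶠ[𝓝 z]
      fun ζ ↦ ((u (φ.symm ζ) : ℝ) : ℂ) := by
    filter_upwards [eventually_symm_mem hz φ₀.open_source hy] with ζ hζ
    rw [φ₀.left_inv hζ.2]
  rw [← complexHessian_congr h3, complexHessian_comp (f := fun ζ ↦ ((u (φ₀.symm ζ) : ℝ) : ℂ))
    (hF.of_le (by simp)) h2.complex_ofReal]
  simp only [leviForm, components_coordVec hφ hz]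
  rfl

section Bundle

variable {L : X → Type*} [TopologicalSpace (TotalSpace ℂ L)] [∀ x, AddCommGroup (L x)]
  [∀ x, Module ℂ (L x)] [∀ x, TopologicalSpace (L x)] [FiberBundle ℂ L] [VectorBundle ℂ ℂ L]
  {p : ℕ} {e e' : Trivialization ℂ (TotalSpace.proj : TotalSpace ℂ L → X)}
  [MemTrivializationAtlas e] [MemTrivializationAtlas e']

/-- The coefficients of a form at a point as an alternating map. -/
noncomputable def coeffAlt (τ : LForm n L p) (φ : OpenPartialHomeomorph X (Fin n → ℂ))
    (e : Trivialization ℂ (TotalSpace.proj : TotalSpace ℂ L → X)) [MemTrivializationAtlas e]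
    (z : Fin n → ℂ) : (Fin n → ℂ) [⋀^Fin p]→ₗ[ℂ] ℂ :=
  (e.linearMapAt ℂ (φ.symm z)).compAlternatingMap ((τ (φ.symm z)).compLinearMap
    (mfderiv 𝓘(ℂ, Fin n → ℂ) 𝓘(ℂ, Fin n → ℂ) φ.symm z).toLinearMap)

omit [IsManifold 𝓘(ℂ, Fin n → ℂ) ω X] in
theorem coeffAlt_apply (τ : LForm n L p) (hz : φ.symm z ∈ e.baseSet) (v : Fin p → Fin n → ℂ) :
    coeffAlt τ φ e z v = coeff τ φ e v z := by
  simp only [coeffAlt, coeff, LinearMap.compAlternatingMap_apply,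
    AlternatingMap.compLinearMap_apply, e.coe_linearMapAt_of_mem (R := ℂ) hz]
  rfl

omit [IsManifold 𝓘(ℂ, Fin n → ℂ) ω X] in
theorem coeff_eq_sum (τ : LForm n L p) (hz : φ.symm z ∈ e.baseSet) (v : Fin p → Fin n → ℂ) :
    coeff τ φ e v z = ∑ k : Fin p → Fin n,
      (∏ a, v a (k a)) * coeff τ φ e (fun a ↦ Pi.single (k a) 1) z := by
  have h : v = fun a ↦ ∑ j, v a j • (Pi.single j 1 : Fin n → ℂ) := by
    ext a : 1
    simpa using (pi_eq_sum_univ' (v a))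
  conv_lhs => rw [h]
  rw [← coeffAlt_apply τ hz]
  change (coeffAlt τ φ e z).toMultilinearMap _ = _
  rw [MultilinearMap.map_sum]
  refine Finset.sum_congr rfl fun k _ ↦ ?_
  rw [MultilinearMap.map_smul_univ, smul_eq_mul, ← coeffAlt_apply τ hz]
  rfl

omit [IsManifold 𝓘(ℂ, Fin n → ℂ) ω X] [ChartedSpace (Fin n → ℂ) X] in
theorem trivialization_snd_eq {y : X} (hy : y ∈ e.baseSet) (hy' : y ∈ e'.baseSet) (u : L y) :
    (e ⟨y, u⟩).2 = (e'.coordChangeL ℂ e y 1) * (e' ⟨y, u⟩).2 := by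
  have h1 : u = e'.symm y ((e' ⟨y, u⟩).2) := (e'.symm_apply_apply_mk hy' u).symm
  conv_lhs => rw [h1]
  rw [← e'.coordChangeL_apply (R := ℂ) e ⟨hy', hy⟩]
  have h2 : (e' ⟨y, u⟩).2 = (e' ⟨y, u⟩).2 • (1 : ℂ) := by simp
  conv_lhs => rw [h2]
  rw [map_smul, smul_eq_mul, mul_comm]

omit [IsManifold 𝓘(ℂ, Fin n → ℂ) ω X] [VectorBundle ℂ ℂ L] [MemTrivializationAtlas e]
  [∀ x, TopologicalSpace (L x)] [FiberBundle ℂ L] in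
theorem trivialization_form_congr (τ : LForm n L p) {x x' : X} (h : x = x')
    {v v' : Fin p → Fin n → ℂ} (hv : v = v') :
    (e ⟨x, τ x v⟩).2 = (e ⟨x', τ x' v'⟩).2 := by
  subst h; subst hv; rfl

theorem coeff_transition (hφ : IsCoord φ) (hφ' : IsCoord φ') (hz : z ∈ φ.target)
    (hz' : φ.symm z ∈ φ'.source) (he : φ.symm z ∈ e.baseSet) (he' : φ.symm z ∈ e'.baseSet)
    (τ : LForm n L p) (v : Fin p → Fin n → ℂ) :
    coeff τ φ e v z = (e'.coordChangeL ℂ e (φ.symm z) 1) *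
      coeff τ φ' e' (fun a ↦ fderiv ℂ (fun ζ ↦ φ' (φ.symm ζ)) z (v a)) (φ' (φ.symm z)) := by
  rw [coeff, trivialization_snd_eq he he']
  congr 1
  refine trivialization_form_congr (e := e') τ (φ'.left_inv hz').symm ?_
  ext a : 1
  exact coordVec_eq hφ hφ' hz hz' (v a)

theorem dbarDir_mul_of_differentiableAt {h k : (Fin n → ℂ) → ℂ} (hh : DifferentiableAt ℂ h z)
    (hk : DifferentiableAt ℝ k z) (w : Fin n → ℂ) :
    dbarDir (fun ζ ↦ h ζ * k ζ) z w = h z * dbarDir k z w := by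
  rw [dbarDir_mul (hh.restrictScalars ℝ) hk, dbarDir_eq_zero hh, mul_zero, add_zero]

omit [IsManifold 𝓘(ℂ, Fin n → ℂ) ω X] [VectorBundle ℂ ℂ L] in
theorem IsSmoothForm.contDiffAt {τ : LForm n L p} (hτ : IsSmoothForm τ) (hφ : IsCoord φ)
    (hz : z ∈ φ.target) (he : φ.symm z ∈ e.baseSet) (v : Fin p → Fin n → ℂ) :
    ContDiffAt ℝ ∞ (coeff τ φ e v) z :=
  (hτ φ hφ e v).contDiffAt ((φ.isOpen_inter_preimage_symm e.open_baseSet).mem_nhds ⟨hz, he⟩)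

/-- The components of `∂̄τ` can be computed in any coordinates and trivialization. -/
theorem dbarForm_coordVec [ContMDiffVectorBundle ω ℂ L 𝓘(ℂ, Fin n → ℂ)] {τ : LForm n L p}
    (hτ : IsSmoothForm τ) (hφ : IsCoord φ) (hz : z ∈ φ.target) (he : φ.symm z ∈ e.baseSet)
    (w : Fin n → ℂ) (v : Fin p → Fin n → ℂ) :
    (e ⟨φ.symm z, dbarForm τ (φ.symm z) (coordVec φ z w) fun a ↦ coordVec φ z (v a)⟩).2 =
      dbarDir (coeff τ φ e v) z w := by
  have hφ₀ := isCoord_chartAt (n := n) (φ.symm z)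
  have hy : φ.symm z ∈ (chartAt (Fin n → ℂ) (φ.symm z)).source := mem_chart_source _ _
  have he₀ : φ.symm z ∈ (trivializationAt ℂ L (φ.symm z)).baseSet :=
    mem_baseSet_trivializationAt ℂ L _
  unfold dbarForm
  simp only [components_coordVec hφ hz]
  set φ₀ := chartAt (Fin n → ℂ) (φ.symm z) with hφ₀_def
  set e₀ := trivializationAt ℂ L (φ.symm z) with he₀_def
  have hz0 : φ₀ (φ.symm z) ∈ φ₀.target := φ₀.map_source hy
  have hsymm0 : φ₀.symm (φ₀ (φ.symm z)) = φ.symm z := φ₀.left_inv hy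
  have he₀' : φ₀.symm (φ₀ (φ.symm z)) ∈ e₀.baseSet := by rw [hsymm0]; exact he₀
  set F : (Fin n → ℂ) → Fin n → ℂ := fun ζ ↦ φ₀ (φ.symm ζ) with hF_def
  have hF : ContDiffAt ℂ ω F z := contDiffAt_transition hφ hφ₀ hz hy
  have hFz : DifferentiableAt ℂ F z := hF.differentiableAt (by simp)
  have hFr : DifferentiableAt ℝ F z := hFz.restrictScalars ℝ
  rw [trivialization_snd_eq he he₀ (e' := e₀), e₀.apply_mk_symm he₀]
  set G : X → ℂ := fun y ↦ e₀.coordChangeL ℂ e y 1 with hG_def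
  have hG : DifferentiableAt ℂ (fun ζ ↦ G (φ.symm ζ)) z := by
    have h1 := contMDiffAt_coordChangeL (n := ω) (IB := 𝓘(ℂ, Fin n → ℂ)) (e := e₀) (e' := e) he₀ he
    have h2 := (h1.comp z (contMDiffAt_symm_of_mem_maximalAtlas hφ hz)).contDiffAt
    exact ((h2.clm_apply (contDiffAt_const (c := (1 : ℂ))))).differentiableAt (by simp)
  have hc : ∀ k : Fin p → Fin n, DifferentiableAt ℝ
      (coeff τ φ₀ e₀ fun a ↦ Pi.single (k a) 1) (F z) := fun k ↦
    (hτ.contDiffAt hφ₀ hz0 he₀' _).differentiableAt (by simp)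
  have hD : ∀ a j, ContDiffAt ℂ 1 (fun ζ ↦ fderiv ℂ F ζ (v a) j) z := fun a j ↦
    contDiffAt_pi.1 ((hF.fderiv_right (m := 1) (by simp)).clm_apply contDiffAt_const) j
  have hP : ∀ k : Fin p → Fin n, DifferentiableAt ℂ
      (fun ζ ↦ ∏ a, fderiv ℂ F ζ (v a) (k a)) z := fun k ↦
    (contDiffAt_prod (n := 1) fun a _ ↦ hD a (k a)).differentiableAt (by norm_num)
  have hcF : ∀ k : Fin p → Fin n, DifferentiableAt ℝ
      (fun ζ ↦ coeff τ φ₀ e₀ (fun a ↦ Pi.single (k a) 1) (F ζ)) z := fun k ↦ (hc k).comp z hFr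
  have hPc : ∀ k : Fin p → Fin n, DifferentiableAt ℝ (fun ζ ↦ (∏ a, fderiv ℂ F ζ (v a) (k a)) *
      coeff τ φ₀ e₀ (fun a ↦ Pi.single (k a) 1) (F ζ)) z := fun k ↦
    ((hP k).restrictScalars ℝ).mul (hcF k)
  -- Near `z` the coefficients in the two systems are related by the transition function `G` of the
  -- bundle and by products of entries of `∂F`. All these factors are holomorphic and pass through
  -- `∂̄`, so only the derivatives of the coefficients in the preferred system remain, and the chain
  -- rule rewrites their direction.
  have h1 : coeff τ φ e v =ᶠ[𝓝 z] fun ζ ↦ G (φ.symm ζ) * ∑ k : Fin p → Fin n,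
      (∏ a, fderiv ℂ F ζ (v a) (k a)) * coeff τ φ₀ e₀ (fun a ↦ Pi.single (k a) 1) (F ζ) := by
    filter_upwards [eventually_symm_mem hz φ₀.open_source hy,
      eventually_symm_mem hz e.open_baseSet he, eventually_symm_mem hz e₀.open_baseSet he₀]
      with ζ h1 h2 h3
    rw [coeff_transition hφ hφ₀ h1.1 h1.2 h2.2 h3.2, coeff_eq_sum τ]
    rw [φ₀.left_inv h1.2]; exact h3.2
  have h2 : (coeff τ φ₀ e₀ fun a ↦ fderiv ℂ F z (v a)) =ᶠ[𝓝 (F z)] fun ζ ↦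
      ∑ k : Fin p → Fin n, (∏ a, fderiv ℂ F z (v a) (k a)) *
        coeff τ φ₀ e₀ (fun a ↦ Pi.single (k a) 1) ζ := by
    filter_upwards [eventually_symm_mem hz0 e₀.open_baseSet he₀'] with ζ hζ
    exact coeff_eq_sum τ hζ.2 _
  rw [dbarDir_congr h1, dbarDir_mul_of_differentiableAt hG
    (DifferentiableAt.fun_sum fun k _ ↦ hPc k), dbarDir_sum _ fun k _ ↦ hPc k]
  change G (φ.symm z) * dbarDir (coeff τ φ₀ e₀ fun a ↦ fderiv ℂ F z (v a)) (F z)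
    (fderiv ℂ F z w) = _
  rw [dbarDir_congr h2, dbarDir_sum _ fun k _ ↦ (hc k).const_mul _]
  congr 1
  refine Finset.sum_congr rfl fun k _ ↦ ?_
  rw [dbarDir_mul_of_differentiableAt (differentiableAt_const _) (hc k),
    dbarDir_mul_of_differentiableAt (hP k) (hcF k), dbarDir_comp hFz (hc k)]

omit [IsManifold 𝓘(ℂ, Fin n → ℂ) ω X] [ChartedSpace (Fin n → ℂ) X] in
theorem IsFiberMetricOn.eq_mul {h : ∀ x, L x → ℝ} {A : Set X} (hh : IsFiberMetricOn h A) {y : X}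
    (hy : y ∈ A) (he : y ∈ e.baseSet) (u : L y) :
    h y u = ‖(e ⟨y, u⟩).2‖ ^ 2 * h y (e.symm y 1) := by
  rw [← (hh y hy).1]
  congr 1
  have h1 : e.symm y ((e ⟨y, u⟩).2) = u := e.symm_apply_apply_mk he u
  conv_lhs => rw [← h1]
  rw [← e.coe_symmₗ (R := ℂ) he, ← map_smul, smul_eq_mul, mul_one]

omit [IsManifold 𝓘(ℂ, Fin n → ℂ) ω X] [ChartedSpace (Fin n → ℂ) X] in
theorem IsFiberMetricOn.symm_pos {h : ∀ x, L x → ℝ} {A : Set X} (hh : IsFiberMetricOn h A) {y : X}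
    (hy : y ∈ A) (he : y ∈ e.baseSet) : 0 < h y (e.symm y 1) := by
  refine (hh y hy).2 _ fun h0 ↦ ?_
  have h1 := e.apply_mk_symm he (1 : ℂ)
  rw [h0] at h1
  have h2 := congrArg Prod.snd h1
  have h3 := congrFun (e.coe_linearMapAt_of_mem (R := ℂ) he) 0
  rw [map_zero] at h3
  simp [← h3] at h2

end Bundle

end Coordinates

/-! ### Sections, metrics and the Poincaré type form in coordinates -/

section SectionCoord

open Filter Topology

variable {n : ℕ} {X : Type*} [TopologicalSpace X] [ChartedSpace (Fin n → ℂ) X]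
  [IsManifold 𝓘(ℂ, Fin n → ℂ) ω X] {φ : OpenPartialHomeomorph X (Fin n → ℂ)} {x : X}
  {F : X → Type*} [TopologicalSpace (TotalSpace ℂ F)]
  [∀ x, AddCommGroup (F x)] [∀ x, Module ℂ (F x)] [∀ x, TopologicalSpace (F x)]
  [FiberBundle ℂ F] [VectorBundle ℂ ℂ F]

/-- A section in coordinates and in the preferred trivialization at `x`. -/
noncomputable def sectionCoord (s : ∀ x, F x) (x : X) (φ : OpenPartialHomeomorph X (Fin n → ℂ))
    (ζ : Fin n → ℂ) : ℂ :=
  (trivializationAt ℂ F x ⟨φ.symm ζ, s (φ.symm ζ)⟩).2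

/-- The logarithm of the squared norm of the preferred frame at `x`, in coordinates. -/
noncomputable def metricLog (h : ∀ x, F x → ℝ) (x : X) (φ : OpenPartialHomeomorph X (Fin n → ℂ))
    (ζ : Fin n → ℂ) : ℝ :=
  Real.log (h (φ.symm ζ) ((trivializationAt ℂ F x).symm (φ.symm ζ) 1))

omit [IsManifold 𝓘(ℂ, Fin n → ℂ) ω X] in
theorem contDiffAt_sectionCoord [ContMDiffVectorBundle ω ℂ F 𝓘(ℂ, Fin n → ℂ)] {s : ∀ x, F x}
    (hs : ContMDiff 𝓘(ℂ, Fin n → ℂ) (𝓘(ℂ, Fin n → ℂ).prod 𝓘(ℂ, ℂ)) ω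
      fun x ↦ (⟨x, s x⟩ : TotalSpace ℂ F)) (hφ : IsCoord φ) (hx : x ∈ φ.source) :
    ContDiffAt ℂ ω (sectionCoord s x φ) (φ x) := by
  have h1 := (contMDiffAt_section (n := ω) x).1 (hs x)
  have h2 : ContMDiffAt 𝓘(ℂ, Fin n → ℂ) 𝓘(ℂ, Fin n → ℂ) ω φ.symm (φ x) :=
    contMDiffAt_symm_of_mem_maximalAtlas hφ (φ.map_source hx)
  exact (ContMDiffAt.comp_of_eq h1 h2 (φ.left_inv hx)).contDiffAt

theorem contDiffAt_metricLog {h : ∀ x, F x → ℝ} (hh : IsSmoothMetric n h) (hφ : IsCoord φ)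
    (hx : x ∈ φ.source) : ContDiffAt ℝ ∞ (metricLog h x φ) (φ x) := by
  set e := trivializationAt ℂ F x with he
  have hxe : x ∈ e.baseSet := mem_baseSet_trivializationAt ℂ F x
  have h1 : ContMDiffAt 𝓘(ℝ, Fin n → ℂ) 𝓘(ℝ, ℝ) ∞ (fun y ↦ h y (e.symm y 1)) x :=
    (hh.2 e).contMDiffAt (e.open_baseSet.mem_nhds hxe)
  have hx0 : x ∈ (chartAt (Fin n → ℂ) x).source := mem_chart_source _ x
  set φ₀ := chartAt (Fin n → ℂ) x with hφ₀_def
  have h2 : ContDiffAt ℝ ∞ (fun ζ ↦ h (φ₀.symm ζ) (e.symm (φ₀.symm ζ) 1)) (φ₀ x) := by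
    have := (contMDiffAt_iff.1 h1).2
    simp only [mfld_simps, contDiffWithinAt_univ, Function.comp_def] at this
    exact this
  have hz : φ x ∈ φ.target := φ.map_source hx
  have hzx : φ.symm (φ x) = x := φ.left_inv hx
  have hT := contDiffAt_transition hφ (isCoord_chartAt (n := n) x) hz
    (by rw [hzx]; exact hx0)
  have h3 : ContDiffAt ℝ ∞ (fun ζ ↦ h (φ.symm ζ) (e.symm (φ.symm ζ) 1)) (φ x) := by
    have h4 : (fun ζ ↦ h (φ.symm ζ) (e.symm (φ.symm ζ) 1)) =ᶠ[𝓝 (φ x)]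
        fun ζ ↦ h (φ₀.symm (φ₀ (φ.symm ζ))) (e.symm (φ₀.symm (φ₀ (φ.symm ζ))) 1) := by
      filter_upwards [eventually_symm_mem hz φ₀.open_source (by rw [hzx]; exact hx0)] with ζ hζ
      rw [φ₀.left_inv hζ.2]
    refine ContDiffAt.congr_of_eventuallyEq ?_ h4
    have h5 : ContDiffAt ℝ ∞ (fun ζ ↦ h (φ₀.symm ζ) (e.symm (φ₀.symm ζ) 1)) (φ₀ (φ.symm (φ x))) := by
      rwa [hzx]
    exact ContDiffAt.comp (g := fun ζ ↦ h (φ₀.symm ζ) (e.symm (φ₀.symm ζ) 1)) (φ x) h5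
      ((hT.restrict_scalars ℝ).of_le (by simp))
  refine h3.log ?_
  have := hh.1.symm_pos (e := e) (mem_univ x) hxe
  rw [hzx]
  exact this.ne'

omit [ChartedSpace (Fin n → ℂ) X] [IsManifold 𝓘(ℂ, Fin n → ℂ) ω X] in
theorem sectionCoord_eq_zero_iff {s : ∀ x, F x} {ζ : Fin n → ℂ}
    (hζ : φ.symm ζ ∈ (trivializationAt ℂ F x).baseSet) :
    sectionCoord s x φ ζ = 0 ↔ s (φ.symm ζ) = 0 := by
  change (trivializationAt ℂ F x).linearEquivAt ℂ _ hζ (s (φ.symm ζ)) = 0 ↔ _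
  exact LinearEquiv.map_eq_zero_iff _

omit [IsManifold 𝓘(ℂ, Fin n → ℂ) ω X] in
theorem norm_section_eq {h : ∀ x, F x → ℝ} (hh : IsSmoothMetric n h) {s : ∀ x, F x}
    {ζ : Fin n → ℂ} (hζ : φ.symm ζ ∈ (trivializationAt ℂ F x).baseSet) :
    h (φ.symm ζ) (s (φ.symm ζ)) = ‖sectionCoord s x φ ζ‖ ^ 2 * Real.exp (metricLog h x φ ζ) := by
  rw [metricLog, Real.exp_log (hh.1.symm_pos (mem_univ _) hζ)]
  exact hh.1.eq_mul (mem_univ _) hζ _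

omit [IsManifold 𝓘(ℂ, Fin n → ℂ) ω X] in
theorem log_inv_norm_section {h : ∀ x, F x → ℝ} (hh : IsSmoothMetric n h) {s : ∀ x, F x}
    {ζ : Fin n → ℂ} (hζ : φ.symm ζ ∈ (trivializationAt ℂ F x).baseSet)
    (h0 : s (φ.symm ζ) ≠ 0) :
    Real.log (1 / h (φ.symm ζ) (s (φ.symm ζ))) =
      -(metricLog h x φ ζ + Real.log (‖sectionCoord s x φ ζ‖ ^ 2)) := by
  have h1 : sectionCoord s x φ ζ ≠ 0 := fun h ↦ h0 ((sectionCoord_eq_zero_iff hζ).1 h)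
  rw [norm_section_eq hh hζ, one_div, Real.log_inv, Real.log_mul (by positivity)
    (Real.exp_ne_zero _), Real.log_exp, add_comm]

omit [IsManifold 𝓘(ℂ, Fin n → ℂ) ω X] in
-- This is `log |s|² < -1` in coordinates. It keeps the iterated logarithm smooth, and divisions by
-- `-log |s|²` do not increase absolute values.
theorem metricLog_add_log_lt {h : ∀ x, F x → ℝ} (hh : IsSmoothMetric n h) {s : ∀ x, F x}
    (hlt : ∀ x, h x (s x) < Real.exp (-1)) {ζ : Fin n → ℂ}
    (hζ : φ.symm ζ ∈ (trivializationAt ℂ F x).baseSet) (h0 : s (φ.symm ζ) ≠ 0) :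
    metricLog h x φ ζ + Real.log (‖sectionCoord s x φ ζ‖ ^ 2) < -1 := by
  have h1 := log_inv_norm_section hh hζ h0
  have hpos : 0 < h (φ.symm ζ) (s (φ.symm ζ)) := (hh.1 _ (mem_univ _)).2 _ h0
  have h2 := Real.log_lt_log hpos (hlt (φ.symm ζ))
  rw [Real.log_exp] at h2
  rw [one_div, Real.log_inv] at h1
  linarith

end SectionCoord

/-! ### The form `ω_E` off the divisor -/

section PoincareForm

open Filter Topology

variable {n N : ℕ} {X : Type*} [TopologicalSpace X]
  [ChartedSpace (Fin n → ℂ) X] [IsManifold 𝓘(ℂ, Fin n → ℂ) ω X]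
  {F : Fin N → X → Type*} [∀ i, TopologicalSpace (TotalSpace ℂ (F i))]
  [∀ i x, AddCommGroup (F i x)] [∀ i x, Module ℂ (F i x)] [∀ i x, TopologicalSpace (F i x)]
  [∀ i, FiberBundle ℂ (F i)] [∀ i, VectorBundle ℂ ℂ (F i)]
  {s : ∀ i x, F i x} {hF : ∀ i x, F i x → ℝ} {g : HermitianMetric n X}
  {φ : OpenPartialHomeomorph X (Fin n → ℂ)} {x : X} {z : Fin n → ℂ}

omit [IsManifold 𝓘(ℂ, Fin n → ℂ) ω X] in
theorem potential_eq (hF_smooth : ∀ i, IsSmoothMetric n (hF i)) {ζ : Fin n → ℂ}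
    (hζ : ∀ i, φ.symm ζ ∈ (trivializationAt ℂ (F i) x).baseSet)
    (hE : φ.symm ζ ∉ divisorSupport s) :
    -∑ i, Real.log (Real.log (1 / hF i (φ.symm ζ) (s i (φ.symm ζ)))) =
      -∑ i, Real.log (-(metricLog (hF i) x φ ζ +
        Real.log (‖sectionCoord (s i) x φ ζ‖ ^ 2))) := by
  congr 1
  refine Finset.sum_congr rfl fun i _ ↦ ?_
  rw [log_inv_norm_section (hF_smooth i) (hζ i) fun h ↦ hE ⟨i, h⟩]

omit [ChartedSpace (Fin n → ℂ) X] [IsManifold 𝓘(ℂ, Fin n → ℂ) ω X] [∀ i, VectorBundle ℂ ℂ (F i)]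
  [∀ i x, Module ℂ (F i x)] [∀ i x, AddCommGroup (F i x)] in
theorem eventually_mem_baseSets (hx : x ∈ φ.source) :
    ∀ᶠ ζ in 𝓝 (φ x), ζ ∈ φ.target ∧ ∀ i, φ.symm ζ ∈ (trivializationAt ℂ (F i) x).baseSet := by
  have h1 : ∀ i, ∀ᶠ ζ in 𝓝 (φ x), ζ ∈ φ.target ∧
      φ.symm ζ ∈ (trivializationAt ℂ (F i) x).baseSet := fun i ↦
    eventually_symm_mem (φ.map_source hx) (trivializationAt ℂ (F i) x).open_baseSet
      (by rw [φ.left_inv hx]; exact mem_baseSet_trivializationAt ℂ (F i) x)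
  filter_upwards [φ.open_target.eventually_mem (φ.map_source hx), eventually_all.2 h1] with ζ h2 h3
  exact ⟨h2, fun i ↦ (h3 i).2⟩

variable [∀ i, ContMDiffVectorBundle ω ℂ (F i) 𝓘(ℂ, Fin n → ℂ)]

omit [IsManifold 𝓘(ℂ, Fin n → ℂ) ω X] in
theorem eventually_notMem_divisorSupport
    (hs : ∀ i, ContMDiff 𝓘(ℂ, Fin n → ℂ) (𝓘(ℂ, Fin n → ℂ).prod 𝓘(ℂ, ℂ)) ω
      fun x ↦ (⟨x, s i x⟩ : TotalSpace ℂ (F i)))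
    (hφ : IsCoord φ) (hx : x ∈ φ.source) (hE : x ∉ divisorSupport s) :
    ∀ᶠ ζ in 𝓝 (φ x), φ.symm ζ ∉ divisorSupport s := by
  have hx' := φ.left_inv hx
  have h1 : ∀ i, ∀ᶠ ζ in 𝓝 (φ x), sectionCoord (s i) x φ ζ ≠ 0 := fun i ↦ by
    refine (contDiffAt_sectionCoord (hs i) hφ hx).continuousAt.eventually_ne fun h ↦ ?_
    rw [sectionCoord_eq_zero_iff (by rw [hx']; exact mem_baseSet_trivializationAt ℂ (F i) x),
      hx'] at h
    exact hE ⟨i, h⟩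
  filter_upwards [eventually_mem_baseSets (F := F) hx, eventually_all.2 h1] with ζ h2 h3
  rintro ⟨i, hi⟩
  exact h3 i ((sectionCoord_eq_zero_iff (h2.2 i)).2 hi)

theorem contDiffAt_potential
    (hs : ∀ i, ContMDiff 𝓘(ℂ, Fin n → ℂ) (𝓘(ℂ, Fin n → ℂ).prod 𝓘(ℂ, ℂ)) ω
      fun x ↦ (⟨x, s i x⟩ : TotalSpace ℂ (F i)))
    (hF_smooth : ∀ i, IsSmoothMetric n (hF i)) (hF_lt : ∀ i x, hF i x (s i x) < Real.exp (-1))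
    (hφ : IsCoord φ) (hx : x ∈ φ.source) (hE : x ∉ divisorSupport s) :
    ContDiffAt ℝ 2 (fun ζ ↦ -∑ i, Real.log (Real.log (1 / hF i (φ.symm ζ) (s i (φ.symm ζ)))))
      (φ x) := by
  have hx' := φ.left_inv hx
  have hb := eventually_mem_baseSets (F := F) hx
  have h1 : (fun ζ ↦ -∑ i, Real.log (Real.log (1 / hF i (φ.symm ζ) (s i (φ.symm ζ)))))
      =ᶠ[𝓝 (φ x)] fun ζ ↦ -∑ i, Real.log (-(metricLog (hF i) x φ ζ +
        Real.log (‖sectionCoord (s i) x φ ζ‖ ^ 2))) := by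
    filter_upwards [hb, eventually_notMem_divisorSupport hs hφ hx hE] with ζ h2 h3
    exact potential_eq hF_smooth h2.2 h3
  refine ContDiffAt.congr_of_eventuallyEq ?_ h1
  refine (ContDiffAt.sum fun i _ ↦ ?_).neg
  have hlt := metricLog_add_log_lt (hF_smooth i) (hF_lt i) (hb.self_of_nhds.2 i)
    (fun h ↦ hE ⟨i, by rwa [hx'] at h⟩)
  have h0 : sectionCoord (s i) x φ (φ x) ≠ 0 := fun h ↦
    hE ⟨i, by rwa [sectionCoord_eq_zero_iff (hb.self_of_nhds.2 i), hx'] at h⟩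
  refine ContDiffAt.log (ContDiffAt.neg (ContDiffAt.add
    ((contDiffAt_metricLog (hF_smooth i) hφ hx).of_le (WithTop.coe_le_coe.2 (le_top : (2 : ℕ∞) ≤ ⊤))) ?_))
    (by linarith)
  exact ((((contDiffAt_sectionCoord (hs i) hφ hx).restrict_scalars ℝ).of_le (by simp)).norm_sq
    ℝ).log (by positivity)

/-- Off the divisor, the Poincaré type form in coordinates is a sesquilinear form. -/
theorem exists_poincareForm_coord
    (hs : ∀ i, ContMDiff 𝓘(ℂ, Fin n → ℂ) (𝓘(ℂ, Fin n → ℂ).prod 𝓘(ℂ, ℂ)) ω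
      fun x ↦ (⟨x, s i x⟩ : TotalSpace ℂ (F i)))
    (hF_smooth : ∀ i, IsSmoothMetric n (hF i)) (hF_lt : ∀ i x, hF i x (s i x) < Real.exp (-1))
    (hφ : IsCoord φ) (hz : z ∈ φ.target) (hE : φ.symm z ∉ divisorSupport s) :
    ∃ H : (Fin n → ℂ) →ₗ⋆[ℂ] (Fin n → ℂ) →ₗ[ℂ] ℂ,
      (∀ v w, H v w = poincareForm g s hF (φ.symm z) (coordVec φ z v) (coordVec φ z w)) ∧
      (∀ v w, (starRingEnd ℂ) (H v w) = H w v) ∧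
      ∀ v w, H v w = g.form (φ.symm z) (coordVec φ z v) (coordVec φ z w) +
        complexHessian (fun ζ ↦ ((-∑ i, Real.log (Real.log
          (1 / hF i (φ.symm ζ) (s i (φ.symm ζ)))) : ℝ) : ℂ)) z v w := by
  have hzx : φ (φ.symm z) = z := φ.right_inv hz
  have hu := contDiffAt_potential (hF := hF) hs hF_smooth hF_lt hφ (φ.map_target hz) hE
  rw [hzx] at hu
  have hadd : ∀ v w, coordVec φ z (v + w) = coordVec φ z v + coordVec φ z w := fun v w ↦
    map_add _ _ _
  have hsmul : ∀ (c : ℂ) v, coordVec φ z (c • v) = c • coordVec φ z v := fun c v ↦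
    map_smul _ _ _
  have hL : ∀ v w, poincareForm g s hF (φ.symm z) (coordVec φ z v) (coordVec φ z w) =
      g.form (φ.symm z) (coordVec φ z v) (coordVec φ z w) +
        complexHessian (fun ζ ↦ ((-∑ i, Real.log (Real.log
          (1 / hF i (φ.symm ζ) (s i (φ.symm ζ)))) : ℝ) : ℂ)) z v w := fun v w ↦ by
    rw [poincareForm, leviForm_coordVec hφ hz hu]
  refine ⟨LinearMap.mk₂'ₛₗ (starRingEnd ℂ) (RingHom.id ℂ) (fun v w ↦
    poincareForm g s hF (φ.symm z) (coordVec φ z v) (coordVec φ z w)) ?_ ?_ ?_ ?_,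
    fun v w ↦ rfl, fun v w ↦ ?_, fun v w ↦ hL v w⟩
  · intro v v' w
    rw [hL, hL, hL, hadd, map_add, LinearMap.add_apply, complexHessian_add_left hu.complex_ofReal]
    exact add_add_add_comm _ _ _ _
  · intro c v w
    rw [hL, hL, hsmul, map_smulₛₗ, LinearMap.smul_apply,
      complexHessian_smul_left hu.complex_ofReal, smul_add, smul_eq_mul, smul_eq_mul]
  · intro v w w'
    rw [hL, hL, hL, hadd, map_add, complexHessian_add_right]
    exact add_add_add_comm _ _ _ _
  · intro c v w
    rw [hL, hL, hsmul, map_smul, complexHessian_smul_right, RingHom.id_apply, smul_add,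
      smul_eq_mul, smul_eq_mul]
  · simp only [LinearMap.mk₂'ₛₗ_apply, hL, map_add, g.conj_symm, complexHessian_conj_symm hu]

/-- The quadratic form of the Poincaré type metric near a point `x`. -/
theorem poincareForm_coord_eq
    (hs : ∀ i, ContMDiff 𝓘(ℂ, Fin n → ℂ) (𝓘(ℂ, Fin n → ℂ).prod 𝓘(ℂ, ℂ)) ω
      fun x ↦ (⟨x, s i x⟩ : TotalSpace ℂ (F i)))
    (hF_smooth : ∀ i, IsSmoothMetric n (hF i)) (hF_lt : ∀ i x, hF i x (s i x) < Real.exp (-1))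
    (hφ : IsCoord φ) (hz : z ∈ φ.target) (hE : φ.symm z ∉ divisorSupport s)
    (hb : ∀ i, φ.symm z ∈ (trivializationAt ℂ (F i) x).baseSet)
    (hf : ∀ i, ContDiffAt ℂ 2 (sectionCoord (s i) x φ) z)
    (hh : ∀ i, ContDiffAt ℝ 2 (metricLog (hF i) x φ) z) (v : Fin n → ℂ) :
    (poincareForm g s hF (φ.symm z) (coordVec φ z v) (coordVec φ z v)).re =
      (g.form (φ.symm z) (coordVec φ z v) (coordVec φ z v)).re +
      ∑ i, ((complexHessian (fun ζ ↦ (metricLog (hF i) x φ ζ : ℂ)) z v v).re /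
        (-(metricLog (hF i) x φ z + Real.log (‖sectionCoord (s i) x φ z‖ ^ 2))) +
        ‖dbarDir (fun ζ ↦ (metricLog (hF i) x φ ζ : ℂ)) z v +
          (starRingEnd ℂ) (fderiv ℂ (sectionCoord (s i) x φ) z v / sectionCoord (s i) x φ z)‖ ^ 2 /
        (metricLog (hF i) x φ z + Real.log (‖sectionCoord (s i) x φ z‖ ^ 2)) ^ 2) := by
  have hzx : φ (φ.symm z) = z := φ.right_inv hz
  have hu := contDiffAt_potential (hF := hF) hs hF_smooth hF_lt hφ (φ.map_target hz) hE
  have hne := eventually_notMem_divisorSupport hs hφ (φ.map_target hz) hE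
  rw [hzx] at hu hne
  have h1 : (fun ζ ↦ ((-∑ i, Real.log (Real.log
      (1 / hF i (φ.symm ζ) (s i (φ.symm ζ)))) : ℝ) : ℂ)) =ᶠ[𝓝 z]
      fun ζ ↦ ((-∑ i, Real.log (-(metricLog (hF i) x φ ζ +
        Real.log (‖sectionCoord (s i) x φ ζ‖ ^ 2))) : ℝ) : ℂ) := by
    have hb' : ∀ᶠ ζ in 𝓝 z, ∀ i, φ.symm ζ ∈ (trivializationAt ℂ (F i) x).baseSet :=
      eventually_all.2 fun i ↦ (eventually_symm_mem hz
        (trivializationAt ℂ (F i) x).open_baseSet (hb i)).mono fun ζ h ↦ h.2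
    filter_upwards [hb', hne] with ζ h2 h3
    rw [potential_eq hF_smooth h2 h3]
  have h0 : ∀ i, s i (φ.symm z) ≠ 0 := fun i h ↦ hE ⟨i, h⟩
  rw [poincareForm, leviForm_coordVec hφ hz hu, Complex.add_re, complexHessian_congr h1,
    complexHessian_sum_neg_log_neg hh hf
      (fun i h ↦ h0 i ((sectionCoord_eq_zero_iff (hb i)).1 h)) fun i ↦ ?_]
  have := metricLog_add_log_lt (hF_smooth i) (hF_lt i) (hb i) (h0 i)
  linarith

end PoincareForm

/-! ### The volume of a Hermitian form in coordinates -/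

section Volume

open Filter Topology

variable {n : ℕ}

/-- The Gram matrix changes to `P* M P`, so its determinant picks up `|det P|²`. -/
theorem det_sesquilinear_comp (H : (Fin n → ℂ) →ₗ⋆[ℂ] (Fin n → ℂ) →ₗ[ℂ] ℂ)
    (A : (Fin n → ℂ) →ₗ[ℂ] Fin n → ℂ) :
    (Matrix.of fun j k : Fin n ↦ H (A (Pi.single j 1)) (A (Pi.single k 1))).det =
      ((‖LinearMap.det A‖ ^ 2 : ℝ) : ℂ) *
        (Matrix.of fun j k : Fin n ↦ H (Pi.single j 1) (Pi.single k 1)).det := by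
  set P := LinearMap.toMatrix' A with hP
  set M : Matrix (Fin n) (Fin n) ℂ := Matrix.of fun j k : Fin n ↦ H (Pi.single j 1) (Pi.single k 1)
    with hM
  have hA : ∀ j, A (Pi.single j 1) = ∑ a, P a j • (Pi.single a 1 : Fin n → ℂ) := by
    intro j
    have : A (Pi.single j 1) = ∑ a, (A (Pi.single j 1)) a • (Pi.single a 1 : Fin n → ℂ) := by
      simpa using (pi_eq_sum_univ' (A (Pi.single j 1)))
    rw [this]
    refine Finset.sum_congr rfl fun a _ ↦ ?_
    rw [hP, LinearMap.toMatrix'_apply]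
  have h1 : (Matrix.of fun j k : Fin n ↦ H (A (Pi.single j 1)) (A (Pi.single k 1))) =
      P.conjTranspose * M * P := by
    ext j k
    rw [Matrix.of_apply, hA j, hA k, Matrix.mul_apply]
    simp only [map_sum, map_smulₛₗ, LinearMap.sum_apply, LinearMap.smul_apply, smul_eq_mul,
      RingHom.id_apply, Matrix.mul_apply, Matrix.conjTranspose_apply, hM, Matrix.of_apply,
      Finset.mul_sum, Finset.sum_mul]
    refine Finset.sum_congr rfl fun b _ ↦ Finset.sum_congr rfl fun a _ ↦ ?_
    rw [starRingEnd_apply]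
    ring
  rw [h1, Matrix.det_mul, Matrix.det_mul, Matrix.det_conjTranspose, ← LinearMap.det_toMatrix' A,
    ← hP, ← Complex.normSq_eq_norm_sq, Complex.normSq_eq_conj_mul_self, starRingEnd_apply]
  ring

/-- The real determinant of a complex linear map is the norm from `ℂ` to `ℝ` of its complex
determinant. So Lebesgue measure has the same Jacobian as the determinant of a Hermitian form, and
the local volumes agree. -/
theorem abs_det_restrictScalars (A : (Fin n → ℂ) →L[ℂ] Fin n → ℂ) :
    |(A.restrictScalars ℝ).det| = ‖LinearMap.det (A : (Fin n → ℂ) →ₗ[ℂ] Fin n → ℂ)‖ ^ 2 := by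
  have h : (A.restrictScalars ℝ).det =
      Algebra.norm ℝ (LinearMap.det (A : (Fin n → ℂ) →ₗ[ℂ] Fin n → ℂ)) := by
    rw [← LinearMap.det_restrictScalars]; rfl
  rw [h, Algebra.norm_complex_eq]
  simp [Complex.normSq_eq_norm_sq]

variable {X : Type*} [TopologicalSpace X] [ChartedSpace (Fin n → ℂ) X]
  {φ φ' : OpenPartialHomeomorph X (Fin n → ℂ)}
  {H : ∀ x : X, TangentSpace 𝓘(ℂ, Fin n → ℂ) x → TangentSpace 𝓘(ℂ, Fin n → ℂ) x → ℂ}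

/-- The density of the volume of `H` in the coordinates `φ`. -/
noncomputable def volumeDensity
    (H : ∀ x : X, TangentSpace 𝓘(ℂ, Fin n → ℂ) x → TangentSpace 𝓘(ℂ, Fin n → ℂ) x → ℂ)
    (φ : OpenPartialHomeomorph X (Fin n → ℂ)) (z : Fin n → ℂ) : ℝ≥0∞ :=
  ENNReal.ofReal ((2 : ℝ) ^ n * (Matrix.det (Matrix.of fun j k : Fin n ↦
    H (φ.symm z) (coordVec φ z (Pi.single j 1)) (coordVec φ z (Pi.single k 1)))).re)

variable [MeasurableSpace X] [BorelSpace X]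

/-- The volume of `H` in the domain of the coordinates `φ`. -/
noncomputable def coordVolume
    (H : ∀ x : X, TangentSpace 𝓘(ℂ, Fin n → ℂ) x → TangentSpace 𝓘(ℂ, Fin n → ℂ) x → ℂ)
    (φ : OpenPartialHomeomorph X (Fin n → ℂ)) : Measure X :=
  Measure.map φ.symm ((volume.restrict φ.target).withDensity (volumeDensity H φ))

omit [BorelSpace X] in
theorem hermVolume_eq_iSup : hermVolume H =
    ⨆ (φ : OpenPartialHomeomorph X (Fin n → ℂ)) (_ : IsCoord φ), coordVolume H φ := rfl

omit [ChartedSpace (Fin n → ℂ) X] in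
theorem aemeasurable_symm (φ : OpenPartialHomeomorph X (Fin n → ℂ)) {ν : Measure (Fin n → ℂ)}
    (hν : ν ≪ volume.restrict φ.target) : AEMeasurable φ.symm ν :=
  (φ.continuousOn_symm.aemeasurable φ.open_target.measurableSet).mono_ac hν

omit [ChartedSpace (Fin n → ℂ) X] in
theorem measurableSet_target_inter_preimage (φ : OpenPartialHomeomorph X (Fin n → ℂ)) {B : Set X}
    (hB : MeasurableSet B) : MeasurableSet (φ.target ∩ φ.symm ⁻¹' B) := by
  have h1 : Measurable (φ.target.domRestrict φ.symm) :=
    (continuousOn_iff_continuous_domRestrict.1 φ.continuousOn_symm).measurable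
  have h2 := MeasurableSet.subtype_image φ.open_target.measurableSet (h1 hB)
  convert h2 using 1
  ext z
  simp [and_comm]

omit [ChartedSpace (Fin n → ℂ) X] in
theorem measurableSet_source_inter_preimage (φ : OpenPartialHomeomorph X (Fin n → ℂ))
    {Q : Set (Fin n → ℂ)} (hQ : MeasurableSet Q) : MeasurableSet (φ.source ∩ φ ⁻¹' Q) := by
  have h1 : Measurable (φ.source.domRestrict φ) :=
    (continuousOn_iff_continuous_domRestrict.1 φ.continuousOn).measurable
  have h2 := MeasurableSet.subtype_image φ.open_source.measurableSet (h1 hQ)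
  convert h2 using 1
  ext z
  simp [and_comm]

theorem coordVolume_apply {B : Set X} (hB : MeasurableSet B) :
    coordVolume H φ B = ∫⁻ z in φ.target ∩ φ.symm ⁻¹' B, volumeDensity H φ z := by
  rw [coordVolume, Measure.map_apply_of_aemeasurable
    (aemeasurable_symm φ (withDensity_absolutelyContinuous _ _)) hB, withDensity_apply',
    Measure.restrict_restrict' φ.open_target.measurableSet, inter_comm]

/-- The volume form transforms correctly under the change of coordinates from `φ` to `φ'` over
`A`. -/
def IsVolumeCompatible
    (H : ∀ x : X, TangentSpace 𝓘(ℂ, Fin n → ℂ) x → TangentSpace 𝓘(ℂ, Fin n → ℂ) x → ℂ)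
    (φ φ' : OpenPartialHomeomorph X (Fin n → ℂ)) (A : Set X) : Prop :=
  ∀ z ∈ φ.target, φ.symm z ∈ A → φ.symm z ∈ φ'.source →
    volumeDensity H φ z = ENNReal.ofReal |(fderiv ℝ (fun ζ ↦ φ' (φ.symm ζ)) z).det| *
      volumeDensity H φ' (φ' (φ.symm z))

variable [IsManifold 𝓘(ℂ, Fin n → ℂ) ω X]

omit [MeasurableSpace X] [BorelSpace X] in
-- Sesquilinearity is asked only over `A`, because that of `ω_E` is available only off the divisor.
theorem isVolumeCompatible_of_sesquilinear (hφ : IsCoord φ) (hφ' : IsCoord φ') {A : Set X}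
    (h : ∀ z ∈ φ'.target, φ'.symm z ∈ A → ∃ H' : (Fin n → ℂ) →ₗ⋆[ℂ] (Fin n → ℂ) →ₗ[ℂ] ℂ,
      ∀ v w, H' v w = H (φ'.symm z) (coordVec φ' z v) (coordVec φ' z w)) :
    IsVolumeCompatible H φ φ' A := by
  intro z hz hzA hz'
  obtain ⟨H', hH'⟩ := h (φ' (φ.symm z)) (φ'.map_source hz') (by rwa [φ'.left_inv hz'])
  have hT := (contDiffAt_transition hφ hφ' hz hz').differentiableAt (by simp)
  have h1 : ∀ v w, H (φ.symm z) (coordVec φ z v) (coordVec φ z w) =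
      H' (fderiv ℂ (fun ζ ↦ φ' (φ.symm ζ)) z v) (fderiv ℂ (fun ζ ↦ φ' (φ.symm ζ)) z w) := by
    intro v w
    rw [hH']
    have h2 : ∀ (x x' : X) (_ : x = x') (a b a' b' : Fin n → ℂ) (_ : a = a') (_ : b = b'),
        H x a b = H x' a' b' := by
      intro x x' hx a b a' b' ha hb
      subst hx; subst ha; subst hb; rfl
    exact h2 _ _ (φ'.left_inv hz').symm _ _ _ _ (coordVec_eq hφ hφ' hz hz' v)
      (coordVec_eq hφ hφ' hz hz' w)
  have h3 : fderiv ℝ (fun ζ ↦ φ' (φ.symm ζ)) z =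
      (fderiv ℂ (fun ζ ↦ φ' (φ.symm ζ)) z).restrictScalars ℝ :=
    (hT.hasFDerivAt.restrictScalars ℝ).fderiv
  rw [volumeDensity, volumeDensity, h3, abs_det_restrictScalars,
    ← ENNReal.ofReal_mul (by positivity)]
  congr 1
  simp only [h1, ← hH']
  rw [mul_left_comm]
  congr 1
  rw [← Complex.re_ofReal_mul]
  congr 1
  exact det_sesquilinear_comp H' (fderiv ℂ (fun ζ ↦ φ' (φ.symm ζ)) z :
    (Fin n → ℂ) →ₗ[ℂ] Fin n → ℂ)

omit [IsManifold 𝓘(ℂ, Fin n → ℂ) ω X] in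
-- Change of variables on the overlap of the charts; it is only an inequality, because a part of `B`
-- may lie outside the domain of `φ'`.
theorem coordVolume_le_of_subset (hφ : IsCoord φ) (hφ' : IsCoord φ') {A B : Set X}
    (hA : A ⊆ φ.source) (hB : MeasurableSet B) (hBA : B ⊆ A) (h : IsVolumeCompatible H φ φ' A) :
    coordVolume H φ' B ≤ coordVolume H φ B := by
  rw [coordVolume_apply hB, coordVolume_apply hB]
  set S := φ.target ∩ φ.symm ⁻¹' (B ∩ φ'.source) with hS
  have hSm : MeasurableSet S :=
    measurableSet_target_inter_preimage φ (hB.inter φ'.open_source.measurableSet)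
  have h1 : φ'.target ∩ φ'.symm ⁻¹' B = (fun ζ ↦ φ' (φ.symm ζ)) '' S := by
    ext w
    constructor
    · rintro ⟨hw, hwB⟩
      have h2 : φ'.symm w ∈ φ.source := hA (hBA hwB)
      refine ⟨φ (φ'.symm w), ⟨φ.map_source h2, ?_⟩, ?_⟩
      · rw [mem_preimage, φ.left_inv h2]; exact ⟨hwB, φ'.map_target hw⟩
      · simp only [φ.left_inv h2, φ'.right_inv hw]
    · rintro ⟨ζ, ⟨_, hζ⟩, rfl⟩
      refine ⟨φ'.map_source hζ.2, ?_⟩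
      simp only [mem_preimage, φ'.left_inv hζ.2]
      exact hζ.1
  have hinj : InjOn (fun ζ ↦ φ' (φ.symm ζ)) S := by
    intro a ha b hb hab
    exact φ.symm.injOn ha.1 hb.1 (φ'.injOn ha.2.2 hb.2.2 hab)
  have hd : ∀ ζ ∈ S, HasFDerivWithinAt (fun ζ ↦ φ' (φ.symm ζ))
      (fderiv ℝ (fun ζ ↦ φ' (φ.symm ζ)) ζ) S ζ := fun ζ hζ ↦
    (((contDiffAt_transition hφ hφ' hζ.1 hζ.2.2).differentiableAt
      (by simp)).restrictScalars ℝ).hasFDerivAt.hasFDerivWithinAt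
  rw [h1, lintegral_image_eq_lintegral_abs_det_fderiv_mul _ hSm hd hinj]
  calc ∫⁻ ζ in S, ENNReal.ofReal |(fderiv ℝ (fun ζ ↦ φ' (φ.symm ζ)) ζ).det| *
        volumeDensity H φ' (φ' (φ.symm ζ))
      = ∫⁻ ζ in S, volumeDensity H φ ζ :=
        setLIntegral_congr_fun hSm fun ζ hζ ↦ (h ζ hζ.1 (hBA hζ.2.1) hζ.2.2).symm
    _ ≤ _ := lintegral_mono_set (inter_subset_inter_right _ (preimage_mono inter_subset_left))

omit [IsManifold 𝓘(ℂ, Fin n → ℂ) ω X] in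
-- The supremum over all charts is already attained by `φ` over `A`, since every other chart
-- contributes at most the volume in `φ` there.
theorem hermVolume_restrict_eq (hφ : IsCoord φ) {A : Set X} (hA : A ⊆ φ.source)
    (hAm : MeasurableSet A) (h : ∀ φ', IsCoord φ' → IsVolumeCompatible H φ φ' A) :
    (hermVolume H).restrict A = (coordVolume H φ).restrict A := by
  refine le_antisymm ?_ (Measure.restrict_mono le_rfl ?_)
  -- Adding infinitely many times the counting measure of the complement of `A` makes the comparison
  -- trivial for sets not contained in `A`, so a supremum of measures can be bounded globally;
  -- restriction to `A` removes the addition.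
  · have h1 : hermVolume H ≤ coordVolume H φ + (∞ : ℝ≥0∞) • Measure.count.restrict Aᶜ := by
      rw [hermVolume_eq_iSup]
      refine iSup₂_le fun φ' hφ' ↦ Measure.le_iff.2 fun B hB ↦ ?_
      by_cases hBA : B ⊆ A
      · rw [Measure.add_apply]
        exact (coordVolume_le_of_subset hφ hφ' hA hB hBA (h φ' hφ')).trans le_self_add
      · obtain ⟨y, hyB, hyA⟩ := not_subset.1 hBA
        have h2 : (Measure.count.restrict Aᶜ) B ≠ 0 := by
          rw [Measure.restrict_apply hB, Ne, Measure.count_eq_zero_iff]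
          exact Set.Nonempty.ne_empty ⟨y, hyB, hyA⟩
        rw [Measure.add_apply, Measure.smul_apply, smul_eq_mul, ENNReal.top_mul h2]
        simp
    have h3 : (Measure.count.restrict Aᶜ).restrict A = 0 := by
      rw [Measure.restrict_restrict hAm]; simp
    calc (hermVolume H).restrict A
        ≤ (coordVolume H φ + (∞ : ℝ≥0∞) • Measure.count.restrict Aᶜ).restrict A :=
          Measure.restrict_mono le_rfl h1
      _ = (coordVolume H φ).restrict A := by
          rw [Measure.restrict_add, Measure.restrict_smul, h3, smul_zero, add_zero]
  · rw [hermVolume_eq_iSup]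
    exact le_iSup₂ (f := fun φ (_ : IsCoord φ) ↦ coordVolume H φ) φ hφ

omit [ChartedSpace (Fin n → ℂ) X] [IsManifold 𝓘(ℂ, Fin n → ℂ) ω X] in
-- The integrand need not be measurable, as the norms of forms are suprema over frames. A measurable
-- minorant with the same integral is transported by the chart, which is a homeomorphism onto its
-- image.
theorem lintegral_map_symm (φ : OpenPartialHomeomorph X (Fin n → ℂ)) {ν : Measure (Fin n → ℂ)}
    (hν : ν ≪ volume.restrict φ.target) (f : X → ℝ≥0∞) :
    ∫⁻ y, f y ∂(Measure.map φ.symm ν) = ∫⁻ z, f (φ.symm z) ∂ν := by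
  refine le_antisymm (lintegral_map_le f φ.symm) ?_
  obtain ⟨g, hg, hgf, hgi⟩ := exists_measurable_le_lintegral_eq ν fun z ↦ f (φ.symm z)
  rw [hgi]
  classical
  have h1 : Measurable (φ.source.piecewise φ fun _ ↦ (0 : Fin n → ℂ)) :=
    φ.continuousOn.measurable_piecewise continuousOn_const φ.open_source.measurableSet
  set g' : X → ℝ≥0∞ := φ.source.indicator
    (fun y ↦ g (φ.source.piecewise φ (fun _ ↦ (0 : Fin n → ℂ)) y)) with hg'
  have hg'm : Measurable g' := (hg.comp h1).indicator φ.open_source.measurableSet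
  have h2 : g' ≤ f := by
    intro y
    by_cases hy : y ∈ φ.source
    · simp only [hg', indicator_of_mem hy, piecewise_eq_of_mem _ _ _ hy]
      exact (hgf (φ y)).trans_eq (by simp only [φ.left_inv hy])
    · simp [hg', indicator_of_notMem hy]
  have h3 : ∀ᵐ z ∂ν, g z = g' (φ.symm z) := by
    refine hν.ae_le ((ae_restrict_iff' φ.open_target.measurableSet).2 (ae_of_all _ fun z hz ↦ ?_))
    have hy := φ.map_target hz
    simp only [hg', indicator_of_mem hy, piecewise_eq_of_mem _ _ _ hy, φ.right_inv hz]
  rw [lintegral_congr_ae h3, ← lintegral_map' hg'm.aemeasurable (aemeasurable_symm φ hν)]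
  exact lintegral_mono h2

omit [IsManifold 𝓘(ℂ, Fin n → ℂ) ω X] in
/-- Integration over a subset of the domain of the coordinates `φ`. -/
theorem setLIntegral_hermVolume (hφ : IsCoord φ) {A : Set X} (hA : A ⊆ φ.source)
    (hAm : MeasurableSet A) (h : ∀ φ', IsCoord φ' → IsVolumeCompatible H φ φ' A)
    {Q : Set (Fin n → ℂ)} (hQ : MeasurableSet Q) (hQA : ∀ z ∈ Q, z ∈ φ.target ∧ φ.symm z ∈ A)
    (f : X → ℝ≥0∞) :
    ∫⁻ y in φ.source ∩ φ ⁻¹' Q, f y ∂(hermVolume H) =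
      ∫⁻ z, f (φ.symm z) ∂((volume.restrict Q).withDensity (volumeDensity H φ)) := by
  set V := φ.source ∩ φ ⁻¹' Q with hV
  have hVm : MeasurableSet V := measurableSet_source_inter_preimage φ hQ
  have hVA : V ⊆ A := fun y hy ↦ by
    have := (hQA _ hy.2).2
    rwa [φ.left_inv hy.1] at this
  have h1 : (hermVolume H).restrict V = (coordVolume H φ).restrict V := by
    have := congrArg (fun ν ↦ ν.restrict V) (hermVolume_restrict_eq hφ hA hAm h)
    simpa only [Measure.restrict_restrict hVm, inter_eq_self_of_subset_left hVA] using this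
  have hVQ : φ.symm ⁻¹' V ∩ φ.target = Q := by
    ext z
    constructor
    · rintro ⟨⟨_, hz⟩, hz'⟩
      rwa [mem_preimage, φ.right_inv hz'] at hz
    · intro hz
      have hz' := (hQA z hz).1
      exact ⟨⟨φ.map_target hz', by rwa [mem_preimage, φ.right_inv hz']⟩, hz'⟩
  have hac : ((volume.restrict φ.target).withDensity (volumeDensity H φ)) ≪
      volume.restrict φ.target := withDensity_absolutelyContinuous _ _
  rw [h1, coordVolume, Measure.restrict_map_of_aemeasurable (aemeasurable_symm φ hac) hVm,
    restrict_withDensity', Measure.restrict_restrict' φ.open_target.measurableSet, hVQ,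
    lintegral_map_symm]
  exact (withDensity_absolutelyContinuous _ _).trans
    (Measure.restrict_mono (fun z hz ↦ (hQA z hz).1) le_rfl).absolutelyContinuous

end Volume

/-! ### Defining functions of coordinate hyperplanes -/

section Hyperplanes

open Filter Topology

variable {n : ℕ}

/-- Shift all coordinates but the `k`-th one. -/
def shiftOff (k : Fin n) (w : Fin n → ℂ) (t : ℂ) (l : Fin n) : ℂ := if l = k then w l else w l + t

theorem tendsto_shiftOff (k : Fin n) (w : Fin n → ℂ) :
    Tendsto (shiftOff k w) (𝓝[≠] 0) (𝓝 w) := by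
  have h : Continuous (shiftOff k w) := by
    refine continuous_pi fun l ↦ ?_
    unfold shiftOff
    split_ifs <;> fun_prop
  have h0 : shiftOff k w 0 = w := by ext l; simp [shiftOff]
  have h1 := (h.tendsto 0).mono_left (nhdsWithin_le_nhds (s := {0}ᶜ))
  rwa [h0] at h1

theorem eventually_shiftOff_ne (k : Fin n) (w : Fin n → ℂ) :
    ∀ᶠ t in 𝓝[≠] (0 : ℂ), ∀ l, l ≠ k → shiftOff k w t l ≠ 0 := by
  refine eventually_all.2 fun l ↦ ?_
  by_cases hl : l = k
  · simp [hl]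
  by_cases hw : w l = 0
  · filter_upwards [self_mem_nhdsWithin] with t ht _
    simpa [shiftOff, hl, hw] using ht
  · have h1 : ∀ᶠ t in 𝓝[≠] (0 : ℂ), w l + t ≠ 0 := by
      refine nhdsWithin_le_nhds ?_
      have : ContinuousAt (fun t : ℂ ↦ w l + t) 0 := by fun_prop
      exact this.eventually_ne (by simpa using hw)
    filter_upwards [h1] with t ht _
    simpa [shiftOff, hl] using ht

/-- Arbitrarily near `c` the hyperplane `z k = 0` has points on no other coordinate hyperplane; move
all the other coordinates by a small common `t ≠ 0`. -/
theorem exists_eq_zero_and_forall_ne {k : Fin n} {c : Fin n → ℂ} (hc : c k = 0)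
    {P : (Fin n → ℂ) → Prop} (hP : ∀ᶠ z in 𝓝 c, P z) :
    ∃ z, P z ∧ z k = 0 ∧ ∀ l, l ≠ k → z l ≠ 0 := by
  obtain ⟨t, h1, h2⟩ := ((tendsto_shiftOff k c).eventually hP |>.and
    (eventually_shiftOff_ne k c)).exists
  exact ⟨shiftOff k c t, h1, by simp [shiftOff, hc], h2⟩

theorem eventually_eq_zero_of_eqOn_line {f : (Fin n → ℂ) → ℂ} {z u : Fin n → ℂ}
    (hf : DifferentiableAt ℂ f z) (h : ∀ᶠ t in 𝓝 (0 : ℂ), f (z + t • u) = 0) :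
    fderiv ℂ f z u = 0 := by
  have h1 : HasDerivAt (fun t : ℂ ↦ z + t • u) u 0 := by
    simpa using ((hasDerivAt_id (0 : ℂ)).smul_const u).const_add z
  have h2 : HasDerivAt (fun t : ℂ ↦ f (z + t • u)) (fderiv ℂ f z u) 0 :=
    HasFDerivAt.comp_hasDerivAt (0 : ℂ) (by simpa using hf.hasFDerivAt) h1
  have h3 : HasDerivAt (fun t : ℂ ↦ f (z + t • u)) 0 0 :=
    (hasDerivAt_const (0 : ℂ) (0 : ℂ)).congr_of_eventuallyEq h
  exact h2.unique h3

theorem eventually_line_mem {c : Fin n → ℂ} {P : (Fin n → ℂ) → Prop} (hP : ∀ᶠ z in 𝓝 c, P z)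
    (u : Fin n → ℂ) : ∀ᶠ z in 𝓝 c, ∀ᶠ t in 𝓝 (0 : ℂ), P (z + t • u) := by
  filter_upwards [hP.eventually_nhds] with z hz
  have : Tendsto (fun t : ℂ ↦ z + t • u) (𝓝 0) (𝓝 z) := by
    have h : Continuous fun t : ℂ ↦ z + t • u := by fun_prop
    simpa using h.tendsto 0
  exact this.eventually hz

/-- A function whose zero set is smooth and contained in a union of coordinate hyperplanes vanishes
on one of them. -/
theorem exists_eventually_eq_zero {f : (Fin n → ℂ) → ℂ} {c : Fin n → ℂ} {S : Finset (Fin n)}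
    (hf : ContDiffAt ℂ 2 f c) (hfc : f c = 0) (hd : fderiv ℂ f c ≠ 0) (hS : ∀ j ∈ S, c j = 0)
    (h : ∀ᶠ z in 𝓝 c, f z = 0 → ∃ j ∈ S, z j = 0) :
    ∃ k ∈ S, (∀ᶠ z in 𝓝 c, z k = 0 → f z = 0) ∧ fderiv ℂ f c (Pi.single k 1) ≠ 0 ∧
      ∀ l, l ≠ k → fderiv ℂ f c (Pi.single l 1) = 0 := by
  classical
  obtain ⟨k, hk⟩ : ∃ k, fderiv ℂ f c (Pi.single k 1) ≠ 0 := by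
    by_contra! hk
    apply hd
    ext v
    have hv : v = ∑ j, v j • (Pi.single j 1 : Fin n → ℂ) := by simpa using (pi_eq_sum_univ' v)
    rw [hv, map_sum]
    simp [hk]
  set f' := fderiv ℂ f c with hf'
  have hstrict : HasStrictFDerivAt f f' c := hf.hasStrictFDerivAt (by norm_num)
  let L : (Fin n → ℂ) →L[ℂ] Fin n → ℂ :=
    ContinuousLinearMap.pi fun l ↦ if l = k then f' else ContinuousLinearMap.proj l
  have hLinj : Function.Injective (L : (Fin n → ℂ) →ₗ[ℂ] Fin n → ℂ) := by
    refine (injective_iff_map_eq_zero _).2 fun v hv ↦ ?_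
    have h1 : ∀ l, l ≠ k → v l = 0 := fun l hl ↦ by
      have := congrFun hv l
      simpa [L, hl] using this
    have h2 : f' v = 0 := by
      have := congrFun hv k
      simpa [L] using this
    have h3 : v = v k • (Pi.single k 1 : Fin n → ℂ) := by
      ext l
      by_cases hl : l = k
      · subst hl; simp
      · simp [h1 l hl, hl]
    rw [h3, map_smul, smul_eq_mul, mul_eq_zero] at h2
    rw [h3, h2.resolve_right hk, zero_smul]
  let Le := (LinearEquiv.ofInjectiveEndo (L : (Fin n → ℂ) →ₗ[ℂ] Fin n → ℂ)
    hLinj).toContinuousLinearEquiv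
  have hLe : (Le : (Fin n → ℂ) →L[ℂ] Fin n → ℂ) = L := by ext v : 1; rfl
  -- By the inverse function theorem `f` can replace the `k`-th coordinate. In the coordinates `Ψ`
  -- the zero set of `f` is a hyperplane.
  let Ψ : (Fin n → ℂ) → Fin n → ℂ := fun z l ↦ if l = k then f z else z l
  have hΨ : HasStrictFDerivAt Ψ (Le : (Fin n → ℂ) →L[ℂ] Fin n → ℂ) c := by
    rw [hLe]
    refine hasStrictFDerivAt_pi.2 fun l ↦ ?_
    by_cases hl : l = k
    · simpa [Ψ, hl] using hstrict
    · have h1 : (fun z ↦ Ψ z l) = fun z ↦ z l := by ext z; simp [Ψ, hl]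
      rw [h1, if_neg hl]
      exact hasStrictFDerivAt_apply (𝕜 := ℂ) l c
  let Φ := hΨ.toOpenPartialHomeomorph Ψ
  have hΦ : ∀ z, Φ z = Ψ z := fun z ↦ rfl
  have hcs : c ∈ Φ.source := hΨ.mem_toOpenPartialHomeomorph_source
  have hT : ∀ᶠ w in 𝓝 (Ψ c), w ∈ Φ.target ∧ (f (Φ.symm w) = 0 → ∃ j ∈ S, Φ.symm w j = 0) := by
    refine (Φ.open_target.eventually_mem (Φ.map_source hcs)).and ?_
    have h1 := (Φ.continuousAt_symm (Φ.map_source hcs))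
    rw [ContinuousAt, Φ.left_inv hcs] at h1
    exact h1.eventually h
  have hsymm : ∀ w ∈ Φ.target, (∀ l, l ≠ k → Φ.symm w l = w l) ∧ f (Φ.symm w) = w k := by
    intro w hw
    have h1 : Ψ (Φ.symm w) = w := Φ.right_inv hw
    refine ⟨fun l hl ↦ ?_, ?_⟩
    · have := congrFun h1 l
      simpa [Ψ, hl] using this
    · have := congrFun h1 k
      simpa [Ψ] using this
  -- At a zero of `f` whose other coordinates are all non-zero, the hyperplane of the union that
  -- contains it can only be `z k = 0`.
  have hgen : ∀ w, (w ∈ Φ.target ∧ (f (Φ.symm w) = 0 → ∃ j ∈ S, Φ.symm w j = 0)) → w k = 0 →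
      (∀ l, l ≠ k → w l ≠ 0) → k ∈ S ∧ Φ.symm w k = 0 := by
    intro w hw hwk hne
    obtain ⟨h1, h2⟩ := hsymm w hw.1
    obtain ⟨j, hj, hj0⟩ := hw.2 (h2.trans hwk)
    by_cases hjk : j = k
    · subst hjk; exact ⟨hj, hj0⟩
    · exact absurd hj0 (by rw [h1 j hjk]; exact hne j hjk)
  have hΨc : Ψ c k = 0 := by simp [Ψ, hfc]
  have hkS : k ∈ S := by
    obtain ⟨w, hw1, hw2, hw3⟩ := exists_eq_zero_and_forall_ne hΨc hT
    exact (hgen w hw1 hw2 hw3).1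
  have hck := hS k hkS
  have hΨcc : Ψ c = c := by
    ext l
    by_cases hl : l = k
    · subst hl; simp [Ψ, hfc, hck]
    · simp [Ψ, hl]
  rw [hΨcc] at hT
  -- Such points are dense in the hyperplane `w k = 0`, so by continuity `Φ⁻¹ w` has vanishing
  -- `k`-th coordinate for every such `w`. Hence `Φ⁻¹ w = w`, and `f` vanishes at `w`.
  have hzero : ∀ᶠ z in 𝓝 c, z k = 0 → f z = 0 := by
    filter_upwards [hT.eventually_nhds] with w hw hwk
    have hwT := hw.self_of_nhds
    have h1 : Tendsto (fun t ↦ Φ.symm (shiftOff k w t) k) (𝓝[≠] 0) (𝓝 (Φ.symm w k)) :=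
      ((continuous_apply k).continuousAt.tendsto.comp
        (Φ.continuousAt_symm hwT.1).tendsto).comp (tendsto_shiftOff k w)
    have h2 : ∀ᶠ t in 𝓝[≠] (0 : ℂ), Φ.symm (shiftOff k w t) k = 0 := by
      filter_upwards [(tendsto_shiftOff k w).eventually hw, eventually_shiftOff_ne k w]
        with t h3 h4
      exact (hgen _ h3 (by simp [shiftOff, hwk]) h4).2
    have h3 : Φ.symm w k = 0 :=
      tendsto_nhds_unique (h1.congr' h2) tendsto_const_nhds
    obtain ⟨h4, h5⟩ := hsymm w hwT.1
    have h6 : Φ.symm w = w := by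
      ext l
      by_cases hl : l = k
      · subst hl; rw [h3, hwk]
      · exact h4 l hl
    rw [h6] at h5
    rw [h5, hwk]
  refine ⟨k, hkS, hzero, hk, fun l hl ↦ ?_⟩
  refine eventually_eq_zero_of_eqOn_line (hf.differentiableAt (by norm_num)) ?_
  filter_upwards [(eventually_line_mem hzero (Pi.single l 1)).self_of_nhds] with t ht
  exact ht (by simp [hck, Ne.symm hl])

/-- Estimates for a function that defines the hyperplane `z k = 0`. -/
theorem exists_bounds_of_eventually_eq_zero {f : (Fin n → ℂ) → ℂ} {c : Fin n → ℂ} {k : Fin n}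
    (hf : ContDiffAt ℂ 2 f c) (hck : c k = 0) (h : ∀ᶠ z in 𝓝 c, z k = 0 → f z = 0)
    (hk : fderiv ℂ f c (Pi.single k 1) ≠ 0) :
    ∃ a > 0, ∃ K > 0, ∀ᶠ z in 𝓝 c, a * ‖z k‖ ≤ ‖f z‖ ∧ ‖f z‖ ≤ K * ‖z k‖ ∧ ∀ v,
      ‖fderiv ℂ f z v‖ ≤ K * (‖v k‖ + ‖z k‖ * ‖v‖) ∧
      a * ‖v k‖ - K * (‖z k‖ * ‖v‖) ≤ ‖fderiv ℂ f z v‖ := by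
  classical
  set A := ‖fderiv ℂ f c (Pi.single k 1)‖ with hA
  have hA0 : 0 < A := norm_pos_iff.2 hk
  have hstrict := hf.hasStrictFDerivAt (by norm_num : (2 : WithTop ℕ∞) ≠ 0)
  -- All estimates compare `z` with its projection to the hyperplane, where `f` vanishes and the
  -- differential of `f` sees the `k`-th component only. Strict differentiability compares the
  -- values, a Lipschitz bound the differentials.
  have hupd : Tendsto (fun z : Fin n → ℂ ↦ Function.update z k 0) (𝓝 c) (𝓝 c) := by
    have h1 : Continuous fun z : Fin n → ℂ ↦ Function.update z k (0 : ℂ) := by fun_prop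
    have h2 : Function.update c k 0 = c := by
      conv_lhs => rw [← hck]
      exact Function.update_eq_self k c
    simpa only [h2] using h1.tendsto c
  have h1 : ∀ᶠ z in 𝓝 c, ‖f z - f (Function.update z k 0) -
      fderiv ℂ f c (z - Function.update z k 0)‖ ≤ A / 2 * ‖z - Function.update z k 0‖ := by
    have := (hasStrictFDerivAt_iff_isLittleO.1 hstrict).def (half_pos hA0)
    exact (tendsto_id.prodMk_nhds hupd).eventually this
  have hd : ContDiffAt ℂ 1 (fderiv ℂ f) c := hf.fderiv_right (by norm_num)
  obtain ⟨K, s, hs, hK⟩ := hd.exists_lipschitzOnWith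
  have h2 : ∀ᶠ z in 𝓝 c, A / 2 ≤ ‖fderiv ℂ f (Function.update z k 0) (Pi.single k 1)‖ ∧
      ‖fderiv ℂ f (Function.update z k 0) (Pi.single k 1)‖ ≤ 2 * A := by
    have hcont : ContinuousAt (fun z ↦ ‖fderiv ℂ f z (Pi.single k 1)‖) c :=
      (hd.continuousAt.clm_apply continuousAt_const).norm
    refine hupd.eventually (p := fun z ↦ A / 2 ≤ ‖fderiv ℂ f z (Pi.single k 1)‖ ∧
      ‖fderiv ℂ f z (Pi.single k 1)‖ ≤ 2 * A) ?_
    filter_upwards [hcont.eventually (lt_mem_nhds (by simp only [← hA]; linarith : A / 2 < _)),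
      hcont.eventually (gt_mem_nhds (by simp only [← hA]; linarith : _ < 2 * A))] with z h3 h4
    exact ⟨h3.le, h4.le⟩
  have hdiff : ∀ᶠ z in 𝓝 c, DifferentiableAt ℂ f z :=
    (hf.eventually (by simp)).mono fun z hz ↦ hz.differentiableAt (by norm_num)
  have h3 : ∀ᶠ z in 𝓝 c, ∀ l, l ≠ k →
      fderiv ℂ f (Function.update z k 0) (Pi.single l 1) = 0 := by
    refine hupd.eventually (p := fun z ↦ ∀ l, l ≠ k → fderiv ℂ f (Function.update z k 0)
      (Pi.single l 1) = 0) ?_ |>.mono fun z hz ↦ by simpa using hz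
    refine eventually_all.2 fun l ↦ ?_
    filter_upwards [hupd.eventually hdiff, hupd.eventually
      (eventually_line_mem h (Pi.single l 1))] with z h4 h5 hl
    refine eventually_eq_zero_of_eqOn_line h4 ?_
    filter_upwards [h5] with t ht
    exact ht (by simp [Ne.symm hl])
  refine ⟨A / 2, half_pos hA0, max (2 * A) K, lt_max_of_lt_left (by linarith), ?_⟩
  filter_upwards [h1, h2, h3, hs, hupd.eventually hs, hupd.eventually h] with z h1 h2 h3 h4 h5 h6
  have hsub : z - Function.update z k 0 = z k • (Pi.single k 1 : Fin n → ℂ) := by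
    ext l
    by_cases hl : l = k
    · subst hl; simp
    · simp [hl]
  have hnorm : ‖z - Function.update z k 0‖ = ‖z k‖ := by
    rw [hsub, norm_smul, Pi.norm_single, norm_one, mul_one]
  have h60 : f (Function.update z k 0) = 0 := h6 (Function.update_self k 0 z)
  rw [hnorm, h60, sub_zero, hsub, map_smul, smul_eq_mul] at h1
  have h7 : ‖z k * fderiv ℂ f c (Pi.single k 1)‖ = ‖z k‖ * A := by rw [norm_mul]
  have h8 := norm_sub_norm_le (z k * fderiv ℂ f c (Pi.single k 1)) (f z)
  have h9 := norm_sub_norm_le (f z) (z k * fderiv ℂ f c (Pi.single k 1))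
  rw [norm_sub_rev] at h8
  have hz0 := norm_nonneg (z k)
  refine ⟨by nlinarith, ?_, fun v ↦ ?_⟩
  · calc ‖f z‖ ≤ 2 * A * ‖z k‖ := by nlinarith
      _ ≤ _ := by gcongr; exact le_max_left _ _
  have hv : fderiv ℂ f (Function.update z k 0) v =
      v k * fderiv ℂ f (Function.update z k 0) (Pi.single k 1) := by
    have hv' : v = ∑ j, v j • (Pi.single j 1 : Fin n → ℂ) := by simpa using (pi_eq_sum_univ' v)
    conv_lhs => rw [hv', map_sum]
    rw [Finset.sum_eq_single k (fun l _ hl ↦ by rw [map_smul, h3 l hl, smul_zero]) (by simp)]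
    rw [map_smul, smul_eq_mul]
  have hlip : ‖fderiv ℂ f z v - fderiv ℂ f (Function.update z k 0) v‖ ≤ K * ‖z k‖ * ‖v‖ := by
    have := hK.norm_sub_le h4 h5
    rw [hnorm] at this
    exact ((fderiv ℂ f z - fderiv ℂ f (Function.update z k 0)).le_opNorm v).trans (by gcongr)
  have hm : (K : ℝ) * ‖z k‖ * ‖v‖ ≤ max (2 * A) K * (‖z k‖ * ‖v‖) := by
    rw [mul_assoc]; gcongr; exact le_max_right _ _
  have hvn : ‖fderiv ℂ f (Function.update z k 0) v‖ =
      ‖v k‖ * ‖fderiv ℂ f (Function.update z k 0) (Pi.single k 1)‖ := by rw [hv, norm_mul]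
  have hvk := norm_nonneg (v k)
  have h10 := norm_sub_norm_le (fderiv ℂ f z v) (fderiv ℂ f (Function.update z k 0) v)
  have h11 := norm_sub_norm_le (fderiv ℂ f (Function.update z k 0) v) (fderiv ℂ f z v)
  rw [norm_sub_rev] at h11
  constructor
  · have h12 : ‖v k‖ * ‖fderiv ℂ f (Function.update z k 0) (Pi.single k 1)‖ ≤
        max (2 * A) K * ‖v k‖ := by
      rw [mul_comm]; gcongr; exact h2.2.trans (le_max_left _ _)
    linarith
  · have h12 : A / 2 * ‖v k‖ ≤ ‖v k‖ * ‖fderiv ℂ f (Function.update z k 0) (Pi.single k 1)‖ := by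
      rw [mul_comm]; gcongr; exact h2.1
    linarith

/-- Normal crossings: the defining functions of the components of the divisor correspond to the
coordinate hyperplanes that make up the divisor. -/
theorem exists_hyperplane_bijection {ι : Type*} [Finite ι] {f : ι → (Fin n → ℂ) → ℂ}
    {c : Fin n → ℂ} {S : Finset (Fin n)} (hf : ∀ i, ContDiffAt ℂ 2 (f i) c) (hfc : ∀ i, f i c = 0)
    (hli : LinearIndependent ℂ fun i ↦ fderiv ℂ (f i) c) (hS : ∀ j ∈ S, c j = 0)
    (h : ∀ᶠ z in 𝓝 c, (∃ i, f i z = 0) ↔ ∃ j ∈ S, z j = 0) :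
    ∃ σ : ι → Fin n, Function.Injective σ ∧ (∀ k, k ∈ S ↔ ∃ i, σ i = k) ∧
      ∀ i, ∃ a > 0, ∃ K > 0, ∀ᶠ z in 𝓝 c,
        a * ‖z (σ i)‖ ≤ ‖f i z‖ ∧ ‖f i z‖ ≤ K * ‖z (σ i)‖ ∧ ∀ v,
          ‖fderiv ℂ (f i) z v‖ ≤ K * (‖v (σ i)‖ + ‖z (σ i)‖ * ‖v‖) ∧
          a * ‖v (σ i)‖ - K * (‖z (σ i)‖ * ‖v‖) ≤ ‖fderiv ℂ (f i) z v‖ := by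
  classical
  have h1 : ∀ i, ∃ k ∈ S, (∀ᶠ z in 𝓝 c, z k = 0 → f i z = 0) ∧
      fderiv ℂ (f i) c (Pi.single k 1) ≠ 0 ∧
      ∀ l, l ≠ k → fderiv ℂ (f i) c (Pi.single l 1) = 0 := fun i ↦
    exists_eventually_eq_zero (hf i) (hfc i) (hli.ne_zero i) hS
      (h.mono fun z hz h0 ↦ hz.1 ⟨i, h0⟩)
  choose σ hσS hσ0 hσk hσl using h1
  have h2 : ∀ i, ∃ a > 0, ∃ K > 0, ∀ᶠ z in 𝓝 c,
        a * ‖z (σ i)‖ ≤ ‖f i z‖ ∧ ‖f i z‖ ≤ K * ‖z (σ i)‖ ∧ ∀ v,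
          ‖fderiv ℂ (f i) z v‖ ≤ K * (‖v (σ i)‖ + ‖z (σ i)‖ * ‖v‖) ∧
          a * ‖v (σ i)‖ - K * (‖z (σ i)‖ * ‖v‖) ≤ ‖fderiv ℂ (f i) z v‖ := fun i ↦
    exists_bounds_of_eventually_eq_zero (hf i) (hS _ (hσS i)) (hσ0 i) (hσk i)
  have hform : ∀ i v, fderiv ℂ (f i) c v = v (σ i) * fderiv ℂ (f i) c (Pi.single (σ i) 1) := by
    intro i v
    have hv' : v = ∑ j, v j • (Pi.single j 1 : Fin n → ℂ) := by simpa using (pi_eq_sum_univ' v)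
    conv_lhs => rw [hv', map_sum]
    rw [Finset.sum_eq_single (σ i) (fun l _ hl ↦ by rw [map_smul, hσl i l hl, smul_zero]) (by simp)]
    rw [map_smul, smul_eq_mul]
  refine ⟨σ, fun i i' hii ↦ ?_, fun k ↦ ⟨fun hk ↦ ?_, fun ⟨i, hi⟩ ↦ hi ▸ hσS i⟩, h2⟩
  -- Two components with the same hyperplane would have proportional differentials at `c`, against
  -- normal crossings.
  · by_contra hne
    have h3 := linearIndependent_iff'.1 hli {i, i'}
      (fun j ↦ if j = i then fderiv ℂ (f i') c (Pi.single (σ i') 1)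
        else -fderiv ℂ (f i) c (Pi.single (σ i) 1)) ?_ i (by simp)
    · simp only [if_true] at h3
      exact hσk i' h3
    · rw [Finset.sum_pair hne, if_pos rfl, if_neg (Ne.symm hne)]
      ext v
      simp only [add_apply, smul_apply, smul_eq_mul, hform i v, hform i' v, hii, zero_apply]
      ring
  -- Every hyperplane of `S` is hit: a generic point of it is a zero of some `f i`, hence lies on
  -- the hyperplane `σ i`, and the only one it lies on is `k`.
  · have h3 : ∀ᶠ z in 𝓝 c, ∀ i, f i z = 0 → z (σ i) = 0 := by
      refine eventually_all.2 fun i ↦ ?_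
      obtain ⟨a, ha, K, _, hz⟩ := h2 i
      filter_upwards [hz] with z hz h0
      have := hz.1
      rw [h0, norm_zero] at this
      have h4 := norm_nonneg (z (σ i))
      exact norm_eq_zero.1 (by nlinarith)
    obtain ⟨z, ⟨hz1, hz2⟩, hzk, hzl⟩ := exists_eq_zero_and_forall_ne (hS k hk) (h.and h3)
    obtain ⟨i, hi⟩ := hz1.2 ⟨k, hk, hzk⟩
    refine ⟨i, ?_⟩
    by_contra hne
    exact hzl _ hne (hz2 i hi)

end Hyperplanes

/-! ### Comparison of the Poincaré type metric with the model metric -/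

section MetricComparison

open Filter Topology

variable {n : ℕ}

theorem eventually_norm_fderiv_le {E G : Type*} [NormedAddCommGroup E] [NormedSpace ℝ E]
    [NormedAddCommGroup G] [NormedSpace ℝ G] {f : E → G} {c : E} (hf : ContDiffAt ℝ 1 f c) :
    ∃ B > 0, ∀ᶠ z in 𝓝 c, ‖fderiv ℝ f z‖ ≤ B := by
  refine ⟨‖fderiv ℝ f c‖ + 1, by positivity, ?_⟩
  have h : ContinuousAt (fun z ↦ ‖fderiv ℝ f z‖) c :=
    (hf.fderiv_right (m := 0) (by norm_num)).continuousAt.norm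
  exact (h.eventually (gt_mem_nhds (lt_add_one _))).mono fun z hz ↦ hz.le

theorem norm_I_smul (v : Fin n → ℂ) : ‖Complex.I • v‖ = ‖v‖ := by
  rw [norm_smul, Complex.norm_I, one_mul]

theorem norm_dbarDir_le {f : (Fin n → ℂ) → ℂ} {z : Fin n → ℂ} {B : ℝ}
    (hB : ‖fderiv ℝ f z‖ ≤ B) (v : Fin n → ℂ) : ‖dbarDir f z v‖ ≤ B * ‖v‖ := by
  have h1 : ∀ w, ‖fderiv ℝ f z w‖ ≤ B * ‖w‖ := fun w ↦
    ((fderiv ℝ f z).le_opNorm w).trans (by gcongr)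
  have h2 := h1 v
  have h3 := h1 (Complex.I • v)
  rw [norm_I_smul] at h3
  rw [dbarDir, norm_mul]
  have h4 : ‖(1 / 2 : ℂ)‖ = 1 / 2 := by norm_num
  have h5 := norm_add_le (fderiv ℝ f z v) (Complex.I * fderiv ℝ f z (Complex.I • v))
  rw [norm_mul, Complex.norm_I, one_mul] at h5
  rw [h4]
  linarith

theorem norm_complexHessian_le {f : (Fin n → ℂ) → ℂ} {z : Fin n → ℂ} {B : ℝ}
    (hf : ContDiffAt ℝ 2 f z) (hB : ‖fderiv ℝ (fderiv ℝ f) z‖ ≤ B) (v : Fin n → ℂ) :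
    ‖complexHessian f z v v‖ ≤ B * ‖v‖ ^ 2 := by
  set D := fderiv ℝ (fderiv ℝ f) z
  have h1 : ∀ a b, ‖D a b‖ ≤ B * ‖a‖ * ‖b‖ := fun a b ↦
    (D.le_opNorm₂ a b).trans (by gcongr)
  have h2 := h1 v v
  have h3 := h1 v (Complex.I • v)
  have h4 := h1 (Complex.I • v) v
  have h5 := h1 (Complex.I • v) (Complex.I • v)
  rw [norm_I_smul] at h3 h4 h5
  rw [complexHessian_eq_fderiv hf, norm_mul]
  have h6 : ‖(1 / 4 : ℂ)‖ = 1 / 4 := by norm_num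
  have h7 := norm_sub_le (D v v + Complex.I * D v (Complex.I • v))
    (Complex.I * (D (Complex.I • v) v + Complex.I * D (Complex.I • v) (Complex.I • v)))
  have h8 := norm_add_le (D v v) (Complex.I * D v (Complex.I • v))
  have h9 := norm_add_le (D (Complex.I • v) v) (Complex.I * D (Complex.I • v) (Complex.I • v))
  rw [norm_mul, Complex.norm_I, one_mul] at h7 h8 h9
  rw [h6]
  linarith [sq (‖v‖)]

theorem sesquilinear_eq_sum (A : (Fin n → ℂ) →ₗ⋆[ℂ] (Fin n → ℂ) →ₗ[ℂ] ℂ) (v w : Fin n → ℂ) :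
    A v w = ∑ j, ∑ k, (starRingEnd ℂ) (v j) * w k * A (Pi.single j 1) (Pi.single k 1) := by
  have hv : v = ∑ j, v j • (Pi.single j 1 : Fin n → ℂ) := by simpa using (pi_eq_sum_univ' v)
  have hw : w = ∑ j, w j • (Pi.single j 1 : Fin n → ℂ) := by simpa using (pi_eq_sum_univ' w)
  conv_lhs => rw [hv, hw]
  simp only [map_sum, map_smulₛₗ, LinearMap.sum_apply, LinearMap.smul_apply, smul_eq_mul,
    RingHom.id_apply, Finset.mul_sum]
  rw [Finset.sum_comm]
  refine Finset.sum_congr rfl fun a _ ↦ Finset.sum_congr rfl fun b _ ↦ ?_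
  ring

/-- A continuous family of Hermitian forms that is positive definite at `c` is comparable with the
norm near `c`. -/
theorem eventually_sesquilinear_bounds
    (A : (Fin n → ℂ) → (Fin n → ℂ) →ₗ⋆[ℂ] (Fin n → ℂ) →ₗ[ℂ] ℂ) {c : Fin n → ℂ}
    (hA : ∀ j k, ContinuousAt (fun z ↦ A z (Pi.single j 1) (Pi.single k 1)) c)
    (hpos : ∀ v, v ≠ 0 → 0 < (A c v v).re) :
    ∃ κ > 0, ∃ B > 0, ∀ᶠ z in 𝓝 c, ∀ v, κ * ‖v‖ ^ 2 ≤ (A z v v).re ∧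
      (A z v v).re ≤ B * ‖v‖ ^ 2 := by
  set q : (Fin n → ℂ) → (Fin n → ℂ) → ℝ := fun z v ↦ (A z v v).re with hq
  have hqc : ∀ v, ContinuousAt (fun p : (Fin n → ℂ) × (Fin n → ℂ) ↦ q p.1 p.2) (c, v) := by
    intro v
    have h1 : (fun p : (Fin n → ℂ) × (Fin n → ℂ) ↦ q p.1 p.2) = fun p ↦
        (∑ j, ∑ k, (starRingEnd ℂ) (p.2 j) * p.2 k * A p.1 (Pi.single j 1) (Pi.single k 1)).re := by
      ext p; simp only [hq]; rw [sesquilinear_eq_sum]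
    rw [h1]
    refine Complex.continuous_re.continuousAt.comp (tendsto_finsetSum _ fun j _ ↦
      tendsto_finsetSum _ fun k _ ↦ ?_)
    have h2 : ContinuousAt (fun p : (Fin n → ℂ) × (Fin n → ℂ) ↦
        A p.1 (Pi.single j 1) (Pi.single k 1)) (c, v) :=
      ContinuousAt.comp (g := fun z ↦ A z (Pi.single j 1) (Pi.single k 1)) (hA j k)
        continuousAt_fst
    have h3 : Continuous (fun p : (Fin n → ℂ) × (Fin n → ℂ) ↦
        (starRingEnd ℂ) (p.2 j) * p.2 k) := by fun_prop
    exact h3.continuousAt.mul h2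
  have hK := isCompact_sphere (0 : Fin n → ℂ) 1
  have hqc' : Continuous (q c) := by
    refine continuous_iff_continuousAt.2 fun v ↦ ?_
    exact ContinuousAt.comp (g := fun p : (Fin n → ℂ) × (Fin n → ℂ) ↦ q p.1 p.2)
      (f := fun v ↦ (c, v)) (hqc v) (by fun_prop)
  obtain ⟨κ, hκ, hκ'⟩ := hK.exists_forall_le' hqc'.continuousOn (a := 0) fun v hv ↦ by
    refine hpos v fun h ↦ ?_
    simp [h] at hv
  obtain ⟨B, hB⟩ := (hK.image hqc').bddAbove
  -- Compactness of the unit sphere makes the bounds uniform in `v` for `z` near `c`; homogeneity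
  -- extends them to all `v`.
  have h1 : ∀ᶠ z in 𝓝 c, ∀ v ∈ Metric.sphere (0 : Fin n → ℂ) 1,
      κ / 2 < q z v ∧ q z v < max B 0 + 1 := by
    refine hK.eventually_forall_of_forall_eventually fun v hv ↦ ?_
    have h2 := hκ' v hv
    have h3 := hB ⟨v, hv, rfl⟩
    exact ((hqc v).eventually (lt_mem_nhds (by simp only; linarith))).and
      ((hqc v).eventually (gt_mem_nhds (by simp only; linarith [le_max_left B 0])))
  refine ⟨κ / 2, by linarith, max B 0 + 1, by positivity, ?_⟩
  filter_upwards [h1] with z hz v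
  by_cases hv : v = 0
  · subst hv; simp
  have hv0 : 0 < ‖v‖ := norm_pos_iff.2 hv
  have h2 := hz ((‖v‖⁻¹ : ℂ) • v) (by simp [norm_smul, hv0.ne'])
  have h3 : q z ((‖v‖⁻¹ : ℂ) • v) = (‖v‖ ^ 2)⁻¹ * q z v := by
    simp only [hq, map_smulₛₗ, LinearMap.smul_apply, smul_eq_mul, RingHom.id_apply, map_inv₀,
      Complex.conj_ofReal]
    rw [← Complex.ofReal_inv, Complex.re_ofReal_mul, Complex.re_ofReal_mul, ← mul_assoc, sq, mul_inv]
  rw [h3, inv_mul_eq_div, lt_div_iff₀ (by positivity), div_lt_iff₀ (by positivity)] at h2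
  exact ⟨h2.1.le, h2.2.le⟩

/-- The term of the Poincaré type metric that comes from one component of the divisor. -/
noncomputable def divisorTerm (h : (Fin n → ℂ) → ℝ) (f : (Fin n → ℂ) → ℂ) (z v : Fin n → ℂ) : ℝ :=
  (complexHessian (fun ζ ↦ (h ζ : ℂ)) z v v).re / (-(h z + Real.log (‖f z‖ ^ 2))) +
    ‖dbarDir (fun ζ ↦ (h ζ : ℂ)) z v + (starRingEnd ℂ) (fderiv ℂ f z v / f z)‖ ^ 2 /
      (h z + Real.log (‖f z‖ ^ 2)) ^ 2

theorem eventually_metric_term_bounds {h : (Fin n → ℂ) → ℝ} {c : Fin n → ℂ}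
    (hh : ContDiffAt ℝ ∞ h c) :
    ∃ B > 0, ∀ᶠ z in 𝓝 c, |h z| ≤ B ∧ ∀ v,
      |(complexHessian (fun ζ ↦ (h ζ : ℂ)) z v v).re| ≤ B * ‖v‖ ^ 2 ∧
      ‖dbarDir (fun ζ ↦ (h ζ : ℂ)) z v‖ ≤ B * ‖v‖ := by
  have h2 : ContDiffAt ℝ 2 (fun ζ ↦ (h ζ : ℂ)) c :=
    (hh.of_le (WithTop.coe_le_coe.2 (le_top : (2 : ℕ∞) ≤ ⊤))).complex_ofReal
  obtain ⟨B₁, hB₁, h3⟩ := eventually_norm_fderiv_le (h2.of_le (by norm_num))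
  obtain ⟨B₂, hB₂, h4⟩ := eventually_norm_fderiv_le (h2.fderiv_right (m := 1) (by norm_num))
  have h5 : ∀ᶠ z in 𝓝 c, |h z| ≤ |h c| + 1 :=
    (hh.continuousAt.abs.eventually (gt_mem_nhds (lt_add_one _))).mono fun z hz ↦ hz.le
  refine ⟨B₁ + B₂ + (|h c| + 1), by positivity, ?_⟩
  filter_upwards [h3, h4, h5, h2.eventually (by simp)] with z h3 h4 h5 h6
  refine ⟨by linarith, fun v ↦ ⟨?_, ?_⟩⟩
  · refine (Complex.abs_re_le_norm _).trans ((norm_complexHessian_le h6 h4 v).trans ?_)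
    gcongr
    linarith [abs_nonneg (h c)]
  · refine (norm_dbarDir_le h3 v).trans ?_
    gcongr
    linarith [abs_nonneg (h c)]

theorem half_norm_sq_sub_le (a b : ℂ) : ‖b‖ ^ 2 / 2 - ‖a‖ ^ 2 ≤ ‖a + b‖ ^ 2 := by
  have h1 : ‖b‖ ≤ ‖a + b‖ + ‖a‖ := by
    have := norm_sub_le (a + b) a
    simpa using this
  nlinarith [norm_nonneg a, norm_nonneg b, norm_nonneg (a + b), sq_nonneg (‖a + b‖ - ‖a‖)]

/-- A component of the divisor that does not pass through `c` contributes a bounded term. -/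
theorem eventually_divisorTerm_bounded {h : (Fin n → ℂ) → ℝ} {f : (Fin n → ℂ) → ℂ} {c : Fin n → ℂ}
    (hh : ContDiffAt ℝ ∞ h c) (hf : ContDiffAt ℂ 2 f c) (h0 : f c ≠ 0) :
    ∃ A > 0, ∀ᶠ z in 𝓝 c, h z + Real.log (‖f z‖ ^ 2) < -1 → ∀ v,
      |divisorTerm h f z v| ≤ A * ‖v‖ ^ 2 := by
  obtain ⟨B, hB, h1⟩ := eventually_metric_term_bounds hh
  have h2 : ContinuousAt (fun z ↦ ‖fderiv ℂ f z‖ / ‖f z‖) c :=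
    (hf.fderiv_right (m := 0) (by norm_num)).continuousAt.norm.div hf.continuousAt.norm
      (norm_ne_zero_iff.2 h0)
  set B' := ‖fderiv ℂ f c‖ / ‖f c‖ + 1 with hB'
  have hB'0 : 0 < B' := by positivity
  refine ⟨B + 2 * B ^ 2 + 2 * B' ^ 2, by positivity, ?_⟩
  filter_upwards [h1, h2.eventually (gt_mem_nhds (lt_add_one _))] with z h3 h4 hu v
  set u := h z + Real.log (‖f z‖ ^ 2) with hu_def
  obtain ⟨h5, h6⟩ := h3.2 v
  have h7 : ‖(starRingEnd ℂ) (fderiv ℂ f z v / f z)‖ ≤ B' * ‖v‖ := by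
    rw [RCLike.norm_conj, norm_div]
    calc ‖fderiv ℂ f z v‖ / ‖f z‖ ≤ ‖fderiv ℂ f z‖ * ‖v‖ / ‖f z‖ := by
          gcongr; exact (fderiv ℂ f z).le_opNorm v
      _ = ‖fderiv ℂ f z‖ / ‖f z‖ * ‖v‖ := by ring
      _ ≤ B' * ‖v‖ := by gcongr
  have h8 := norm_add_sq_le_two_mul (dbarDir (fun ζ ↦ (h ζ : ℂ)) z v)
    ((starRingEnd ℂ) (fderiv ℂ f z v / f z))
  have h9 : ‖dbarDir (fun ζ ↦ (h ζ : ℂ)) z v‖ ^ 2 ≤ B ^ 2 * ‖v‖ ^ 2 := by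
    rw [← mul_pow]; gcongr
  have h10 : ‖(starRingEnd ℂ) (fderiv ℂ f z v / f z)‖ ^ 2 ≤ B' ^ 2 * ‖v‖ ^ 2 := by
    rw [← mul_pow]; gcongr
  rw [divisorTerm]
  refine (abs_add_le _ _).trans ?_
  rw [abs_div, abs_div, abs_of_nonneg (by positivity : (0 : ℝ) ≤ ‖_‖ ^ 2), abs_neg,
    abs_of_nonneg (sq_nonneg u), abs_of_neg (by linarith : u < 0)]
  have h11 : |(complexHessian (fun ζ ↦ (h ζ : ℂ)) z v v).re| / -u ≤ B * ‖v‖ ^ 2 :=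
    (div_le_self (abs_nonneg _) (by linarith)).trans h5
  have h12 : ‖dbarDir (fun ζ ↦ (h ζ : ℂ)) z v +
      (starRingEnd ℂ) (fderiv ℂ f z v / f z)‖ ^ 2 / u ^ 2 ≤ 2 * (B ^ 2 * ‖v‖ ^ 2) +
        2 * (B' ^ 2 * ‖v‖ ^ 2) :=
    (div_le_self (by positivity) (by nlinarith)).trans (by linarith)
  linarith

/-- Here `x = ‖v k‖`, `y = ‖v‖`, `r = ‖z k‖`, `l = -log r`, `u = log |s_i|²`; `e` is the size of `∂f
/ f`, `d` that of the smooth part of the `∂̄`-derivative, `s` is `|d + e|²` for the complex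
quantities, and `p` is the curvature term. Since `e` is of order `x / r + y`, division by `u² ≥ l²`
turns `e²` into the Poincaré term. -/
theorem poincare_term_upper {a K B r l u x y d e s p : ℝ} (ha : 0 < a) (hK : 0 < K) (hB : 0 < B)
    (hr : 0 < r) (hl : 0 < l) (hu : l ≤ -u) (hu' : 1 < -u) (he0 : 0 ≤ e)
    (he : e ≤ K / a * (x / r + y)) (hd : d ^ 2 ≤ B ^ 2 * y ^ 2) (hs : s ≤ 2 * d ^ 2 + 2 * e ^ 2)
    (hp : p ≤ B * y ^ 2) :
    p + s / u ^ 2 ≤ (B + 2 * B ^ 2 + 4 * (K / a) ^ 2 + 36 * (K / a) ^ 2 + 1) *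
      (x ^ 2 / (r ^ 2 * l ^ 2) + y ^ 2) := by
  have hu4 : 1 ≤ u ^ 2 := by nlinarith
  have hu5 : l ^ 2 ≤ u ^ 2 := by nlinarith
  set q := K / a with hq
  have hq0 : 0 < q := by positivity
  have he2 : e ^ 2 ≤ 2 * q ^ 2 * (x ^ 2 / r ^ 2 + y ^ 2) := by
    calc e ^ 2 ≤ (q * (x / r + y)) ^ 2 := by gcongr
      _ = q ^ 2 * (x / r + y) ^ 2 := by ring
      _ ≤ q ^ 2 * (2 * ((x / r) ^ 2 + y ^ 2)) := by
          gcongr; nlinarith [sq_nonneg (x / r - y)]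
      _ = _ := by rw [div_pow]; ring
  have h9 : s / u ^ 2 ≤ 2 * B ^ 2 * y ^ 2 + 4 * q ^ 2 * y ^ 2 +
      4 * q ^ 2 * (x ^ 2 / (r ^ 2 * l ^ 2)) := by
    calc s / u ^ 2 ≤ (2 * B ^ 2 * y ^ 2 + 4 * q ^ 2 * y ^ 2 +
          4 * q ^ 2 * (x ^ 2 / r ^ 2)) / u ^ 2 := by
          gcongr; linarith
      _ = (2 * B ^ 2 * y ^ 2 + 4 * q ^ 2 * y ^ 2) / u ^ 2 +
          4 * q ^ 2 * (x ^ 2 / r ^ 2) / u ^ 2 := add_div _ _ _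
      _ ≤ (2 * B ^ 2 * y ^ 2 + 4 * q ^ 2 * y ^ 2) + 4 * q ^ 2 * (x ^ 2 / r ^ 2) / l ^ 2 := by
          gcongr
          exact div_le_self (by positivity) hu4
      _ = _ := by rw [mul_div_assoc, div_div]
  have h10 : 0 ≤ x ^ 2 / (r ^ 2 * l ^ 2) := by positivity
  have h11 : 0 ≤ y ^ 2 := by positivity
  have h12 : 0 ≤ q ^ 2 := by positivity
  nlinarith [mul_nonneg h12 h10, mul_nonneg h12 h11, mul_nonneg hB.le h10,
    mul_nonneg (sq_nonneg B) h10]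

/-- The same quantities as in the upper bound. Now `x / r` is bounded by `e` and `y`, `e²` by `s` up
to a multiple of `y²`, and `u² ≤ 9 l²` restores the denominator. What is lost is a multiple of `y²`,
which is added on the right. -/
theorem poincare_term_lower {a K B r l u x y e s p : ℝ} (ha : 0 < a) (hK : 0 < K) (hB : 0 < B)
    (hr : 0 < r) (hl : 0 < l) (hu : l ≤ -u) (hu' : 1 < -u) (hu'' : -u ≤ 3 * l) (hx : 0 ≤ x)
    (hs0 : 0 ≤ s) (he : x / r ≤ K / a * e + K / a * y)
    (hs : e ^ 2 ≤ 2 * s + 2 * B ^ 2 * y ^ 2) (hp : -(B * y ^ 2) ≤ p) :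
    x ^ 2 / (r ^ 2 * l ^ 2) ≤ (B + 2 * B ^ 2 + 4 * (K / a) ^ 2 + 36 * (K / a) ^ 2 + 1) *
      (p + s / u ^ 2 + (B + 2 * B ^ 2 + 4 * (K / a) ^ 2 + 36 * (K / a) ^ 2 + 1) * y ^ 2) := by
  have hu4 : 1 ≤ u ^ 2 := by nlinarith
  have hu6 : u ^ 2 ≤ 9 * l ^ 2 := by nlinarith
  set q := K / a with hq
  have hq0 : 0 < q := by positivity
  have he2 : x ^ 2 / r ^ 2 ≤ 2 * q ^ 2 * (e ^ 2 + y ^ 2) := by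
    rw [← div_pow]
    calc (x / r) ^ 2 ≤ (q * e + q * y) ^ 2 := by gcongr
      _ = q ^ 2 * (e + y) ^ 2 := by ring
      _ ≤ q ^ 2 * (2 * (e ^ 2 + y ^ 2)) := by
          gcongr; nlinarith [sq_nonneg (e - y)]
      _ = _ := by ring
  have h8 : x ^ 2 / (r ^ 2 * l ^ 2) ≤ 36 * q ^ 2 * (s / u ^ 2 + (B ^ 2 + 1) * y ^ 2) := by
    calc x ^ 2 / (r ^ 2 * l ^ 2) = x ^ 2 / r ^ 2 / l ^ 2 := by rw [div_div]
      _ ≤ 2 * q ^ 2 * (2 * s + 2 * B ^ 2 * y ^ 2 + y ^ 2) / l ^ 2 := by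
          gcongr
          exact he2.trans (by gcongr)
      _ ≤ 2 * q ^ 2 * (2 * s + 2 * B ^ 2 * y ^ 2 + y ^ 2) / (u ^ 2 / 9) := by
          gcongr
          linarith
      _ = 18 * q ^ 2 * (2 * (s / u ^ 2) + (2 * B ^ 2 * y ^ 2 + y ^ 2) / u ^ 2) := by
          have : u ≠ 0 := by rintro rfl; norm_num at hu4
          field_simp
          ring
      _ ≤ 18 * q ^ 2 * (2 * (s / u ^ 2) + (2 * B ^ 2 * y ^ 2 + y ^ 2)) := by
          gcongr
          exact div_le_self (by positivity) hu4
      _ ≤ _ := by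
          have : 0 ≤ q ^ 2 * y ^ 2 := by positivity
          nlinarith
  refine h8.trans ?_
  have h10 : s / u ^ 2 + (B ^ 2 + 1) * y ^ 2 ≤
      p + s / u ^ 2 + (B + 2 * B ^ 2 + 4 * q ^ 2 + 36 * q ^ 2 + 1) * y ^ 2 := by
    have : 0 ≤ q ^ 2 * y ^ 2 := by positivity
    have : 0 ≤ B ^ 2 * y ^ 2 := by positivity
    nlinarith
  gcongr
  nlinarith [sq_nonneg q, sq_nonneg B]

/-- A component of the divisor through `c` contributes a term of Poincaré type. -/
theorem eventually_divisorTerm_poincare {h : (Fin n → ℂ) → ℝ} {f : (Fin n → ℂ) → ℂ}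
    {c : Fin n → ℂ} {k : Fin n} (hh : ContDiffAt ℝ ∞ h c) (hck : c k = 0) {a K : ℝ} (ha : 0 < a)
    (hK : 0 < K) (hb : ∀ᶠ z in 𝓝 c, a * ‖z k‖ ≤ ‖f z‖ ∧ ‖f z‖ ≤ K * ‖z k‖ ∧ ∀ v,
      ‖fderiv ℂ f z v‖ ≤ K * (‖v k‖ + ‖z k‖ * ‖v‖) ∧
      a * ‖v k‖ - K * (‖z k‖ * ‖v‖) ≤ ‖fderiv ℂ f z v‖) :
    ∃ A > 0, ∀ᶠ z in 𝓝 c, z k ≠ 0 → h z + Real.log (‖f z‖ ^ 2) < -1 → ∀ v,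
      divisorTerm h f z v ≤ A * (‖v k‖ ^ 2 / (‖z k‖ * Real.log ‖z k‖) ^ 2 + ‖v‖ ^ 2) ∧
      ‖v k‖ ^ 2 / (‖z k‖ * Real.log ‖z k‖) ^ 2 ≤ A * (divisorTerm h f z v + A * ‖v‖ ^ 2) := by
  obtain ⟨B, hB, h1⟩ := eventually_metric_term_bounds hh
  -- As `log ‖f z‖` differs from `log r` by a constant, `-log |s_i|²` is `2 l` up to an error of at
  -- most `M`; once `l > M` it lies between `l` and `3 l`.
  set M := B + 2 * |Real.log a| + 2 * |Real.log K| + 1 with hM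
  have hM0 : 0 < M := by positivity
  have hsmall : ∀ᶠ z in 𝓝 c, ‖z k‖ < Real.exp (-M) := by
    have h2 : ContinuousAt (fun z : Fin n → ℂ ↦ ‖z k‖) c :=
      (continuous_apply k).norm.continuousAt
    exact h2.eventually (gt_mem_nhds (by simp only [hck, norm_zero]; positivity))
  set A := B + 2 * B ^ 2 + 4 * (K / a) ^ 2 + 36 * (K / a) ^ 2 + 1 with hA
  have hA0 : 0 < A := by positivity
  refine ⟨A, hA0, ?_⟩
  filter_upwards [h1, hsmall, hb] with z h3 hs hb hz hu v
  obtain ⟨hb1, hb2, hb3⟩ := hb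
  obtain ⟨hb4, hb5⟩ := hb3 v
  obtain ⟨h5, h6⟩ := h3.2 v
  have hr : 0 < ‖z k‖ := norm_pos_iff.2 hz
  set r := ‖z k‖ with hr_def
  have hf0 : 0 < ‖f z‖ := lt_of_lt_of_le (by positivity) hb1
  set l := -Real.log r with hl_def
  have hlM : M < l := by
    have := Real.log_lt_log hr hs
    rw [Real.log_exp] at this
    linarith
  have hl0 : 0 < l := by linarith
  have hlogf : Real.log (‖f z‖ ^ 2) = 2 * Real.log ‖f z‖ := by
    rw [Real.log_pow]; norm_num
  have hlf1 : Real.log a + Real.log r ≤ Real.log ‖f z‖ := by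
    rw [← Real.log_mul ha.ne' hr.ne']; exact Real.log_le_log (by positivity) hb1
  have hlf2 : Real.log ‖f z‖ ≤ Real.log K + Real.log r := by
    rw [← Real.log_mul hK.ne' hr.ne']; exact Real.log_le_log hf0 hb2
  set u := h z + Real.log (‖f z‖ ^ 2) with hu_def
  have hhz := abs_le.1 h3.1
  have hla := neg_abs_le (Real.log a)
  have hlK := le_abs_self (Real.log K)
  have haK := abs_nonneg (Real.log a)
  have haK' := abs_nonneg (Real.log K)
  have hu1 : l ≤ -u := by rw [hu_def, hlogf]; linarith
  have hu2 : -u ≤ 3 * l := by rw [hu_def, hlogf]; linarith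
  have hu3 : 1 < -u := by linarith
  have hlog : (r * Real.log r) ^ 2 = r ^ 2 * l ^ 2 := by rw [hl_def]; ring
  rw [hlog]
  set P := complexHessian (fun ζ ↦ (h ζ : ℂ)) z v v
  set d := dbarDir (fun ζ ↦ (h ζ : ℂ)) z v
  set e := (starRingEnd ℂ) (fderiv ℂ f z v / f z) with he
  have hen : ‖e‖ = ‖fderiv ℂ f z v‖ / ‖f z‖ := by rw [he, RCLike.norm_conj, norm_div]
  have hterm : divisorTerm h f z v = P.re / -u + ‖d + e‖ ^ 2 / u ^ 2 := rfl
  have hP : |P.re / -u| ≤ B * ‖v‖ ^ 2 := by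
    rw [abs_div, abs_of_pos (by linarith : 0 < -u)]
    exact (div_le_self (abs_nonneg _) hu3.le).trans h5
  have hP' := abs_le.1 hP
  have hd : ‖d‖ ^ 2 ≤ B ^ 2 * ‖v‖ ^ 2 := by rw [← mul_pow]; gcongr
  have hvk := norm_nonneg (v k)
  have hv := norm_nonneg v
  rw [hterm]
  constructor
  · refine poincare_term_upper ha hK hB hr hl0 hu1 hu3 (norm_nonneg e) ?_ hd
      (norm_add_sq_le_two_mul d e) hP'.2
    rw [hen]
    calc ‖fderiv ℂ f z v‖ / ‖f z‖ ≤ K * (‖v k‖ + r * ‖v‖) / (a * r) := by gcongr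
      _ = K / a * (‖v k‖ / r + ‖v‖) := by field_simp
  · refine poincare_term_lower (e := ‖e‖) ha hK hB hr hl0 hu1 hu3 hu2 hvk (by positivity) ?_
      (by linarith [half_norm_sq_sub_le d e]) hP'.1
    have h8 : a * ‖v k‖ ≤ ‖f z‖ * ‖e‖ + K * (r * ‖v‖) := by
      rw [hen, mul_div_cancel₀ _ hf0.ne']; linarith
    have h9 : a * ‖v k‖ ≤ K * r * ‖e‖ + K * (r * ‖v‖) :=
      h8.trans (by gcongr)
    rw [div_le_iff₀ hr]
    have h10 : ‖v k‖ = (a * ‖v k‖) / a := by field_simp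
    rw [h10, div_le_iff₀ ha]
    refine h9.trans_eq ?_
    field_simp

end MetricComparison

/-! ### The model Poincaré metric -/

section ModelMetric

open Filter Topology

variable {n : ℕ}

/-- The coefficients of the inverse of the model Poincaré metric. -/
noncomputable def modelWeight (S : Finset (Fin n)) (z : Fin n → ℂ) (j : Fin n) : ℝ :=
  if j ∈ S then (‖z j‖ * Real.log ‖z j‖) ^ 2 else 1

theorem sq_mul_log_pos {r : ℝ} (h0 : 0 < r) (h1 : r < 1) : 0 < (r * Real.log r) ^ 2 := by
  have := Real.log_neg h0 h1
  have : r * Real.log r ≠ 0 := mul_ne_zero h0.ne' this.ne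
  positivity

theorem sq_mul_log_le_one {r : ℝ} (h0 : 0 < r) (h1 : r < 1) : (r * Real.log r) ^ 2 ≤ 1 := by
  have := Real.abs_log_mul_self_lt r h0 h1.le
  rw [mul_comm, ← sq_abs]
  nlinarith [abs_nonneg (Real.log r * r)]

theorem modelWeight_pos {S : Finset (Fin n)} {z : Fin n → ℂ} (h0 : ∀ j ∈ S, z j ≠ 0)
    (h1 : ∀ j ∈ S, ‖z j‖ < 1) (j : Fin n) : 0 < modelWeight S z j := by
  unfold modelWeight
  split_ifs with hj
  · exact sq_mul_log_pos (norm_pos_iff.2 (h0 j hj)) (h1 j hj)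
  · exact one_pos

theorem modelWeight_le_one {S : Finset (Fin n)} {z : Fin n → ℂ} (h0 : ∀ j ∈ S, z j ≠ 0)
    (h1 : ∀ j ∈ S, ‖z j‖ < 1) (j : Fin n) : modelWeight S z j ≤ 1 := by
  unfold modelWeight
  split_ifs with hj
  · exact sq_mul_log_le_one (norm_pos_iff.2 (h0 j hj)) (h1 j hj)
  · exact le_rfl

theorem norm_sq_le_sum_norm_sq (v : Fin n → ℂ) : ‖v‖ ^ 2 ≤ ∑ j, ‖v j‖ ^ 2 := by
  have h1 : ‖v‖ ≤ Real.sqrt (∑ j, ‖v j‖ ^ 2) := by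
    refine (pi_norm_le_iff_of_nonneg (Real.sqrt_nonneg _)).2 fun j ↦ ?_
    refine Real.le_sqrt_of_sq_le ?_
    exact Finset.single_le_sum (f := fun j ↦ ‖v j‖ ^ 2) (fun j _ ↦ by positivity)
      (Finset.mem_univ j)
  calc ‖v‖ ^ 2 ≤ (Real.sqrt (∑ j, ‖v j‖ ^ 2)) ^ 2 := by gcongr
    _ = _ := Real.sq_sqrt (by positivity)

/-- A form that is the sum of a bounded form and of terms of Poincaré type, and that is bounded
below, is comparable with the model metric. -/
theorem comparable_of_terms {N : ℕ} {S : Finset (Fin n)} {z v : Fin n → ℂ} {P : Fin N → Prop}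
    [DecidablePred P] {σ : {i // P i} → Fin n} (hσ : Function.Injective σ)
    (hσS : ∀ k, k ∈ S ↔ ∃ i, σ i = k) {Q G : ℝ} {T : Fin N → ℝ} {A B κ : ℝ} (hA : 0 < A)
    (hκ : 0 < κ) (hQ : Q = G + ∑ i, T i) (hG0 : 0 ≤ G) (hGB : G ≤ B * ‖v‖ ^ 2)
    (hQκ : κ * ‖v‖ ^ 2 ≤ Q) (h0 : ∀ j ∈ S, z j ≠ 0) (h1 : ∀ j ∈ S, ‖z j‖ < 1)
    (hT : ∀ i, T i ≤ A * ((if h : P i then ‖v (σ ⟨i, h⟩)‖ ^ 2 /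
          modelWeight S z (σ ⟨i, h⟩) else 0) + ‖v‖ ^ 2) ∧
        (if h : P i then ‖v (σ ⟨i, h⟩)‖ ^ 2 / modelWeight S z (σ ⟨i, h⟩) else 0) ≤
          A * (T i + A * ‖v‖ ^ 2)) (hB : 0 ≤ B) :
    (A + (N * A ^ 2 + n) / κ)⁻¹ * ∑ j, ‖v j‖ ^ 2 / modelWeight S z j ≤ Q ∧
      Q ≤ (B + A + N * A) * ∑ j, ‖v j‖ ^ 2 / modelWeight S z j := by
  have hm := modelWeight_pos h0 h1
  set m := modelWeight S z with hm_def
  set Y := ∑ j, ‖v j‖ ^ 2 / m j with hY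
  set x : Fin N → ℝ := fun i ↦ if h : P i then ‖v (σ ⟨i, h⟩)‖ ^ 2 / m (σ ⟨i, h⟩) else 0 with hx
  have hterm : ∀ j, 0 ≤ ‖v j‖ ^ 2 / m j := fun j ↦ div_nonneg (by positivity) (hm j).le
  have hY0 : 0 ≤ Y := Finset.sum_nonneg fun j _ ↦ hterm j
  have hvY : ‖v‖ ^ 2 ≤ Y := (norm_sq_le_sum_norm_sq v).trans (Finset.sum_le_sum fun j _ ↦
    le_div_self (by positivity) (hm j) (modelWeight_le_one h0 h1 j))
  have hxS : ∑ i, x i = ∑ j ∈ S, ‖v j‖ ^ 2 / m j := by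
    have h2 : ∑ i, x i = ∑ i : {i // P i}, ‖v (σ i)‖ ^ 2 / m (σ i) := by
      simp only [hx]
      rw [Finset.sum_dite]
      simp only [Finset.sum_const_zero, add_zero]
      refine Finset.sum_bij' (fun i _ ↦ ⟨i.1, (Finset.mem_filter.1 i.2).2⟩)
        (fun i _ ↦ ⟨i.1, Finset.mem_filter.2 ⟨Finset.mem_univ _, i.2⟩⟩) ?_ ?_ ?_ ?_ ?_ <;> simp
    have h3 : S = Finset.univ.map ⟨σ, hσ⟩ := by
      ext k; simp [hσS]
    rw [h2, h3, Finset.sum_map]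
    rfl
  have hSY : ∑ j ∈ S, ‖v j‖ ^ 2 / m j ≤ Y :=
    Finset.sum_le_univ_sum_of_nonneg hterm
  have hYS : Y ≤ ∑ j ∈ S, ‖v j‖ ^ 2 / m j + n * ‖v‖ ^ 2 := by
    rw [hY, ← Finset.sum_add_sum_compl S]
    gcongr
    have h2 : ∀ j ∈ Sᶜ, ‖v j‖ ^ 2 / m j ≤ ‖v‖ ^ 2 := by
      intro j hj
      rw [hm_def, modelWeight, if_neg (Finset.mem_compl.1 hj), div_one]
      gcongr
      exact norm_le_pi_norm v j
    calc ∑ j ∈ Sᶜ, ‖v j‖ ^ 2 / m j ≤ ∑ j ∈ Sᶜ, ‖v‖ ^ 2 := Finset.sum_le_sum h2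
      _ = (Sᶜ.card : ℝ) * ‖v‖ ^ 2 := by rw [Finset.sum_const, nsmul_eq_mul]
      _ ≤ n * ‖v‖ ^ 2 := by
          gcongr
          simpa using Finset.card_le_univ Sᶜ
  have hTu : ∑ i, T i ≤ A * (∑ i, x i + N * ‖v‖ ^ 2) := by
    calc ∑ i, T i ≤ ∑ i, A * (x i + ‖v‖ ^ 2) := Finset.sum_le_sum fun i _ ↦ (hT i).1
      _ = _ := by
          rw [← Finset.mul_sum, Finset.sum_add_distrib, Finset.sum_const, Finset.card_univ,
            Fintype.card_fin, nsmul_eq_mul]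
  have hTl : ∑ i, x i ≤ A * (∑ i, T i + N * (A * ‖v‖ ^ 2)) := by
    calc ∑ i, x i ≤ ∑ i, A * (T i + A * ‖v‖ ^ 2) := Finset.sum_le_sum fun i _ ↦ (hT i).2
      _ = _ := by
          rw [← Finset.mul_sum, Finset.sum_add_distrib, Finset.sum_const, Finset.card_univ,
            Fintype.card_fin, nsmul_eq_mul]
  have hN : (0 : ℝ) ≤ N := Nat.cast_nonneg N
  have hn : (0 : ℝ) ≤ n := Nat.cast_nonneg n
  constructor
  -- The terms `T i` may be negative, but only up to a multiple of `‖v‖²`; this multiple and the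
  -- directions outside `S` are absorbed by the coercivity `κ ‖v‖² ≤ Q` of the whole form.
  · have hpos : 0 < A + (N * A ^ 2 + n) / κ := by positivity
    rw [inv_mul_le_iff₀ hpos, add_mul, div_mul_eq_mul_div]
    have h2 : ‖v‖ ^ 2 ≤ Q / κ := by rw [le_div_iff₀ hκ]; linarith
    calc Y ≤ A * (∑ i, T i + N * (A * ‖v‖ ^ 2)) + n * ‖v‖ ^ 2 := by linarith
      _ ≤ A * Q + (N * A ^ 2 + n) * ‖v‖ ^ 2 := by
          have : A * ∑ i, T i ≤ A * Q := by gcongr; linarith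
          nlinarith
      _ ≤ A * Q + (N * A ^ 2 + n) * (Q / κ) := by gcongr
      _ = _ := by ring
  · have h2 : A * (∑ i, x i + N * ‖v‖ ^ 2) ≤ A * (Y + N * Y) := by
      gcongr; rw [hxS]; exact hSY
    have h3 : B * ‖v‖ ^ 2 ≤ B * Y := by gcongr
    rw [hQ]
    linarith

end ModelMetric

/-! ### Comparison of `ω_E` with the model metric -/

section PoincareComparison

open Filter Topology

theorem linearIndependent_comp_of_right_inverse {n : ℕ} {ι : Type*} {ℓ : ι → (Fin n → ℂ) →L[ℂ] ℂ}
    (h : LinearIndependent ℂ ℓ) {A B : (Fin n → ℂ) →L[ℂ] Fin n → ℂ}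
    (hAB : A.comp B = ContinuousLinearMap.id ℂ _) :
    LinearIndependent ℂ fun i ↦ (ℓ i).comp A := by
  refine h.map'
    ((ContinuousLinearMap.compL ℂ (Fin n → ℂ) (Fin n → ℂ) ℂ).flip A).toLinearMap ?_
  rw [LinearMap.ker_eq_bot']
  intro m hm
  have h1 : m.comp A = 0 := hm
  have h2 : (m.comp A).comp B = m := by
    rw [ContinuousLinearMap.comp_assoc, hAB, ContinuousLinearMap.comp_id]
  rw [← h2, h1, ContinuousLinearMap.zero_comp]

variable {n N : ℕ} {X : Type*} [TopologicalSpace X]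
  [ChartedSpace (Fin n → ℂ) X] [IsManifold 𝓘(ℂ, Fin n → ℂ) ω X]
  {F : Fin N → X → Type*} [∀ i, TopologicalSpace (TotalSpace ℂ (F i))]
  [∀ i x, AddCommGroup (F i x)] [∀ i x, Module ℂ (F i x)] [∀ i x, TopologicalSpace (F i x)]
  [∀ i, FiberBundle ℂ (F i)] [∀ i, VectorBundle ℂ ℂ (F i)]
  {s : ∀ i x, F i x} {hF : ∀ i x, F i x → ℝ} {g : HermitianMetric n X}
  {φ : OpenPartialHomeomorph X (Fin n → ℂ)} {x : X}

/-- Normal crossings are stated in the preferred chart at `x`; the differential of the transition to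
`φ` is invertible and preserves independence. -/
theorem linearIndependent_fderiv_sectionCoord
    [∀ i, ContMDiffVectorBundle ω ℂ (F i) 𝓘(ℂ, Fin n → ℂ)]
    (hs : ∀ i, ContMDiff 𝓘(ℂ, Fin n → ℂ) (𝓘(ℂ, Fin n → ℂ).prod 𝓘(ℂ, ℂ)) ω
      fun x ↦ (⟨x, s i x⟩ : TotalSpace ℂ (F i)))
    (hsnc : IsSNC n s) (hφ : IsCoord φ) (hx : x ∈ φ.source) :
    LinearIndependent ℂ fun i : {i : Fin N // s i x = 0} ↦
      fderiv ℂ (sectionCoord (s i) x φ) (φ x) := by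
  have hx₀ : x ∈ (chartAt (Fin n → ℂ) x).source := mem_chart_source _ x
  have hφ₀ := isCoord_chartAt (n := n) x
  have h1 := hsnc x
  set φ₀ := chartAt (Fin n → ℂ) x with hφ₀_def
  have hz : φ x ∈ φ.target := φ.map_source hx
  have hz₀ : φ₀ x ∈ φ₀.target := φ₀.map_source hx₀
  have hzx : φ.symm (φ x) = x := φ.left_inv hx
  have hzx₀ : φ₀.symm (φ₀ x) = x := φ₀.left_inv hx₀
  have hT : DifferentiableAt ℂ (fun ζ ↦ φ₀ (φ.symm ζ)) (φ x) :=
    (contDiffAt_transition hφ hφ₀ hz (by rw [hzx]; exact hx₀)).differentiableAt (by simp)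
  have hR : DifferentiableAt ℂ (fun ζ ↦ φ (φ₀.symm ζ)) (φ₀ x) :=
    (contDiffAt_transition hφ₀ hφ hz₀ (by rw [hzx₀]; exact hx)).differentiableAt (by simp)
  have hTR : (fderiv ℂ (fun ζ ↦ φ₀ (φ.symm ζ)) (φ x)).comp
      (fderiv ℂ (fun ζ ↦ φ (φ₀.symm ζ)) (φ₀ x)) = ContinuousLinearMap.id ℂ _ := by
    have h2 : (fun ζ ↦ φ₀ (φ.symm (φ (φ₀.symm ζ)))) =ᶠ[𝓝 (φ₀ x)] id := by
      filter_upwards [eventually_symm_mem hz₀ φ.open_source (by rw [hzx₀]; exact hx)] with ζ hζ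
      rw [φ.left_inv hζ.2, φ₀.right_inv hζ.1]; rfl
    have h3 : φ x = φ (φ₀.symm (φ₀ x)) := by rw [hzx₀]
    have h4 := fderiv_comp (𝕜 := ℂ) (φ₀ x) (g := fun ζ ↦ φ₀ (φ.symm ζ)) (by rw [← h3]; exact hT) hR
    rw [← h3] at h4
    rw [← h4]
    exact h2.fderiv_eq.trans fderiv_id
  have h5 := linearIndependent_comp_of_right_inverse h1 hTR
  have h6 : ∀ i, fderiv ℂ (sectionCoord (s i) x φ) (φ x) =
      (fderiv ℂ (fun z : Fin n → ℂ ↦ (trivializationAt ℂ (F i) x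
        ⟨φ₀.symm z, s i (φ₀.symm z)⟩).2) (φ₀ x)).comp
        (fderiv ℂ (fun ζ ↦ φ₀ (φ.symm ζ)) (φ x)) := by
    intro i
    have h7 : sectionCoord (s i) x φ =ᶠ[𝓝 (φ x)] fun ζ ↦ (trivializationAt ℂ (F i) x
        ⟨φ₀.symm (φ₀ (φ.symm ζ)), s i (φ₀.symm (φ₀ (φ.symm ζ)))⟩).2 := by
      filter_upwards [eventually_symm_mem hz φ₀.open_source (by rw [hzx]; exact hx₀)] with ζ hζ
      rw [φ₀.left_inv hζ.2]
      rfl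
    have h8 : DifferentiableAt ℂ (fun z : Fin n → ℂ ↦ (trivializationAt ℂ (F i) x
        ⟨φ₀.symm z, s i (φ₀.symm z)⟩).2) (φ₀ x) :=
      (contDiffAt_sectionCoord (hs i) hφ₀ hx₀).differentiableAt (by simp)
    have h9 : φ₀ (φ.symm (φ x)) = φ₀ x := by rw [hzx]
    rw [h7.fderiv_eq]
    have h10 := fderiv_comp (𝕜 := ℂ) (φ x) (f := fun ζ ↦ φ₀ (φ.symm ζ))
      (g := fun z : Fin n → ℂ ↦ (trivializationAt ℂ (F i) x
        ⟨φ₀.symm z, s i (φ₀.symm z)⟩).2) (by rw [h9]; exact h8) hT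
    rw [h9] at h10
    exact h10
  have h11 : (fun i : {i : Fin N // s i x = 0} ↦ fderiv ℂ (sectionCoord (s i) x φ) (φ x)) =
      fun i : {i : Fin N // s i x = 0} ↦ (fderiv ℂ (fun z : Fin n → ℂ ↦
        (trivializationAt ℂ (F i) x ⟨φ₀.symm z, s i (φ₀.symm z)⟩).2) (φ₀ x)).comp
        (fderiv ℂ (fun ζ ↦ φ₀ (φ.symm ζ)) (φ x)) := funext fun i ↦ h6 i
  rw [h11]
  exact h5

/-- The components through `x` correspond to the hyperplanes in `S` and contribute the Poincaré
terms, the other components and the smooth metric contribute bounded forms, and the lower bound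
needs `ω_E ≥ c ω`. The constants hold on a whole punctured neighbourhood. -/
theorem exists_isComparable [∀ i, ContMDiffVectorBundle ω ℂ (F i) 𝓘(ℂ, Fin n → ℂ)]
    (hs : ∀ i, ContMDiff 𝓘(ℂ, Fin n → ℂ) (𝓘(ℂ, Fin n → ℂ).prod 𝓘(ℂ, ℂ)) ω
      fun x ↦ (⟨x, s i x⟩ : TotalSpace ℂ (F i)))
    (hsnc : IsSNC n s) (hF_smooth : ∀ i, IsSmoothMetric n (hF i))
    (hF_lt : ∀ i x, hF i x (s i x) < Real.exp (-1))
    (hg : ∃ c : ℝ, 0 < c ∧ ∀ x, x ∉ divisorSupport s →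
      ∀ v, c * (g.form x v v).re ≤ (poincareForm g s hF x v v).re)
    (hφ : IsCoord φ) (hx : x ∈ φ.source) {S : Finset (Fin n)} (hS : ∀ j ∈ S, φ x j = 0)
    (hE : ∀ᶠ z in 𝓝 (φ x), φ.symm z ∈ divisorSupport s ↔ ∃ j ∈ S, z j = 0) :
    ∃ c₀ C₀ : ℝ, ∀ᶠ z in 𝓝 (φ x), φ.symm z ∉ divisorSupport s →
      ∃ H : (Fin n → ℂ) →ₗ⋆[ℂ] (Fin n → ℂ) →ₗ[ℂ] ℂ,
        (∀ v w, H v w = poincareForm g s hF (φ.symm z) (coordVec φ z v) (coordVec φ z w)) ∧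
        IsComparable H (modelWeight S z) c₀ C₀ := by
  classical
  obtain ⟨c, hc, hgc⟩ := hg
  have hzx : φ.symm (φ x) = x := φ.left_inv hx
  have hz : φ x ∈ φ.target := φ.map_source hx
  set f : Fin N → (Fin n → ℂ) → ℂ := fun i ↦ sectionCoord (s i) x φ with hf_def
  set h : Fin N → (Fin n → ℂ) → ℝ := fun i ↦ metricLog (hF i) x φ with hh_def
  have hf : ∀ i, ContDiffAt ℂ 2 (f i) (φ x) := fun i ↦
    (contDiffAt_sectionCoord (hs i) hφ hx).of_le (by simp)
  have hh : ∀ i, ContDiffAt ℝ ∞ (h i) (φ x) := fun i ↦ contDiffAt_metricLog (hF_smooth i) hφ hx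
  have hb := eventually_mem_baseSets (F := F) hx
  have hf0 : ∀ i, f i (φ x) = 0 ↔ s i x = 0 := fun i ↦ by
    rw [hf_def]; simp only
    rw [sectionCoord_eq_zero_iff (hb.self_of_nhds.2 i), hzx]
  have hne : ∀ᶠ z in 𝓝 (φ x), ∀ i, s i x ≠ 0 → f i z ≠ 0 := by
    refine eventually_all.2 fun i ↦ ?_
    by_cases hi : s i x = 0
    · exact Eventually.of_forall fun z hz ↦ absurd hi hz
    · exact ((hf i).continuousAt.eventually_ne fun h ↦ hi ((hf0 i).1 h)).mono fun z hz _ ↦ hz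
  have hEf : ∀ᶠ z in 𝓝 (φ x), (∃ i : {i : Fin N // s i x = 0}, f i z = 0) ↔ ∃ j ∈ S, z j = 0 := by
    filter_upwards [hE, hb, hne] with z h1 h2 h3
    rw [← h1]
    constructor
    · rintro ⟨i, hi⟩
      exact ⟨i, (sectionCoord_eq_zero_iff (h2.2 i)).1 hi⟩
    · rintro ⟨i, hi⟩
      have h4 : f i z = 0 := (sectionCoord_eq_zero_iff (h2.2 i)).2 hi
      by_cases hi' : s i x = 0
      · exact ⟨⟨i, hi'⟩, h4⟩
      · exact absurd h4 (h3 i hi')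
  obtain ⟨σ, hσ, hσS, hσb⟩ := exists_hyperplane_bijection
    (f := fun i : {i : Fin N // s i x = 0} ↦ f i) (fun i ↦ hf i) (fun i ↦ (hf0 i).2 i.2)
    (linearIndependent_fderiv_sectionCoord hs hsnc hφ hx) hS hEf
  -- the bounded part
  have hadd : ∀ z v w, coordVec φ z (v + w) = coordVec φ z v + coordVec φ z w :=
    fun z v w ↦ map_add _ _ _
  have hsmul : ∀ z (c : ℂ) v, coordVec φ z (c • v) = c • coordVec φ z v :=
    fun _ _ _ ↦ map_smul _ _ _
  let A : (Fin n → ℂ) → (Fin n → ℂ) →ₗ⋆[ℂ] (Fin n → ℂ) →ₗ[ℂ] ℂ := fun z ↦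
    LinearMap.mk₂'ₛₗ (starRingEnd ℂ) (RingHom.id ℂ)
      (fun v w ↦ g.form (φ.symm z) (coordVec φ z v) (coordVec φ z w))
      (fun v v' w ↦ by rw [hadd, map_add, LinearMap.add_apply])
      (fun c v w ↦ by rw [hsmul, map_smulₛₗ, LinearMap.smul_apply])
      (fun v w w' ↦ by rw [hadd, map_add])
      (fun c v w ↦ by rw [hsmul, map_smul, RingHom.id_apply])
  obtain ⟨κ, hκ, B, hB, hgb⟩ := eventually_sesquilinear_bounds A (c := φ x)
    (fun j k ↦ ((g.smooth φ hφ (Pi.single j 1) (Pi.single k 1)).continuousOn.continuousAt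
      (φ.open_target.mem_nhds hz)))
    (fun v hv ↦ g.pos _ _ fun h ↦ hv ((coordEquiv hφ hz).map_eq_zero_iff.1 h))
  -- the terms of the components of the divisor
  have hterm : ∀ i, ∃ A > 0, ∀ᶠ z in 𝓝 (φ x), (∀ j ∈ S, z j ≠ 0) →
      (∀ i, h i z + Real.log (‖f i z‖ ^ 2) < -1) → ∀ v,
      divisorTerm (h i) (f i) z v ≤ A * ((if h : s i x = 0 then ‖v (σ ⟨i, h⟩)‖ ^ 2 /
          modelWeight S z (σ ⟨i, h⟩) else 0) + ‖v‖ ^ 2) ∧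
      (if h : s i x = 0 then ‖v (σ ⟨i, h⟩)‖ ^ 2 / modelWeight S z (σ ⟨i, h⟩) else 0) ≤
          A * (divisorTerm (h i) (f i) z v + A * ‖v‖ ^ 2) := by
    intro i
    by_cases hi : s i x = 0
    · obtain ⟨a, ha, K, hK, h1⟩ := hσb ⟨i, hi⟩
      have hσi : σ ⟨i, hi⟩ ∈ S := (hσS _).2 ⟨_, rfl⟩
      obtain ⟨A, hA, h2⟩ := eventually_divisorTerm_poincare (hh i) (hS _ hσi) ha hK h1
      refine ⟨A, hA, ?_⟩
      filter_upwards [h2] with z hz h0 hlt v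
      have h3 := hz (h0 _ hσi) (hlt i) v
      rw [dif_pos hi]
      rw [modelWeight, if_pos hσi]
      exact h3
    · obtain ⟨A, hA, h2⟩ := eventually_divisorTerm_bounded (hh i) (hf i)
        (fun h ↦ hi ((hf0 i).1 h))
      refine ⟨A, hA, ?_⟩
      filter_upwards [h2] with z hz h0 hlt v
      have h3 := abs_le.1 (hz (hlt i) v)
      rw [dif_neg hi, zero_add]
      exact ⟨h3.2, mul_nonneg hA.le (by linarith)⟩
  choose A' hA' hterm using hterm
  set A₀ := 1 + ∑ i, A' i with hA₀
  have hA₀0 : 0 < A₀ := by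
    have : 0 ≤ ∑ i, A' i := Finset.sum_nonneg fun i _ ↦ (hA' i).le
    positivity
  have hA'le : ∀ i, A' i ≤ A₀ := fun i ↦ by
    have := Finset.single_le_sum (f := A') (fun i _ ↦ (hA' i).le) (Finset.mem_univ i)
    linarith
  have hsmall : ∀ᶠ z in 𝓝 (φ x), ∀ j ∈ S, ‖z j‖ < 1 := by
    refine (eventually_all_finset S).2 fun j hj ↦ ?_
    have h2 : ContinuousAt (fun z : Fin n → ℂ ↦ ‖z j‖) (φ x) :=
      (continuous_apply j).norm.continuousAt
    exact h2.eventually (gt_mem_nhds (by simp [hS j hj]))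
  have hfz : ∀ᶠ z in 𝓝 (φ x), ∀ i, ContDiffAt ℂ 2 (f i) z := eventually_all.2 fun i ↦
    (hf i).eventually (by simp)
  have hhz : ∀ᶠ z in 𝓝 (φ x), ∀ i, ContDiffAt ℝ 2 (h i) z := eventually_all.2 fun i ↦
    ((hh i).of_le (WithTop.coe_le_coe.2 (le_top : (2 : ℕ∞) ≤ ⊤))).eventually (by simp)
  refine ⟨(A₀ + (N * A₀ ^ 2 + n) / (c * κ))⁻¹, B + A₀ + N * A₀, ?_⟩
  filter_upwards [hE, hb, hgb, eventually_all.2 hterm, hsmall, hfz, hhz] with z hEz hbz hgz htz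
    hsz hfz hhz hzE
  have hz0 : ∀ j ∈ S, z j ≠ 0 := fun j hj h0 ↦ hzE (hEz.2 ⟨j, hj, h0⟩)
  obtain ⟨H, hH, hHsymm, -⟩ := exists_poincareForm_coord (g := g) hs hF_smooth hF_lt hφ hbz.1 hzE
  have hlt : ∀ i, h i z + Real.log (‖f i z‖ ^ 2) < -1 := fun i ↦
    metricLog_add_log_lt (hF_smooth i) (hF_lt i) (hbz.2 i) fun h ↦ hzE ⟨i, h⟩
  have hQ : ∀ v, (H v v).re = (A z v v).re + ∑ i, divisorTerm (h i) (f i) z v := fun v ↦ by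
    rw [hH]
    exact poincareForm_coord_eq hs hF_smooth hF_lt hφ hbz.1 hzE hbz.2 hfz hhz v
  have hcmp : ∀ v, _ := fun v ↦ comparable_of_terms (z := z) (v := v) (P := fun i ↦ s i x = 0) hσ hσS
    (A := A₀) (B := B) (κ := c * κ) hA₀0
    (by positivity) (hQ v) ((mul_nonneg hκ.le (by positivity)).trans (hgz v).1) (hgz v).2
    (by
      -- The assumption that `ω_E` dominates `c ω` provides the coercivity.
      have h1 := hgc _ hzE (coordVec φ z v)
      rw [← hH] at h1
      refine le_trans ?_ h1
      rw [mul_assoc]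
      exact mul_le_mul_of_nonneg_left (hgz v).1 hc.le)
    hz0 hsz (fun i ↦ by
      obtain ⟨h1, h2⟩ := htz i hz0 hlt v
      have hx0 : 0 ≤ (if h : s i x = 0 then ‖v (σ ⟨i, h⟩)‖ ^ 2 /
          modelWeight S z (σ ⟨i, h⟩) else 0) := by
        split_ifs
        · exact div_nonneg (by positivity) (modelWeight_pos hz0 hsz _).le
        · exact le_rfl
      have h4 : 0 ≤ divisorTerm (h i) (f i) z v + A' i * ‖v‖ ^ 2 := by
        have := hx0.trans h2
        exact nonneg_of_mul_nonneg_right this (hA' i)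
      have hle := hA'le i
      refine ⟨h1.trans (by gcongr), h2.trans ?_⟩
      have hAi := hA' i
      gcongr) hB.le
  refine ⟨H, hH, hHsymm, modelWeight_pos hz0 hsz, by positivity, by positivity, fun v ↦ (hcmp v).1,
    fun v ↦ (hcmp v).2⟩

end PoincareComparison

/-! ### Weights of logarithmic type -/

section SlowWeights

/-- The weight is `c ∏ (A_I + κ_I T)^{b_I}` with `T = -log r`. Its logarithmic derivative in `T` is
`∑ b_I κ_I / (A_I + κ_I T)`, and since `A_I ≥ 0` each term with `κ_I ≠ 0` is at most `b_I / T`. So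
the exponents of the factors that really depend on `r` add up to the growth rate. -/
theorem isSlowWeight_exp_sum_log {ι : Type*} (s : Finset ι) {b A κ : ι → ℝ}
    (hb : ∀ I ∈ s, 0 ≤ b I) (hA : ∀ I ∈ s, 1 ≤ A I) (hκ : ∀ I ∈ s, 0 ≤ κ I) {β r₂ c : ℝ}
    (hβ : ∑ I ∈ s with κ I ≠ 0, b I ≤ β) (hr₂ : r₂ < 1) (hc : 0 < c) :
    IsSlowWeight (fun r ↦ c * Real.exp (∑ I ∈ s, b I * Real.log (A I + κ I * -Real.log r)))
      (fun r ↦ c * (Real.exp (∑ I ∈ s, b I * Real.log (A I + κ I * -Real.log r)) *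
        ∑ I ∈ s, b I * (-(κ I * r⁻¹) / (A I + κ I * -Real.log r)))) r₂ β := by
  have hpos : ∀ r ∈ Ioc 0 r₂, ∀ I ∈ s, 0 < A I + κ I * -Real.log r := fun r hr I hI ↦ by
    have h1 := Real.log_neg hr.1 (hr.2.trans_lt hr₂)
    have h2 := mul_nonneg (hκ I hI) (neg_nonneg.2 h1.le)
    have h3 := hA I hI
    linarith
  have hterm : ∀ r ∈ Ioc 0 r₂, ∀ I ∈ s, b I * (-(κ I * r⁻¹) / (A I + κ I * -Real.log r)) ≤ 0 :=
    fun r hr I hI ↦ by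
      have h1 : 0 ≤ κ I * r⁻¹ := mul_nonneg (hκ I hI) (inv_nonneg.2 hr.1.le)
      exact mul_nonpos_of_nonneg_of_nonpos (hb I hI)
        (div_nonpos_of_nonpos_of_nonneg (by linarith) (hpos r hr I hI).le)
  refine ⟨?_, fun r hr ↦ ?_, ?_, fun r hr ↦ by positivity, fun r hr ↦ ?_, fun r hr ↦ ?_⟩
  · have : ∀ I ∈ s, Measurable fun r : ℝ ↦ b I * Real.log (A I + κ I * -Real.log r) :=
      fun I _ ↦ by fun_prop
    exact (Real.measurable_exp.comp (Finset.measurable_fun_sum s this)).const_mul c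
  · have h1 : ∀ I ∈ s, HasDerivAt (fun r ↦ b I * Real.log (A I + κ I * -Real.log r))
        (b I * (-(κ I * r⁻¹) / (A I + κ I * -Real.log r))) r := fun I hI ↦ by
      have h2 : HasDerivAt (fun r ↦ A I + κ I * -Real.log r) (-(κ I * r⁻¹)) r :=
        (((Real.hasDerivAt_log hr.1.ne').neg.const_mul (κ I)).const_add (A I)).congr_deriv (by ring)
      exact (h2.log (hpos r hr I hI).ne').const_mul (b I)
    exact (HasDerivAt.fun_sum h1).exp.const_mul c
  · have hlog : ContinuousOn Real.log (Ioc 0 r₂) :=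
      Real.continuousOn_log.mono fun r hr ↦ hr.1.ne'
    have hinv : ContinuousOn (fun r : ℝ ↦ r⁻¹) (Ioc 0 r₂) :=
      continuousOn_inv₀.mono fun r hr ↦ hr.1.ne'
    have h1 : ∀ I, ContinuousOn (fun r ↦ A I + κ I * -Real.log r) (Ioc 0 r₂) := fun I ↦
      continuousOn_const.add (continuousOn_const.mul hlog.neg)
    refine continuousOn_const.mul (ContinuousOn.mul ?_ ?_)
    · refine Real.continuous_exp.comp_continuousOn (continuousOn_finsetSum s fun I hI ↦ ?_)
      exact continuousOn_const.mul ((h1 I).log fun r hr ↦ (hpos r hr I hI).ne')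
    · refine continuousOn_finsetSum s fun I hI ↦ continuousOn_const.mul ?_
      exact (continuousOn_const.mul hinv).neg.div (h1 I) fun r hr ↦ (hpos r hr I hI).ne'
  · have h1 := Finset.sum_nonpos (hterm r hr)
    exact mul_nonpos_of_nonneg_of_nonpos hc.le
      (mul_nonpos_of_nonneg_of_nonpos (Real.exp_pos _).le h1)
  · have ht : 0 < -Real.log r := neg_pos.2 (Real.log_neg hr.1 (hr.2.trans_lt hr₂))
    set w := Real.exp (∑ I ∈ s, b I * Real.log (A I + κ I * -Real.log r)) with hw
    have hw0 : 0 < w := Real.exp_pos _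
    have h1 : ∑ I ∈ s, b I * (κ I / (A I + κ I * -Real.log r)) ≤ β / -Real.log r := by
      have h2 : ∑ I ∈ s, b I * (κ I / (A I + κ I * -Real.log r)) ≤
          ∑ I ∈ s, (if κ I ≠ 0 then b I else 0) / -Real.log r := by
        refine Finset.sum_le_sum fun I hI ↦ ?_
        by_cases h0 : κ I = 0
        · simp [h0]
        · rw [if_pos h0, div_eq_mul_inv (b I)]
          refine mul_le_mul_of_nonneg_left ?_ (hb I hI)
          rw [← one_div, div_le_div_iff₀ (hpos r hr I hI) ht]
          linarith [hA I hI]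
      refine h2.trans ?_
      rw [← Finset.sum_div, ← Finset.sum_filter]
      gcongr
    have h3 : -(r * (c * (w * ∑ I ∈ s, b I * (-(κ I * r⁻¹) / (A I + κ I * -Real.log r))))) =
        c * w * ∑ I ∈ s, b I * (κ I / (A I + κ I * -Real.log r)) := by
      rw [Finset.mul_sum, Finset.mul_sum, Finset.mul_sum, Finset.mul_sum, ← Finset.sum_neg_distrib]
      refine Finset.sum_congr rfl fun I hI ↦ ?_
      have := hr.1.ne'
      have := (hpos r hr I hI).ne'
      field_simp
    rw [h3]
    calc c * w * ∑ I ∈ s, b I * (κ I / (A I + κ I * -Real.log r))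
        ≤ c * w * (β / -Real.log r) := by gcongr
      _ = β * (c * w / -Real.log r) := by ring

variable {n : ℕ}

/-- The model of a weight with logarithmic type singularities along the hyperplanes `zⱼ = 0`,
`j ∈ S`. -/
noncomputable def logWeight (S : Finset (Fin n)) (s : Finset (Finset (Fin n)))
    (b : Finset (Fin n) → ℝ) (k : Fin n → ℕ) (z : Fin n → ℂ) : ℝ :=
  Real.exp (∑ I ∈ s, b I * Real.log (1 + ∑ l ∈ I ∩ S, k l * -Real.log ‖z l‖))

/-- The model of the weight with which the coefficient of index `J` enters in the norm of a
form. -/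
noncomputable def formWeight {p : ℕ} (S : Finset (Fin n)) (s : Finset (Finset (Fin n)))
    (b : Finset (Fin n) → ℝ) (k : Fin n → ℕ) (J : Fin p ↪o Fin n) (z : Fin n → ℂ) : ℝ :=
  logWeight S s b k z * ∏ j with j ∉ range J, (modelWeight S z j)⁻¹

variable {p : ℕ} {S : Finset (Fin n)} {s : Finset (Finset (Fin n))} {b : Finset (Fin n) → ℝ}
  {k : Fin n → ℕ}

theorem logWeight_pos (z : Fin n → ℂ) : 0 < logWeight S s b k z := Real.exp_pos _

theorem measurable_logWeight : Measurable (logWeight S s b k) := by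
  unfold logWeight
  refine Real.measurable_exp.comp (Finset.measurable_fun_sum s fun I _ ↦ ?_)
  refine (Real.measurable_log.comp (measurable_const.add
    (Finset.measurable_fun_sum _ fun l _ ↦ ?_))).const_mul _
  exact ((Real.measurable_log.comp (measurable_pi_apply l).norm).neg).const_mul _

theorem measurable_modelWeight (j : Fin n) : Measurable fun z ↦ modelWeight S z j := by
  unfold modelWeight
  split_ifs
  · exact (((measurable_pi_apply j).norm).mul
      (Real.measurable_log.comp (measurable_pi_apply j).norm)).pow_const 2
  · exact measurable_const

theorem modelWeight_nonneg (z : Fin n → ℂ) (j : Fin n) : 0 ≤ modelWeight S z j := by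
  unfold modelWeight
  split_ifs <;> positivity

theorem formWeight_nonneg (J : Fin p ↪o Fin n) (z : Fin n → ℂ) : 0 ≤ formWeight S s b k J z :=
  mul_nonneg (logWeight_pos z).le (Finset.prod_nonneg fun j _ ↦
    inv_nonneg.2 (modelWeight_nonneg z j))

theorem measurable_formWeight (J : Fin p ↪o Fin n) : Measurable (formWeight S s b k J) := by
  unfold formWeight
  exact measurable_logWeight.mul (Finset.measurable_fun_prod _ fun j _ ↦
    (measurable_modelWeight j).inv)

theorem formWeight_eq_one (J : Fin p ↪o Fin n) (z : Fin n → ℂ) : formWeight ∅ s b k J z = 1 := by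
  simp [formWeight, logWeight, modelWeight]

theorem modelWeight_update_self {i : Fin n} (hi : i ∈ S) (z : Fin n → ℂ) (t : ℂ) :
    modelWeight S (Function.update z i t) i = (‖t‖ * Real.log ‖t‖) ^ 2 := by
  simp [modelWeight, hi]

theorem modelWeight_update_of_ne {i j : Fin n} (hij : j ≠ i) (z : Fin n → ℂ) (t : ℂ) :
    modelWeight S (Function.update z i t) j = modelWeight S z j := by
  simp [modelWeight, hij]

/-- With all coordinates but the `i`-th fixed, the other logarithms are non-negative and go into
constants `A I ≥ 1`. This is why the slow growth has to be uniform in the `A I`, and why only the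
exponents with `i ∈ I` matter, and those only if `k i ≠ 0`. -/
theorem exists_isSlowWeight_slice (hb : ∀ I ∈ s, 0 ≤ b I) {i : Fin n} (hi : i ∈ S)
    {r₂ : ℝ} (hr₂ : r₂ < 1) {z : Fin n → ℂ} (h1 : ∀ j ∈ S, j ≠ i → ‖z j‖ < 1) {c : ℝ} (hc : 0 < c) :
    ∃ w w' : ℝ → ℝ, IsSlowWeight w w' r₂ (∑ I ∈ s with i ∈ I ∧ k i ≠ 0, b I) ∧
      ∀ t, c * logWeight S s b k (Function.update z i t) = w ‖t‖ := by
  have h2 := isSlowWeight_exp_sum_log s (b := b)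
    (A := fun I ↦ 1 + ∑ l ∈ (I ∩ S).erase i, k l * -Real.log ‖z l‖)
    (κ := fun I ↦ if i ∈ I then (k i : ℝ) else 0) hb (fun I hI ↦ by
      refine le_add_of_nonneg_right (Finset.sum_nonneg fun l hl ↦ ?_)
      have h3 := Finset.mem_erase.1 hl
      have h4 := Real.log_nonpos (norm_nonneg _) (h1 l (Finset.mem_inter.1 h3.2).2 h3.1).le
      have : (0 : ℝ) ≤ k l := Nat.cast_nonneg _
      exact mul_nonneg this (by linarith)) (fun I hI ↦ by split_ifs <;> positivity)
    (β := ∑ I ∈ s with i ∈ I ∧ k i ≠ 0, b I) (le_of_eq (by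
      congr 1
      ext I
      simp only [Finset.mem_filter]
      by_cases hI : i ∈ I <;> simp [hI])) hr₂ hc
  refine ⟨_, _, h2, fun t ↦ ?_⟩
  unfold logWeight
  congr 2
  refine Finset.sum_congr rfl fun I hI ↦ ?_
  congr 2
  have h3 : ∀ l ∈ (I ∩ S).erase i, (k l : ℝ) * -Real.log ‖Function.update z i t l‖ =
      k l * -Real.log ‖z l‖ := fun l hl ↦ by
    rw [Function.update_of_ne (Finset.ne_of_mem_erase hl)]
  by_cases hiI : i ∈ I
  · rw [if_pos hiI, ← Finset.sum_erase_add _ _ (Finset.mem_inter.2 ⟨hiI, hi⟩),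
      Finset.sum_congr rfl h3, Function.update_self]
    ring
  · rw [if_neg hiI]
    have h4 : (I ∩ S).erase i = I ∩ S := Finset.erase_eq_of_notMem fun h ↦
      hiI (Finset.mem_inter.1 h).1
    rw [h4] at h3 ⊢
    rw [Finset.sum_congr rfl h3]
    ring

/-- The Hardy type inequality in the direction of a coordinate that vanishes on the divisor. -/
theorem lintegral_pi_le_formWeight (hb : ∀ I ∈ s, 0 ≤ b I) {i : Fin n} (hi : i ∈ S)
    (hk : k i ≠ 0 → ∑ I ∈ s with i ∈ I, b I < 1) (J : Fin p ↪o Fin n) {r₁ r₂ : ℝ} (h₁ : 0 < r₁)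
    (h₂ : r₁ < r₂) (h₂' : r₂ ≤ Real.exp (-40)) :
    ∃ C : ℝ, 0 < C ∧ ∀ Q : Fin n → Set ℂ, (∀ j, MeasurableSet (Q j)) →
      (∀ j ∈ S, Q j ⊆ Metric.ball 0 1) → ∀ f : (Fin n → ℂ) → ℂ, ContDiff ℝ 2 f →
      (∃ a > 0, ∀ z, ∀ j ∈ S, ‖z j‖ ≤ a → f z = 0) →
      ∫⁻ z in univ.pi (Function.update Q i (Metric.ball 0 r₁)),
          ENNReal.ofReal (formWeight S s b k J z * ‖f z‖ ^ 2) ≤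
        ENNReal.ofReal C * (∫⁻ z in univ.pi (Function.update Q i (Metric.ball 0 r₂)),
          ENNReal.ofReal (formWeight S s b k J z * modelWeight S z i *
            ‖dbarDir f z (Pi.single i 1)‖ ^ 2)) +
        ENNReal.ofReal C * ∫⁻ z in univ.pi (Function.update Q i
          (Metric.ball 0 r₂ \ Metric.ball 0 r₁)),
          ENNReal.ofReal (formWeight S s b k J z * ‖f z‖ ^ 2) := by
  classical
  have hr₂1 : r₂ < 1 := h₂'.trans_lt (by rw [Real.exp_lt_one_iff]; norm_num)
  have hβ : ∑ I ∈ s with i ∈ I ∧ k i ≠ 0, b I < 1 := by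
    by_cases h0 : k i = 0
    · simp [h0]
    · simpa [h0] using hk h0
  obtain ⟨C₁, hC₁, H₁⟩ := lintegral_ball_le_slowWeight h₁ h₂ h₂' hβ
  obtain ⟨C₂, hC₂, H₂⟩ := lintegral_ball_le_slowWeight_mul h₁ h₂ h₂' hβ
  have key : ∃ C : ℝ, 0 < C ∧ ∀ f : (Fin n → ℂ) → ℂ, ContDiff ℝ 2 f →
      (∃ a > 0, ∀ z, ∀ j ∈ S, ‖z j‖ ≤ a → f z = 0) → ∀ z : Fin n → ℂ,
      (∀ j ∈ S, j ≠ i → z j ≠ 0 ∧ ‖z j‖ < 1) →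
      ∫⁻ t in Metric.ball 0 r₁, ENNReal.ofReal (formWeight S s b k J (Function.update z i t) *
          ‖f (Function.update z i t)‖ ^ 2) ≤
        ENNReal.ofReal C * (∫⁻ t in Metric.ball 0 r₂,
          ENNReal.ofReal (formWeight S s b k J (Function.update z i t) *
            modelWeight S (Function.update z i t) i *
            ‖dbarDir f (Function.update z i t) (Pi.single i 1)‖ ^ 2)) +
        ENNReal.ofReal C * ∫⁻ t in Metric.ball 0 r₂ \ Metric.ball 0 r₁,
          ENNReal.ofReal (formWeight S s b k J (Function.update z i t) *
            ‖f (Function.update z i t)‖ ^ 2) := by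
    -- If `dz_i` occurs, the factor `1 / m_i` of the volume is cancelled by the norm of `dz_i` and
    -- the multiplied form of the Hardy inequality applies; otherwise `1 / m_i = 1 / (r log r)²` is
    -- the Hardy weight itself.
    by_cases hiJ : i ∈ range J
    · refine ⟨C₂, hC₂, fun f hf ⟨a, ha, hfa⟩ z hz ↦ ?_⟩
      set c := ∏ j with j ∉ range J, (modelWeight S z j)⁻¹ with hc
      have hc0 : 0 < c := by
        refine Finset.prod_pos fun j hj ↦ inv_pos.2 ?_
        have hji : j ≠ i := fun h ↦ (Finset.mem_filter.1 hj).2 (h ▸ hiJ)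
        unfold modelWeight
        split_ifs with hjS
        · exact sq_mul_log_pos (norm_pos_iff.2 (hz j hjS hji).1) (hz j hjS hji).2
        · exact one_pos
      obtain ⟨w, w', hw, hwt⟩ := exists_isSlowWeight_slice (k := k) hb hi hr₂1
        (fun j hj hji ↦ (hz j hj hji).2) hc0
      have h3 := H₂ w w' hw _ (contDiff_update_slice hf z i)
        ⟨a, ha, fun t ht ↦ hfa _ i hi (by simpa using ht)⟩
      have h4 : ∀ t, formWeight S s b k J (Function.update z i t) = w ‖t‖ := fun t ↦ by
        rw [← hwt, formWeight, mul_comm, hc]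
        congr 1
        refine Finset.prod_congr rfl fun j hj ↦ ?_
        have hji : j ≠ i := fun h ↦ (Finset.mem_filter.1 hj).2 (h ▸ hiJ)
        rw [modelWeight_update_of_ne hji]
      simpa only [h4, modelWeight_update_self hi, dbarOne_update hf] using h3
    · refine ⟨C₁, hC₁, fun f hf ⟨a, ha, hfa⟩ z hz ↦ ?_⟩
      set c := ∏ j ∈ (Finset.univ.filter fun j ↦ j ∉ range J).erase i, (modelWeight S z j)⁻¹ with hc
      have hc0 : 0 < c := by
        refine Finset.prod_pos fun j hj ↦ inv_pos.2 ?_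
        have hji : j ≠ i := Finset.ne_of_mem_erase hj
        unfold modelWeight
        split_ifs with hjS
        · exact sq_mul_log_pos (norm_pos_iff.2 (hz j hjS hji).1) (hz j hjS hji).2
        · exact one_pos
      obtain ⟨w, w', hw, hwt⟩ := exists_isSlowWeight_slice (k := k) hb hi hr₂1
        (fun j hj hji ↦ (hz j hj hji).2) hc0
      have h3 := H₁ w w' hw _ (contDiff_update_slice hf z i)
        ⟨a, ha, fun t ht ↦ hfa _ i hi (by simpa using ht)⟩
      have h4 : ∀ t, formWeight S s b k J (Function.update z i t) =
          w ‖t‖ / (‖t‖ * Real.log ‖t‖) ^ 2 := fun t ↦ by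
        rw [← hwt, formWeight, ← Finset.prod_erase_mul _ _ (Finset.mem_filter.2
          ⟨Finset.mem_univ i, hiJ⟩), modelWeight_update_self hi, div_eq_mul_inv, ← mul_assoc,
          mul_comm c, hc]
        congr 2
        refine Finset.prod_congr rfl fun j hj ↦ ?_
        rw [modelWeight_update_of_ne (Finset.ne_of_mem_erase hj)]
      have h5 : ∀ t ∈ Metric.ball (0 : ℂ) r₂,
          formWeight S s b k J (Function.update z i t) *
            modelWeight S (Function.update z i t) i *
            ‖dbarDir f (Function.update z i t) (Pi.single i 1)‖ ^ 2 =
          w ‖t‖ * ‖dbarDir f (Function.update z i t) (Pi.single i 1)‖ ^ 2 := by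
        intro t ht
        -- At the puncture `m_i = 0` and its inverse is zero by convention, so the cancellation
        -- fails; but there `f` vanishes identically nearby.
        by_cases ht0 : t = 0
        · have h6 : dbarDir f (Function.update z i t) (Pi.single i 1) = 0 := by
            have h7 : f =ᶠ[nhds (Function.update z i t)] fun _ ↦ 0 := by
              have h8 : ContinuousAt (fun z : Fin n → ℂ ↦ ‖z i‖) (Function.update z i t) :=
                (continuous_apply i).norm.continuousAt
              have h9 : ‖Function.update z i t i‖ < a := by simpa [ht0] using ha
              filter_upwards [h8.eventually (Iio_mem_nhds h9)] with y hy
              exact hfa y i hi (le_of_lt hy)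
            rw [dbarDir_congr h7, dbarDir_const]
          rw [h6]; simp
        · have h6 := sq_mul_log_pos (norm_pos_iff.2 ht0)
            ((mem_ball_zero_iff.1 ht).trans hr₂1)
          rw [h4, modelWeight_update_self hi, div_mul_cancel₀ _ h6.ne']
      rw [setLIntegral_congr_fun Metric.isOpen_ball.measurableSet
        fun t ht ↦ congrArg ENNReal.ofReal (h5 t ht)]
      simpa only [h4, dbarOne_update hf] using h3
  obtain ⟨C, hC, H⟩ := key
  refine ⟨C, hC, fun Q hQ hQS f hf hfa ↦ ?_⟩
  have m (r : ℝ) : MeasurableSet (Metric.ball (0 : ℂ) r) := Metric.isOpen_ball.measurableSet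
  have hF₀ : Measurable fun z ↦ ENNReal.ofReal (formWeight S s b k J z * ‖f z‖ ^ 2) :=
    ((measurable_formWeight J).mul (hf.continuous.norm.pow 2).measurable).ennreal_ofReal
  have hF₁ : Measurable fun z ↦ ENNReal.ofReal (formWeight S s b k J z * modelWeight S z i *
      ‖dbarDir f z (Pi.single i 1)‖ ^ 2) :=
    (((measurable_formWeight J).mul (measurable_modelWeight i)).mul
      ((continuous_dbarDir hf _).norm.pow 2).measurable).ennreal_ofReal
  -- The third term of the slicing lemma is switched off by the empty set and a zero coefficient.
  have h := lintegral_pi_le_of_slices hQ i (m r₁) (m r₂) ((m r₂).diff (m r₁)) MeasurableSet.empty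
    (c₁ := ENNReal.ofReal C) (c₂ := ENNReal.ofReal C) (c₃ := 0) hF₀ hF₁ hF₀
    (measurable_const (a := 0)) fun z hz ↦ by
      simp only [lintegral_zero, mul_zero, add_zero]
      by_cases h0 : ∀ j ∈ S, j ≠ i → z j ≠ 0
      · exact H f hf hfa z fun j hj hji ↦
          ⟨h0 j hj hji, mem_ball_zero_iff.1 (hQS j hj (hz j hji))⟩
      -- Slices inside another hyperplane of the divisor carry no mass, because `f` vanishes near
      -- that hyperplane.
      · push Not at h0
        obtain ⟨j, hj, hji, hj0⟩ := h0
        obtain ⟨a, ha, hfa⟩ := hfa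
        have h7 : ∀ t, f (Function.update z i t) = 0 := fun t ↦
          hfa _ j hj (by rw [Function.update_of_ne hji, hj0, norm_zero]; exact ha.le)
        simp [h7]
  simpa using h

end SlowWeights

/-! ### Reduction of logarithmic type weights to the model weight -/

section LogSingularities

open Filter Topology

variable {n : ℕ}

/-- The relation forces `Y ≤ X ≤ 3 Y`. The factor 2 is the one in the exponent `2 kᵢ`, and `ψ`
collects everything that stays bounded. -/
theorem abs_log_sub_log_le {X Y B ψ : ℝ} (hX : X = ψ + 2 * (Y - 1)) (hψ : |ψ| ≤ B)
    (hY : B + 2 ≤ Y) : |Real.log X - Real.log Y| ≤ Real.log 3 := by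
  have hB := (abs_nonneg ψ).trans hψ
  have h1 := abs_le.1 hψ
  have hY0 : 0 < Y := by linarith
  have hXY : Y ≤ X := by linarith
  have hX0 : 0 < X := by linarith
  have h2 := Real.log_le_log hY0 hXY
  have h3 : Real.log X ≤ Real.log (3 * Y) := Real.log_le_log hX0 (by linarith)
  rw [Real.log_mul (by norm_num) hY0.ne'] at h3
  rw [abs_of_nonneg (by linarith)]
  linarith

/-- If no coordinate that vanishes at `c` enters with `k ≠ 0`, the argument of the logarithm is
continuous and positive at `c` and the model is `log 1`. Otherwise both arguments tend to infinity
near `c`, and the bounded part `ψ` of the argument, which includes the coordinates that do not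
vanish at `c`, becomes negligible. -/
theorem eventually_abs_log_sub_log_le {c : Fin n → ℂ} {ϕ : (Fin n → ℂ) → ℝ}
    (hϕ : ContinuousAt ϕ c) (I : Finset (Fin n)) (k : Fin n → ℕ)
    (hpos : ∏ i ∈ I, ‖c i‖ ^ (2 * k i) ≠ 0 →
      0 < ϕ c - Real.log (∏ i ∈ I, ‖c i‖ ^ (2 * k i))) :
    ∃ M, 0 ≤ M ∧ ∀ᶠ z in 𝓝 c, (∀ l ∈ I, c l = 0 → z l ≠ 0) →
      |Real.log (ϕ z - Real.log (∏ i ∈ I, ‖z i‖ ^ (2 * k i))) -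
        Real.log (1 + ∑ l ∈ I with c l = 0, k l * -Real.log ‖z l‖)| ≤ M := by
  set ψ : (Fin n → ℂ) → ℝ := fun z ↦
    ϕ z - ∑ i ∈ I with c i ≠ 0, (2 * k i) * Real.log ‖z i‖ with hψ
  have hψc : ContinuousAt ψ c := by
    refine hϕ.sub (tendsto_finsetSum _ fun i hi ↦ ContinuousAt.const_mul ?_ _)
    exact (continuous_apply i).norm.continuousAt.log
      (norm_ne_zero_iff.2 (Finset.mem_filter.1 hi).2)
  have hne : ∀ᶠ z in 𝓝 c, ∀ i, c i ≠ 0 → z i ≠ 0 := eventually_all.2 fun i ↦ by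
    by_cases hi : c i = 0
    · exact Eventually.of_forall fun z h ↦ absurd hi h
    · exact ((continuous_apply i).continuousAt.eventually_ne hi).mono fun z h _ ↦ h
  have hX : ∀ z : Fin n → ℂ, (∀ i, c i ≠ 0 → z i ≠ 0) → (∀ l ∈ I, c l = 0 → z l ≠ 0) →
      ϕ z - Real.log (∏ i ∈ I, ‖z i‖ ^ (2 * k i)) =
        ψ z + 2 * (1 + ∑ l ∈ I with c l = 0, k l * -Real.log ‖z l‖ - 1) := by
    intro z h1 h2
    have h3 : ∀ i ∈ I, ‖z i‖ ^ (2 * k i) ≠ 0 := fun i hi ↦ by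
      refine pow_ne_zero _ (norm_ne_zero_iff.2 ?_)
      by_cases h0 : c i = 0
      · exact h2 i hi h0
      · exact h1 i h0
    rw [Real.log_prod h3, ← Finset.sum_filter_add_sum_filter_not I (fun i ↦ c i = 0), hψ]
    simp only [Real.log_pow, Nat.cast_mul, Nat.cast_ofNat, mul_neg, Finset.sum_neg_distrib,
      mul_assoc, ← Finset.mul_sum]
    ring
  by_cases hk : ∀ l ∈ I, c l = 0 → k l = 0
  · have hc0 : ∏ i ∈ I, ‖c i‖ ^ (2 * k i) ≠ 0 := by
      refine Finset.prod_ne_zero_iff.2 fun i hi ↦ ?_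
      by_cases h0 : c i = 0
      · simp [hk i hi h0]
      · exact pow_ne_zero _ (norm_ne_zero_iff.2 h0)
    have hsum : ∀ z : Fin n → ℂ, ∑ l ∈ I with c l = 0, (k l : ℝ) * -Real.log ‖z l‖ = 0 := fun z ↦
      Finset.sum_eq_zero fun l hl ↦ by
        have h1 := Finset.mem_filter.1 hl
        simp [hk l h1.1 h1.2]
    have hcont : ContinuousAt (fun z : Fin n → ℂ ↦
        Real.log (ϕ z - Real.log (∏ i ∈ I, ‖z i‖ ^ (2 * k i)))) c := by
      refine ContinuousAt.log (hϕ.sub (ContinuousAt.log ?_ hc0)) (hpos hc0).ne'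
      exact tendsto_finsetProd _ fun i _ ↦ ((continuous_apply i).norm.pow _).continuousAt
    set v := Real.log (ϕ c - Real.log (∏ i ∈ I, ‖c i‖ ^ (2 * k i))) with hv
    refine ⟨|v| + 1, by positivity, ?_⟩
    filter_upwards [hcont.abs.eventually (Iio_mem_nhds (lt_add_one |v|))] with z hz _
    rw [hsum, add_zero, Real.log_one, sub_zero]
    exact le_of_lt hz
  · push Not at hk
    obtain ⟨l, hl, hcl, hkl⟩ := hk
    refine ⟨Real.log 3, Real.log_nonneg (by norm_num), ?_⟩
    set B := |ψ c| + 1 with hB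
    have hB0 : 0 ≤ B := by positivity
    have hsmall : ∀ᶠ z in 𝓝 c, ∀ j, c j = 0 → ‖z j‖ < Real.exp (-(B + 2)) :=
      eventually_all.2 fun j ↦ by
        by_cases hj : c j = 0
        · have h1 : ContinuousAt (fun z : Fin n → ℂ ↦ ‖z j‖) c :=
            (continuous_apply j).norm.continuousAt
          have h2 : ‖c j‖ < Real.exp (-(B + 2)) := by simp [hj, Real.exp_pos]
          filter_upwards [h1.eventually (Iio_mem_nhds h2)] with z hz _ using hz
        · exact Eventually.of_forall fun z h ↦ absurd h hj
    filter_upwards [hψc.abs.eventually (Iio_mem_nhds (lt_add_one |ψ c|)), hne, hsmall]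
      with z h1 h2 h3 h4
    refine abs_log_sub_log_le (hX z h2 h4) (le_of_lt h1) ?_
    have h5 : ∀ j ∈ I, c j = 0 → B + 2 ≤ -Real.log ‖z j‖ := fun j hj hcj ↦ by
      have h6 := Real.log_le_log (norm_pos_iff.2 (h4 j hj hcj)) (h3 j hcj).le
      rw [Real.log_exp] at h6
      linarith
    have h7 : (k l : ℝ) * -Real.log ‖z l‖ ≤ ∑ l ∈ I with c l = 0, k l * -Real.log ‖z l‖ := by
      refine Finset.single_le_sum (f := fun l ↦ (k l : ℝ) * -Real.log ‖z l‖) (fun j hj ↦ ?_)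
        (Finset.mem_filter.2 ⟨hl, hcl⟩)
      have h8 := Finset.mem_filter.1 hj
      have h9 := h5 j h8.1 h8.2
      have : (0 : ℝ) ≤ k j := Nat.cast_nonneg _
      exact mul_nonneg this (by linarith)
    have h10 : (1 : ℝ) ≤ k l := by exact_mod_cast Nat.one_le_iff_ne_zero.2 hkl
    have h11 := h5 l hl hcl
    nlinarith

variable {X : Type*} [TopologicalSpace X] [ChartedSpace (Fin n → ℂ) X]
  {L : X → Type*} [TopologicalSpace (TotalSpace ℂ L)] [∀ x, AddCommGroup (L x)]
  [∀ x, Module ℂ (L x)] [∀ x, TopologicalSpace (L x)] [FiberBundle ℂ L] [VectorBundle ℂ ℂ L]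

/-- The coordinate set around `x` may contain hyperplanes of the divisor that miss `x`. Only those
through `x` are kept in `S`; the others and the smooth functions `ϕ`, `χ` change the weight by a
bounded factor near `x`. -/
theorem HasLogSing.exists_coord {h : ∀ x, L x → ℝ} {E : Set X} (hlog : HasLogSing (n := n) h E)
    (hh : IsFiberMetricOn h Eᶜ) (x : X) :
    ∃ φ : OpenPartialHomeomorph X (Fin n → ℂ), IsCoord φ ∧ x ∈ φ.source ∧
      φ.source ⊆ (trivializationAt ℂ L x).baseSet ∧
      ∃ (S : Finset (Fin n)) (s : Finset (Finset (Fin n))) (b : Finset (Fin n) → ℝ)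
        (k : Fin n → ℕ) (M : ℝ), (∀ j ∈ S, φ x j = 0) ∧ (∀ I ∈ s, 0 ≤ b I) ∧
        (∀ i ∈ S, k i ≠ 0 → ∑ I ∈ s with i ∈ I, b I < 1) ∧
        (∀ᶠ z in 𝓝 (φ x), φ.symm z ∈ E ↔ ∃ j ∈ S, z j = 0) ∧
        ∀ᶠ z in 𝓝 (φ x), φ.symm z ∉ E →
          Real.exp (-M) * logWeight S s b k z ≤
            h (φ.symm z) ((trivializationAt ℂ L x).symm (φ.symm z) 1) ∧
          h (φ.symm z) ((trivializationAt ℂ L x).symm (φ.symm z) 1) ≤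
            Real.exp M * logWeight S s b k z := by
  obtain ⟨φ, hφ, hx, hsub, S, hE, b, k, ϕ, χ, hχ, hI, hk, hw⟩ := hlog x
  have hz : φ x ∈ φ.target := φ.map_source hx
  set c := φ x with hc
  have hnhds := φ.open_target.mem_nhds hz
  have hterm : ∀ I : Finset (Fin n), ∃ M, 0 ≤ M ∧ (I ∈ S.powerset.erase ∅ → ∀ᶠ z in 𝓝 c,
      (∀ l ∈ I, c l = 0 → z l ≠ 0) →
      |Real.log (ϕ I z - Real.log (∏ i ∈ I, ‖z i‖ ^ (2 * k i))) -
        Real.log (1 + ∑ l ∈ I with c l = 0, k l * -Real.log ‖z l‖)| ≤ M) := by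
    intro I
    by_cases hIS : I ∈ S.powerset.erase ∅
    · obtain ⟨-, -, h1, h2⟩ := hI I hIS
      obtain ⟨M, hM, h3⟩ := eventually_abs_log_sub_log_le (h1.continuousOn.continuousAt hnhds) I k
        (h2 c hz)
      exact ⟨M, hM, fun _ ↦ h3⟩
    · exact ⟨0, le_rfl, fun h ↦ absurd h hIS⟩
  choose M hM hterm using hterm
  have hterm' := (eventually_all_finset (S.powerset.erase ∅)).2 fun I hI ↦ hterm I hI
  have hχc := (hχ.continuousOn.continuousAt hnhds).abs.eventually
    (Iio_mem_nhds (lt_add_one |χ c|))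
  have hne : ∀ᶠ z in 𝓝 c, ∀ i, c i ≠ 0 → z i ≠ 0 := eventually_all.2 fun i ↦ by
    by_cases hi : c i = 0
    · exact Eventually.of_forall fun z h ↦ absurd hi h
    · exact ((continuous_apply i).continuousAt.eventually_ne hi).mono fun z h _ ↦ h
  have hE' : ∀ᶠ z in 𝓝 c, φ.symm z ∈ E ↔ ∃ j ∈ S.filter fun j ↦ c j = 0, z j = 0 := by
    filter_upwards [hne, hnhds] with z h1 h2
    rw [hE _ (φ.map_target h2), φ.right_inv h2, Finset.prod_eq_zero_iff]
    constructor
    · rintro ⟨j, hj, h0⟩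
      exact ⟨j, Finset.mem_filter.2 ⟨hj, by_contra fun h ↦ h1 j h h0⟩, h0⟩
    · rintro ⟨j, hj, h0⟩
      exact ⟨j, (Finset.mem_filter.1 hj).1, h0⟩
  refine ⟨φ, hφ, hx, hsub, S.filter fun j ↦ c j = 0, S.powerset.erase ∅, b, k,
    ∑ I ∈ S.powerset.erase ∅, b I * M I + (|χ c| + 1), fun j hj ↦ (Finset.mem_filter.1 hj).2,
    fun I hIS ↦ (hI I hIS).1, fun i hi hki ↦ ?_, hE', ?_⟩
  -- The empty set is irrelevant here, because it does not contain `i`.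
  · refine lt_of_eq_of_lt (Finset.sum_congr ?_ fun _ _ ↦ rfl)
      (hk i (Finset.mem_filter.1 hi).1 hki)
    ext I
    simp only [Finset.mem_filter, Finset.mem_erase]
    exact ⟨fun h ↦ ⟨h.1.2, h.2⟩, fun h ↦ ⟨⟨fun h0 ↦ by simp [h0] at h, h.1⟩, h.2⟩⟩
  · filter_upwards [hterm', hχc, hE', hnhds] with z h1 h2 h3 h4 h5
    have hys := φ.map_target h4
    have hpos := hh.symm_pos h5 (hsub hys)
    set η := h (φ.symm z) ((trivializationAt ℂ L x).symm (φ.symm z) 1) with hη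
    have h6 := hw _ hys h5
    rw [localWeight, ← hη, φ.right_inv h4] at h6
    have h7 : ∀ I ∈ S.powerset.erase ∅,
        |b I * Real.log (ϕ I z - Real.log (∏ i ∈ I, ‖z i‖ ^ (2 * k i))) -
          b I * Real.log (1 + ∑ l ∈ I ∩ (S.filter fun j ↦ c j = 0), k l * -Real.log ‖z l‖)| ≤
          b I * M I := fun I hIS ↦ by
      have hIsub : I ⊆ S := Finset.mem_powerset.1 (Finset.mem_erase.1 hIS).2
      have h8 : I ∩ (S.filter fun j ↦ c j = 0) = I.filter fun j ↦ c j = 0 := by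
        ext j
        simp only [Finset.mem_inter, Finset.mem_filter]
        exact ⟨fun h ↦ ⟨h.1, h.2.2⟩, fun h ↦ ⟨h.1, hIsub h.1, h.2⟩⟩
      rw [← mul_sub, abs_mul, abs_of_nonneg (hI I hIS).1, h8]
      exact mul_le_mul_of_nonneg_left (h1 I hIS fun l hl hcl h0 ↦ h5 (h3.2
        ⟨l, Finset.mem_filter.2 ⟨hIsub hl, hcl⟩, h0⟩)) (hI I hIS).1
    have h9 : |Real.log η - ∑ I ∈ S.powerset.erase ∅, b I * Real.log
        (1 + ∑ l ∈ I ∩ (S.filter fun j ↦ c j = 0), k l * -Real.log ‖z l‖)| ≤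
        ∑ I ∈ S.powerset.erase ∅, b I * M I + (|χ c| + 1) := by
      have h10 : Real.log η = ∑ I ∈ S.powerset.erase ∅,
          b I * Real.log (ϕ I z - Real.log (∏ i ∈ I, ‖z i‖ ^ (2 * k i))) - χ z := by linarith
      rw [h10, sub_right_comm, ← Finset.sum_sub_distrib]
      refine (abs_sub _ _).trans (add_le_add ?_ (le_of_lt h2))
      exact (Finset.abs_sum_le_sum_abs _ _).trans (Finset.sum_le_sum h7)
    have h11 := abs_le.1 h9
    rw [logWeight, ← Real.exp_add, ← Real.exp_add, ← Real.exp_log hpos]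
    exact ⟨Real.exp_le_exp.2 (by linarith), Real.exp_le_exp.2 (by linarith)⟩

end LogSingularities

/-! ### Pointwise norms of forms in the rescaled coordinate frame -/

section PointwiseNorms

open Filter Topology

theorem norm_sq_alternating_scaledFrame {n p : ℕ} (α : (Fin n → ℂ) [⋀^Fin p]→ₗ[ℂ] ℂ)
    {m : Fin n → ℝ} (hm : ∀ j, 0 ≤ m j) (J : Fin p → Fin n) :
    ‖α fun a ↦ scaledFrame m (J a)‖ ^ 2 =
      (∏ a, m (J a)) * ‖α fun a ↦ Pi.single (J a) 1‖ ^ 2 := by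
  have h1 : α (fun a ↦ scaledFrame m (J a)) =
      (∏ a, (Real.sqrt (m (J a)) : ℂ)) • α fun a ↦ Pi.single (J a) 1 :=
    α.toMultilinearMap.map_smul_univ (fun a ↦ (Real.sqrt (m (J a)) : ℂ))
      fun a ↦ (Pi.single (J a) 1 : Fin n → ℂ)
  rw [h1, norm_smul, mul_pow, norm_prod, ← Finset.prod_pow]
  congr 1
  refine Finset.prod_congr rfl fun a _ ↦ ?_
  rw [Complex.norm_real, Real.norm_eq_abs, sq_abs, Real.sq_sqrt (hm _)]

variable {n p : ℕ} {X : Type*} [TopologicalSpace X] [ChartedSpace (Fin n → ℂ) X]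
  [IsManifold 𝓘(ℂ, Fin n → ℂ) ω X]
  {L : X → Type*} [TopologicalSpace (TotalSpace ℂ L)] [∀ x, AddCommGroup (L x)]
  [∀ x, Module ℂ (L x)] [∀ x, TopologicalSpace (L x)] [FiberBundle ℂ L] [VectorBundle ℂ ℂ L]
  {e : Trivialization ℂ (TotalSpace.proj : TotalSpace ℂ L → X)} [MemTrivializationAtlas e]
  {φ : OpenPartialHomeomorph X (Fin n → ℂ)} {z : Fin n → ℂ}
  {P : ∀ x : X, TangentSpace 𝓘(ℂ, Fin n → ℂ) x → TangentSpace 𝓘(ℂ, Fin n → ℂ) x → ℂ}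
  {H : (Fin n → ℂ) →ₗ⋆[ℂ] (Fin n → ℂ) →ₗ[ℂ] ℂ} {m : Fin n → ℝ} {c C : ℝ}
  {h : ∀ x, L x → ℝ} {A : Set X} {τ : LForm n L p}

/-- Every unitary frame has bounded coefficients in the frame `√m_j ∂/∂z_j`, and on the latter the
form takes the values `∏ √m_j` times the coefficients. -/
theorem formNormSq_le (hφ : IsCoord φ) (hz : z ∈ φ.target) (he : φ.symm z ∈ e.baseSet)
    (hh : IsFiberMetricOn h A) (hA : φ.symm z ∈ A)
    (hH : ∀ v w, H v w = P (φ.symm z) (coordVec φ z v) (coordVec φ z w))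
    (hcmp : IsComparable H m c C) :
    formNormSq P h τ (φ.symm z) ≤ ENNReal.ofReal (frameConst n p c⁻¹ *
      (h (φ.symm z) (e.symm (φ.symm z) 1) * ∑ J : Fin p ↪o Fin n,
        (∏ a, m (J a)) * ‖coeff τ φ e (fun a ↦ Pi.single (J a) 1) z‖ ^ 2)) := by
  set η := h (φ.symm z) (e.symm (φ.symm z) 1) with hη
  have hη0 : 0 ≤ η := (hh.symm_pos hA he).le
  refine iSup₂_le fun V hV ↦ ?_
  set v : Fin n → Fin n → ℂ := fun a ↦ (coordEquiv hφ hz).symm (V a) with hv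
  have hvV : ∀ a, coordVec φ z (v a) = V a := fun a ↦ (coordEquiv hφ hz).apply_symm_apply (V a)
  have hvH : ∀ a b, H (v a) (v b) = if a = b then 1 else 0 := fun a b ↦ by
    rw [hH, hvV, hvV]; exact hV a b
  have h1 : ∀ J : Fin p ↪o Fin n, h (φ.symm z) (τ (φ.symm z) fun a ↦ V (J a)) =
      ‖coeffAlt τ φ e z fun a ↦ v (J a)‖ ^ 2 * η := fun J ↦ by
    rw [hh.eq_mul hA he, coeffAlt_apply τ he, coeff]
    simp only [hvV]
    rfl
  simp only [h1]
  rw [← ENNReal.ofReal_sum_of_nonneg fun J _ ↦ by positivity, ← Finset.sum_mul]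
  refine ENNReal.ofReal_le_ofReal ?_
  have h2 := sum_norm_sq_alternating_le (coeffAlt τ φ e z) (scaledFrame m) v _
    (hcmp.norm_frame_sq_le hvH) (hcmp.frame_eq_sum v)
  simp only [norm_sq_alternating_scaledFrame _ fun j ↦ (hcmp.pos j).le] at h2
  simp only [coeffAlt_apply τ he] at h2 ⊢
  calc _ ≤ _ := mul_le_mul_of_nonneg_right h2 hη0
    _ = _ := by ring

omit [IsManifold 𝓘(ℂ, Fin n → ℂ) ω X] in
-- One unitary frame is enough for a lower bound of the supremum; the rescaled frame has bounded
-- coefficients in it.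
theorem le_formNormSq (he : φ.symm z ∈ e.baseSet)
    (hh : IsFiberMetricOn h A) (hA : φ.symm z ∈ A)
    (hH : ∀ v w, H v w = P (φ.symm z) (coordVec φ z v) (coordVec φ z w))
    (hcmp : IsComparable H m c C) :
    ENNReal.ofReal (h (φ.symm z) (e.symm (φ.symm z) 1) * ∑ J : Fin p ↪o Fin n,
        (∏ a, m (J a)) * ‖coeff τ φ e (fun a ↦ Pi.single (J a) 1) z‖ ^ 2) ≤
      ENNReal.ofReal (frameConst n p C) * formNormSq P h τ (φ.symm z) := by
  set η := h (φ.symm z) (e.symm (φ.symm z) 1) with hη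
  have hη0 : 0 ≤ η := (hh.symm_pos hA he).le
  obtain ⟨v, hv⟩ := hcmp.exists_frame
  have hV : IsUnitaryFrame (P (φ.symm z)) fun a ↦ coordVec φ z (v a) := fun a b ↦ by
    rw [← hH]; exact hv a b
  have h0 : ∑ J : Fin p ↪o Fin n, ENNReal.ofReal (h (φ.symm z) (τ (φ.symm z)
      fun a ↦ coordVec φ z (v (J a)))) ≤ formNormSq P h τ (φ.symm z) :=
    le_iSup₂_of_le (fun a ↦ coordVec φ z (v a)) hV le_rfl
  refine le_trans ?_ (mul_le_mul_right h0 _)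
  have h1 : ∀ J : Fin p ↪o Fin n, h (φ.symm z) (τ (φ.symm z) fun a ↦ coordVec φ z (v (J a))) =
      ‖coeffAlt τ φ e z fun a ↦ v (J a)‖ ^ 2 * η := fun J ↦ by
    rw [hh.eq_mul hA he, coeffAlt_apply τ he, coeff]
  simp only [h1]
  rw [← ENNReal.ofReal_sum_of_nonneg fun J _ ↦ by positivity, ← Finset.sum_mul,
    ← ENNReal.ofReal_mul (frameConst_nonneg n p hcmp.hC.le)]
  refine ENNReal.ofReal_le_ofReal ?_
  have h2 := sum_norm_sq_alternating_le (coeffAlt τ φ e z) v (scaledFrame m)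
    (fun j a ↦ H (v a) (scaledFrame m j)) (fun j a ↦ hcmp.norm_coeff_sq_le hv a j)
    fun j ↦ IsComparable.frame_expansion hv _
  simp only [norm_sq_alternating_scaledFrame _ fun j ↦ (hcmp.pos j).le] at h2
  simp only [coeffAlt_apply τ he] at h2 ⊢
  calc _ ≤ η * _ := mul_le_mul_of_nonneg_left h2 hη0
    _ = _ := by ring

/-- The components of `∂̄τ` in a fixed `(0,1)`-direction as an alternating map. -/
noncomputable def dbarCoeffAlt (hτ : IsSmoothForm τ) (hφ : IsCoord φ) (hz : z ∈ φ.target)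
    (he : φ.symm z ∈ e.baseSet) (w : Fin n → ℂ) : (Fin n → ℂ) [⋀^Fin p]→ₗ[ℂ] ℂ where
  toFun u := dbarDir (coeff τ φ e u) z w
  map_update_add' {inst} u i x y := by
    have hd : ∀ u, DifferentiableAt ℝ (coeff τ φ e u) z := fun u ↦
      (hτ.contDiffAt hφ hz he u).differentiableAt (by simp)
    rw [← dbarDir_add (hd _) (hd _)]
    refine dbarDir_congr ?_ w
    filter_upwards [eventually_symm_mem hz e.open_baseSet he] with ζ hζ
    rw [← coeffAlt_apply τ hζ.2, ← coeffAlt_apply τ hζ.2, ← coeffAlt_apply τ hζ.2]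
    exact (coeffAlt τ φ e ζ).map_update_add u i x y
  map_update_smul' {inst} u i a x := by
    have hd : DifferentiableAt ℝ (coeff τ φ e (Function.update u i x)) z :=
      (hτ.contDiffAt hφ hz he _).differentiableAt (by simp)
    rw [smul_eq_mul, ← dbarDir_mul_of_differentiableAt
      (differentiableAt_const (𝕜 := ℂ) (x := z) a) hd]
    refine dbarDir_congr ?_ w
    filter_upwards [eventually_symm_mem hz e.open_baseSet he] with ζ hζ
    rw [← coeffAlt_apply τ hζ.2, ← coeffAlt_apply τ hζ.2]
    exact (coeffAlt τ φ e ζ).map_update_smul u i a x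
  map_eq_zero_of_eq' u i j hij hne := by
    have h0 : coeff τ φ e u =ᶠ[𝓝 z] fun _ ↦ 0 := by
      filter_upwards [eventually_symm_mem hz e.open_baseSet he] with ζ hζ
      rw [← coeffAlt_apply τ hζ.2]
      exact (coeffAlt τ φ e ζ).map_eq_zero_of_eq u hij hne
    rw [dbarDir_congr h0, dbarDir_const]

omit [IsManifold 𝓘(ℂ, Fin n → ℂ) ω X] in
theorem dbarCoeffAlt_apply (hτ : IsSmoothForm τ) (hφ : IsCoord φ) (hz : z ∈ φ.target)
    (he : φ.symm z ∈ e.baseSet) (w : Fin n → ℂ) (u : Fin p → Fin n → ℂ) :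
    dbarCoeffAlt hτ hφ hz he w u = dbarDir (coeff τ φ e u) z w := rfl

/-- For a fixed `(0,1)`-direction the values of `∂̄τ` form an alternating map, to which the
comparison of frames applies. The direction itself is expanded conjugate-linearly, which costs the
additional factor `n² C`. -/
theorem le_dbarNormSq [ContMDiffVectorBundle ω ℂ L 𝓘(ℂ, Fin n → ℂ)] (hτ : IsSmoothForm τ)
    (hφ : IsCoord φ) (hz : z ∈ φ.target) (he : φ.symm z ∈ e.baseSet)
    (hh : IsFiberMetricOn h A) (hA : φ.symm z ∈ A)
    (hH : ∀ v w, H v w = P (φ.symm z) (coordVec φ z v) (coordVec φ z w))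
    (hcmp : IsComparable H m c C) :
    ENNReal.ofReal (h (φ.symm z) (e.symm (φ.symm z) 1) * ∑ b : Fin n, ∑ J : Fin p ↪o Fin n,
        m b * ((∏ a, m (J a)) *
          ‖dbarDir (coeff τ φ e (fun a ↦ Pi.single (J a) 1)) z (Pi.single b 1)‖ ^ 2)) ≤
      ENNReal.ofReal (n ^ 2 * C * frameConst n p C) * dbarNormSq P h τ (φ.symm z) := by
  set η := h (φ.symm z) (e.symm (φ.symm z) 1) with hη
  have hη0 : 0 ≤ η := (hh.symm_pos hA he).le
  have hC := hcmp.hC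
  have hfC := frameConst_nonneg n p hC.le
  obtain ⟨v, hv⟩ := hcmp.exists_frame
  have hV : IsUnitaryFrame (P (φ.symm z)) fun a ↦ coordVec φ z (v a) := fun a b ↦ by
    rw [← hH]; exact hv a b
  have h0 : ∑ b : Fin n, ∑ J : Fin p ↪o Fin n, ENNReal.ofReal (h (φ.symm z)
      (dbarForm τ (φ.symm z) (coordVec φ z (v b)) fun a ↦ coordVec φ z (v (J a)))) ≤
      dbarNormSq P h τ (φ.symm z) :=
    le_iSup₂_of_le (fun a ↦ coordVec φ z (v a)) hV le_rfl
  refine le_trans ?_ (mul_le_mul_right h0 _)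
  have h1 : ∀ (b : Fin n) (J : Fin p ↪o Fin n), h (φ.symm z)
      (dbarForm τ (φ.symm z) (coordVec φ z (v b)) fun a ↦ coordVec φ z (v (J a))) =
      ‖dbarCoeffAlt hτ hφ hz he (v b) fun a ↦ v (J a)‖ ^ 2 * η := fun b J ↦ by
    rw [hh.eq_mul hA he, dbarForm_coordVec hτ hφ hz he, dbarCoeffAlt_apply]
  simp only [h1]
  have h2 : ∀ b, ∑ J : Fin p ↪o Fin n, ENNReal.ofReal
      (‖dbarCoeffAlt hτ hφ hz he (v b) fun a ↦ v (J a)‖ ^ 2 * η) = ENNReal.ofReal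
      (∑ J : Fin p ↪o Fin n, ‖dbarCoeffAlt hτ hφ hz he (v b) fun a ↦ v (J a)‖ ^ 2 * η) := fun b ↦
    (ENNReal.ofReal_sum_of_nonneg fun J _ ↦ by positivity).symm
  simp only [h2]
  rw [← ENNReal.ofReal_sum_of_nonneg fun b _ ↦ by positivity,
    ← ENNReal.ofReal_mul (by positivity)]
  refine ENNReal.ofReal_le_ofReal ?_
  simp only [← Finset.sum_mul]
  -- the comparison in the `(0,1)`-directions
  have h3 : ∀ (b : Fin n) (J : Fin p ↪o Fin n),
      m b * ((∏ a, m (J a)) *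
        ‖dbarDir (coeff τ φ e (fun a ↦ Pi.single (J a) 1)) z (Pi.single b 1)‖ ^ 2) ≤
      n * C * ∑ a, ‖dbarCoeffAlt hτ hφ hz he (v a) fun i ↦ scaledFrame m (J i)‖ ^ 2 := by
    intro b J
    have h4 : m b * ((∏ a, m (J a)) *
        ‖dbarDir (coeff τ φ e (fun a ↦ Pi.single (J a) 1)) z (Pi.single b 1)‖ ^ 2) =
        ‖dbarCoeffAlt hτ hφ hz he (scaledFrame m b) fun i ↦ scaledFrame m (J i)‖ ^ 2 := by
      rw [norm_sq_alternating_scaledFrame _ fun j ↦ (hcmp.pos j).le, dbarCoeffAlt_apply,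
        scaledFrame, dbarDir_smul_right, norm_mul, mul_pow, RCLike.norm_conj, Complex.norm_real,
        Real.norm_eq_abs, sq_abs, Real.sq_sqrt (hcmp.pos b).le]
      ring
    rw [h4]
    have h5 : dbarCoeffAlt hτ hφ hz he (scaledFrame m b) (fun i ↦ scaledFrame m (J i)) =
        ∑ a, (starRingEnd ℂ) (H (v a) (scaledFrame m b)) *
          dbarCoeffAlt hτ hφ hz he (v a) (fun i ↦ scaledFrame m (J i)) := by
      simp only [dbarCoeffAlt_apply]
      conv_lhs => rw [IsComparable.frame_expansion hv (scaledFrame m b)]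
      rw [dbarDir_sum_right]
    rw [h5]
    calc ‖∑ a, (starRingEnd ℂ) (H (v a) (scaledFrame m b)) *
          dbarCoeffAlt hτ hφ hz he (v a) (fun i ↦ scaledFrame m (J i))‖ ^ 2
        ≤ (∑ a, ‖(starRingEnd ℂ) (H (v a) (scaledFrame m b)) *
          dbarCoeffAlt hτ hφ hz he (v a) (fun i ↦ scaledFrame m (J i))‖) ^ 2 := by
          gcongr; exact norm_sum_le _ _
      _ ≤ n * ∑ a, ‖(starRingEnd ℂ) (H (v a) (scaledFrame m b)) *
          dbarCoeffAlt hτ hφ hz he (v a) (fun i ↦ scaledFrame m (J i))‖ ^ 2 := by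
          simpa using sq_sum_le_card_mul_sum_sq (s := Finset.univ) (f := fun a ↦
            ‖(starRingEnd ℂ) (H (v a) (scaledFrame m b)) *
              dbarCoeffAlt hτ hφ hz he (v a) (fun i ↦ scaledFrame m (J i))‖)
      _ ≤ n * ∑ a, C * ‖dbarCoeffAlt hτ hφ hz he (v a) (fun i ↦ scaledFrame m (J i))‖ ^ 2 := by
          gcongr with a
          rw [norm_mul, mul_pow, RCLike.norm_conj]
          gcongr
          exact hcmp.norm_coeff_sq_le hv a b
      _ = _ := by rw [← Finset.mul_sum]; ring
  have h6 : ∀ a, ∑ J : Fin p ↪o Fin n,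
      ‖dbarCoeffAlt hτ hφ hz he (v a) fun i ↦ scaledFrame m (J i)‖ ^ 2 ≤ frameConst n p C *
      ∑ J : Fin p ↪o Fin n, ‖dbarCoeffAlt hτ hφ hz he (v a) fun i ↦ v (J i)‖ ^ 2 := fun a ↦
    sum_norm_sq_alternating_le (dbarCoeffAlt hτ hφ hz he (v a)) v (scaledFrame m)
      (fun j a ↦ H (v a) (scaledFrame m j)) (fun j a ↦ hcmp.norm_coeff_sq_le hv a j)
      fun j ↦ IsComparable.frame_expansion hv _
  have h7 : ∑ b : Fin n, ∑ J : Fin p ↪o Fin n, m b * ((∏ a, m (J a)) *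
        ‖dbarDir (coeff τ φ e (fun a ↦ Pi.single (J a) 1)) z (Pi.single b 1)‖ ^ 2) ≤
      n ^ 2 * C * frameConst n p C * ∑ a, ∑ J : Fin p ↪o Fin n,
        ‖dbarCoeffAlt hτ hφ hz he (v a) fun i ↦ v (J i)‖ ^ 2 := by
    calc _ ≤ ∑ b : Fin n, ∑ J : Fin p ↪o Fin n, n * C *
          ∑ a, ‖dbarCoeffAlt hτ hφ hz he (v a) fun i ↦ scaledFrame m (J i)‖ ^ 2 :=
          Finset.sum_le_sum fun b _ ↦ Finset.sum_le_sum fun J _ ↦ h3 b J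
      _ = n ^ 2 * C * ∑ a, ∑ J : Fin p ↪o Fin n,
          ‖dbarCoeffAlt hτ hφ hz he (v a) fun i ↦ scaledFrame m (J i)‖ ^ 2 := by
          rw [Finset.sum_const, Finset.card_univ, Fintype.card_fin, nsmul_eq_mul,
            ← Finset.mul_sum, Finset.sum_comm]
          ring
      _ ≤ n ^ 2 * C * ∑ a, frameConst n p C * ∑ J : Fin p ↪o Fin n,
          ‖dbarCoeffAlt hτ hφ hz he (v a) fun i ↦ v (J i)‖ ^ 2 := by
          gcongr with a
          exact h6 a
      _ = _ := by rw [← Finset.mul_sum]; ring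
  calc _ ≤ η * _ := mul_le_mul_of_nonneg_left h7 hη0
    _ = _ := by ring

end PointwiseNorms

/-! ### Integrals against densities that are only bounded -/

section Integrals

variable {α : Type*} [MeasurableSpace α] {μ : Measure α} {Q : Set α} {d F G : α → ℝ≥0∞}
  {g : α → ℝ} {C : ℝ≥0∞}

/-- Neither the density `d` nor the integrand `F` is known to be measurable. The density is first
replaced by the finite measurable bound `g`, for which the product formula holds with arbitrary
integrands. -/
theorem lintegral_withDensity_le_mul (hQ : MeasurableSet Q) (hg : Measurable g) (hC : C ≠ ⊤)
    (hd : ∀ z ∈ Q, d z ≤ ENNReal.ofReal (g z))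
    (hF : ∀ z ∈ Q, ENNReal.ofReal (g z) * F z ≤ C * G z) :
    ∫⁻ z, F z ∂((μ.restrict Q).withDensity d) ≤ C * ∫⁻ z in Q, G z ∂μ := by
  calc ∫⁻ z, F z ∂((μ.restrict Q).withDensity d)
      ≤ ∫⁻ z, F z ∂((μ.restrict Q).withDensity fun z ↦ ENNReal.ofReal (g z)) :=
        lintegral_mono' (withDensity_mono (ae_restrict_of_forall_mem hQ hd)) le_rfl
    _ = ∫⁻ z in Q, ENNReal.ofReal (g z) * F z ∂μ :=
        lintegral_withDensity_eq_lintegral_mul_non_measurable _ hg.ennreal_ofReal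
          (Filter.Eventually.of_forall fun _ ↦ ENNReal.ofReal_lt_top) F
    _ ≤ ∫⁻ z in Q, C * G z ∂μ := lintegral_mono_ae (ae_restrict_of_forall_mem hQ hF)
    _ = _ := lintegral_const_mul' _ _ hC

theorem le_mul_lintegral_withDensity (hQ : MeasurableSet Q) (hg : Measurable g) (hC : C ≠ ⊤)
    (hd : ∀ z ∈ Q, ENNReal.ofReal (g z) ≤ d z)
    (hF : ∀ z ∈ Q, G z ≤ C * (ENNReal.ofReal (g z) * F z)) :
    ∫⁻ z in Q, G z ∂μ ≤ C * ∫⁻ z, F z ∂((μ.restrict Q).withDensity d) := by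
  calc ∫⁻ z in Q, G z ∂μ ≤ ∫⁻ z in Q, C * (ENNReal.ofReal (g z) * F z) ∂μ :=
        lintegral_mono_ae (ae_restrict_of_forall_mem hQ hF)
    _ = C * ∫⁻ z in Q, ENNReal.ofReal (g z) * F z ∂μ := lintegral_const_mul' _ _ hC
    _ = C * ∫⁻ z, F z ∂((μ.restrict Q).withDensity fun z ↦ ENNReal.ofReal (g z)) := by
        congr 1
        exact (lintegral_withDensity_eq_lintegral_mul_non_measurable _ hg.ennreal_ofReal
          (Filter.Eventually.of_forall fun _ ↦ ENNReal.ofReal_lt_top) F).symm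
    _ ≤ _ := by
        exact mul_le_mul_right
          (lintegral_mono' (withDensity_mono (ae_restrict_of_forall_mem hQ hd)) le_rfl) C

theorem setLIntegral_diff_of_eq_zero {N : Set α} (hQ : MeasurableSet Q) (hN : MeasurableSet N)
    (h : ∀ z ∈ N, F z = 0) : ∫⁻ z in Q, F z ∂μ = ∫⁻ z in Q \ N, F z ∂μ := by
  rw [← lintegral_inter_add_sdiff F Q hN, setLIntegral_congr_fun (g := fun _ ↦ 0) (hQ.inter hN)
    fun z hz ↦ h z hz.2, lintegral_zero, zero_add]

end Integrals

/-! ### Local models and comparison constants -/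

section LocalModel

open Filter Topology

variable {n p : ℕ} {X : Type*} [TopologicalSpace X]

/-- Coordinates near `x` in which a family of masses `A` and energies `D` is comparable with the
weighted integrals of functions on `ℂⁿ` and of their `∂̄`-derivatives. -/
structure PoincareModel {𝒯 : Type*} (n p : ℕ) (E : Set X) (A : 𝒯 → Set X → ℝ≥0∞) (D : 𝒯 → ℝ≥0∞)
    (x : X) where
  chart : OpenPartialHomeomorph X (Fin n → ℂ)
  mem_source : x ∈ chart.source
  S : Finset (Fin n)
  s : Finset (Finset (Fin n))
  b : Finset (Fin n) → ℝ
  k : Fin n → ℕ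
  R : ℝ
  R_pos : 0 < R
  R_le : R ≤ Real.exp (-40)
  ball_subset : Metric.ball (chart x) R ⊆ chart.target
  eq_zero : ∀ j ∈ S, chart x j = 0
  mem_iff : ∀ z ∈ Metric.ball (chart x) R, chart.symm z ∈ E ↔ ∃ j ∈ S, z j = 0
  b_nonneg : ∀ I ∈ s, 0 ≤ b I
  b_lt : ∀ i ∈ S, k i ≠ 0 → ∑ I ∈ s with i ∈ I, b I < 1
  C : ℝ
  exists_coeff : ∀ τ, ∃ f : (Fin p ↪o Fin n) → (Fin n → ℂ) → ℂ, (∀ J, ContDiff ℝ 2 (f J)) ∧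
    (∃ a > 0, ∀ J z, ∀ j ∈ S, ‖z j‖ ≤ a → f J z = 0) ∧
    ∀ Q, MeasurableSet Q → Q ⊆ Metric.ball (chart x) R →
      A τ (chart.source ∩ chart ⁻¹' Q) ≤ ENNReal.ofReal C * ∑ J, ∫⁻ z in Q,
        ENNReal.ofReal (formWeight S s b k J z * ‖f J z‖ ^ 2) ∧
      (∀ J, ∫⁻ z in Q, ENNReal.ofReal (formWeight S s b k J z * ‖f J z‖ ^ 2) ≤
        ENNReal.ofReal C * A τ (chart.source ∩ chart ⁻¹' Q)) ∧
      ∀ J i, ∫⁻ z in Q, ENNReal.ofReal (formWeight S s b k J z * modelWeight S z i *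
        ‖dbarDir (f J) z (Pi.single i 1)‖ ^ 2) ≤ ENNReal.ofReal C * D τ

/-- The volume contributes `∏ 1/m_j` over all `j`, the norm of `dz_J` contributes `∏ m_j` over `J`;
what remains is the product in `formWeight`. -/
theorem prod_inv_mul_prod_range (J : Fin p ↪o Fin n) {m : Fin n → ℝ} (hm : ∀ j, m j ≠ 0) :
    (∏ j, (m j)⁻¹) * ∏ a, m (J a) = ∏ j with j ∉ range J, (m j)⁻¹ := by
  have h1 : ∏ j with j ∈ range J, (m j)⁻¹ = ∏ a, (m (J a))⁻¹ := by
    have : Finset.univ.filter (fun j ↦ j ∈ range J) = Finset.univ.map J.toEmbedding := by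
      ext j; simp
    rw [this, Finset.prod_map]
    rfl
  rw [← Finset.prod_filter_mul_prod_filter_not Finset.univ fun j ↦ j ∈ range J, h1,
    Finset.prod_inv_distrib, mul_comm, ← mul_assoc,
    mul_inv_cancel₀ (Finset.prod_ne_zero_iff.2 fun a _ ↦ hm _), one_mul]

variable [ChartedSpace (Fin n → ℂ) X] [IsManifold 𝓘(ℂ, Fin n → ℂ) ω X]
  {L : X → Type*} [TopologicalSpace (TotalSpace ℂ L)] [∀ x, AddCommGroup (L x)]
  [∀ x, Module ℂ (L x)] [∀ x, TopologicalSpace (L x)] [FiberBundle ℂ L] [VectorBundle ℂ ℂ L]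
  {e : Trivialization ℂ (TotalSpace.proj : TotalSpace ℂ L → X)} [MemTrivializationAtlas e]
  {φ : OpenPartialHomeomorph X (Fin n → ℂ)} {z : Fin n → ℂ}
  {P : ∀ x : X, TangentSpace 𝓘(ℂ, Fin n → ℂ) x → TangentSpace 𝓘(ℂ, Fin n → ℂ) x → ℂ}
  {H : (Fin n → ℂ) →ₗ⋆[ℂ] (Fin n → ℂ) →ₗ[ℂ] ℂ} {c C : ℝ}
  {h : ∀ x, L x → ℝ} {E : Set X} {τ : LForm n L p}
  {S : Finset (Fin n)} {s : Finset (Finset (Fin n))} {b : Finset (Fin n) → ℝ} {k : Fin n → ℕ}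
  {M : ℝ}

/-- The constants in the bounds for the density of the volume. -/
noncomputable def densityConst (n : ℕ) (C : ℝ) : ℝ := 2 ^ n * ((n.factorial : ℝ) ^ 2 * C ^ n)

theorem densityConst_pos (n : ℕ) {C : ℝ} (hC : 0 < C) : 0 < densityConst n C := by
  unfold densityConst; positivity

omit [IsManifold 𝓘(ℂ, Fin n → ℂ) ω X] in
theorem volumeDensity_bounds
    (hH : ∀ v w, H v w = P (φ.symm z) (coordVec φ z v) (coordVec φ z w)) {m : Fin n → ℝ}
    (hcmp : IsComparable H m c C) :
    ENNReal.ofReal (2 ^ n * 2 ^ n * (densityConst n c⁻¹)⁻¹ * ∏ j, (m j)⁻¹) ≤ volumeDensity P φ z ∧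
      volumeDensity P φ z ≤ ENNReal.ofReal (densityConst n C * ∏ j, (m j)⁻¹) := by
  obtain ⟨h1, h2⟩ := hcmp.det_bounds
  simp only [hH] at h1 h2
  unfold volumeDensity densityConst
  constructor
  · refine ENNReal.ofReal_le_ofReal ?_
    calc _ = (2 : ℝ) ^ n * (((n.factorial : ℝ) ^ 2 * (c⁻¹) ^ n)⁻¹ * ∏ j, (m j)⁻¹) := by
          rw [mul_inv]; field_simp
      _ ≤ _ := by gcongr
  · refine ENNReal.ofReal_le_ofReal ?_
    calc _ ≤ (2 : ℝ) ^ n * (((n.factorial : ℝ) ^ 2 * C ^ n) * ∏ j, (m j)⁻¹) := by gcongr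
      _ = _ := by ring

theorem density_mul_formNormSq_le (hφ : IsCoord φ) (hz : z ∈ φ.target) (he : φ.symm z ∈ e.baseSet)
    (hh : IsFiberMetricOn h Eᶜ) (hE : φ.symm z ∉ E)
    (hH : ∀ v w, H v w = P (φ.symm z) (coordVec φ z v) (coordVec φ z w))
    (hcmp : IsComparable H (modelWeight S z) c C)
    (hw : h (φ.symm z) (e.symm (φ.symm z) 1) ≤ Real.exp M * logWeight S s b k z) :
    ENNReal.ofReal (densityConst n C * ∏ j, (modelWeight S z j)⁻¹) *
        formNormSq P h τ (φ.symm z) ≤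
      ENNReal.ofReal (densityConst n C * frameConst n p c⁻¹ * Real.exp M) *
        ∑ J : Fin p ↪o Fin n, ENNReal.ofReal (formWeight S s b k J z *
          ‖coeff τ φ e (fun a ↦ Pi.single (J a) 1) z‖ ^ 2) := by
  have hpos := hcmp.pos
  have hfc := frameConst_nonneg n p (inv_nonneg.2 hcmp.hc.le)
  have hdc := (densityConst_pos n hcmp.hC).le
  have hm : 0 ≤ ∏ j, (modelWeight S z j)⁻¹ :=
    Finset.prod_nonneg fun j _ ↦ inv_nonneg.2 (hpos j).le
  refine (mul_le_mul_right (formNormSq_le hφ hz he hh hE hH hcmp) _).trans ?_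
  rw [← ENNReal.ofReal_mul (by positivity), ← ENNReal.ofReal_sum_of_nonneg fun J _ ↦
    mul_nonneg (formWeight_nonneg J z) (by positivity), ← ENNReal.ofReal_mul (by positivity)]
  refine ENNReal.ofReal_le_ofReal ?_
  have h0 : 0 ≤ ∑ J : Fin p ↪o Fin n, (∏ a, modelWeight S z (J a)) *
      ‖coeff τ φ e (fun a ↦ Pi.single (J a) 1) z‖ ^ 2 :=
    Finset.sum_nonneg fun J _ ↦ mul_nonneg (Finset.prod_nonneg fun a _ ↦ (hpos _).le) (by positivity)
  have h1 : ∀ J : Fin p ↪o Fin n, formWeight S s b k J z *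
      ‖coeff τ φ e (fun a ↦ Pi.single (J a) 1) z‖ ^ 2 =
      logWeight S s b k z * (∏ j, (modelWeight S z j)⁻¹) * ((∏ a, modelWeight S z (J a)) *
      ‖coeff τ φ e (fun a ↦ Pi.single (J a) 1) z‖ ^ 2) := fun J ↦ by
    rw [formWeight, ← prod_inv_mul_prod_range J fun j ↦ (hpos j).ne']; ring
  simp only [h1]
  rw [← Finset.mul_sum]
  calc _ ≤ densityConst n C * (∏ j, (modelWeight S z j)⁻¹) * (frameConst n p c⁻¹ *
        ((Real.exp M * logWeight S s b k z) * ∑ J : Fin p ↪o Fin n, (∏ a, modelWeight S z (J a)) *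
      ‖coeff τ φ e (fun a ↦ Pi.single (J a) 1) z‖ ^ 2)) := by gcongr
    _ = _ := by ring

/-- The constant in the lower bounds of the norms of forms. -/
noncomputable def lowerConst (n : ℕ) (c M : ℝ) : ℝ :=
  Real.exp M * (2 ^ n * 2 ^ n * (densityConst n c⁻¹)⁻¹)⁻¹

theorem lowerConst_pos (n : ℕ) {c : ℝ} (hc : 0 < c) (M : ℝ) : 0 < lowerConst n c M := by
  have := densityConst_pos n (inv_pos.2 hc)
  unfold lowerConst; positivity

/-- The common step of the lower bounds for the mass and for the energy: one coefficient `x` is part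
of the sum `T`, the model weight `W` is passed to the true weight `η`, and `d` stands for the model
volume. -/
theorem ofReal_weight_mul_le {c η W d T x K M : ℝ} (hc : 0 < c) (hd : 0 ≤ d)
    (hx : x ≤ W * d * T) (hT : 0 ≤ T) (hW : Real.exp (-M) * W ≤ η) {N : ℝ≥0∞}
    (hN : ENNReal.ofReal (η * T) ≤ ENNReal.ofReal K * N) :
    ENNReal.ofReal x ≤ ENNReal.ofReal (lowerConst n c M * K) *
      (ENNReal.ofReal (2 ^ n * 2 ^ n * (densityConst n c⁻¹)⁻¹ * d) * N) := by
  have hdc := densityConst_pos n (inv_pos.2 hc)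
  have hl := (lowerConst_pos n hc M).le
  set κ : ℝ := 2 ^ n * 2 ^ n * (densityConst n c⁻¹)⁻¹ with hκ
  have hκ0 : 0 < κ := by positivity
  have hW' : W ≤ Real.exp M * η := by
    have h1 : W = Real.exp M * (Real.exp (-M) * W) := by
      rw [← mul_assoc, ← Real.exp_add, add_neg_cancel, Real.exp_zero, one_mul]
    rw [h1]
    gcongr
  have h2 : x ≤ lowerConst n c M * (κ * d) * (η * T) := by
    calc x ≤ W * d * T := hx
      _ ≤ (Real.exp M * η) * d * T := by gcongr
      _ = _ := by
          rw [lowerConst, ← hκ]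
          field_simp
  calc ENNReal.ofReal x ≤ ENNReal.ofReal (lowerConst n c M * (κ * d) * (η * T)) :=
        ENNReal.ofReal_le_ofReal h2
    _ = ENNReal.ofReal (lowerConst n c M) * ENNReal.ofReal (κ * d) * ENNReal.ofReal (η * T) := by
        rw [ENNReal.ofReal_mul (by positivity), ENNReal.ofReal_mul hl]
    _ ≤ ENNReal.ofReal (lowerConst n c M) * ENNReal.ofReal (κ * d) * (ENNReal.ofReal K * N) := by
        gcongr
    _ = _ := by rw [ENNReal.ofReal_mul hl]; ring

omit [IsManifold 𝓘(ℂ, Fin n → ℂ) ω X] in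
theorem ofReal_formWeight_le (he : φ.symm z ∈ e.baseSet)
    (hh : IsFiberMetricOn h Eᶜ) (hE : φ.symm z ∉ E)
    (hH : ∀ v w, H v w = P (φ.symm z) (coordVec φ z v) (coordVec φ z w))
    (hcmp : IsComparable H (modelWeight S z) c C)
    (hw : Real.exp (-M) * logWeight S s b k z ≤ h (φ.symm z) (e.symm (φ.symm z) 1))
    (J : Fin p ↪o Fin n) :
    ENNReal.ofReal (formWeight S s b k J z * ‖coeff τ φ e (fun a ↦ Pi.single (J a) 1) z‖ ^ 2) ≤
      ENNReal.ofReal (lowerConst n c M * frameConst n p C) *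
        (ENNReal.ofReal (2 ^ n * 2 ^ n * (densityConst n c⁻¹)⁻¹ * ∏ j, (modelWeight S z j)⁻¹) *
          formNormSq P h τ (φ.symm z)) := by
  have hpos := hcmp.pos
  have hnn : ∀ J : Fin p ↪o Fin n, 0 ≤ (∏ a, modelWeight S z (J a)) *
      ‖coeff τ φ e (fun a ↦ Pi.single (J a) 1) z‖ ^ 2 := fun J ↦
    mul_nonneg (Finset.prod_nonneg fun a _ ↦ (hpos _).le) (by positivity)
  have hm : 0 ≤ ∏ j, (modelWeight S z j)⁻¹ :=
    Finset.prod_nonneg fun j _ ↦ inv_nonneg.2 (hpos j).le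
  refine ofReal_weight_mul_le hcmp.hc hm ?_ (Finset.sum_nonneg fun J _ ↦ hnn J) hw
    (le_formNormSq he hh hE hH hcmp)
  rw [formWeight, ← prod_inv_mul_prod_range J fun j ↦ (hpos j).ne']
  have h1 := Finset.single_le_sum (f := fun J : Fin p ↪o Fin n ↦ (∏ a, modelWeight S z (J a)) *
      ‖coeff τ φ e (fun a ↦ Pi.single (J a) 1) z‖ ^ 2) (fun J _ ↦ hnn J) (Finset.mem_univ J)
  calc _ = logWeight S s b k z * (∏ j, (modelWeight S z j)⁻¹) *
        ((∏ a, modelWeight S z (J a)) * ‖coeff τ φ e (fun a ↦ Pi.single (J a) 1) z‖ ^ 2) := by ring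
    _ ≤ _ := mul_le_mul_of_nonneg_left h1 (mul_nonneg (logWeight_pos z).le hm)

theorem ofReal_formWeight_dbarDir_le [ContMDiffVectorBundle ω ℂ L 𝓘(ℂ, Fin n → ℂ)]
    (hτ : IsSmoothForm τ) (hφ : IsCoord φ) (hz : z ∈ φ.target)
    (he : φ.symm z ∈ e.baseSet) (hh : IsFiberMetricOn h Eᶜ) (hE : φ.symm z ∉ E)
    (hH : ∀ v w, H v w = P (φ.symm z) (coordVec φ z v) (coordVec φ z w))
    (hcmp : IsComparable H (modelWeight S z) c C)
    (hw : Real.exp (-M) * logWeight S s b k z ≤ h (φ.symm z) (e.symm (φ.symm z) 1))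
    (J : Fin p ↪o Fin n) (i : Fin n) :
    ENNReal.ofReal (formWeight S s b k J z * modelWeight S z i *
        ‖dbarDir (coeff τ φ e (fun a ↦ Pi.single (J a) 1)) z (Pi.single i 1)‖ ^ 2) ≤
      ENNReal.ofReal (lowerConst n c M * (n ^ 2 * C * frameConst n p C)) *
        (ENNReal.ofReal (2 ^ n * 2 ^ n * (densityConst n c⁻¹)⁻¹ * ∏ j, (modelWeight S z j)⁻¹) *
          dbarNormSq P h τ (φ.symm z)) := by
  have hpos := hcmp.pos
  have hC := hcmp.hC
  have hfC := frameConst_nonneg n p hC.le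
  have hnn : ∀ (i : Fin n) (J : Fin p ↪o Fin n), 0 ≤ modelWeight S z i *
      ((∏ a, modelWeight S z (J a)) *
      ‖dbarDir (coeff τ φ e (fun a ↦ Pi.single (J a) 1)) z (Pi.single i 1)‖ ^ 2) := fun i J ↦
    mul_nonneg (hpos i).le (mul_nonneg (Finset.prod_nonneg fun a _ ↦ (hpos _).le) (by positivity))
  have hm : 0 ≤ ∏ j, (modelWeight S z j)⁻¹ :=
    Finset.prod_nonneg fun j _ ↦ inv_nonneg.2 (hpos j).le
  refine ofReal_weight_mul_le hcmp.hc hm ?_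
    (Finset.sum_nonneg fun i _ ↦ Finset.sum_nonneg fun J _ ↦ hnn i J)
    hw
    (le_dbarNormSq hτ hφ hz he hh hE hH hcmp)
  rw [formWeight, ← prod_inv_mul_prod_range J fun j ↦ (hpos j).ne']
  have h1 := (Finset.single_le_sum (f := fun J : Fin p ↪o Fin n ↦ modelWeight S z i *
      ((∏ a, modelWeight S z (J a)) *
      ‖dbarDir (coeff τ φ e (fun a ↦ Pi.single (J a) 1)) z (Pi.single i 1)‖ ^ 2))
      (fun J _ ↦ hnn i J) (Finset.mem_univ J)).trans
    (Finset.single_le_sum (f := fun i ↦ ∑ J : Fin p ↪o Fin n, modelWeight S z i *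
      ((∏ a, modelWeight S z (J a)) *
      ‖dbarDir (coeff τ φ e (fun a ↦ Pi.single (J a) 1)) z (Pi.single i 1)‖ ^ 2))
      (fun i _ ↦ Finset.sum_nonneg fun J _ ↦ hnn i J) (Finset.mem_univ i))
  calc _ = logWeight S s b k z * (∏ j, (modelWeight S z j)⁻¹) *
        (modelWeight S z i * ((∏ a, modelWeight S z (J a)) *
        ‖dbarDir (coeff τ φ e (fun a ↦ Pi.single (J a) 1)) z (Pi.single i 1)‖ ^ 2)) := by ring
    _ ≤ _ := mul_le_mul_of_nonneg_left h1 (mul_nonneg (logWeight_pos z).le hm)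

end LocalModel

/-! ### Construction of the local models -/

section ModelConstruction

open Filter Topology

variable {n p : ℕ} {X : Type*} [TopologicalSpace X] [ChartedSpace (Fin n → ℂ) X]
  {L : X → Type*} [TopologicalSpace (TotalSpace ℂ L)] [∀ x, AddCommGroup (L x)]
  [∀ x, Module ℂ (L x)] [∀ x, TopologicalSpace (L x)] [FiberBundle ℂ L] [VectorBundle ℂ ℂ L]
  {e : Trivialization ℂ (TotalSpace.proj : TotalSpace ℂ L → X)} [MemTrivializationAtlas e]
  {φ : OpenPartialHomeomorph X (Fin n → ℂ)} {z : Fin n → ℂ} {E K : Set X} {τ : LForm n L p}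

theorem coeff_eq_zero (he : φ.symm z ∈ e.baseSet) (hτ : τ (φ.symm z) = 0)
    (v : Fin p → Fin n → ℂ) : coeff τ φ e v z = 0 := by
  rw [coeff, hτ, AlternatingMap.zero_apply]
  have h := congrFun (e.coe_linearMapAt_of_mem (R := ℂ) he) 0
  rw [map_zero] at h
  exact h.symm

/-- The coefficients of a form with compact support off the divisor, cut off outside a
neighbourhood of the center of the coordinates. -/
theorem exists_cutoff_coeff {τ : LForm n L p} (hτ : IsSmoothForm τ) (hφ : IsCoord φ)
    (he : φ.source ⊆ e.baseSet) {c : Fin n → ℂ} {R : ℝ} (hR : 0 < R)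
    (hball : Metric.ball c R ⊆ φ.target) {S : Finset (Fin n)}
    (hE : ∀ z ∈ Metric.ball c R, φ.symm z ∈ E ↔ ∃ j ∈ S, z j = 0) (hK : IsClosed K)
    (hKE : Disjoint K E) (hτK : ∀ x, x ∉ K → τ x = 0) :
    ∃ f : (Fin p ↪o Fin n) → (Fin n → ℂ) → ℂ, (∀ J, ContDiff ℝ 2 (f J)) ∧
      (∃ a > 0, ∀ J z, ∀ j ∈ S, ‖z j‖ ≤ a → f J z = 0) ∧
      ∀ J, EqOn (f J) (coeff τ φ e fun a ↦ Pi.single (J a) 1) (Metric.ball c (R / 4)) := by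
  let B : ContDiffBump c := ⟨R / 4, R / 2, by positivity, by linarith⟩
  have heb : ∀ z ∈ Metric.ball c R, φ.symm z ∈ e.baseSet := fun z hz ↦
    he (φ.map_target (hball hz))
  refine ⟨fun J z ↦ B z • coeff τ φ e (fun a ↦ Pi.single (J a) 1) z, fun J ↦ ?_, ?_,
    fun J z hz ↦ ?_⟩
  · refine contDiff_iff_contDiffAt.2 fun z ↦ ?_
    by_cases hz : z ∈ Metric.ball c R
    · refine B.contDiffAt.smul ?_
      exact (hτ.contDiffAt hφ (hball hz) (heb z hz) _).of_le
        (WithTop.coe_le_coe.2 (le_top : (2 : ℕ∞) ≤ ⊤))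
    · have h1 : (fun z ↦ B z • coeff τ φ e (fun a ↦ Pi.single (J a) 1) z) =ᶠ[𝓝 z]
          fun _ ↦ 0 := by
        have h2 : R / 2 < dist z c := by
          rw [Metric.mem_ball, not_lt] at hz; linarith
        have h3 : ContinuousAt (fun z ↦ dist z c) z := by fun_prop
        filter_upwards [h3.eventually (Ioi_mem_nhds h2)] with y hy
        rw [B.zero_of_le_dist (le_of_lt hy), zero_smul]
      exact contDiffAt_const.congr_of_eventuallyEq h1
  -- The support meets the closed half ball in a compact set off the hyperplanes, so `‖z j‖` has a
  -- positive minimum on it for each `j ∈ S`. The radius `a` depends on the form.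
  · set K' := Metric.closedBall c (R / 2) ∩ φ.symm ⁻¹' K with hK'
    have hsub : Metric.closedBall c (R / 2) ⊆ Metric.ball c R :=
      Metric.closedBall_subset_ball (by linarith)
    have hK'c : IsCompact K' := by
      refine (isCompact_closedBall c (R / 2)).of_isClosed_subset ?_ inter_subset_left
      exact (φ.continuousOn_symm.mono (hsub.trans hball)).preimage_isClosed_of_isClosed
        Metric.isClosed_closedBall hK
    have h1 : ∀ j ∈ S, ∀ᶠ a in 𝓝[>] (0 : ℝ), ∀ z ∈ K', a < ‖z j‖ := by
      intro j hj
      rcases K'.eq_empty_or_nonempty with h0 | h0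
      · simp [h0]
      · obtain ⟨y, hy, hmin⟩ := hK'c.exists_isMinOn h0
          (f := fun z : Fin n → ℂ ↦ ‖z j‖) (continuous_apply j).norm.continuousOn
        have hy0 : 0 < ‖y j‖ := by
          refine norm_pos_iff.2 fun h ↦ ?_
          exact hKE.le_bot ⟨hy.2, (hE y (hsub hy.1)).2 ⟨j, hj, h⟩⟩
        filter_upwards [nhdsWithin_le_nhds (Iio_mem_nhds hy0)] with a ha z hz
        exact lt_of_lt_of_le ha (hmin hz)
    obtain ⟨a, h2, ha⟩ := (((eventually_all_finset S).2 h1).and self_mem_nhdsWithin).exists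
    refine ⟨a, ha, fun J z j hj hz ↦ ?_⟩
    have hzK : z ∉ K' := fun h ↦ absurd (h2 j hj z h) (not_lt.2 hz)
    by_cases hd : z ∈ Metric.closedBall c (R / 2)
    · have h3 : φ.symm z ∉ K := fun h ↦ hzK ⟨hd, h⟩
      beta_reduce
      rw [coeff_eq_zero (heb z (hsub hd)) (hτK _ h3), smul_zero]
    · rw [Metric.mem_closedBall, not_le] at hd
      beta_reduce
      rw [B.zero_of_le_dist hd.le, zero_smul]
  · beta_reduce
    rw [B.one_of_mem_closedBall (Metric.ball_subset_closedBall hz), one_smul]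

variable [IsManifold 𝓘(ℂ, Fin n → ℂ) ω X] [MeasurableSpace X] [BorelSpace X]
  {P : ∀ x : X, TangentSpace 𝓘(ℂ, Fin n → ℂ) x → TangentSpace 𝓘(ℂ, Fin n → ℂ) x → ℂ}
  {h : ∀ x, L x → ℝ} {S : Finset (Fin n)} {s : Finset (Finset (Fin n))}
  {b : Finset (Fin n) → ℝ} {k : Fin n → ℕ} {M c₀ C₀ : ℝ} {x : X}

/-- The pointwise comparisons of the metric, the weight, the volume and the norms, integrated over a
small ball. The constants depend on the point `x` only, not on the form, and the coefficients are
extended to all of `ℂⁿ` by a cutoff. -/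
theorem nonempty_poincareModel [ContMDiffVectorBundle ω ℂ L 𝓘(ℂ, Fin n → ℂ)] {𝒯 : Type*}
    (T : 𝒯 → LForm n L p) (hT : ∀ t, IsSmoothForm (T t))
    (hTK : ∀ t, ∃ K, IsClosed K ∧ Disjoint K E ∧ ∀ x, x ∉ K → T t x = 0)
    (hEm : MeasurableSet E) (hh : IsFiberMetricOn h Eᶜ)
    (hP : ∀ φ : OpenPartialHomeomorph X (Fin n → ℂ), IsCoord φ → ∀ z ∈ φ.target, φ.symm z ∉ E →
      ∃ H : (Fin n → ℂ) →ₗ⋆[ℂ] (Fin n → ℂ) →ₗ[ℂ] ℂ,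
        ∀ v w, H v w = P (φ.symm z) (coordVec φ z v) (coordVec φ z w))
    (hφ : IsCoord φ) (hx : x ∈ φ.source) (he : φ.source ⊆ e.baseSet)
    (hS : ∀ j ∈ S, φ x j = 0) (hb : ∀ I ∈ s, 0 ≤ b I)
    (hk : ∀ i ∈ S, k i ≠ 0 → ∑ I ∈ s with i ∈ I, b I < 1)
    (hE : ∀ᶠ z in 𝓝 (φ x), φ.symm z ∈ E ↔ ∃ j ∈ S, z j = 0)
    (hw : ∀ᶠ z in 𝓝 (φ x), φ.symm z ∉ E →
      Real.exp (-M) * logWeight S s b k z ≤ h (φ.symm z) (e.symm (φ.symm z) 1) ∧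
        h (φ.symm z) (e.symm (φ.symm z) 1) ≤ Real.exp M * logWeight S s b k z)
    (hcmp : ∀ᶠ z in 𝓝 (φ x), φ.symm z ∉ E →
      ∃ H : (Fin n → ℂ) →ₗ⋆[ℂ] (Fin n → ℂ) →ₗ[ℂ] ℂ,
        (∀ v w, H v w = P (φ.symm z) (coordVec φ z v) (coordVec φ z w)) ∧
        IsComparable H (modelWeight S z) c₀ C₀) :
    Nonempty (PoincareModel n p E
      (fun t V ↦ ∫⁻ y in V \ E, formNormSq P h (T t) y ∂hermVolume P)
      (fun t ↦ ∫⁻ y in Eᶜ, dbarNormSq P h (T t) y ∂hermVolume P) x) := by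
  obtain ⟨R, hR, hball⟩ := Metric.eventually_nhds_iff_ball.1
    ((φ.open_target.eventually_mem (φ.map_source hx)).and (hE.and (hw.and hcmp)))
  -- On the quarter ball the cutoff equals one; `exp (-40)` is the range of the Hardy inequality.
  set R₀ := min (R / 4) (Real.exp (-40)) with hR₀
  have hR₀0 : 0 < R₀ := lt_min (by positivity) (Real.exp_pos _)
  have hRR : Metric.ball (φ x) R₀ ⊆ Metric.ball (φ x) (R / 4) :=
    Metric.ball_subset_ball (min_le_left _ _)
  have hRR' : Metric.ball (φ x) R₀ ⊆ Metric.ball (φ x) R :=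
    hRR.trans (Metric.ball_subset_ball (by linarith))
  set c₁ := densityConst n C₀ * frameConst n p c₀⁻¹ * Real.exp M with hc₁
  set c₂ := lowerConst n c₀ M * frameConst n p C₀ with hc₂
  set c₃ := lowerConst n c₀ M * (n ^ 2 * C₀ * frameConst n p C₀) with hc₃
  set C := max c₁ (max c₂ c₃) with hC
  refine ⟨⟨φ, hx, S, s, b, k, R₀, hR₀0, min_le_right _ _, fun z hz ↦ (hball z (hRR' hz)).1, hS,
    fun z hz ↦ (hball z (hRR' hz)).2.1, hb, hk, C, fun t ↦ ?_⟩⟩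
  obtain ⟨K, hK, hKE, hτK⟩ := hTK t
  obtain ⟨f, hf, hfa, hfc⟩ := exists_cutoff_coeff (hT t) hφ he hR (fun z hz ↦ (hball z hz).1)
    (fun z hz ↦ (hball z hz).2.1) hK hKE hτK
  refine ⟨f, hf, hfa, fun Q hQ hQR ↦ ?_⟩
  -- The hyperplanes are removed, because the comparison of metrics holds off the divisor only. The
  -- cut-off coefficients vanish near them, so nothing is lost.
  set N : Set (Fin n → ℂ) := {z | ∃ j ∈ S, z j = 0} with hN
  have hNm : MeasurableSet N := by
    have : N = ⋃ j ∈ S, {z : Fin n → ℂ | z j = 0} := by ext z; simp [hN]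
    rw [this]
    exact Finset.measurableSet_biUnion _ fun j _ ↦
      measurable_pi_apply j (measurableSet_singleton 0)
  have hQN : MeasurableSet (Q \ N) := hQ.diff hNm
  have hQE : ∀ z ∈ Q \ N, φ.symm z ∉ E := fun z hz h0 ↦
    hz.2 ((hball z (hRR' (hQR hz.1))).2.1.1 h0)
  have hset : (φ.source ∩ φ ⁻¹' Q) \ E = φ.source ∩ φ ⁻¹' (Q \ N) := by
    ext y
    constructor
    · rintro ⟨⟨h1, h2⟩, h3⟩
      refine ⟨h1, h2, fun h4 ↦ h3 ?_⟩
      have h5 := (hball _ (hRR' (hQR h2))).2.1.2 h4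
      rwa [φ.left_inv h1] at h5
    · rintro ⟨h1, h2, h3⟩
      refine ⟨⟨h1, h2⟩, fun h4 ↦ h3 ?_⟩
      exact (hball _ (hRR' (hQR h2))).2.1.1 (by rwa [φ.left_inv h1])
  have hint : ∀ F : X → ℝ≥0∞, ∫⁻ y in (φ.source ∩ φ ⁻¹' Q) \ E, F y ∂hermVolume P =
      ∫⁻ z, F (φ.symm z) ∂((volume.restrict (Q \ N)).withDensity (volumeDensity P φ)) := by
    intro F
    rw [hset]
    refine setLIntegral_hermVolume hφ (A := φ.source \ E) sdiff_subset
      (φ.open_source.measurableSet.diff hEm) (fun φ' hφ' ↦ ?_) hQN (fun z hz ↦ ?_) F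
    · exact isVolumeCompatible_of_sesquilinear hφ hφ' fun z hz hzA ↦ hP φ' hφ' z hz hzA.2
    · have hzt := (hball z (hRR' (hQR hz.1))).1
      exact ⟨hzt, φ.map_target hzt, hQE z hz⟩
  have hmw : ∀ a : ℝ, Measurable fun z : Fin n → ℂ ↦ a * ∏ j, (modelWeight S z j)⁻¹ := fun a ↦
    (Finset.measurable_fun_prod _ fun j _ ↦ (measurable_modelWeight j).inv).const_mul a
  have hCle : ∀ {a : ℝ}, a ≤ C → ∀ x y : ℝ≥0∞, x ≤ ENNReal.ofReal a * y →
      x ≤ ENNReal.ofReal C * y := fun {a} ha x y hxy ↦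
    hxy.trans (mul_le_mul_left (ENNReal.ofReal_le_ofReal ha) y)
  have hpt : ∀ z ∈ Q \ N, z ∈ φ.target ∧ φ.symm z ∈ e.baseSet := fun z hz ↦ by
    have hzt := (hball z (hRR' (hQR hz.1))).1
    exact ⟨hzt, he (φ.map_target hzt)⟩
  obtain ⟨a, ha, hfa⟩ := hfa
  refine ⟨hCle (le_max_left _ _) _ _ ?_, fun J ↦
    hCle ((le_max_left _ _).trans (le_max_right _ _)) _ _ ?_, fun J i ↦
    hCle ((le_max_right _ _).trans (le_max_right _ _)) _ _ ?_⟩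
  · rw [hint]
    refine (lintegral_withDensity_le_mul (G := fun z ↦ ∑ J, ENNReal.ofReal
      (formWeight S s b k J z * ‖f J z‖ ^ 2)) hQN (hmw (densityConst n C₀))
      ENNReal.ofReal_ne_top (C := ENNReal.ofReal c₁) (fun z hz ↦ ?_) fun z hz ↦ ?_).trans ?_
    · obtain ⟨H, hH, hc⟩ := (hball z (hRR' (hQR hz.1))).2.2.2 (hQE z hz)
      exact (volumeDensity_bounds hH hc).2
    · obtain ⟨H, hH, hc⟩ := (hball z (hRR' (hQR hz.1))).2.2.2 (hQE z hz)
      have hwz := ((hball z (hRR' (hQR hz.1))).2.2.1 (hQE z hz)).2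
      have h1 := density_mul_formNormSq_le (τ := T t) hφ (hpt z hz).1 (hpt z hz).2 hh (hQE z hz)
        hH hc hwz
      have h2 : ∀ J, f J z = _ := fun J ↦ hfc J (hRR (hQR hz.1))
      simp only [h2]
      exact h1
    · have h1 : ∀ J ∈ (Finset.univ : Finset (Fin p ↪o Fin n)), Measurable fun z ↦
          ENNReal.ofReal (formWeight S s b k J z * ‖f J z‖ ^ 2) := fun J _ ↦
        ((measurable_formWeight J).mul ((hf J).continuous.norm.pow 2).measurable).ennreal_ofReal
      rw [lintegral_finsetSum _ h1]
      exact mul_le_mul_right (Finset.sum_le_sum fun J _ ↦ lintegral_mono_set sdiff_subset) _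
  · rw [hint, setLIntegral_diff_of_eq_zero hQ hNm fun z ⟨j, hj, h0⟩ ↦ by
      rw [hfa J z j hj (by rw [h0, norm_zero]; exact ha.le)]; simp]
    refine le_mul_lintegral_withDensity hQN (hmw (2 ^ n * 2 ^ n * (densityConst n c₀⁻¹)⁻¹))
      ENNReal.ofReal_ne_top (fun z hz ↦ ?_) fun z hz ↦ ?_
    · obtain ⟨H, hH, hc⟩ := (hball z (hRR' (hQR hz.1))).2.2.2 (hQE z hz)
      exact (volumeDensity_bounds hH hc).1
    · obtain ⟨H, hH, hc⟩ := (hball z (hRR' (hQR hz.1))).2.2.2 (hQE z hz)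
      have hwz := ((hball z (hRR' (hQR hz.1))).2.2.1 (hQE z hz)).1
      rw [hfc J (hRR (hQR hz.1))]
      exact ofReal_formWeight_le (hpt z hz).2 hh (hQE z hz) hH hc hwz J
  · have h1 : ∫⁻ y in (φ.source ∩ φ ⁻¹' Q) \ E, dbarNormSq P h (T t) y ∂hermVolume P ≤
        ∫⁻ y in Eᶜ, dbarNormSq P h (T t) y ∂hermVolume P :=
      lintegral_mono_set fun y hy ↦ hy.2
    refine le_trans ?_ (mul_le_mul_right h1 _)
    rw [hint, setLIntegral_diff_of_eq_zero hQ hNm fun z ⟨j, hj, h0⟩ ↦ by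
      have h3 : f J =ᶠ[𝓝 z] fun _ ↦ 0 := by
        have h4 : ContinuousAt (fun z : Fin n → ℂ ↦ ‖z j‖) z :=
          (continuous_apply j).norm.continuousAt
        have h5 : ‖z j‖ < a := by rw [h0, norm_zero]; exact ha
        filter_upwards [h4.eventually (Iio_mem_nhds h5)] with y hy
        exact hfa J y j hj (le_of_lt hy)
      rw [dbarDir_congr h3, dbarDir_const]; simp]
    refine le_mul_lintegral_withDensity hQN (hmw (2 ^ n * 2 ^ n * (densityConst n c₀⁻¹)⁻¹))
      ENNReal.ofReal_ne_top (fun z hz ↦ ?_) fun z hz ↦ ?_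
    · obtain ⟨H, hH, hc⟩ := (hball z (hRR' (hQR hz.1))).2.2.2 (hQE z hz)
      exact (volumeDensity_bounds hH hc).1
    · obtain ⟨H, hH, hc⟩ := (hball z (hRR' (hQR hz.1))).2.2.2 (hQE z hz)
      have hwz := ((hball z (hRR' (hQR hz.1))).2.2.1 (hQE z hz)).1
      rw [dbarDir_congr ((hfc J).eventuallyEq_of_mem
        (Metric.isOpen_ball.mem_nhds (hRR (hQR hz.1))))]
      exact ofReal_formWeight_dbarDir_le (hT t) hφ (hpt z hz).1 (hpt z hz).2 hh (hQE z hz) hH hc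
        hwz J i

end ModelConstruction

/-! ### Controlled sets and propagation off the divisor -/

section Controlled

open Filter Topology

variable {X 𝒯 : Type*} {A : 𝒯 → Set X → ℝ≥0∞} {D : 𝒯 → ℝ≥0∞}

/-- A family of monotone and subadditive set functions. -/
structure IsMass (A : 𝒯 → Set X → ℝ≥0∞) : Prop where
  empty : ∀ t, A t ∅ = 0
  mono : ∀ t, Monotone (A t)
  union : ∀ t V W, A t (V ∪ W) ≤ A t V + A t W

/-- The mass over `V` is controlled by the energy, up to a small multiple of the total mass. -/
def IsControlled (A : 𝒯 → Set X → ℝ≥0∞) (D : 𝒯 → ℝ≥0∞) (V : Set X) : Prop :=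
  ∀ δ : ℝ, 0 < δ → ∃ C : ℝ, 0 ≤ C ∧ ∀ t, A t V ≤ ENNReal.ofReal δ * A t univ +
    ENNReal.ofReal C * D t

theorem IsControlled.mono {V W : Set X} (hA : IsMass A) (h : IsControlled A D W) (hVW : V ⊆ W) :
    IsControlled A D V := fun δ hδ ↦ by
  obtain ⟨C, hC, H⟩ := h δ hδ
  exact ⟨C, hC, fun t ↦ (hA.mono t hVW).trans (H t)⟩

theorem isControlled_of_eq_zero {V : Set X} (h : ∀ t, A t V = 0) : IsControlled A D V :=
  fun δ _ ↦ ⟨0, le_rfl, fun t ↦ by simp [h t]⟩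

theorem IsControlled.union {V W : Set X} (hA : IsMass A) (hV : IsControlled A D V)
    (hW : IsControlled A D W) : IsControlled A D (V ∪ W) := fun δ hδ ↦ by
  obtain ⟨C₁, h1, H₁⟩ := hV (δ / 2) (half_pos hδ)
  obtain ⟨C₂, h2, H₂⟩ := hW (δ / 2) (half_pos hδ)
  refine ⟨C₁ + C₂, by positivity, fun t ↦ ?_⟩
  calc A t (V ∪ W) ≤ A t V + A t W := hA.union t V W
    _ ≤ _ := add_le_add (H₁ t) (H₂ t)
    _ = (ENNReal.ofReal (δ / 2) + ENNReal.ofReal (δ / 2)) * A t univ +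
        (ENNReal.ofReal C₁ + ENNReal.ofReal C₂) * D t := by ring
    _ = _ := by
        rw [← ENNReal.ofReal_add h1 h2, ← ENNReal.ofReal_add (by positivity) (by positivity),
          add_halves]

variable [TopologicalSpace X]

/-- The points with a neighbourhood over which the mass is controlled by the energy. -/
def controlledSet (A : 𝒯 → Set X → ℝ≥0∞) (D : 𝒯 → ℝ≥0∞) : Set X :=
  {x | ∃ V ∈ 𝓝 x, IsControlled A D V}

theorem isOpen_controlledSet : IsOpen (controlledSet A D) := by
  refine isOpen_iff_mem_nhds.2 fun x ⟨V, hV, h⟩ ↦ ?_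
  filter_upwards [eventually_mem_nhds_iff.2 hV] with y hy using ⟨V, hy, h⟩

theorem IsCompact.isControlled (hA : IsMass A) {K : Set X} (hK : IsCompact K)
    (h : K ⊆ controlledSet A D) : IsControlled A D K :=
  hK.induction_on (p := IsControlled A D) (isControlled_of_eq_zero hA.empty)
    (fun _ _ hst ht ↦ ht.mono hA hst) (fun _ _ hs ht ↦ hs.union hA ht) fun x hx ↦ by
      obtain ⟨V, hV, hVc⟩ := h hx
      exact ⟨V, mem_nhdsWithin_of_mem_nhds hV, hVc⟩

variable {n p : ℕ} {E : Set X} {x : X}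

namespace PoincareModel

variable (m : PoincareModel n p E A D x)

/-- The coefficients in the coordinates of the model. -/
noncomputable def coeff (t : 𝒯) (J : Fin p ↪o Fin n) : (Fin n → ℂ) → ℂ := (m.exists_coeff t).choose J

/-- The weighted mass of a coefficient. -/
noncomputable def mass (t : 𝒯) (J : Fin p ↪o Fin n) (Q : Set (Fin n → ℂ)) : ℝ≥0∞ :=
  ∫⁻ z in Q, ENNReal.ofReal (formWeight m.S m.s m.b m.k J z * ‖m.coeff t J z‖ ^ 2)

/-- The weighted energy of a coefficient in the direction of a coordinate. -/
noncomputable def energy (t : 𝒯) (J : Fin p ↪o Fin n) (i : Fin n) (Q : Set (Fin n → ℂ)) : ℝ≥0∞ :=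
  ∫⁻ z in Q, ENNReal.ofReal (formWeight m.S m.s m.b m.k J z * modelWeight m.S z i *
    ‖dbarDir (m.coeff t J) z (Pi.single i 1)‖ ^ 2)

/-- The part of `X` that corresponds to `Q` in the coordinates of the model. -/
def region (Q : Set (Fin n → ℂ)) : Set X := m.chart.source ∩ m.chart ⁻¹' Q

theorem region_mono {Q Q' : Set (Fin n → ℂ)} (h : Q ⊆ Q') : m.region Q ⊆ m.region Q' :=
  inter_subset_inter_right _ (preimage_mono h)

theorem region_subset_image {Q : Set (Fin n → ℂ)} : m.region Q ⊆ m.chart.symm '' Q :=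
  fun y hy ↦ ⟨m.chart y, hy.2, m.chart.left_inv hy.1⟩

theorem region_mem_nhds {Q : Set (Fin n → ℂ)} (hQ : IsOpen Q) {z : Fin n → ℂ} (hz : z ∈ Q)
    (hzt : z ∈ m.chart.target) : m.region Q ∈ 𝓝 (m.chart.symm z) :=
  (m.chart.isOpen_inter_preimage hQ).mem_nhds
    ⟨m.chart.map_target hzt, by rwa [mem_preimage, m.chart.right_inv hzt]⟩

theorem contDiff_coeff (t : 𝒯) (J : Fin p ↪o Fin n) : ContDiff ℝ 2 (m.coeff t J) :=
  (m.exists_coeff t).choose_spec.1 J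

theorem exists_coeff_eq_zero (t : 𝒯) (J : Fin p ↪o Fin n) :
    ∃ a > 0, ∀ z, ∀ j ∈ m.S, ‖z j‖ ≤ a → m.coeff t J z = 0 := by
  obtain ⟨a, ha, h⟩ := (m.exists_coeff t).choose_spec.2.1
  exact ⟨a, ha, h J⟩

variable {Q Q₁ Q₂ : Set (Fin n → ℂ)}

theorem le_mass (hQ : MeasurableSet Q) (hQR : Q ⊆ Metric.ball (m.chart x) m.R) (t : 𝒯) :
    A t (m.region Q) ≤ ENNReal.ofReal m.C * ∑ J, m.mass t J Q :=
  ((m.exists_coeff t).choose_spec.2.2 Q hQ hQR).1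

theorem mass_le (hQ : MeasurableSet Q) (hQR : Q ⊆ Metric.ball (m.chart x) m.R) (t : 𝒯)
    (J : Fin p ↪o Fin n) : m.mass t J Q ≤ ENNReal.ofReal m.C * A t (m.region Q) :=
  ((m.exists_coeff t).choose_spec.2.2 Q hQ hQR).2.1 J

theorem energy_le (hQ : MeasurableSet Q) (hQR : Q ⊆ Metric.ball (m.chart x) m.R) (t : 𝒯)
    (J : Fin p ↪o Fin n) (i : Fin n) : m.energy t J i Q ≤ ENNReal.ofReal m.C * D t :=
  ((m.exists_coeff t).choose_spec.2.2 Q hQ hQR).2.2 J i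

/-- An estimate of the coefficients yields control over a region. -/
theorem isControlled_region (hA : IsMass A) (hQ : MeasurableSet Q)
    (hQR : Q ⊆ Metric.ball (m.chart x) m.R) (hQ₁ : MeasurableSet Q₁)
    (hQR₁ : Q₁ ⊆ Metric.ball (m.chart x) m.R) (hQ₂ : MeasurableSet Q₂)
    (hQR₂ : Q₂ ⊆ Metric.ball (m.chart x) m.R) (i : Fin n)
    (hc : IsControlled A D (m.region Q₁))
    (h : ∀ δ : ℝ, 0 < δ → ∃ C : (Fin p ↪o Fin n) → ℝ, (∀ J, 0 < C J) ∧ ∀ t J, m.mass t J Q ≤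
      ENNReal.ofReal (C J) * m.mass t J Q₁ + ENNReal.ofReal (C J) * m.energy t J i Q₂ +
        ENNReal.ofReal δ * m.mass t J Q₂) : IsControlled A D (m.region Q) := by
  intro δ hδ
  set B : ℝ := |m.C| + 1 with hB
  have hB0 : 0 < B := by positivity
  have hCB : ENNReal.ofReal m.C ≤ ENNReal.ofReal B :=
    ENNReal.ofReal_le_ofReal ((le_abs_self _).trans (by linarith))
  set N : ℝ := Fintype.card (Fin p ↪o Fin n) + 1 with hN
  have hN0 : 0 < N := by positivity
  set K : ℝ := B * N * B with hK
  have hK0 : 0 < K := by positivity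
  -- `K` collects the comparison constants and the number of coefficients. Half of `δ` is spent
  -- here, the other half on the control over `Q₁`, whose parameter can be chosen only after the
  -- constant `C₁` that multiplies it is known.
  obtain ⟨C₀, hC₀, H₀⟩ := h (δ / (2 * K)) (by positivity)
  set C₁ : ℝ := 1 + ∑ J, C₀ J with hC₁_def
  have hC₁ : 0 < C₁ := by
    have : 0 ≤ ∑ J, C₀ J := Finset.sum_nonneg fun J _ ↦ (hC₀ J).le
    positivity
  have hC₀₁ : ∀ J, C₀ J ≤ C₁ := fun J ↦ by
    have := Finset.single_le_sum (f := C₀) (fun J _ ↦ (hC₀ J).le) (Finset.mem_univ J)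
    linarith
  obtain ⟨C₂, hC₂, H₂⟩ := hc (δ / (2 * K * C₁)) (by positivity)
  refine ⟨K * C₁ * C₂ + K * C₁, by positivity, fun t ↦ ?_⟩
  have h1 : ∀ J, m.mass t J Q ≤ ENNReal.ofReal B * (ENNReal.ofReal C₁ * A t (m.region Q₁) +
      ENNReal.ofReal C₁ * D t + ENNReal.ofReal (δ / (2 * K)) * A t univ) := fun J ↦ by
    calc m.mass t J Q ≤ _ := H₀ t J
      _ ≤ ENNReal.ofReal C₁ * (ENNReal.ofReal B * A t (m.region Q₁)) +
          ENNReal.ofReal C₁ * (ENNReal.ofReal B * D t) +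
          ENNReal.ofReal (δ / (2 * K)) * (ENNReal.ofReal B * A t univ) := by
          gcongr
          · exact hC₀₁ J
          · exact (m.mass_le hQ₁ hQR₁ t J).trans (mul_le_mul_left hCB _)
          · exact hC₀₁ J
          · exact (m.energy_le hQ₂ hQR₂ t J i).trans (mul_le_mul_left hCB _)
          · exact (m.mass_le hQ₂ hQR₂ t J).trans
              (mul_le_mul' hCB (hA.mono t (subset_univ _)))
      _ = _ := by ring
  have h2 : A t (m.region Q) ≤ ENNReal.ofReal K * (ENNReal.ofReal C₁ * A t (m.region Q₁) +
      ENNReal.ofReal C₁ * D t + ENNReal.ofReal (δ / (2 * K)) * A t univ) := by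
    calc A t (m.region Q) ≤ ENNReal.ofReal m.C * ∑ J, m.mass t J Q := m.le_mass hQ hQR t
      _ ≤ ENNReal.ofReal B * ∑ J : Fin p ↪o Fin n, ENNReal.ofReal B *
          (ENNReal.ofReal C₁ * A t (m.region Q₁) +
          ENNReal.ofReal C₁ * D t + ENNReal.ofReal (δ / (2 * K)) * A t univ) :=
          mul_le_mul' hCB (Finset.sum_le_sum fun J _ ↦ h1 J)
      _ ≤ ENNReal.ofReal B * (ENNReal.ofReal N * (ENNReal.ofReal B *
          (ENNReal.ofReal C₁ * A t (m.region Q₁) +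
          ENNReal.ofReal C₁ * D t + ENNReal.ofReal (δ / (2 * K)) * A t univ))) := by
          rw [Finset.sum_const, Finset.card_univ, nsmul_eq_mul]
          gcongr
          rw [← ENNReal.ofReal_natCast]
          exact ENNReal.ofReal_le_ofReal (by rw [hN]; linarith)
      _ = _ := by
          rw [hK, ENNReal.ofReal_mul (by positivity), ENNReal.ofReal_mul hB0.le]; ring
  refine h2.trans ?_
  calc _ ≤ ENNReal.ofReal K * (ENNReal.ofReal C₁ * (ENNReal.ofReal (δ / (2 * K * C₁)) * A t univ +
        ENNReal.ofReal C₂ * D t) + ENNReal.ofReal C₁ * D t +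
        ENNReal.ofReal (δ / (2 * K)) * A t univ) := by gcongr; exact H₂ t
    _ = (ENNReal.ofReal K * ENNReal.ofReal C₁ * ENNReal.ofReal (δ / (2 * K * C₁)) +
          ENNReal.ofReal K * ENNReal.ofReal (δ / (2 * K))) * A t univ +
        (ENNReal.ofReal K * ENNReal.ofReal C₁ * ENNReal.ofReal C₂ +
          ENNReal.ofReal K * ENNReal.ofReal C₁) * D t := by ring
    _ = _ := by
        rw [← ENNReal.ofReal_mul hK0.le, ← ENNReal.ofReal_mul hK0.le,
          ← ENNReal.ofReal_mul (by positivity), ← ENNReal.ofReal_mul (by positivity),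
          ← ENNReal.ofReal_add (by positivity) (by positivity),
          ← ENNReal.ofReal_add (by positivity) (by positivity)]
        congr 3
        field_simp
        norm_num

theorem center_mem : m.chart x ∈ m.chart.target := m.chart.map_source m.mem_source

theorem symm_center : m.chart.symm (m.chart x) = x := m.chart.left_inv m.mem_source

theorem S_eq_empty (hx : x ∉ E) : m.S = ∅ := by
  refine Finset.eq_empty_of_forall_notMem fun j hj ↦ hx ?_
  have h := (m.mem_iff _ (Metric.mem_ball_self m.R_pos)).2 ⟨j, hj, m.eq_zero j hj⟩
  rwa [m.symm_center] at h

/-- Control propagates off the divisor. -/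
theorem mem_controlledSet_of_notMem (m : PoincareModel n p E A D x) (hA : IsMass A) (hx : x ∉ E)
    (hcl : x ∈ closure (controlledSet A D)) : x ∈ controlledSet A D := by
  have hS := m.S_eq_empty hx
  have hR := m.R_pos
  have hV : m.region (Metric.ball (m.chart x) (m.R / 8)) ∈ 𝓝 x := by
    have := m.region_mem_nhds Metric.isOpen_ball
      (Metric.mem_ball_self (x := m.chart x) (by positivity : 0 < m.R / 8)) m.center_mem
    rwa [m.symm_center] at this
  -- Propagation starts from a controlled point `y` much closer to `x` than the radius of the model,
  -- so that polydiscs around `y` reach `x` and stay in the model.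
  obtain ⟨y, ⟨hys, hyB⟩, W, hW, hWc⟩ := mem_closure_iff_nhds.1 hcl _ hV
  set w := m.chart y with hw
  have hwx : dist w (m.chart x) < m.R / 8 := hyB
  have hsymm : ∀ᶠ z in 𝓝 w, m.chart.symm z ∈ W := by
    refine (m.chart.continuousAt_symm (m.chart.map_source hys)).eventually ?_
    rw [m.chart.left_inv hys]
    exact hW
  obtain ⟨ρ₀, hρ₀, hρW⟩ := Metric.eventually_nhds_iff_ball.1 hsymm
  set ρ := min ρ₀ (m.R / 8) with hρ
  have hρ0 : 0 < ρ := lt_min hρ₀ (by positivity)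
  have hρR : ρ ≤ m.R / 8 := min_le_right _ _
  -- The small polydisc of radius `ρ` lies in the controlled set `W`. The coordinates are enlarged
  -- to radius `R / 4` one by one, `T` being those already enlarged; the error term of each step
  -- uses the radius `R / 2`, still inside the model.
  set box : Finset (Fin n) → Fin n → Set ℂ := fun T j ↦
    Metric.ball (w j) (if j ∈ T then m.R / 4 else ρ) with hbox
  have hboxm : ∀ T j, MeasurableSet (box T j) := fun T j ↦ Metric.isOpen_ball.measurableSet
  have hsub : ∀ Q : Fin n → Set ℂ, (∀ j, Q j ⊆ Metric.ball (w j) (m.R / 2)) →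
      univ.pi Q ⊆ Metric.ball (m.chart x) m.R := by
    intro Q hQ z hz
    have h1 : dist z w < m.R / 2 := by
      rw [dist_pi_lt_iff (by positivity)]
      exact fun j ↦ hQ j (hz j (mem_univ j))
    rw [Metric.mem_ball]
    linarith [dist_triangle z w (m.chart x)]
  have hbsub : ∀ T j, box T j ⊆ Metric.ball (w j) (m.R / 2) := fun T j ↦ by
    refine Metric.ball_subset_ball ?_
    split_ifs <;> linarith
  have key : ∀ T : Finset (Fin n), IsControlled A D (m.region (univ.pi (box T))) := by
    intro T
    induction T using Finset.induction_on with
    | empty =>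
      refine hWc.mono hA fun v hv ↦ ?_
      rw [← m.chart.left_inv hv.1]
      refine hρW _ (Metric.ball_subset_ball (min_le_left ρ₀ (m.R / 8)) ?_)
      rw [ball_pi _ hρ0]
      simpa [hbox] using hv.2
    | insert i T hi ih =>
      have h1 : box (insert i T) = Function.update (box T) i (Metric.ball (w i) (m.R / 4)) := by
        ext1 j
        by_cases hj : j = i
        · subst hj; simp [hbox]
        · simp [hbox, hj]
      have h2 : box T = Function.update (box T) i (Metric.ball (w i) ρ) := by
        ext1 j
        by_cases hj : j = i
        · subst hj; simp [hbox, hi]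
        · simp [hj]
      have hQ₂ : ∀ j, Function.update (box T) i (Metric.ball (w i) (m.R / 2)) j ⊆
          Metric.ball (w j) (m.R / 2) := fun j ↦ by
        by_cases hj : j = i
        · subst hj; simp
        · simpa [hj] using hbsub T j
      refine m.isControlled_region hA (MeasurableSet.univ_pi (hboxm _)) (hsub _ (hbsub _))
        (MeasurableSet.univ_pi (hboxm T)) (hsub _ (hbsub T))
        (measurableSet_pi_update (hboxm T) i Metric.isOpen_ball.measurableSet) (hsub _ hQ₂) i ih
        fun δ hδ ↦ ?_
      obtain ⟨C, hC, H⟩ := lintegral_pi_le_propagation (n := n) hρ0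
        (show ρ < m.R / 4 by linarith) (show m.R / 4 < m.R / 2 by linarith) hδ
      refine ⟨fun _ ↦ C, fun _ ↦ hC, fun t J ↦ ?_⟩
      have h3 := H (box T) (hboxm T) i (w i) _ (m.contDiff_coeff t J)
      rw [← h1, ← h2] at h3
      -- Off the divisor `S` is empty and all weights are trivial.
      have hm : ∀ z : Fin n → ℂ, modelWeight ∅ z i = 1 := fun z ↦ by simp [modelWeight]
      simpa only [mass, energy, hS, formWeight_eq_one, hm, one_mul] using h3
  refine ⟨_, hV, (key Finset.univ).mono hA (m.region_mono fun z hz ↦ ?_)⟩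
  intro j _
  have h1 : dist z w < m.R / 4 := by
    have h2 := dist_triangle z (m.chart x) w
    rw [dist_comm (m.chart x)] at h2
    rw [Metric.mem_ball] at hz
    linarith
  have h3 := (dist_pi_lt_iff (by positivity : 0 < m.R / 4)).1 h1 j
  simpa [hbox] using h3

end PoincareModel

theorem isPreconnected_ball_diff_zero (r : ℝ) : IsPreconnected (Metric.ball (0 : ℂ) r \ {0}) := by
  have h : Metric.ball (0 : ℂ) r \ {0} =
      (fun q : ℝ × ℝ ↦ (q.1 : ℂ) * Complex.exp (q.2 * Complex.I)) '' (Ioo 0 r ×ˢ univ) := by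
    ext z
    constructor
    · rintro ⟨h1, h2⟩
      refine ⟨(‖z‖, z.arg), ⟨⟨norm_pos_iff.2 h2, mem_ball_zero_iff.1 h1⟩, mem_univ _⟩, ?_⟩
      exact Complex.norm_mul_exp_arg_mul_I z
    · rintro ⟨⟨q, θ⟩, ⟨⟨h1, h2⟩, -⟩, rfl⟩
      refine ⟨?_, ?_⟩
      · rw [mem_ball_zero_iff]
        simpa [Complex.norm_exp_ofReal_mul_I, abs_of_pos h1] using h2
      · simp [h1.ne', Complex.exp_ne_zero]
  rw [h]
  refine (isPreconnected_Ioo.prod isPreconnected_univ).image _ ?_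
  fun_prop

theorem exists_forall_ne_zero {c : Fin n → ℂ} {P : (Fin n → ℂ) → Prop} (hP : ∀ᶠ z in 𝓝 c, P z) :
    ∃ z, P z ∧ ∀ j, z j ≠ 0 := by
  have h1 : Tendsto (fun t : ℂ ↦ c + fun _ ↦ t) (𝓝[≠] 0) (𝓝 c) := by
    have h : Continuous fun t : ℂ ↦ c + fun _ : Fin n ↦ t := by fun_prop
    have h0 : c + (fun _ : Fin n ↦ (0 : ℂ)) = c := by ext; simp
    have h2 := (h.tendsto 0).mono_left (nhdsWithin_le_nhds (s := {0}ᶜ))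
    rwa [h0] at h2
  have h2 : ∀ᶠ t in 𝓝[≠] (0 : ℂ), ∀ j, (c + fun _ : Fin n ↦ t) j ≠ 0 := by
    refine eventually_all.2 fun j ↦ ?_
    by_cases hj : c j = 0
    · filter_upwards [self_mem_nhdsWithin] with t ht
      simpa [hj] using ht
    · refine nhdsWithin_le_nhds ?_
      have : ContinuousAt (fun t : ℂ ↦ (c + fun _ : Fin n ↦ t) j) 0 := by
        simp only [Pi.add_apply]; fun_prop
      exact this.eventually_ne (by simpa using hj)
  obtain ⟨t, h3, h4⟩ := ((h1.eventually hP).and h2).exists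
  exact ⟨_, h3, h4⟩

end Controlled

/-! ### Control at the divisor and the global estimate -/

section Propagation

open Filter Topology

variable {X 𝒯 : Type*} {A : 𝒯 → Set X → ℝ≥0∞} {D : 𝒯 → ℝ≥0∞} [TopologicalSpace X] {n p : ℕ}
  {E : Set X} {x : X}

namespace PoincareModel

/-- The coordinate polydisc of a model with the divisor removed is connected. -/
theorem isPreconnected_ball_diff (m : PoincareModel n p E A D x) :
    IsPreconnected {z | z ∈ Metric.ball (m.chart x) m.R ∧ ∀ j ∈ m.S, z j ≠ 0} := by
  classical
  have h : {z | z ∈ Metric.ball (m.chart x) m.R ∧ ∀ j ∈ m.S, z j ≠ 0} =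
      univ.pi fun j ↦ if j ∈ m.S then Metric.ball 0 m.R \ {0}
        else Metric.ball (m.chart x j) m.R := by
    ext z
    rw [mem_ofPred_eq, ball_pi _ m.R_pos]
    simp only [Set.mem_pi, mem_univ, true_imp_iff, ← forall_and]
    refine forall_congr' fun j ↦ ?_
    by_cases hj : j ∈ m.S
    · rw [if_pos hj, m.eq_zero j hj]
      simp [hj]
    · simp [hj]
  rw [h]
  refine isPreconnected_univ_pi fun j ↦ ?_
  split_ifs
  · exact isPreconnected_ball_diff_zero _
  · exact (convex_ball _ _).isPreconnected

/-- Control extends from the complement of the divisor to the divisor. -/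
theorem mem_controlledSet_of_ball (m : PoincareModel n p E A D x) (hA : IsMass A)
    (h : ∀ z ∈ Metric.ball (m.chart x) m.R, (∀ j ∈ m.S, z j ≠ 0) →
      m.chart.symm z ∈ controlledSet A D) : x ∈ controlledSet A D := by
  classical
  have hR := m.R_pos
  -- Strong induction on the number of coordinates in `S` that vanish at `z`; none is the
  -- hypothesis.
  have key : ∀ d : ℕ, ∀ z ∈ Metric.ball (m.chart x) m.R,
      (m.S.filter fun j ↦ z j = 0).card = d → m.chart.symm z ∈ controlledSet A D := by
    intro d
    induction d using Nat.strong_induction_on with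
    | _ d ih =>
    intro z hz hd
    by_cases hne : ∀ j ∈ m.S, z j ≠ 0
    · exact h z hz hne
    push Not at hne
    obtain ⟨i, hi, hzi⟩ := hne
    have hev : ∀ᶠ y in 𝓝 z, y ∈ Metric.ball (m.chart x) m.R ∧ ∀ j, z j ≠ 0 → y j ≠ 0 := by
      refine (Metric.isOpen_ball.eventually_mem hz).and (eventually_all.2 fun j ↦ ?_)
      by_cases hj : z j = 0
      · exact Eventually.of_forall fun y h ↦ absurd hj h
      · exact ((continuous_apply j).continuousAt.eventually_ne hj).mono fun y h _ ↦ h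
    obtain ⟨ρ, hρ, hball⟩ := Metric.eventually_nhds_iff_ball.1 hev
    set r₂ := min (ρ / 2) (Real.exp (-40)) with hr₂
    have hr₂0 : 0 < r₂ := lt_min (by positivity) (Real.exp_pos _)
    have hr₂ρ : r₂ < ρ := (min_le_left _ _).trans_lt (by linarith)
    have hr₂e : r₂ ≤ Real.exp (-40) := min_le_right _ _
    set Q : Fin n → Set ℂ := fun j ↦ Metric.ball (z j) r₂ with hQ
    have hQm : ∀ j, MeasurableSet (Q j) := fun j ↦ Metric.isOpen_ball.measurableSet
    have hQ1 : ∀ j ∈ m.S, Q j ⊆ Metric.ball 0 1 := by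
      intro j hj y hy
      have h1 : ‖z j‖ < m.R := by
        have := (dist_pi_lt_iff hR).1 hz j
        rwa [m.eq_zero j hj, dist_zero_right] at this
      have h2 : Real.exp (-40) < 1 / 2 := by
        have h3 : Real.exp (-40) * Real.exp 40 = 1 := by rw [← Real.exp_add]; simp
        have h4 := Real.add_one_le_exp (40 : ℝ)
        nlinarith [Real.exp_pos (-40)]
      have h3 : dist y 0 ≤ dist y (z j) + dist (z j) 0 := dist_triangle _ _ _
      have h4 : dist y (z j) < r₂ := hy
      rw [dist_zero_right (z j)] at h3
      rw [Metric.mem_ball]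
      linarith [m.R_le]
    have hball' : ∀ B : Set ℂ, B ⊆ Metric.closedBall 0 r₂ →
        univ.pi (Function.update (fun j ↦ Metric.closedBall (z j) r₂) i B) ⊆ Metric.ball z ρ := by
      intro B hB y hy
      rw [Metric.mem_ball, dist_pi_lt_iff hρ]
      intro j
      have h3 := hy j (mem_univ j)
      by_cases hj : j = i
      · subst hj
        rw [Function.update_self] at h3
        rw [hzi]
        exact lt_of_le_of_lt (hB h3) hr₂ρ
      · rw [Function.update_of_ne hj] at h3
        exact lt_of_le_of_lt h3 hr₂ρ
    have hsub : ∀ B : Set ℂ, univ.pi (Function.update Q i B) ⊆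
        univ.pi (Function.update (fun j ↦ Metric.closedBall (z j) r₂) i B) := fun B ↦ by
      refine pi_mono fun j _ ↦ ?_
      by_cases hj : j = i
      · subst hj; simp
      · simpa [hj, hQ] using Metric.ball_subset_closedBall
    have hsubR : ∀ B : Set ℂ, B ⊆ Metric.closedBall 0 r₂ →
        univ.pi (Function.update Q i B) ⊆ Metric.ball (m.chart x) m.R := fun B hB y hy ↦
      (hball y (hball' B hB (hsub B hy))).1
    -- Replacing the `i`-th disc by a closed ring gives a compact set. Its points have at most the
    -- vanishing coordinates of `z`, and no longer the `i`-th, so the induction hypothesis and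
    -- compactness give control over it. The Hardy inequality then passes from the ring to the disc.
    set ring := Metric.closedBall (0 : ℂ) r₂ \ Metric.ball 0 (r₂ / 2) with hring
    set Kc := univ.pi (Function.update (fun j ↦ Metric.closedBall (z j) r₂) i ring) with hKc
    have hKcc : IsCompact Kc := by
      refine isCompact_univ_pi fun j ↦ ?_
      by_cases hj : j = i
      · subst hj
        rw [Function.update_self]
        exact (isCompact_closedBall _ _).diff Metric.isOpen_ball
      · rw [Function.update_of_ne hj]
        exact isCompact_closedBall _ _
    have hKcb : Kc ⊆ Metric.ball z ρ := hball' ring sdiff_subset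
    have hKcG : m.chart.symm '' Kc ⊆ controlledSet A D := by
      rintro _ ⟨y, hy, rfl⟩
      obtain ⟨h1, h2⟩ := hball y (hKcb hy)
      refine ih _ ?_ y h1 rfl
      rw [← hd]
      refine Finset.card_lt_card (Finset.ssubset_iff_subset_ne.2 ⟨fun j hj ↦ ?_, fun heq ↦ ?_⟩)
      · have h3 := Finset.mem_filter.1 hj
        exact Finset.mem_filter.2 ⟨h3.1, by_contra fun h4 ↦ h2 j h4 h3.2⟩
      · have h3 : i ∈ m.S.filter fun j ↦ z j = 0 := Finset.mem_filter.2 ⟨hi, hzi⟩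
        rw [← heq] at h3
        have h4 := hy i (mem_univ i)
        rw [Function.update_self] at h4
        refine h4.2 ?_
        rw [(Finset.mem_filter.1 h3).2]
        exact Metric.mem_ball_self (by positivity)
    have hcont : IsControlled A D (m.chart.symm '' Kc) :=
      (hKcc.image_of_continuousOn (m.chart.continuousOn_symm.mono fun y hy ↦
        m.ball_subset (hball y (hKcb hy)).1)).isControlled hA hKcG
    have hb (r : ℝ) : MeasurableSet (Metric.ball (0 : ℂ) r) := Metric.isOpen_ball.measurableSet
    have hc1 : Metric.ball (0 : ℂ) (r₂ / 2) ⊆ Metric.closedBall 0 r₂ :=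
      (Metric.ball_subset_ball (by linarith)).trans Metric.ball_subset_closedBall
    have hmain := m.isControlled_region hA
      (Q := univ.pi (Function.update Q i (Metric.ball 0 (r₂ / 2))))
      (Q₁ := univ.pi (Function.update Q i (Metric.ball 0 r₂ \ Metric.ball 0 (r₂ / 2))))
      (Q₂ := univ.pi (Function.update Q i (Metric.ball 0 r₂)))
      (measurableSet_pi_update hQm i (hb _)) (hsubR _ hc1)
      (measurableSet_pi_update hQm i ((hb _).diff (hb _)))
      (hsubR _ (sdiff_subset.trans Metric.ball_subset_closedBall))
      (measurableSet_pi_update hQm i (hb _)) (hsubR _ Metric.ball_subset_closedBall) i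
      (hcont.mono hA ((m.region_mono ((hsub _).trans (pi_mono fun j _ ↦ by
        by_cases hj : j = i
        · subst hj
          rw [Function.update_self, Function.update_self]
          exact sdiff_subset_sdiff_left Metric.ball_subset_closedBall
        · rw [Function.update_of_ne hj, Function.update_of_ne hj]))).trans
        m.region_subset_image))
      fun δ hδ ↦ by
        choose C hC H using fun J : Fin p ↪o Fin n ↦ lintegral_pi_le_formWeight m.b_nonneg hi
          (m.b_lt i hi) J (half_pos hr₂0) (half_lt_self hr₂0) hr₂e
        refine ⟨C, hC, fun t J ↦ ?_⟩
        have h1 := H J Q hQm hQ1 _ (m.contDiff_coeff t J) (m.exists_coeff_eq_zero t J)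
        -- The Hardy inequality has no small error term, so the `δ`-term is only added for free.
        refine le_trans (le_trans h1 (le_of_eq (add_comm _ _))) le_self_add
    refine ⟨_, m.region_mem_nhds ?_ ?_ (m.ball_subset hz), hmain⟩
    · refine isOpen_set_pi finite_univ fun j _ ↦ ?_
      by_cases hj : j = i
      · subst hj; simp
      · simp [hj, hQ]
    · intro j _
      by_cases hj : j = i
      · subst hj; simp [hzi, hr₂0]
      · simp [hj, hQ, hr₂0]
  have h1 := key _ _ (Metric.mem_ball_self m.R_pos) rfl
  rwa [m.symm_center] at h1

end PoincareModel

/-- A limit point of the set may lie on the divisor, so control is first obtained on the nearby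
points off the divisor. In the model they form a connected set, in which the controlled points are
open and, by propagation off the divisor, relatively closed. -/
theorem isClosed_controlledSet (hA : IsMass A) (hm : ∀ x, Nonempty (PoincareModel n p E A D x)) :
    IsClosed (controlledSet A D) := by
  have hclE : ∀ y, y ∉ E → y ∈ closure (controlledSet A D) → y ∈ controlledSet A D :=
    fun y hy hcl ↦ (hm y).some.mem_controlledSet_of_notMem hA hy hcl
  refine isClosed_of_closure_subset fun x hx ↦ ?_
  obtain ⟨m⟩ := hm x
  refine m.mem_controlledSet_of_ball hA ?_
  set P := {z | z ∈ Metric.ball (m.chart x) m.R ∧ ∀ j ∈ m.S, z j ≠ 0} with hP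
  have hPE : ∀ z ∈ P, m.chart.symm z ∉ E := fun z hz h0 ↦ by
    obtain ⟨j, hj, h1⟩ := (m.mem_iff z hz.1).1 h0
    exact hz.2 j hj h1
  have hsub : m.chart.symm '' P ⊆ controlledSet A D := by
    refine (m.isPreconnected_ball_diff.image _ (m.chart.continuousOn_symm.mono fun z hz ↦
      m.ball_subset hz.1)).subset_of_closure_inter_subset isOpen_controlledSet ?_ ?_
    · have hV : m.region (Metric.ball (m.chart x) m.R) ∈ 𝓝 x := by
        have := m.region_mem_nhds Metric.isOpen_ball (Metric.mem_ball_self m.R_pos) m.center_mem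
        rwa [m.symm_center] at this
      obtain ⟨y, ⟨hys, hyB⟩, hyG⟩ := mem_closure_iff_nhds.1 hx _ hV
      have h1 : ∀ᶠ z in 𝓝 (m.chart y), z ∈ Metric.ball (m.chart x) m.R ∧
          m.chart.symm z ∈ controlledSet A D := by
        refine (Metric.isOpen_ball.eventually_mem hyB).and ?_
        refine (m.chart.continuousAt_symm (m.chart.map_source hys)).eventually ?_
        rw [m.chart.left_inv hys]
        exact isOpen_controlledSet.mem_nhds hyG
      -- The controlled point found near `x` may itself lie on the divisor; since the set is open,
      -- it can be moved off all coordinate hyperplanes.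
      obtain ⟨z, ⟨h2, h3⟩, h4⟩ := exists_forall_ne_zero h1
      exact ⟨_, ⟨z, ⟨h2, fun j _ ↦ h4 j⟩, rfl⟩, h3⟩
    · rintro _ ⟨hcl, ⟨z, hz, rfl⟩⟩
      exact hclE _ (hPE z hz) hcl
  exact fun z hz hne ↦ hsub ⟨z, ⟨hz, hne⟩, rfl⟩

/-- Off the divisor the weights are trivial and the coefficients continuous. This finiteness is what
allows the final absorption. -/
theorem PoincareModel.exists_nhds_mass_lt_top (m : PoincareModel n p E A D x) (hx : x ∉ E)
    (t : 𝒯) : ∃ V ∈ 𝓝 x, A t V < ⊤ := by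
  have hS := m.S_eq_empty hx
  have hR := m.R_pos
  set Q := Metric.ball (m.chart x) m.R with hQ
  have hV : m.region Q ∈ 𝓝 x := by
    have := m.region_mem_nhds Metric.isOpen_ball (Metric.mem_ball_self m.R_pos) m.center_mem
    rwa [m.symm_center] at this
  refine ⟨_, hV, (m.le_mass Metric.isOpen_ball.measurableSet le_rfl t).trans_lt ?_⟩
  refine ENNReal.mul_lt_top ENNReal.ofReal_lt_top (ENNReal.sum_lt_top.2 fun J _ ↦ ?_)
  refine lt_of_le_of_lt (lintegral_mono_set Metric.ball_subset_closedBall) ?_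
  simp only [hS, formWeight_eq_one, one_mul]
  exact setLIntegral_lt_top_of_isCompact measure_closedBall_lt_top.ne (isCompact_closedBall _ _)
    (continuous_real_toNNReal.comp ((m.contDiff_coeff t J).continuous.norm.pow 2))

/-- The mass is bounded by the energy. -/
theorem exists_mass_le_energy [CompactSpace X] (hA : IsMass A)
    (hm : ∀ x, Nonempty (PoincareModel n p E A D x))
    (hK : ∀ t, ∃ K, IsClosed K ∧ Disjoint K E ∧ A t Kᶜ = 0)
    (hcomp : ∀ x : X, ∃ y ∈ connectedComponent x, y ∈ controlledSet A D) :
    ∃ C : ℝ, 0 < C ∧ ∀ t, A t univ ≤ ENNReal.ofReal C * D t := by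
  have hclopen : IsClopen (controlledSet A D) :=
    ⟨isClosed_controlledSet hA hm, isOpen_controlledSet⟩
  have huniv : univ ⊆ controlledSet A D := fun x _ ↦ by
    obtain ⟨y, hy, hyG⟩ := hcomp x
    -- A clopen set contains the whole component of each of its points.
    have h1 := hclopen.connectedComponent_subset hyG
    rw [← connectedComponent_eq hy] at h1
    exact h1 mem_connectedComponent
  have hfin : ∀ t, A t univ < ⊤ := fun t ↦ by
    refine isCompact_univ.induction_on (p := fun V ↦ A t V < ⊤) (by simp [hA.empty])
      (fun V W hVW h ↦ (hA.mono t hVW).trans_lt h)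
      (fun V W h1 h2 ↦ (hA.union t V W).trans_lt (ENNReal.add_lt_top.2 ⟨h1, h2⟩)) fun x _ ↦ ?_
    obtain ⟨K, hK1, hK2, hK3⟩ := hK t
    by_cases hx : x ∈ K
    · obtain ⟨V, hV, h1⟩ := (hm x).some.exists_nhds_mass_lt_top
        (fun h ↦ hK2.le_bot ⟨hx, h⟩) t
      exact ⟨V, mem_nhdsWithin_of_mem_nhds hV, h1⟩
    · exact ⟨Kᶜ, mem_nhdsWithin_of_mem_nhds (hK1.isOpen_compl.mem_nhds hx), by simp [hK3]⟩
  -- With `δ = 1/2` the total mass is at most half of itself plus a multiple of the energy; being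
  -- finite, the half can be cancelled.
  obtain ⟨C, hC, H⟩ := isCompact_univ.isControlled hA huniv (1 / 2) (by norm_num)
  refine ⟨2 * C + 1, by positivity, fun t ↦ ?_⟩
  have h1 := H t
  have h2 : A t univ = ENNReal.ofReal (1 / 2) * A t univ + ENNReal.ofReal (1 / 2) * A t univ := by
    rw [← add_mul, ← ENNReal.ofReal_add (by norm_num) (by norm_num)]
    norm_num
  have h3 : ENNReal.ofReal (1 / 2) * A t univ ≤ ENNReal.ofReal C * D t := by
    have h4 : ENNReal.ofReal (1 / 2) * A t univ ≠ ⊤ :=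
      ENNReal.mul_ne_top ENNReal.ofReal_ne_top (hfin t).ne
    rw [← ENNReal.add_le_add_iff_left h4, ← h2]
    exact h1
  calc A t univ = ENNReal.ofReal 2 * (ENNReal.ofReal (1 / 2) * A t univ) := by
        rw [← mul_assoc, ← ENNReal.ofReal_mul (by norm_num)]
        norm_num
    _ ≤ ENNReal.ofReal 2 * (ENNReal.ofReal C * D t) := by gcongr
    _ = ENNReal.ofReal (2 * C) * D t := by
        rw [← mul_assoc, ← ENNReal.ofReal_mul (by norm_num)]
    _ ≤ _ := by
        gcongr
        linarith

end Propagation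

/-! ### Vanishing of the norms outside the support -/

section Vanishing

open Filter Topology

variable {n p : ℕ} {X : Type*} [TopologicalSpace X] [ChartedSpace (Fin n → ℂ) X]
  {L : X → Type*} [TopologicalSpace (TotalSpace ℂ L)] [∀ x, AddCommGroup (L x)]
  [∀ x, Module ℂ (L x)] [∀ x, TopologicalSpace (L x)] [FiberBundle ℂ L]
  {P : ∀ x : X, TangentSpace 𝓘(ℂ, Fin n → ℂ) x → TangentSpace 𝓘(ℂ, Fin n → ℂ) x → ℂ}
  {h : ∀ x, L x → ℝ} {B K : Set X} {τ : LForm n L p} {x : X}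

omit [TopologicalSpace X] [ChartedSpace (Fin n → ℂ) X] [TopologicalSpace (TotalSpace ℂ L)]
  [∀ x, TopologicalSpace (L x)] [FiberBundle ℂ L] in
theorem IsFiberMetricOn.apply_zero (hh : IsFiberMetricOn h B) (hx : x ∈ B) : h x 0 = 0 := by
  have h1 := (hh x hx).1 0 0
  simpa using h1

omit [TopologicalSpace (TotalSpace ℂ L)] [∀ x, TopologicalSpace (L x)] [FiberBundle ℂ L] in
theorem formNormSq_eq_zero (hh : IsFiberMetricOn h B) (hx : x ∈ B) (hτ : τ x = 0) :
    formNormSq P h τ x = 0 := by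
  simp [formNormSq, hτ, hh.apply_zero hx]

variable [VectorBundle ℂ ℂ L]

theorem dbarNormSq_eq_zero (hh : IsFiberMetricOn h B) (hx : x ∈ B) (hK : IsClosed K) (hxK : x ∉ K)
    (hτ : ∀ y, y ∉ K → τ y = 0) : dbarNormSq P h τ x = 0 := by
  have hx₀ : x ∈ (trivializationAt ℂ L x).baseSet := mem_baseSet_trivializationAt ℂ L x
  have hc₀ : x ∈ (chartAt (Fin n → ℂ) x).source := mem_chart_source _ x
  have h1 : ∀ v w, dbarForm τ x w v = 0 := fun v w ↦ by
    have h2 : coeff τ (chartAt (Fin n → ℂ) x) (trivializationAt ℂ L x)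
        (fun a ↦ components x (v a)) =ᶠ[𝓝 (chartAt (Fin n → ℂ) x x)] fun _ ↦ 0 := by
      filter_upwards [eventually_symm_mem ((chartAt (Fin n → ℂ) x).map_source hc₀)
        (hK.isOpen_compl.inter (trivializationAt ℂ L x).open_baseSet)
        (by rw [(chartAt (Fin n → ℂ) x).left_inv hc₀]; exact ⟨hxK, hx₀⟩)] with ζ hζ
      exact coeff_eq_zero hζ.2.2 (hτ _ hζ.2.1) _
    rw [dbarForm, dbarDir_congr h2, dbarDir_const,
      ← (trivializationAt ℂ L x).coe_symmₗ (R := ℂ) hx₀, map_zero]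
  simp [dbarNormSq, h1, hh.apply_zero hx]

end Vanishing

theorem proposition2p3 {n N M : ℕ}
    -- a compact complex manifold
    {X : Type*} [TopologicalSpace X] [T2Space X] [CompactSpace X]
    [ChartedSpace (Fin n → ℂ) X] [IsManifold 𝓘(ℂ, Fin n → ℂ) ω X]
    [MeasurableSpace X] [BorelSpace X]
    -- the holomorphic line bundles of the components of the divisor
    (F : Fin N → X → Type*) [∀ i, TopologicalSpace (TotalSpace ℂ (F i))]
    [∀ i x, AddCommGroup (F i x)] [∀ i x, Module ℂ (F i x)] [∀ i x, TopologicalSpace (F i x)]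
    [∀ i, FiberBundle ℂ (F i)] [∀ i, VectorBundle ℂ ℂ (F i)]
    [∀ i, ContMDiffVectorBundle ω ℂ (F i) 𝓘(ℂ, Fin n → ℂ)]
    -- the holomorphic sections that cut out the components, and smooth metrics
    (s : ∀ i x, F i x)
    (hs : ∀ i, ContMDiff 𝓘(ℂ, Fin n → ℂ) (𝓘(ℂ, Fin n → ℂ).prod 𝓘(ℂ, ℂ)) ω
      fun x ↦ (⟨x, s i x⟩ : TotalSpace ℂ (F i)))
    (hsnc : IsSNC n s)
    (hF : ∀ i x, F i x → ℝ) (hF_smooth : ∀ i, IsSmoothMetric n (hF i))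
    (hF_lt : ∀ i x, hF i x (s i x) < Real.exp (-1))
    -- the metric with Poincaré singularities
    (g : HermitianMetric n X)
    (hg : ∃ c : ℝ, 0 < c ∧ ∀ x, x ∉ divisorSupport s →
      ∀ v, c * (g.form x v v).re ≤ (poincareForm g s hF x v v).re)
    -- a holomorphic line bundle with a metric with logarithmic type singularities
    (L : X → Type*) [TopologicalSpace (TotalSpace ℂ L)]
    [∀ x, AddCommGroup (L x)] [∀ x, Module ℂ (L x)] [∀ x, TopologicalSpace (L x)]
    [FiberBundle ℂ L] [VectorBundle ℂ ℂ L] [ContMDiffVectorBundle ω ℂ L 𝓘(ℂ, Fin n → ℂ)]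
    (hL : ∀ x, L x → ℝ) (hL_metric : IsFiberMetricOn hL (divisorSupport s)ᶜ)
    (hL_log : HasLogSing (n := n) hL (divisorSupport s))
    -- coordinate sets covering the divisor, and an open set in their union
    (Ω : Fin M → OpenPartialHomeomorph X (Fin n → ℂ)) (hΩ : ∀ j, IsCoord (Ω j))
    (hΩE : divisorSupport s ⊆ ⋃ j, (Ω j).source)
    (U : Set X) (hU : IsOpen U) (hUΩ : U ⊆ ⋃ j, (Ω j).source)
    (hU_dense : ∀ x : X, ∃ y ∈ connectedComponent x, y ∉ closure U)
    (p : ℕ) :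
    ∃ C : ℝ, 0 < C ∧ ∀ τ : LForm n L p, IsSmoothForm τ →
      (∃ K : Set X, IsCompact K ∧ K ⊆ U \ divisorSupport s ∧ ∀ x, x ∉ K → τ x = 0) →
      ∫⁻ x in U \ divisorSupport s, formNormSq (poincareForm g s hF) hL τ x
          ∂hermVolume (poincareForm g s hF) ≤
        ENNReal.ofReal C *
          ∫⁻ x in U \ divisorSupport s, dbarNormSq (poincareForm g s hF) hL τ x
            ∂hermVolume (poincareForm g s hF) := by
  classical
  set E := divisorSupport s with hE_def
  set P := poincareForm g s hF with hP_def
  have hEcl : IsClosed E := by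
    refine isOpen_compl_iff.1 (isOpen_iff_mem_nhds.2 fun x hx ↦ ?_)
    have hx₀ : x ∈ (chartAt (Fin n → ℂ) x).source := mem_chart_source _ x
    have h1 := eventually_notMem_divisorSupport hs (isCoord_chartAt x) hx₀ hx
    filter_upwards [((chartAt (Fin n → ℂ) x).continuousAt hx₀).eventually h1,
      (chartAt (Fin n → ℂ) x).open_source.mem_nhds hx₀] with y h2 h3
    rwa [(chartAt (Fin n → ℂ) x).left_inv h3] at h2
  -- The admissible forms serve as parameter space, so that the constants of control are uniform in
  -- the form by construction.
  let 𝒯 := {τ : LForm n L p // IsSmoothForm τ ∧ ∃ K : Set X, IsCompact K ∧ K ⊆ U \ E ∧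
    ∀ x, x ∉ K → τ x = 0}
  let A : 𝒯 → Set X → ℝ≥0∞ := fun t V ↦ ∫⁻ y in V \ E, formNormSq P hL t.1 y ∂hermVolume P
  -- Mass and energy are taken over all of `X` without the divisor, because propagation runs through
  -- all of `X`; both vanish outside `U`.
  let D : 𝒯 → ℝ≥0∞ := fun t ↦ ∫⁻ y in Eᶜ, dbarNormSq P hL t.1 y ∂hermVolume P
  have hA : IsMass A :=
    { empty := fun t ↦ by simp [A]
      mono := fun t V W hVW ↦ lintegral_mono_set (sdiff_subset_sdiff_left hVW)
      union := fun t V W ↦ by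
        simp only [A, union_sdiff_distrib]
        exact lintegral_union_le _ _ _ }
  have hzero : ∀ t : 𝒯, ∀ V : Set X, MeasurableSet V → (∀ x ∈ V, x ∉ U) → A t V = 0 := by
    rintro ⟨τ, hτ, K, hK, hKU, hτK⟩ V hV hVU
    have h1 : ∀ x ∈ V \ E, formNormSq P hL τ x = 0 := fun x hx ↦
      formNormSq_eq_zero hL_metric hx.2 (hτK x fun h ↦ hVU x hx.1 (hKU h).1)
    change ∫⁻ y in V \ E, formNormSq P hL τ y ∂hermVolume P = 0
    rw [setLIntegral_congr_fun (g := fun _ ↦ 0) (hV.diff hEcl.measurableSet) h1, lintegral_zero]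
  have hm : ∀ x, Nonempty (PoincareModel n p E A D x) := by
    intro x
    obtain ⟨φ, hφ, hx, he, S, b', b, k, M', hS, hb, hk, hE, hw⟩ :=
      hL_log.exists_coord hL_metric x
    obtain ⟨c₀, C₀, hcmp⟩ := exists_isComparable hs hsnc hF_smooth hF_lt hg hφ hx hS hE
    refine nonempty_poincareModel (T := fun t : 𝒯 ↦ t.1) (fun t ↦ t.2.1) (fun t ↦ ?_)
      hEcl.measurableSet hL_metric (fun φ' hφ' z hz hzE ↦ ?_) hφ hx he hS hb hk hE hw hcmp
    · obtain ⟨K, hK, hKU, hτK⟩ := t.2.2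
      exact ⟨K, hK.isClosed, disjoint_left.2 fun y hy ↦ (hKU hy).2, hτK⟩
    · obtain ⟨H, hH, -⟩ := exists_poincareForm_coord (g := g) hs hF_smooth hF_lt hφ' hz hzE
      exact ⟨H, hH⟩
  obtain ⟨C, hC, hmain⟩ := exists_mass_le_energy hA hm (fun t ↦ by
    obtain ⟨K, hK, hKU, hτK⟩ := t.2.2
    refine ⟨K, hK.isClosed, disjoint_left.2 fun y hy ↦ (hKU hy).2, ?_⟩
    have h1 : ∀ x ∈ Kᶜ \ E, formNormSq P hL t.1 x = 0 := fun x hx ↦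
      formNormSq_eq_zero hL_metric hx.2 (hτK x hx.1)
    change ∫⁻ y in Kᶜ \ E, formNormSq P hL t.1 y ∂hermVolume P = 0
    rw [setLIntegral_congr_fun (g := fun _ ↦ 0)
      (hK.isClosed.measurableSet.compl.diff hEcl.measurableSet) h1, lintegral_zero]) fun x ↦ by
    -- The exterior of `U` carries no mass of any admissible form, so its points are controlled with
    -- constant zero. This starts the propagation in every component.
    obtain ⟨y, hy, hyU⟩ := hU_dense x
    refine ⟨y, hy, (closure U)ᶜ, isClosed_closure.isOpen_compl.mem_nhds hyU,
      isControlled_of_eq_zero fun t ↦ hzero t _ isClosed_closure.measurableSet.compl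
        fun z hz hzU ↦ hz (subset_closure hzU)⟩
  refine ⟨C, hC, fun τ hτ hK ↦ ?_⟩
  refine (lintegral_mono_set (sdiff_subset_sdiff_left (subset_univ U))).trans
    ((hmain ⟨τ, hτ, hK⟩).trans ?_)
  refine mul_le_mul_right ?_ _
  obtain ⟨K, hK, hKU, hτK⟩ := hK
  -- As the support of `τ` is a closed subset of `U`, the form vanishes near every point outside
  -- `U`, and the energy over the complement of `E` is the one over `U`.
  have h1 : ∀ x ∈ Eᶜ \ U, dbarNormSq P hL τ x = 0 := fun x hx ↦
    dbarNormSq_eq_zero hL_metric hx.1 hK.isClosed (fun h ↦ hx.2 (hKU h).1) hτK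
  change ∫⁻ y in Eᶜ, dbarNormSq P hL τ y ∂hermVolume P ≤ _
  rw [← lintegral_inter_add_sdiff _ Eᶜ hU.measurableSet, setLIntegral_congr_fun (g := fun _ ↦ 0)
    (hEcl.measurableSet.compl.diff hU.measurableSet) h1, lintegral_zero, add_zero,
    inter_comm, ← sdiff_eq]
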